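/- **Conventions.** Let $G$ be a finite group. Spaces are compactly generated weak Hausdorff, and products are taken in that category. Let $\Pi$ be the category with objects the based sets $\mathbf n=\{0,1,\dots,n\}$ with base point $0$, $n\ge 0$, and morphisms the based maps $\phi$ such that $\phi^{-1}(j)$ has at most one element for each $j\neq 0$. A *$\Pi$-$G$-space* $X$ is a functor $\mathbf n\mapsto X_n$ from $\Pi$ to $G$-spaces and $G$-maps such that $X_0$ is a point and the base point of each $X_n$, the image of $X_0\to X_n$, is nondegenerate (its inclusion is a $G$-cofibration). The group $G\times\Sigma_n$ acts on $X_n$. The *latching space* $L_nX\subset X_n$ is the union of the images of the maps $X_{n-1}\to X_n$ induced by the ordered injections $\mathbf{n-1}\to\mathbf n$ (and $L_0X=\emptyset$), and $X$ is *Reedy cofibrant* if $L_nX\to X_n$ is a $(G\times\Sigma_n)$-cofibration for every $n\ge 0$. For a homomorphism $\alpha\colon G\to\Sigma_n$ let $\Lambda_\alpha=\{(g,\alpha(g))\}\subset G\times\Sigma_n$; a $(G\times\Sigma_n)$-map is a weak $\Lambda_\alpha$-equivalence if it restricts to a weak equivalence on $L$-fixed points for every subgroup $L\subset\Lambda_\alpha$.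 A map $f\colon X\to Y$ of $\Pi$-$G$-spaces is an *$\mathbb F_\bullet$-level equivalence* if each $f_n\colon X_n\to Y_n$ is a weak $\Lambda_\alpha$-equivalence for all $\alpha\colon G\to\Sigma_n$. $X$ is *$\mathbb F_\bullet$-special* if, for all $n\ge0$, the Segal map $X_n\to X_1^n$, whose coordinates are induced by the projections $\delta_i\colon\mathbf n\to\mathbf 1$ that send $i$ to $1$ and all $j\ne i$ to $0$, is a weak $\Lambda_\alpha$-equivalence for all $\alpha\colon G\to\Sigma_n$. Let $\mathscr C_G$ be an operad of $G$-spaces with $\mathscr C_G(0)$ a point, which is *$\Sigma$-free*: for each $j$ the group $\Sigma_j$ acts freely on $\mathscr C_G(j)$ and $\mathscr C_G(j)\to\mathscr C_G(j)/\Sigma_j$ is a covering (which is automatic for a free action if $\mathscr C_G(j)$ is Hausdorff). Its category of operators $\mathscr D$ has objects $\mathbf n$ and morphism $G$-spaces $$\mathscr D(\mathbf m,\mathbf n)=\coprod_{\phi}\ \prod_{1\le j\le n}\mathscr C_G(|\phi^{-1}(j)|),$$ where $\phi$ runs over the based maps $\mathbf m\to\mathbf n$; composition is induced by the structure maps of $\mathscr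 C_G$, and $\Pi\subset\mathscr D$ by use of the point of $\mathscr C_G(0)$ and the unit element of $\mathscr C_G(1)$. Let $\mathbb D$ be the monad on $\Pi$-$G$-spaces associated to $\mathscr D$, with $(\mathbb DX)_n=\mathscr D(-,\mathbf n)\otimes_\Pi X$. **Theorem.** Let $\mathscr C_G$ be a $\Sigma$-free $G$-operad. 1. If $f\colon X\to Y$ is an $\mathbb F_\bullet$-level equivalence of Reedy cofibrant $\Pi$-$G$-spaces, then $\mathbb Df\colon\mathbb DX\to\mathbb DY$ is an $\mathbb F_\bullet$-level equivalence. 2. If $X$ is an $\mathbb F_\bullet$-special Reedy cofibrant $\Pi$-$G$-space, then $\mathbb DX$ is $\mathbb F_\bullet$-special. 3. For any Reedy cofibrant $\Pi$-$G$-space $X$, $\mathbb DX$ is a Reedy cofibrant $\Pi$-$G$-space. -/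

import Mathlib

universe u v

open Topology TopologicalSpace

/-! ### Spaces -/

/-- `X` is weak Hausdorff: images of compact Hausdorff spaces under continuous maps are closed. -/
class WeakHausdorffSpace (X : Type u) [TopologicalSpace X] : Prop where
  isClosed_range : ∀ (K : Type u) [TopologicalSpace K] [CompactSpace K] [T2Space K] (f : K → X),
    Continuous f → IsClosed (Set.range f)

/-- The set `X` with the compactly generated topology (the `k`-ification of `X`). -/
structure Kify (X : Type u) : Type u where
  of ::
  get : X

instance (X : Type u) [TopologicalSpace X] : TopologicalSpace (Kify X) :=
  coinduced Kify.of (compactlyGenerated.{u} X)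

theorem Kify.continuous_dom {X Y : Type u} [TopologicalSpace X] [TopologicalSpace Y]
    {f : Kify X → Y}
    (h : ∀ (K : Type u) [TopologicalSpace K] [CompactSpace K] [T2Space K] (g : K → X),
      Continuous g → Continuous (fun k => f (Kify.of (g k)))) : Continuous f :=
  continuous_coinduced_dom.2
    (continuous_from_compactlyGenerated (X := X) (f ∘ Kify.of) fun S g => h S g g.continuous)

theorem Kify.continuous_of_compact {K X : Type u} [TopologicalSpace K] [CompactSpace K] [T2Space K]
    [TopologicalSpace X] {f : K → X} (hf : Continuous f) :
    Continuous (fun k => Kify.of (f k)) := by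
  have h1 : @Continuous (Σ (i : (S : CompHaus.{u}) × C(S, X)), i.fst) X _
      (compactlyGenerated.{u} X) (fun x => x.1.2 x.2) :=
    @continuous_coinduced_rng _ _ _ _
  have h2 : @Continuous X (Kify X) (compactlyGenerated.{u} X) _ Kify.of :=
    (@continuous_iff_coinduced_le _ _ _ (compactlyGenerated.{u} X) _).2 le_rfl
  have h3 := @Continuous.comp _ _ _ _ (compactlyGenerated.{u} X) _ _ _ h2 h1
  exact h3.comp (continuous_sigmaMk
    (σ := fun i : (S : CompHaus.{u}) × C(S, X) => (i.fst : Type u))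
    (i := ⟨CompHaus.of K, ⟨f, hf⟩⟩))

theorem Kify.continuous_rng {Y X : Type u} [TopologicalSpace Y] [CompactlyGeneratedSpace Y]
    [TopologicalSpace X] {f : Y → X} (hf : Continuous f) :
    Continuous (fun k => Kify.of (f k)) :=
  continuous_from_compactlyGeneratedSpace _ fun _ _ _ _ _ hg =>
    Kify.continuous_of_compact (hf.comp hg)

theorem Kify.continuous_get {X : Type u} [TopologicalSpace X] :
    Continuous (Kify.get : Kify X → X) :=
  Kify.continuous_dom fun _ _ _ _ _ hg => hg

instance (X : Type u) [TopologicalSpace X] : CompactlyGeneratedSpace (Kify X) :=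
  compactlyGeneratedSpace_of_continuous_maps fun _ h =>
    Kify.continuous_dom fun K _ _ _ _ hg => h K _ (Kify.continuous_of_compact hg)

/-! ### The category of finite based sets -/

/-- A based map `𝐦 → 𝐧` between the based sets `𝐦 = {0, 1, …, m}` and `𝐧 = {0, 1, …, n}`, where `0`
is the base point.  It is recorded by its values on the non-base points of `𝐦`, which are
indexed by `Fin m`; the value `none` is the base point of `𝐧`. -/
abbrev BasedMap (m n : ℕ) : Type := Fin m → Option (Fin n)

namespace BasedMap

/-- The composite `φ ∘ ψ`. -/
def comp {k m n : ℕ} (φ : BasedMap m n) (ψ : BasedMap k m) : BasedMap k n :=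
  fun i => (ψ i).bind φ

theorem comp_assoc {a b c d : ℕ} (φ : BasedMap c d) (ψ : BasedMap b c) (χ : BasedMap a b) :
    (φ.comp ψ).comp χ = φ.comp (ψ.comp χ) := by
  funext i
  cases h : χ i <;> simp [comp, h]

/-- The set `φ⁻¹(j)`, for a non-base point `j`. -/
abbrev Fiber {m n : ℕ} (φ : BasedMap m n) (j : Fin n) : Type := {i : Fin m // φ i = some j}

/-- The number of elements `|φ⁻¹(j)|`. -/
def card {m n : ℕ} (φ : BasedMap m n) (j : Fin n) : ℕ := Fintype.card (φ.Fiber j)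

/-- The enumeration of `φ⁻¹(j)` in its natural order as a subset of `{1, …, m}`. -/
def enum {m n : ℕ} (φ : BasedMap m n) (j : Fin n) : Fin (φ.card j) ≃ φ.Fiber j :=
  (monoEquivOfFin (φ.Fiber j) rfl).toEquiv

/-- `(φ ∘ ψ)⁻¹(j)` is the disjoint union of the sets `ψ⁻¹(i)` for `i ∈ φ⁻¹(j)`. -/
def fiberComp {k m n : ℕ} (φ : BasedMap m n) (ψ : BasedMap k m) (j : Fin n) :
    (φ.comp ψ).Fiber j ≃ Σ i : φ.Fiber j, ψ.Fiber i.1 where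
  toFun x := ⟨⟨(ψ x.1).get (by
      have h := x.2
      unfold comp at h
      rw [Option.bind_eq_some_iff] at h
      obtain ⟨i, hi, -⟩ := h
      simp [hi]), by
      have h := x.2
      unfold comp at h
      rw [Option.bind_eq_some_iff] at h
      obtain ⟨i, hi, hj⟩ := h
      simp only [hi, Option.get_some]
      exact hj⟩, ⟨x.1, by simp⟩⟩
  invFun y := ⟨y.2.1, by
    have h := y.2.2
    have h' := y.1.2
    unfold comp
    rw [h]
    exact h'⟩
  left_inv x := rfl
  right_inv y := by
    have key : ∀ (i i' : φ.Fiber j) (t : Fin k) (h : ψ t = some i.1) (h' : ψ t = some i'.1),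
        (⟨i, ⟨t, h⟩⟩ : Σ i : φ.Fiber j, ψ.Fiber i.1) = ⟨i', ⟨t, h'⟩⟩ := by
      intro i i' t h h'
      have e : i = i' := Subtype.ext (by simpa [h] using h')
      subst e
      rfl
    exact key _ _ _ _ _

/-- The permutation converting the natural ordering of `(φ ∘ ψ)⁻¹(j)` to its ordering as the
disjoint union of the sets `ψ⁻¹(i)` with `φ(i) = j`, in which `ψ⁻¹(i)` precedes `ψ⁻¹(i')` for
`i < i'` and each `ψ⁻¹(i)` has its natural ordering. -/
def blockPerm {k m n : ℕ} (φ : BasedMap m n) (ψ : BasedMap k m) (j : Fin n) :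
    Fin ((φ.comp ψ).card j) ≃ Fin (∑ s : Fin (φ.card j), ψ.card (φ.enum j s).1) :=
  ((φ.comp ψ).enum j).trans ((fiberComp φ ψ j).trans
    ((Equiv.sigmaCongr (φ.enum j) (fun s => ψ.enum (φ.enum j s).1)).symm.trans finSigmaFinEquiv))

/-- `φ` is a morphism of `Π`: each `φ⁻¹(j)`, `j ≠ 0`, has at most one element. -/
def IsPi {m n : ℕ} (φ : BasedMap m n) : Prop := ∀ j, φ.card j ≤ 1

theorem isPi_iff {m n : ℕ} {φ : BasedMap m n} :
    φ.IsPi ↔ ∀ j i i', φ i = some j → φ i' = some j → i = i' := by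
  simp only [IsPi, card, Fintype.card_le_one_iff, Subtype.forall, Subtype.mk.injEq]
  exact ⟨fun h j i i' hi hi' => h j i hi i' hi', fun h j i hi i' hi' => h j i i' hi hi'⟩

end BasedMap

/-- The morphisms `𝐦 → 𝐧` of the category `Π`. -/
def PiHom (m n : ℕ) : Type := {φ : BasedMap m n // φ.IsPi}

namespace PiHom

/-- The identity of `𝐧`. -/
def id (n : ℕ) : PiHom n n :=
  ⟨fun i => some i, BasedMap.isPi_iff.2 fun j i i' h h' => by simp_all⟩

/-- The composite `φ ∘ ψ`. -/
def comp {k m n : ℕ} (φ : PiHom m n) (ψ : PiHom k m) : PiHom k n :=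
  ⟨φ.1.comp ψ.1, BasedMap.isPi_iff.2 fun j i i' h h' => by
    have hφ := BasedMap.isPi_iff.1 φ.2
    have hψ := BasedMap.isPi_iff.1 ψ.2
    cases e : ψ.1 i <;> cases e' : ψ.1 i' <;> simp_all [BasedMap.comp]
    rename_i a b
    have := hφ _ _ _ h h'
    subst this
    exact hψ _ _ _ e e'⟩

/-- A permutation, as a morphism of `Π`. -/
def ofPerm {n : ℕ} (σ : Equiv.Perm (Fin n)) : PiHom n n :=
  ⟨fun i => some (σ i), BasedMap.isPi_iff.2 fun j i i' h h' => σ.injective (by simp_all)⟩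

/-- The ordered injection `σᵢ : 𝐧 → 𝐧+𝟏` that skips `i`. -/
def skip {n : ℕ} (i : Fin (n + 1)) : PiHom n (n + 1) :=
  ⟨fun k => some (i.succAbove k), BasedMap.isPi_iff.2 fun j a b h h' =>
    Fin.succAbove_right_injective (p := i) (by simp_all)⟩

/-- The projection `δᵢ : 𝐧 → 𝟏` that sends `i` to `1` and all `j ≠ i` to `0`. -/
def delta {n : ℕ} (i : Fin n) : PiHom n 1 :=
  ⟨fun k => if k = i then some 0 else none, BasedMap.isPi_iff.2 fun j a b h h' => by
    split_ifs at h h' with h1 h2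
    rw [h1, h2]⟩

/-- The zero map `𝐦 → 𝟎 → 𝐧`. -/
def zero (m n : ℕ) : PiHom m n :=
  ⟨fun _ => none, BasedMap.isPi_iff.2 fun j a b h h' => by simp at h⟩

theorem ofPerm_one (n : ℕ) : ofPerm (1 : Equiv.Perm (Fin n)) = id n := rfl

theorem ofPerm_mul {n : ℕ} (σ τ : Equiv.Perm (Fin n)) :
    ofPerm (σ * τ) = (ofPerm σ).comp (ofPerm τ) := rfl

theorem delta_comp_ofPerm {n : ℕ} (i : Fin n) (σ : Equiv.Perm (Fin n)) :
    (delta i).comp (ofPerm σ) = delta (σ⁻¹ i) := by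
  apply Subtype.ext
  funext k
  simp only [comp, BasedMap.comp, ofPerm, delta, Option.bind_some]
  congr 1
  exact propext Equiv.Perm.eq_inv_iff_eq.symm

end PiHom

/-! ### `G`-operads -/

/-- The bijection of `∐ₛ Fin (a s)` with `∐ₛ Fin (b s)` (both in block order) that sends the block
`s` to the block `σ s` by means of `τ s`. -/
def blockSum {k k' : ℕ} {a : Fin k → ℕ} {b : Fin k' → ℕ} (σ : Fin k ≃ Fin k')
    (τ : ∀ s, Fin (a s) ≃ Fin (b (σ s))) : Fin (∑ s, a s) ≃ Fin (∑ s, b s) :=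
  finSigmaFinEquiv.symm.trans ((Equiv.sigmaCongr σ τ).trans finSigmaFinEquiv)

/-- The order preserving identification of blocks of blocks with blocks. -/
def blockAssoc {k : ℕ} (a : Fin k → ℕ) (b : Fin (∑ i, a i) → ℕ) :
    Fin (∑ i, ∑ t, b (finSigmaFinEquiv ⟨i, t⟩)) ≃ Fin (∑ s, b s) :=
  finSigmaFinEquiv.symm.trans
    ((Equiv.sigmaCongrRight fun _ => finSigmaFinEquiv.symm).trans
      ((Equiv.sigmaAssoc fun i t => Fin (b (finSigmaFinEquiv ⟨i, t⟩))).symm.trans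
        ((Equiv.sigmaCongrLeft (β := fun s => Fin (b s)) finSigmaFinEquiv).trans
          finSigmaFinEquiv)))

/-- A single block. -/
def blockOne (a : ℕ) : Fin (∑ _i : Fin 1, a) ≃ Fin a :=
  finSigmaFinEquiv.symm.trans (Equiv.uniqueSigma fun _ : Fin 1 => Fin a)

/-- Blocks of size one. -/
def blockOnes (k : ℕ) : Fin (∑ _i : Fin k, 1) ≃ Fin k :=
  finSigmaFinEquiv.symm.trans (Equiv.sigmaUnique (Fin k) fun _ => Fin 1)

/-- A (reduced) operad of `G`-spaces, in the category of compactly generated weak Hausdorff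
`G`-spaces and its cartesian product.

A bijection `e : Fin a ≃ Fin b` exists only when `a = b`, so that `perm` is nothing but a right
action of the symmetric group `Σ_a` on `obj a` for each `a`, written `c ↦ c σ`; allowing `a` and `b`
to differ syntactically avoids casts.  In the composition `γ(c; d₁, …, d_k)`, the inputs are
ordered by blocks. -/
structure GOperad (G : Type v) [Group G] where
  /-- the spaces of the operad -/
  obj : ℕ → Type u
  [top : ∀ j, TopologicalSpace (obj j)]
  [cg : ∀ j, CompactlyGeneratedSpace (obj j)]
  [wh : ∀ j, WeakHausdorffSpace (obj j)]
  [act : ∀ j, MulAction G (obj j)]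
  [cont_act : ∀ j, ContinuousConstSMul G (obj j)]
  /-- the right action of the symmetric groups -/
  perm : ∀ {a b : ℕ}, (Fin a ≃ Fin b) → obj b → obj a
  continuous_perm : ∀ {a b : ℕ} (e : Fin a ≃ Fin b), Continuous (perm e)
  perm_smul : ∀ {a b : ℕ} (e : Fin a ≃ Fin b) (g : G) (c : obj b), perm e (g • c) = g • perm e c
  perm_refl : ∀ {a : ℕ} (c : obj a), perm (Equiv.refl (Fin a)) c = c
  perm_trans : ∀ {a b d : ℕ} (e : Fin a ≃ Fin b) (f : Fin b ≃ Fin d) (c : obj d),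
    perm (e.trans f) c = perm e (perm f c)
  /-- the structure maps -/
  γ : ∀ {k : ℕ} {a : Fin k → ℕ}, obj k → (∀ i, obj (a i)) → obj (∑ i, a i)
  continuous_γ : ∀ {k : ℕ} {a : Fin k → ℕ},
    Continuous fun p : Kify (obj k × ∀ i, obj (a i)) => γ p.get.1 p.get.2
  γ_smul : ∀ {k : ℕ} {a : Fin k → ℕ} (g : G) (c : obj k) (d : ∀ i, obj (a i)),
    γ (g • c) (fun i => g • d i) = g • γ c d
  γ_assoc : ∀ {k : ℕ} {a : Fin k → ℕ} {b : Fin (∑ i, a i) → ℕ} (c : obj k) (d : ∀ i, obj (a i))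
    (e : ∀ s, obj (b s)),
    γ c (fun i => γ (d i) fun t => e (finSigmaFinEquiv ⟨i, t⟩)) =
      perm (blockAssoc a b) (γ (γ c d) e)
  /-- both equivariance axioms at once: `γ(c σ; d₁ τ₁, …)` is the result of letting the permutation
  of blocks given by `σ` and the `τᵢ` act on `γ(c; …)` -/
  γ_perm : ∀ {k k' : ℕ} {a : Fin k → ℕ} {b : Fin k' → ℕ} (σ : Fin k ≃ Fin k')
    (τ : ∀ s, Fin (a s) ≃ Fin (b (σ s))) (c : obj k') (d : ∀ i, obj (b i)),
    γ (perm σ c) (fun s => perm (τ s) (d (σ s))) = perm (blockSum σ τ) (γ c d)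
  /-- the unit element -/
  one : obj 1
  one_smul : ∀ g : G, g • one = one
  γ_one_left : ∀ {a : ℕ} (d : obj a), γ one (fun _ => d) = perm (blockOne a) d
  γ_one_right : ∀ {k : ℕ} (c : obj k), γ c (fun _ => one) = perm (blockOnes k) c
  /-- the unique point of the `0`th space -/
  nil : obj 0
  eq_nil : ∀ c : obj 0, c = nil

namespace GOperad

attribute [instance] GOperad.top GOperad.cg GOperad.wh GOperad.act GOperad.cont_act

variable {G : Type v} [Group G] (C : GOperad.{u} G)

/-- `C` is `Σ`-free: the group `Σ_j` acts freely on the `j`th space, and the action is properly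
discontinuous, that is, the projection to the orbit space is a covering.  The second
condition follows from the first when the spaces of `C` are Hausdorff, see
`GOperad.isSigmaFree_of_t2`. -/
def IsSigmaFree : Prop :=
  ∀ (j : ℕ) (c : C.obj j), ∃ U : Set (C.obj j), IsOpen U ∧ c ∈ U ∧
    ∀ σ : Equiv.Perm (Fin j), σ ≠ 1 → Disjoint U (C.perm σ '' U)

theorem IsSigmaFree.free {C : GOperad.{u} G} (h : C.IsSigmaFree) {j : ℕ} (c : C.obj j)
    (σ : Equiv.Perm (Fin j)) (hσ : C.perm σ c = c) : σ = 1 := by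
  obtain ⟨U, -, hc, hU⟩ := h j c
  by_contra hne
  exact Set.disjoint_left.1 (hU σ hne) hc ⟨c, hc, hσ⟩

theorem isSigmaFree_of_t2 [∀ j, T2Space (C.obj j)]
    (h : ∀ (j : ℕ) (c : C.obj j) (σ : Equiv.Perm (Fin j)), C.perm σ c = c → σ = 1) :
    C.IsSigmaFree := by
  intro j c
  have key : ∀ σ : Equiv.Perm (Fin j), ∃ U : Set (C.obj j), IsOpen U ∧ c ∈ U ∧
      (σ ≠ 1 → Disjoint U (C.perm σ '' U)) := by
    intro σ
    by_cases hσ : σ = 1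
    · exact ⟨Set.univ, isOpen_univ, trivial, fun h => absurd hσ h⟩
    · obtain ⟨A, B, hA, hB, hcA, hcB, hAB⟩ :=
        t2_separation (fun e : c = C.perm σ c => hσ (h j c σ e.symm))
      refine ⟨A ∩ C.perm σ ⁻¹' B, hA.inter (hB.preimage (C.continuous_perm σ)), ⟨hcA, hcB⟩,
        fun _ => hAB.mono Set.inter_subset_left ?_⟩
      rintro _ ⟨x, hx, rfl⟩
      exact hx.2
  choose U hU hc hd using key
  refine ⟨⋂ σ, U σ, isOpen_iInter_of_finite hU, Set.mem_iInter.2 hc, fun σ hσ => ?_⟩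
  exact (hd σ hσ).mono (Set.iInter_subset _ _) (Set.image_mono (Set.iInter_subset _ _))

/-! ### The category of operators -/

/-- The space of morphisms `𝐦 → 𝐧` of the category of operators `𝒟(C)`: the disjoint union, over the
based maps `φ : 𝐦 → 𝐧`, of the products of the spaces `C(|φ⁻¹(j)|)`, `1 ≤ j ≤ n`. -/
abbrev DHom (m n : ℕ) : Type u :=
  Kify (Σ φ : BasedMap m n, ∀ j : Fin n, C.obj (φ.card j))

namespace DHom

variable {C}

/-- The underlying based map. -/
abbrev fn {m n : ℕ} (f : C.DHom m n) : BasedMap m n := f.get.1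

/-- The components `c₁, …, c_n` in the operad. -/
abbrev op {m n : ℕ} (f : C.DHom m n) (j : Fin n) : C.obj (f.fn.card j) := f.get.2 j

/-- The composite `(φ, c) ∘ (ψ, d)`, with `j`th component `γ(c_j; ∏_{φ(i) = j} dᵢ) σ_j`. -/
def comp {k m n : ℕ} (f : C.DHom m n) (h : C.DHom k m) : C.DHom k n :=
  ⟨f.fn.comp h.fn, fun j =>
    C.perm (f.fn.blockPerm h.fn j) (C.γ (f.op j) fun s => h.op (f.fn.enum j s).1)⟩

instance {m n : ℕ} : SMul G (C.DHom m n) := ⟨fun g f => ⟨f.fn, fun j => g • f.op j⟩⟩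

instance {m n : ℕ} : MulAction G (C.DHom m n) where
  one_smul f := by
    change (⟨⟨f.fn, fun j => (1 : G) • f.op j⟩⟩ : C.DHom m n) = f
    simp
  mul_smul g h f := by
    change (⟨⟨f.fn, fun j => (g * h) • f.op j⟩⟩ : C.DHom m n) = ⟨⟨f.fn, fun j => g • h • f.op j⟩⟩
    simp [mul_smul]

end DHom

/-- The unit element of `C(1)` or the point of `C(0)`. -/
def piElt : ∀ a : ℕ, a ≤ 1 → C.obj a
  | 0, _ => C.nil
  | 1, _ => C.one
  | _ + 2, h => absurd h (by omega)

/-- The inclusion `Π → 𝒟(C)`. -/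
def incl {m n : ℕ} (φ : PiHom m n) : C.DHom m n :=
  ⟨φ.1, fun j => C.piElt (φ.1.card j) (φ.2 j)⟩

end GOperad

namespace BasedMap

variable {k m n q : ℕ}

/-- The element of `{1, …, q}` that corresponds to a position in a sum of blocks. -/
def label (χ : BasedMap q m) {k : ℕ} (g : Fin k → Fin m) (w : Fin (∑ s, χ.card (g s))) : Fin q :=
  (χ.enum (g (finSigmaFinEquiv.symm w).1) (finSigmaFinEquiv.symm w).2).1

theorem label_mk (χ : BasedMap q m) {k : ℕ} (g : Fin k → Fin m) (s : Fin k)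
    (t : Fin (χ.card (g s))) : χ.label g (finSigmaFinEquiv ⟨s, t⟩) = (χ.enum (g s) t).1 := by
  have : ∀ p : (Σ s, Fin (χ.card (g s))), p = ⟨s, t⟩ →
      (χ.enum (g p.1) p.2).1 = (χ.enum (g s) t).1 := by
    rintro _ rfl
    rfl
  exact this _ (Equiv.symm_apply_apply _ _)

theorem label_injective (χ : BasedMap q m) {k : ℕ} {g : Fin k → Fin m}
    (hg : Function.Injective g) : Function.Injective (χ.label g) := by
  intro w w' h
  obtain ⟨⟨s, t⟩, rfl⟩ := finSigmaFinEquiv.surjective w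
  obtain ⟨⟨s', t'⟩, rfl⟩ := finSigmaFinEquiv.surjective w'
  rw [label_mk, label_mk] at h
  have h1 := (χ.enum (g s) t).2
  have h2 := (χ.enum (g s') t').2
  rw [h, h2, Option.some_inj] at h1
  obtain rfl := hg h1
  have : t = t' := (χ.enum (g s')).injective (Subtype.ext h)
  rw [this]

theorem label_blockPerm (φ : BasedMap m n) (ψ : BasedMap k m) (j : Fin n)
    (x : Fin ((φ.comp ψ).card j)) :
    ψ.label (fun s => (φ.enum j s).1) (φ.blockPerm ψ j x) = ((φ.comp ψ).enum j x).1 := by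
  obtain ⟨⟨s, t⟩, hst⟩ : ∃ p, blockPerm φ ψ j x = finSigmaFinEquiv p :=
    ⟨_, (Equiv.apply_symm_apply _ _).symm⟩
  rw [hst, label_mk]
  have h2 : (Equiv.sigmaCongr (φ.enum j) (fun s => ψ.enum (φ.enum j s).1)) ⟨s, t⟩ =
      fiberComp φ ψ j ((φ.comp ψ).enum j x) := by
    rw [← Equiv.eq_symm_apply]
    exact finSigmaFinEquiv.injective hst.symm
  have h3 : ((fiberComp φ ψ j).symm ((Equiv.sigmaCongr (φ.enum j)
      (fun s => ψ.enum (φ.enum j s).1)) ⟨s, t⟩)).1 = ((φ.comp ψ).enum j x).1 := by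
    rw [h2, Equiv.symm_apply_apply]
  exact h3

theorem blockSum_mk {k k' : ℕ} {a : Fin k → ℕ} {b : Fin k' → ℕ} (σ : Fin k ≃ Fin k')
    (τ : ∀ s, Fin (a s) ≃ Fin (b (σ s))) (s : Fin k) (t : Fin (a s)) :
    blockSum σ τ (finSigmaFinEquiv ⟨s, t⟩) = finSigmaFinEquiv ⟨σ s, τ s t⟩ := by
  simp [blockSum, Equiv.sigmaCongr, Equiv.sigmaCongrLeft]

theorem blockAssoc_mk {k : ℕ} (a : Fin k → ℕ) (b : Fin (∑ i, a i) → ℕ) (s : Fin k)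
    (t : Fin (a s)) (r : Fin (b (finSigmaFinEquiv ⟨s, t⟩))) :
    blockAssoc a b (finSigmaFinEquiv ⟨s, finSigmaFinEquiv
      (n := fun t => b (finSigmaFinEquiv ⟨s, t⟩)) ⟨t, r⟩⟩) =
      finSigmaFinEquiv ⟨finSigmaFinEquiv ⟨s, t⟩, r⟩ := by
  simp [blockAssoc, Equiv.sigmaCongrLeft, Equiv.sigmaAssoc]

theorem enum_congr (χ : BasedMap q m) {i i' : Fin m} (h : i = i') (t : Fin (χ.card i)) :
    (χ.enum i' (finCongr (congrArg χ.card h) t)).1 = (χ.enum i t).1 := by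
  subst h
  rfl

theorem label_blockSum (χ : BasedMap q m) {k k' : ℕ} (σ : Fin k ≃ Fin k') (g : Fin k → Fin m)
    (g' : Fin k' → Fin m) (h : ∀ s, g s = g' (σ s)) (w : Fin (∑ s, χ.card (g s))) :
    χ.label g' (blockSum σ (fun s => finCongr (congrArg χ.card (h s))) w) = χ.label g w := by
  obtain ⟨⟨s, t⟩, rfl⟩ := finSigmaFinEquiv.surjective w
  rw [blockSum_mk, label_mk, label_mk, enum_congr χ (h s)]

/-- The permutation of the block `s` of a sum of sums of blocks. -/
def nestPerm (χ : BasedMap q m) (ψ : BasedMap m n) {k : ℕ} (g : Fin k → Fin n)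
    (e : ∀ (s : Fin k) (t : Fin (ψ.card (g s))),
      (ψ.enum (g s) t).1 = ψ.label g (finSigmaFinEquiv ⟨s, t⟩)) (s : Fin k) :
    Fin ((ψ.comp χ).card (g s)) ≃
      Fin (∑ t, χ.card (ψ.label g (finSigmaFinEquiv ⟨s, t⟩))) :=
  (ψ.blockPerm χ (g s)).trans (blockSum (Equiv.refl (Fin (ψ.card (g s))))
    (a := fun t => χ.card (ψ.enum (g s) t).1)
    (b := fun t => χ.card (ψ.label g (finSigmaFinEquiv ⟨s, t⟩)))
    fun t => finCongr (congrArg χ.card (e s t)))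

theorem label_blockAssoc (χ : BasedMap q m) (ψ : BasedMap m n) {k : ℕ} (g : Fin k → Fin n)
    (e : ∀ (s : Fin k) (t : Fin (ψ.card (g s))),
      (ψ.enum (g s) t).1 = ψ.label g (finSigmaFinEquiv ⟨s, t⟩))
    (z : Fin (∑ s, (ψ.comp χ).card (g s))) :
    χ.label (ψ.label g) (blockAssoc (fun s => ψ.card (g s)) (fun w => χ.card (ψ.label g w))
      (blockSum (Equiv.refl (Fin k)) (nestPerm χ ψ g e) z)) =
      (ψ.comp χ).label g z := by
  obtain ⟨⟨s, t⟩, rfl⟩ := finSigmaFinEquiv.surjective z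
  rw [label_mk]
  have h2 := blockSum_mk (a := fun s => (ψ.comp χ).card (g s))
    (b := fun s => ∑ t, χ.card (ψ.label g (finSigmaFinEquiv ⟨s, t⟩)))
    (Equiv.refl (Fin k)) (nestPerm χ ψ g e) s t
  have h3 : χ.label (fun t => ψ.label g (finSigmaFinEquiv ⟨s, t⟩))
      (nestPerm χ ψ g e s t) =
      ((ψ.comp χ).enum (g s) t).1 :=
    (label_blockSum χ _ _ _ (e s) _).trans (label_blockPerm ψ χ _ t)
  refine Eq.trans (congrArg (fun z => χ.label (ψ.label g) (blockAssoc
    (fun s => ψ.card (g s)) (fun w => χ.card (ψ.label g w)) z)) h2) (Eq.trans ?_ h3)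
  obtain ⟨⟨t', r⟩, htr⟩ := finSigmaFinEquiv.surjective
    (nestPerm χ ψ g e s t)
  have h4 := blockAssoc_mk (fun s => ψ.card (g s)) (fun w => χ.card (ψ.label g w)) s t' r
  have h5 := label_mk χ (ψ.label g) (finSigmaFinEquiv ⟨s, t'⟩) r
  have h6 := label_mk χ (fun t => ψ.label g (finSigmaFinEquiv ⟨s, t⟩)) t' r
  rw [htr] at h4 h6
  exact (congrArg (χ.label (ψ.label g)) h4).trans (h5.trans h6.symm)

theorem blockPerm_assoc {l : ℕ} (φ : BasedMap m n) (ψ : BasedMap l m) (χ : BasedMap k l)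
    (j : Fin n)
    (e₁ : ∀ s, ((φ.comp ψ).enum j s).1 =
      ψ.label (fun s => (φ.enum j s).1) (φ.blockPerm ψ j s))
    (e₂ : ∀ (s : Fin (φ.card j)) (t : Fin (ψ.card (φ.enum j s).1)),
      (ψ.enum (φ.enum j s).1 t).1 = ψ.label (fun s => (φ.enum j s).1) (finSigmaFinEquiv ⟨s, t⟩)) :
    ((φ.comp ψ).blockPerm χ j).trans (blockSum (φ.blockPerm ψ j)
      (a := fun s => χ.card ((φ.comp ψ).enum j s).1)
      (b := fun s => χ.card (ψ.label (fun s => (φ.enum j s).1) s))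
      fun s => finCongr (congrArg χ.card (e₁ s))) =
    (finCongr (congrArg (fun φ => card φ j) (comp_assoc φ ψ χ))).trans
      ((φ.blockPerm (ψ.comp χ) j).trans ((blockSum (Equiv.refl (Fin (φ.card j)))
        (nestPerm χ ψ (fun s => (φ.enum j s).1) e₂)).trans
          (blockAssoc (fun s => ψ.card (φ.enum j s).1)
            fun w => χ.card (ψ.label (fun s => (φ.enum j s).1) w)))) := by
  have hg₂ : Function.Injective (ψ.label fun s => (φ.enum j s).1) :=
    ψ.label_injective fun s s' h => (φ.enum j).injective (Subtype.ext h)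
  refine Equiv.ext fun x => χ.label_injective hg₂ ?_
  rw [Equiv.trans_apply, Equiv.trans_apply, Equiv.trans_apply, Equiv.trans_apply]
  have hxy : ∀ (α β : BasedMap k n) (h : α = β) (x : Fin (α.card j)),
      (α.enum j x).1 = (β.enum j (finCongr (congrArg (fun φ => BasedMap.card φ j) h) x)).1 := by
    rintro α _ rfl x
    rfl
  exact (label_blockSum χ (φ.blockPerm ψ j) _ _ e₁ ((φ.comp ψ).blockPerm χ j x)).trans
    ((label_blockPerm (φ.comp ψ) χ j x).trans
      ((hxy _ _ (comp_assoc φ ψ χ) x).trans ((label_blockPerm φ (ψ.comp χ) j _).symm.trans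
        (label_blockAssoc χ ψ (fun s => (φ.enum j s).1) e₂ _).symm)))

end BasedMap

namespace GOperad

variable {G : Type v} [Group G] {C : GOperad.{u} G}

namespace DHom

theorem ext' {m n : ℕ} {f h : C.DHom m n} (e : f.fn = h.fn)
    (e' : ∀ j, f.op j = C.perm (finCongr (congrArg (fun φ => BasedMap.card φ j) e)) (h.op j)) :
    f = h := by
  obtain ⟨φ, c⟩ := f
  obtain ⟨ψ, d⟩ := h
  change φ = ψ at e
  subst e
  congr 2
  funext j
  exact (e' j).trans (C.perm_refl _)

theorem op_congr {m n : ℕ} (h : C.DHom m n) {i i' : Fin n} (e : i = i') :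
    h.op i = C.perm (finCongr (congrArg h.fn.card e)) (h.op i') := by
  subst e
  exact (C.perm_refl _).symm

theorem perm_γ_op {m q : ℕ} (h : C.DHom q m) {k k' : ℕ} (σ : Fin k ≃ Fin k') (g : Fin k → Fin m)
    (g' : Fin k' → Fin m) (e : ∀ s, g s = g' (σ s)) (c : C.obj k') :
    C.γ (C.perm σ c) (fun s => h.op (g s)) =
      C.perm (blockSum σ fun s => finCongr (congrArg h.fn.card (e s)))
        (C.γ c fun s => h.op (g' s)) := by
  rw [← C.γ_perm]
  congr 1
  funext s
  exact h.op_congr (e s)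

theorem comp_assoc {k l m n : ℕ} (f₁ : C.DHom m n) (f₂ : C.DHom l m) (f₃ : C.DHom k l) :
    (f₁.comp f₂).comp f₃ = f₁.comp (f₂.comp f₃) := by
  obtain ⟨φ, c⟩ := f₁
  obtain ⟨ψ, d⟩ := f₂
  refine ext' (BasedMap.comp_assoc _ _ _) fun j => ?_
  let χ := f₃.fn
  -- the positions in the sum of blocks
  let g₁ : Fin ((φ.comp ψ).card j) → Fin l := fun s => ((φ.comp ψ).enum j s).1
  let g₂ : Fin (∑ s, ψ.card (φ.enum j s).1) → Fin l := ψ.label fun s => (φ.enum j s).1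
  have e₁ : ∀ s, g₁ s = g₂ (φ.blockPerm ψ j s) := fun s => (φ.label_blockPerm ψ j s).symm
  have e₂ : ∀ (s : Fin (φ.card j)) (t : Fin (ψ.card (φ.enum j s).1)),
      (ψ.enum (φ.enum j s).1 t).1 = g₂ (finSigmaFinEquiv ⟨s, t⟩) :=
    fun s t => (ψ.label_mk (fun s => (φ.enum j s).1) s t).symm
  let X := C.γ (C.γ (c j) fun s => d (φ.enum j s).1) fun w => f₃.op (g₂ w)
  have hL : (comp (comp ⟨⟨φ, c⟩⟩ ⟨⟨ψ, d⟩⟩) f₃).op j =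
      C.perm (((φ.comp ψ).blockPerm χ j).trans (blockSum (φ.blockPerm ψ j)
        fun s => finCongr (congrArg χ.card (e₁ s)))) X := by
    rw [C.perm_trans, ← perm_γ_op f₃ _ g₁ g₂ e₁]
    rfl
  have hin : ∀ s : Fin (φ.card j),
      C.γ (d (φ.enum j s).1) (fun t => f₃.op (ψ.enum (φ.enum j s).1 t).1) =
      C.perm (blockSum (Equiv.refl (Fin (ψ.card (φ.enum j s).1)))
        fun t => finCongr (congrArg χ.card (e₂ s t)))
        (C.γ (d (φ.enum j s).1) fun t => f₃.op (g₂ (finSigmaFinEquiv ⟨s, t⟩))) := by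
    intro s
    have h := perm_γ_op f₃ (Equiv.refl (Fin (ψ.card (φ.enum j s).1)))
      (fun t => (ψ.enum (φ.enum j s).1 t).1) (fun t => g₂ (finSigmaFinEquiv ⟨s, t⟩)) (e₂ s)
      (d (φ.enum j s).1)
    rwa [C.perm_refl] at h
  let τ := BasedMap.nestPerm χ ψ (fun s => (φ.enum j s).1) e₂
  have hR : (comp ⟨⟨φ, c⟩⟩ (comp ⟨⟨ψ, d⟩⟩ f₃)).op j =
      C.perm ((φ.blockPerm (ψ.comp χ) j).trans ((blockSum (Equiv.refl _) τ).trans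
        (blockAssoc _ fun w => χ.card (g₂ w)))) X := by
    rw [C.perm_trans, C.perm_trans, ← C.γ_assoc]
    have h := C.γ_perm (Equiv.refl (Fin (φ.card j))) τ (c j)
      (fun s => C.γ (d (φ.enum j s).1) fun t => f₃.op (g₂ (finSigmaFinEquiv ⟨s, t⟩)))
    rw [C.perm_refl] at h
    refine Eq.trans ?_ (congrArg (C.perm (φ.blockPerm (ψ.comp χ) j)) h)
    change C.perm (φ.blockPerm (ψ.comp χ) j) (C.γ (c j) fun s =>
      C.perm (ψ.blockPerm χ (φ.enum j s).1)
      (C.γ (d (φ.enum j s).1) (fun t => f₃.op (ψ.enum (φ.enum j s).1 t).1))) = _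
    congr 2
    funext s
    rw [hin, ← C.perm_trans]
    rfl
  rw [hL, hR]
  refine Eq.trans ?_ (C.perm_trans _ _ _)
  exact congrArg (fun E => C.perm E X) (BasedMap.blockPerm_assoc φ ψ χ j e₁ e₂)

end DHom

end GOperad

theorem Kify.continuous_sigma {ι : Type} {A : ι → Type u} {Y : Type u}
    [∀ i, TopologicalSpace (A i)] [TopologicalSpace Y] {f : Kify (Σ i, A i) → Y}
    (h : ∀ (i : ι) (K : Type u) [TopologicalSpace K] [CompactSpace K] [T2Space K] (g : K → A i),
      Continuous g → Continuous (fun k => f (Kify.of ⟨i, g k⟩))) : Continuous f := by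
  refine Kify.continuous_dom fun K _ _ _ g hg => continuous_iff_continuousAt.2 fun k₀ => ?_
  have hcl : IsClopen (g ⁻¹' Set.range (Sigma.mk (g k₀).1)) :=
    ⟨isClosed_range_sigmaMk.preimage hg, isOpen_range_sigmaMk.preimage hg⟩
  let U : Type u := g ⁻¹' Set.range (Sigma.mk (g k₀).1)
  have : CompactSpace U := isCompact_iff_compactSpace.1 hcl.1.isCompact
  have hv : ∀ k : U, ∃ a : A (g k₀).1, Sigma.mk (g k₀).1 a = g k.1 := fun k => k.2
  choose v hv using hv
  have hvc : Continuous v := by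
    rw [(Topology.IsEmbedding.sigmaMk (σ := A) (i := (g k₀).1)).continuous_iff]
    exact (hg.comp continuous_subtype_val).congr fun k => (hv k).symm
  have h1 := h (g k₀).1 U v hvc
  simp only [hv] at h1
  exact (continuousOn_iff_continuous_domRestrict.2 h1).continuousAt
    (hcl.2.mem_nhds ⟨(g k₀).2, rfl⟩)

theorem blockOne_mk (a : ℕ) (s : Fin 1) (t : Fin a) : blockOne a (finSigmaFinEquiv ⟨s, t⟩) = t := by
  obtain rfl := Fin.fin_one_eq_zero s
  simp [blockOne, Equiv.uniqueSigma]

namespace GOperad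

variable {G : Type v} [Group G] {C : GOperad.{u} G}

theorem perm_γ_piElt {a : ℕ} (ha : a ≤ 1) (b : Fin a → ℕ) (hb : ∀ s, b s ≤ 1) {N : ℕ} (hN : N ≤ 1)
    (e : Fin N ≃ Fin (∑ s, b s)) :
    C.perm e (C.γ (C.piElt a ha) fun s => C.piElt (b s) (hb s)) = C.piElt N hN := by
  have h0 : ∀ (N : ℕ) (hN : N ≤ 1) (h : N = 0) (c : C.obj N), c = C.piElt N hN := by
    rintro _ _ rfl c
    exact C.eq_nil c
  match a, ha with
  | 0, _ =>
    exact h0 N hN (by simpa using Fintype.card_congr e) _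
  | 1, _ =>
    obtain ⟨b', rfl⟩ : ∃ b' : ℕ, b = fun _ => b' := ⟨b 0, by funext s; rw [Fin.fin_one_eq_zero s]⟩
    change C.perm e (C.γ C.one fun _ => C.piElt b' (hb 0)) = _
    rw [C.γ_one_left, ← C.perm_trans]
    generalize e.trans (blockOne b') = e'
    have hb' := hb 0
    obtain rfl : N = b' := by simpa using Fintype.card_congr e'
    match N, hN with
    | 0, _ => exact h0 0 _ rfl _
    | 1, _ =>
      obtain rfl : e' = Equiv.refl _ := Subsingleton.elim _ _
      exact C.perm_refl _

namespace DHom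

theorem incl_comp_incl {k m n : ℕ} (φ : PiHom m n) (ψ : PiHom k m) :
    (C.incl φ).comp (C.incl ψ) = C.incl (φ.comp ψ) := by
  refine ext' rfl fun j => ?_
  refine Eq.trans ?_ (C.perm_refl _).symm
  exact perm_γ_piElt (φ.2 j) (fun s => ψ.1.card (φ.1.enum j s).1) _ _ _

theorem perm_γ_one {m n : ℕ} (f : C.DHom m n) (j : Fin n) {a : ℕ} (ha : a ≤ 1) (h1 : a = 1)
    (g : Fin a → Fin n) (hg : ∀ s, g s = j) {N : ℕ} (P : Fin N ≃ Fin (∑ s, f.fn.card (g s)))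
    (Q : Fin N ≃ Fin (f.fn.card j)) (hPQ : ∀ x, f.fn.label g (P x) = (f.fn.enum j (Q x)).1) :
    C.perm P (C.γ (C.piElt a ha) fun s => f.op (g s)) = C.perm Q (f.op j) := by
  subst h1
  obtain rfl : g = fun _ => j := funext hg
  change C.perm P (C.γ C.one fun _ => f.op j) = _
  rw [C.γ_one_left, ← C.perm_trans]
  congr 1
  ext1 x
  apply (f.fn.enum j).injective
  apply Subtype.ext
  rw [← hPQ, Equiv.trans_apply]
  obtain ⟨⟨s, t⟩, hst⟩ := finSigmaFinEquiv.surjective (P x)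
  rw [← hst, BasedMap.label_mk, blockOne_mk]

theorem id_comp {m n : ℕ} (f : C.DHom m n) : (C.incl (PiHom.id n)).comp f = f := by
  have e : (PiHom.id n).1.comp f.fn = f.fn := by
    funext i
    cases h : f.fn i <;> simp [BasedMap.comp, PiHom.id, h]
  have h1 : ∀ j, (PiHom.id n).1.card j = 1 := by
    intro j
    refine Fintype.card_eq_one_iff.2 ⟨⟨j, rfl⟩, fun x => Subtype.ext ?_⟩
    exact Option.some_inj.1 x.2
  refine ext' e fun j => ?_
  refine perm_γ_one f j ((PiHom.id n).2 j) (h1 j) (fun s => ((PiHom.id n).1.enum j s).1)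
    (fun s => Option.some_inj.1 ((PiHom.id n).1.enum j s).2) _ _ fun x => ?_
  refine (BasedMap.label_blockPerm (PiHom.id n).1 f.fn j x).trans ?_
  have : ∀ (α β : BasedMap m n) (h : α = β) (x : Fin (α.card j)),
      (α.enum j x).1 = (β.enum j (finCongr (congrArg (fun φ => BasedMap.card φ j) h) x)).1 := by
    rintro α _ rfl x
    rfl
  exact this _ _ e x

theorem smul_comp {k m n : ℕ} (g : G) (f : C.DHom m n) (h : C.DHom k m) :
    (g • f).comp (g • h) = g • f.comp h := by
  refine ext' rfl fun j => ?_
  refine Eq.trans ?_ (C.perm_refl _).symm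
  exact (congrArg _ (C.γ_smul g _ _)).trans (C.perm_smul _ _ _)

theorem smul_incl {m n : ℕ} (g : G) (φ : PiHom m n) : g • C.incl φ = C.incl φ := by
  refine ext' rfl fun j => ?_
  refine Eq.trans ?_ (C.perm_refl _).symm
  have : ∀ (a : ℕ) (ha : a ≤ 1), g • C.piElt a ha = C.piElt a ha := by
    intro a ha
    match a, ha with
    | 0, _ => exact C.eq_nil _
    | 1, _ => exact C.one_smul g
  exact this _ _

theorem continuous_comp {k m n : ℕ} (f : C.DHom m n) :
    Continuous fun h : C.DHom k m => f.comp h := by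
  refine Kify.continuous_sigma fun ψ K _ _ _ d hd => Kify.continuous_of_compact
    (f := fun x => (f.comp (Kify.of ⟨ψ, d x⟩)).get) ?_
  refine (continuous_sigmaMk (σ := fun φ : BasedMap k n => ∀ j, C.obj (φ.card j))
    (i := f.fn.comp ψ)).comp (f := fun k j => C.perm (f.fn.blockPerm ψ j)
    (C.γ (f.op j) fun s => d k (f.fn.enum j s).1))
    (continuous_pi fun j => (C.continuous_perm _).comp ?_)
  exact C.continuous_γ.comp (Kify.continuous_of_compact
    (f := fun x => (f.op j, fun s => d x (f.fn.enum j s).1))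
    (continuous_const.prodMk (continuous_pi fun s => (continuous_apply _).comp hd)))

instance {m n : ℕ} : ContinuousConstSMul G (C.DHom m n) where
  continuous_const_smul g := by
    refine Kify.continuous_sigma fun ψ K _ _ _ d hd => Kify.continuous_of_compact
      (f := fun k => (⟨ψ, fun j => g • d k j⟩ : Σ φ : BasedMap m n, ∀ j, C.obj (φ.card j))) ?_
    exact continuous_sigmaMk.comp (continuous_pi fun j =>
      (continuous_const_smul g).comp ((continuous_apply j).comp hd))

end DHom

end GOperad

/-! ### Weak equivalences and cofibrations of `G`-spaces -/

section WeakEquivalence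

variable {A B : Type u} [TopologicalSpace A] [TopologicalSpace B]

/-- The map induced by `f` on path components. -/
def pi0Map (f : C(A, B)) : ZerothHomotopy A → ZerothHomotopy B :=
  Quotient.map f fun _ _ h => h.map f.continuous

/-- The map induced by `f` on the homotopy groups `π_n(-, a)`. -/
def piMap (f : C(A, B)) (n : ℕ) (a : A) :
    HomotopyGroup (Fin n) A a → HomotopyGroup (Fin n) B (f a) :=
  Quotient.map (fun p => ⟨f.comp p.1, fun y hy => congrArg f (p.2 y hy)⟩)
    fun _ _ h => h.comp_continuousMap f

/-- `f` is a weak equivalence: it induces bijections on path components and on all homotopy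
groups, for all choices of base points. -/
def IsWeakEquiv (f : C(A, B)) : Prop :=
  Function.Bijective (pi0Map f) ∧ ∀ (n : ℕ) (a : A), Function.Bijective (piMap f (n + 1) a)

variable {K : Type v} [Group K] [MulAction K A] [MulAction K B]

/-- The map `f^L : A^L → B^L` of fixed point spaces. -/
def fixedMap (f : C(A, B)) (hf : ∀ (k : K) (a : A), f (k • a) = k • f a) (L : Subgroup K) :
    C(MulAction.fixedPoints L A, MulAction.fixedPoints L B) where
  toFun a := ⟨f a.1, fun l => (hf l a.1).symm.trans (congrArg f (a.2 l))⟩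
  continuous_toFun := (f.continuous.comp continuous_subtype_val).subtype_mk _

/-- The `K`-map `f` is a weak `Λ`-equivalence, where `Λ` is a subgroup of `K`: the map `f^L` is a weak
equivalence for all subgroups `L` of `Λ`. -/
def IsWeakEquivOver (f : C(A, B)) (hf : ∀ (k : K) (a : A), f (k • a) = k • f a)
    (Λ : Subgroup K) : Prop :=
  ∀ L : Subgroup K, L ≤ Λ → IsWeakEquiv (fixedMap f hf L)

end WeakEquivalence

/-- The inclusion of the (`K`-stable) subspace `A` of the `K`-space `B` is a `K`-cofibration: it has
the homotopy extension property for maps to compactly generated weak Hausdorff `K`-spaces. -/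
def IsCofibration (K : Type v) [Group K] {B : Type u} [TopologicalSpace B] [MulAction K B]
    (A : Set B) : Prop :=
  ∀ (Y : Type u) [TopologicalSpace Y] [CompactlyGeneratedSpace Y] [WeakHausdorffSpace Y]
    [MulAction K Y] [ContinuousConstSMul K Y] (f : C(B, Y)) (h : C(A × unitInterval, Y)),
    (∀ (k : K) (b : B), f (k • b) = k • f b) →
    (∀ (k : K) (a : A) (ha : k • a.1 ∈ A) (t : unitInterval), h (⟨k • a.1, ha⟩, t) = k • h (a, t)) →
    (∀ a : A, h (a, 0) = f a) →
    ∃ H : C(B × unitInterval, Y), (∀ (k : K) (b : B) (t : unitInterval),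
        H (k • b, t) = k • H (b, t)) ∧
      (∀ b : B, H (b, 0) = f b) ∧ ∀ (a : A) (t : unitInterval), H (a, t) = h (a, t)

/-! ### `Π`-`G`-spaces -/

/-- A functor from `Π` to the category of compactly generated `G`-spaces and `G`-maps, where `G` is
a discrete group. -/
structure PiDiagram (G : Type v) [Group G] where
  /-- the spaces `X_n` -/
  obj : ℕ → Type u
  [top : ∀ n, TopologicalSpace (obj n)]
  [cg : ∀ n, CompactlyGeneratedSpace (obj n)]
  [act : ∀ n, MulAction G (obj n)]
  [cont_act : ∀ n, ContinuousConstSMul G (obj n)]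
  /-- the maps `φ_* : X_m → X_n` -/
  map : ∀ {m n : ℕ}, PiHom m n → C(obj m, obj n)
  map_smul : ∀ {m n : ℕ} (φ : PiHom m n) (g : G) (x : obj m), map φ (g • x) = g • map φ x
  map_id : ∀ {n : ℕ} (x : obj n), map (PiHom.id n) x = x
  map_comp : ∀ {k m n : ℕ} (φ : PiHom m n) (ψ : PiHom k m) (x : obj k),
    map (φ.comp ψ) x = map φ (map ψ x)

namespace PiDiagram

attribute [instance] PiDiagram.top PiDiagram.cg PiDiagram.act PiDiagram.cont_act

variable {G : Type v} [Group G]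

/-- The action of `G × Σ_n` on `X_n`. -/
instance prodAction (X : PiDiagram.{u} G) (n : ℕ) :
    MulAction (G × Equiv.Perm (Fin n)) (X.obj n) where
  smul p x := X.map (PiHom.ofPerm p.2) (p.1 • x)
  one_smul x := by
    change X.map (PiHom.ofPerm 1) ((1 : G) • x) = x
    rw [one_smul, PiHom.ofPerm_one, X.map_id]
  mul_smul p q x := by
    change X.map (PiHom.ofPerm (p.2 * q.2)) ((p.1 * q.1) • x) =
      X.map (PiHom.ofPerm p.2) (p.1 • X.map (PiHom.ofPerm q.2) (q.1 • x))
    rw [PiHom.ofPerm_mul, X.map_comp, mul_smul, X.map_smul]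

theorem prod_smul_def (X : PiDiagram.{u} G) {n : ℕ} (p : G × Equiv.Perm (Fin n)) (x : X.obj n) :
    p • x = X.map (PiHom.ofPerm p.2) (p.1 • x) := rfl

/-- `X` is a `Π`-`G`-space, that is, a based functor from `Π` to nondegenerately based compactly
generated weak Hausdorff `G`-spaces: the spaces `X_n` are weak Hausdorff, `X_0` is a point, and the
base point of `X_n`, which is the image of `X_0 → X_n`, is nondegenerate. -/
structure IsPiSpace (X : PiDiagram.{u} G) : Prop where
  weakHausdorff : ∀ n, WeakHausdorffSpace (X.obj n)
  point : Nonempty (Unique (X.obj 0))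
  nondegenerate : ∀ n, IsCofibration G (Set.range (X.map (PiHom.zero 0 n)))

/-- The `n`th latching space `L_n X`, the union of the images of the maps
`(σᵢ)_* : X_{n-1} → X_n`, `1 ≤ i ≤ n`. -/
def latching (X : PiDiagram.{u} G) : ∀ n, Set (X.obj n)
  | 0 => ∅
  | _ + 1 => ⋃ i, Set.range (X.map (PiHom.skip i))

/-- `X` is Reedy cofibrant: `L_n X → X_n` is a `(G × Σ_n)`-cofibration for each `n`. -/
def IsReedyCofibrant (X : PiDiagram.{u} G) : Prop :=
  ∀ n, IsCofibration (G × Equiv.Perm (Fin n)) (X.latching n)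

/-- Maps of `Π`-`G`-spaces. -/
structure Hom (X Y : PiDiagram.{u} G) where
  /-- the maps `f_n : X_n → Y_n` -/
  app : ∀ n, C(X.obj n, Y.obj n)
  app_smul : ∀ (n : ℕ) (g : G) (x : X.obj n), app n (g • x) = g • app n x
  naturality : ∀ {m n : ℕ} (φ : PiHom m n) (x : X.obj m),
    app n (X.map φ x) = Y.map φ (app m x)

theorem Hom.app_prod_smul {X Y : PiDiagram.{u} G} (f : Hom X Y) (n : ℕ)
    (p : G × Equiv.Perm (Fin n)) (x : X.obj n) : f.app n (p • x) = p • f.app n x := by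
  rw [prod_smul_def, prod_smul_def, f.naturality, f.app_smul]

/-- `f` is an `𝔽_•`-level equivalence: `f_n` is a weak `Λ_α`-equivalence for all `n` and all
homomorphisms `α : G → Σ_n`, where `Λ_α` is the graph of `α`. -/
def Hom.IsLevelEquiv {X Y : PiDiagram.{u} G} (f : Hom X Y) : Prop :=
  ∀ (n : ℕ) (α : G →* Equiv.Perm (Fin n)),
    IsWeakEquivOver (f.app n) (f.app_prod_smul n) α.graph

/-- The space `X_1^n`, with the product in compactly generated spaces. -/
abbrev Power (X : PiDiagram.{u} G) (n : ℕ) : Type u := Kify (Fin n → X.obj 1)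

/-- The action of `G × Σ_n` on `X_1^n`. -/
instance powerAction (X : PiDiagram.{u} G) (n : ℕ) :
    MulAction (G × Equiv.Perm (Fin n)) (X.Power n) where
  smul p x := ⟨fun i => p.1 • x.get (p.2⁻¹ i)⟩
  one_smul x := by
    change (⟨fun i => (1 : G) • x.get i⟩ : X.Power n) = x
    simp
  mul_smul p q x := by
    change (⟨fun i => (p.1 * q.1) • x.get ((p.2 * q.2)⁻¹ i)⟩ : X.Power n) =
      ⟨fun i => p.1 • q.1 • x.get (q.2⁻¹ (p.2⁻¹ i))⟩
    simp [mul_smul]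

/-- The Segal map `δ : X_n → X_1^n`, with coordinates induced by the `δᵢ`. -/
def segal (X : PiDiagram.{u} G) (n : ℕ) : C(X.obj n, X.Power n) where
  toFun x := ⟨fun i => X.map (PiHom.delta i) x⟩
  continuous_toFun := Kify.continuous_rng (continuous_pi fun _ => (X.map _).continuous)

theorem segal_smul (X : PiDiagram.{u} G) (n : ℕ) (p : G × Equiv.Perm (Fin n)) (x : X.obj n) :
    X.segal n (p • x) = p • X.segal n x := by
  change (⟨fun i => X.map (PiHom.delta i) (X.map (PiHom.ofPerm p.2) (p.1 • x))⟩ : X.Power n) =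
    ⟨fun i => p.1 • X.map (PiHom.delta (p.2⁻¹ i)) x⟩
  congr 1
  funext i
  rw [← X.map_comp, PiHom.delta_comp_ofPerm, X.map_smul]

/-- `X` is `𝔽_•`-special: the Segal maps `X_n → X_1^n` are weak `Λ_α`-equivalences for all `n` and all
homomorphisms `α : G → Σ_n`. -/
def IsSpecial (X : PiDiagram.{u} G) : Prop :=
  ∀ (n : ℕ) (α : G →* Equiv.Perm (Fin n)),
    IsWeakEquivOver (X.segal n) (X.segal_smul n) α.graph

end PiDiagram

/-! ### The monad `𝔻` -/

namespace GOperad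

variable {G : Type v} [Group G] (C : GOperad.{u} G)

/-- The disjoint union of the products `𝒟(𝐪, 𝐧) × X_q`. -/
abbrev PreD (X : PiDiagram.{u} G) (n : ℕ) : Type u := Kify (Σ q : ℕ, C.DHom q n × X.obj q)

/-- The relation `(ψ^* f, x) ∼ (f, ψ_* x)`, for `f : 𝐪 → 𝐧` in `𝒟(C)`, `ψ : 𝐩 → 𝐪` in `Π` and
`x ∈ X_p`. -/
inductive DRel (X : PiDiagram.{u} G) (n : ℕ) : C.PreD X n → C.PreD X n → Prop
  | mk {p q : ℕ} (f : C.DHom q n) (ψ : PiHom p q) (x : X.obj p) :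
      DRel X n ⟨p, (f.comp (C.incl ψ), x)⟩ ⟨q, (f, X.map ψ x)⟩

/-- The space `(𝔻X)_n = 𝒟(-, 𝐧) ⊗_Π X`. -/
abbrev DObj (X : PiDiagram.{u} G) (n : ℕ) : Type u := Quot (C.DRel X n)

variable {C}

theorem DObj.continuous_desc {X : PiDiagram.{u} G} {n : ℕ} {Y : Type u} [TopologicalSpace Y]
    {F : C.DObj X n → Y}
    (h : ∀ (q : ℕ) (K : Type u) [TopologicalSpace K] [CompactSpace K] [T2Space K]
      (f : K → C.DHom q n) (x : K → X.obj q), Continuous f → Continuous x →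
      Continuous (fun k => F (Quot.mk _ ⟨q, (f k, x k)⟩))) : Continuous F :=
  continuous_coinduced_dom.2 (Kify.continuous_sigma fun q K _ _ _ g hg =>
    h q K (fun k => (g k).1) (fun k => (g k).2) (continuous_fst.comp hg) (continuous_snd.comp hg))

theorem DObj.continuous_mk {X : PiDiagram.{u} G} {q n : ℕ} {K : Type u} [TopologicalSpace K]
    [CompactSpace K] [T2Space K] {f : K → C.DHom q n} {x : K → X.obj q} (hf : Continuous f)
    (hx : Continuous x) :
    Continuous (fun k => (Quot.mk _ ⟨q, (f k, x k)⟩ : C.DObj X n)) :=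
  continuous_quot_mk.comp (Kify.continuous_of_compact
    ((continuous_sigmaMk (σ := fun q => C.DHom q n × X.obj q)).comp (hf.prodMk hx)))

/-- The action of `G` on `(𝔻X)_n`. -/
instance (X : PiDiagram.{u} G) (n : ℕ) : MulAction G (C.DObj X n) where
  smul g := Quot.map (fun y => ⟨y.get.1, (g • y.get.2.1, g • y.get.2.2)⟩) (by
    rintro _ _ ⟨f, ψ, x⟩
    have h := DRel.mk (C := C) (X := X) (g • f) ψ (g • x)
    rwa [← DHom.smul_incl g ψ, DHom.smul_comp, X.map_smul] at h)
  one_smul := by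
    rintro ⟨⟨q, f, x⟩⟩
    change (Quot.mk _ ⟨q, ((1 : G) • f, (1 : G) • x)⟩ : C.DObj X n) = _
    rw [_root_.one_smul, _root_.one_smul]
  mul_smul g h := by
    rintro ⟨⟨q, f, x⟩⟩
    change (Quot.mk _ ⟨q, ((g * h) • f, (g * h) • x)⟩ : C.DObj X n) =
      Quot.mk _ ⟨q, (g • h • f, g • h • x)⟩
    rw [mul_smul, mul_smul]

instance (X : PiDiagram.{u} G) (n : ℕ) : ContinuousConstSMul G (C.DObj X n) where
  continuous_const_smul g := DObj.continuous_desc fun _ _ _ _ _ f x hf hx =>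
    DObj.continuous_mk (f := fun k => g • f k) (x := fun k => g • x k)
      ((continuous_const_smul g).comp hf) ((continuous_const_smul g).comp hx)

instance (X : PiDiagram.{u} G) (n : ℕ) : CompactlyGeneratedSpace (C.DObj X n) :=
  compactlyGeneratedSpace_of_coinduced (X := C.PreD X n) (f := Quot.mk _) continuous_quot_mk rfl

variable (C) in
/-- The endofunctor `𝔻` on objects, with `φ_*[f, x] = [φ ∘ f, x]`. -/
def D (X : PiDiagram.{u} G) : PiDiagram.{u} G where
  obj := C.DObj X
  map φ :=
    { toFun := Quot.map (fun y => ⟨y.get.1, ((C.incl φ).comp y.get.2.1, y.get.2.2)⟩) (by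
        rintro _ _ ⟨f, ψ, x⟩
        have h := DRel.mk (C := C) (X := X) ((C.incl φ).comp f) ψ x
        rwa [DHom.comp_assoc] at h)
      continuous_toFun := DObj.continuous_desc fun q K _ _ _ f x hf hx =>
        DObj.continuous_mk (f := fun k => (C.incl φ).comp (f k)) ((DHom.continuous_comp _).comp hf)
          hx }
  map_smul φ g := by
    rintro ⟨⟨q, f, x⟩⟩
    change (Quot.mk _ ⟨q, ((C.incl φ).comp (g • f), g • x)⟩ : C.DObj X _) =
      Quot.mk _ ⟨q, (g • (C.incl φ).comp f, g • x)⟩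
    rw [← DHom.smul_comp, DHom.smul_incl]
  map_id := by
    rintro n ⟨⟨q, f, x⟩⟩
    change (Quot.mk _ ⟨q, ((C.incl (PiHom.id n)).comp f, x)⟩ : C.DObj X _) = _
    rw [DHom.id_comp]
  map_comp φ ψ := by
    rintro ⟨⟨q, f, x⟩⟩
    change (Quot.mk _ ⟨q, ((C.incl (φ.comp ψ)).comp f, x)⟩ : C.DObj X _) =
      Quot.mk _ ⟨q, ((C.incl φ).comp ((C.incl ψ).comp f), x)⟩
    rw [← DHom.comp_assoc, DHom.incl_comp_incl]

variable (C) in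
/-- The endofunctor `𝔻` on maps, `(𝔻h)[f, x] = [f, h x]`. -/
def DMap {X Y : PiDiagram.{u} G} (h : PiDiagram.Hom X Y) : PiDiagram.Hom (C.D X) (C.D Y) where
  app n :=
    { toFun := Quot.map (fun y => ⟨y.get.1, (y.get.2.1, h.app _ y.get.2.2)⟩) (by
        rintro _ _ ⟨f, ψ, x⟩
        have e := DRel.mk (C := C) (X := Y) f ψ (h.app _ x)
        rwa [← h.naturality] at e)
      continuous_toFun := DObj.continuous_desc fun q K _ _ _ f x hf hx =>
        DObj.continuous_mk (x := fun k => h.app q (x k)) hf ((h.app q).continuous.comp hx) }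
  app_smul n g := by
    rintro ⟨⟨q, f, x⟩⟩
    change (Quot.mk _ ⟨q, (g • f, h.app q (g • x))⟩ : C.DObj Y _) =
      Quot.mk _ ⟨q, (g • f, g • h.app q x)⟩
    rw [h.app_smul]
  naturality φ := by
    rintro ⟨⟨q, f, x⟩⟩
    rfl

end GOperad

/-! ### The homotopy extension property of cubes -/

section CubeHEP

open unitInterval

local notation "Cu" m => Fin m → unitInterval

/-! A point of `(𝔻X)_n` is a class `[f, x]`. Coordinates that `f` sends to the base point can be
dropped, so there is a representative with `f` effective, and a map out of `𝔻X` amounts to data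
compatible with the injections of `Π` only (`DObj.injDesc`). For effective `f`, Σ-freeness gives a
neighbourhood disjoint from its translates by permutations (`DHom.exists_slim`). This would make
`𝔻X` locally a product of morphisms and points of `X_q`, were it not that the number of coordinates
drops where `x` is degenerate.

The remedy is the diagram `W X` of pairs `(x, t)`, with `x` degenerate in every coordinate where `tᵢ
≠ 0`; morphisms of `Π` insert coordinates `1`. For a threshold `a < 1`, the set of coordinates with
`tᵢ < a` is then independent of the representative. Where no `tᵢ` equals `a`, restricting `f` and
`x` to the `q` low coordinates gives a label in `𝒟(𝐪, 𝐧) × X_q`, unique up to renumbering; a `Chart`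
fixes the numbering. In the high coordinates `x` is degenerate, so nothing of `x` is lost, and
shrinking the low coordinates to `0` shows that the domain of the chart is homotopy equivalent to
the product of `X_q` and the corresponding domain for the terminal diagram
(`Chart.exists_isWeakEquiv_prod`). This holds on `L`-fixed points for `L ⊂ G × Σ_n`, with `L` acting
on `X_q` through some `ρ : L → Σ_q`, and on finite intersections of domains if the chart of least
degree is used. Being a weak equivalence is local on the target (`isWeakEquiv_of_open_cover`), so `𝔻
W f` is a weak equivalence on `L`-fixed points once the `f_q` are so on the fixed points of the
images of `L` in `G × Σ_q`. For `L` in the graph of a homomorphism `α` this follows from the level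
equivalence: a finite `L`-set embeds into a finite `G`-set, which exhibits the fixed points in
question as retracts (`Hom.IsLevelEquiv.isWeakEquiv_range`).

Reedy cofibrancy enters through one induction over degrees, `Insertion.exists_homotopy`: homotopies
on all `X_q` can be built with prescribed behaviour at degenerate points. It deforms the zero
section `X → W X`, which is not natural, to a map natural for injections. Hence `𝔻 W X → 𝔻 X` is an
equivariant homotopy equivalence (`exists_D_WProj_inverse`), and the first claim follows.

For the second claim, a special `X` is level equivalent to the diagram of powers of `X_1`. The
diagram `W` of these powers has invertible Segal maps, and `𝔻` preserves this up to the topology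
seen by compact spaces, because a morphism of `𝒟` is determined by its coordinates and any `n`
morphisms to `𝟏` with disjoint supports can be glued (`isWeakEquiv_segal_of_joins`). The comparison
takes place between values of `𝔻 W`, so no cofibrancy of the powers is needed.

For the third claim the same induction is run with values in spaces of maps from the nondegenerate
morphisms to the target of the extension problem (`ExtensionProblem.exists_extension`). The spaces
`(𝔻X)_n` are weak Hausdorff because equality of classes is witnessed by one of finitely many partial
injections (`DObj.mk_eq_mk_iff`).

Weak equivalences are handled throughout by the homotopy extension and lifting property for cubes
(`IsWeakEquiv.help`, `isWeakEquiv_of_help`). -/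

theorem exists_cube_retraction (m : ℕ) : ∃ ρ : C((Cu m) × I, (Cu m) × I),
    (∀ p, (ρ p).2 = 0 ∨ (ρ p).1 ∈ Cube.boundary (Fin m)) ∧ (∀ x, ρ (x, 0) = (x, 0)) ∧
      ∀ x ∈ Cube.boundary (Fin m), ∀ t, ρ (x, t) = (x, t) := by
  let y : (Cu m) → Fin m → ℝ := fun x i => 2 * (x i : ℝ) - 1
  have hy : Continuous y := by fun_prop
  have hy1 : ∀ x, ‖y x‖ ≤ 1 := fun x => (pi_norm_le_iff_of_nonneg zero_le_one).2 fun i => by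
    rw [Real.norm_eq_abs, abs_le]
    constructor <;> linarith [(x i).2.1, (x i).2.2]
  have hyb : ∀ x ∈ Cube.boundary (Fin m), ‖y x‖ = 1 := by
    rintro x ⟨i, hi⟩
    refine le_antisymm (hy1 x) ?_
    have := norm_le_pi_norm (y x) i
    rcases hi with hi | hi <;> simp [y, hi] at this <;> norm_num at this <;> exact this
  -- In the coordinate `y` the cube is the unit ball of the sup norm. The map `ρ` is the projection
  -- from the point at height `2` over the centre: the displacement from that point is divided by
  -- `M`, which is the factor needed to reach either the side (`‖y‖` larger) or the bottom (`1 -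
  -- t/2` larger).
  let M : (Cu m) × I → ℝ := fun p => max ‖y p.1‖ (1 - (p.2 : ℝ) / 2)
  have hM : Continuous M := by fun_prop
  have hMpos : ∀ p, 0 < M p := fun p => lt_of_lt_of_le (by linarith [p.2.2.2]) (le_max_right _ _)
  let ρ : C((Cu m) × I, (Cu m) × I) :=
    { toFun := fun p => (fun i => Set.projIcc 0 1 zero_le_one ((y p.1 i / M p + 1) / 2),
        Set.projIcc 0 1 zero_le_one (2 - (2 - (p.2 : ℝ)) / M p))
      continuous_toFun := by
        refine Continuous.prodMk (continuous_pi fun i => continuous_projIcc.comp ?_)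
          (continuous_projIcc.comp ?_)
        · exact (((continuous_apply i).comp (hy.comp continuous_fst)).div hM
            (fun p => (hMpos p).ne') |>.add continuous_const).div_const _
        · exact continuous_const.sub ((continuous_const.sub
            (continuous_subtype_val.comp continuous_snd)).div hM fun p => (hMpos p).ne') }
  have hfix : ∀ p, M p = 1 → ρ p = p := by
    intro p hp
    refine Prod.ext (funext fun i => ?_) ?_
    · change Set.projIcc 0 1 zero_le_one ((y p.1 i / M p + 1) / 2) = p.1 i
      have : (y p.1 i / M p + 1) / 2 = p.1 i := by simp only [y, hp]; ring
      rw [this, Set.projIcc_val]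
    · change Set.projIcc 0 1 zero_le_one (2 - (2 - (p.2 : ℝ)) / M p) = p.2
      have : 2 - (2 - (p.2 : ℝ)) / M p = p.2 := by rw [hp]; ring
      rw [this, Set.projIcc_val]
  refine ⟨ρ, fun p => ?_, fun x => hfix _ ?_, fun x hx t => hfix _ ?_⟩
  · rcases le_total ‖y p.1‖ (1 - (p.2 : ℝ) / 2) with h | h
    · left
      have e : M p = 1 - (p.2 : ℝ) / 2 := max_eq_right h
      have := hMpos p
      change Set.projIcc 0 1 zero_le_one (2 - (2 - (p.2 : ℝ)) / M p) = 0
      refine Set.projIcc_of_le_left _ ?_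
      have : 2 * M p = 2 - p.2 := by rw [e]; ring
      rw [sub_nonpos, le_div_iff₀ (hMpos p)]
      linarith
    · right
      have e : M p = ‖y p.1‖ := max_eq_left h
      have hpos := hMpos p
      rw [e] at hpos
      have hne : Nonempty (Fin m) := by
        by_contra hemp
        rw [not_nonempty_iff] at hemp
        have : y p.1 = 0 := Subsingleton.elim _ _
        rw [this, norm_zero] at hpos
        exact lt_irrefl _ hpos
      obtain ⟨i, hi⟩ := Finite.exists_max (fun i => ‖y p.1 i‖)
      have hi' : ‖y p.1‖ = ‖y p.1 i‖ := le_antisymm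
        ((pi_norm_le_iff_of_nonneg (norm_nonneg _)).2 hi) (norm_le_pi_norm _ i)
      refine ⟨i, ?_⟩
      change Set.projIcc 0 1 zero_le_one ((y p.1 i / M p + 1) / 2) = 0 ∨
        Set.projIcc 0 1 zero_le_one ((y p.1 i / M p + 1) / 2) = 1
      rw [e, hi', Real.norm_eq_abs]
      rw [hi', Real.norm_eq_abs] at hpos
      rcases abs_cases (y p.1 i) with ⟨h1, h2⟩ | ⟨h1, h2⟩
      · right
        rw [h1] at hpos ⊢
        rw [div_self hpos.ne']
        exact Set.projIcc_of_right_le _ (by norm_num)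
      · left
        rw [h1] at hpos ⊢
        rw [div_neg, div_self (by linarith)]
        exact Set.projIcc_of_le_left _ (by norm_num)
  · change max _ _ = _
    simp [hy1 x]
  · change max _ _ = _
    rw [hyb x hx]
    exact max_eq_left (by linarith [t.2.1])

variable {A B : Type*} [TopologicalSpace A] [TopologicalSpace B]

theorem isClosed_boundary (m : ℕ) : IsClosed (Cube.boundary (Fin m)) := by
  have : Cube.boundary (Fin m) = ⋃ i, ({y | y i = 0} ∪ {y | y i = 1}) := by
    ext y; simp [Cube.boundary]
  rw [this]
  exact isClosed_iUnion_of_finite fun i =>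
    (isClosed_eq (continuous_apply i) continuous_const).union
      (isClosed_eq (continuous_apply i) continuous_const)

/-- Glue `f` on the bottom with `h` on the sides, both closed, and compose with the retraction of
the cylinder onto their union. The homotopy is a total function that is continuous only on the
boundary, so that partial data can be glued without passing to subtypes. -/
theorem cube_hep {m : ℕ} (f : C(Cu m, B)) (h : (Cu m) → I → B)
    (hc : ContinuousOn (Function.uncurry h) (Cube.boundary (Fin m) ×ˢ Set.univ))
    (h0 : ∀ x ∈ Cube.boundary (Fin m), h x 0 = f x) :
    ∃ F : C((Cu m) × I, B), (∀ x, F (x, 0) = f x) ∧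
      ∀ x ∈ Cube.boundary (Fin m), ∀ t, F (x, t) = h x t := by
  classical
  obtain ⟨ρ, h1, h2, h3⟩ := exists_cube_retraction m
  let g : (Cu m) × I → B := fun p => if p.2 = 0 then f p.1 else h p.1 p.2
  have e1 : Set.EqOn g (fun p => f p.1) {p | p.2 = 0} := fun p hp => if_pos hp
  have e2 : Set.EqOn g (Function.uncurry h) (Cube.boundary (Fin m) ×ˢ Set.univ) := by
    rintro ⟨x, t⟩ ⟨hx, -⟩
    by_cases ht : t = 0
    · subst ht; simp [g, h0 x hx]
    · simp [g, ht]
  have hg : ContinuousOn g ({p | p.2 = 0} ∪ Cube.boundary (Fin m) ×ˢ Set.univ) := by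
    refine ContinuousOn.union_of_isClosed ?_ ?_ ?_ ?_
    · exact (f.continuous.comp continuous_fst).continuousOn.congr e1
    · exact hc.congr e2
    · exact isClosed_eq continuous_snd continuous_const
    · exact (isClosed_boundary m).prod isClosed_univ
  refine ⟨⟨fun p => g (ρ p), ?_⟩, fun x => ?_, fun x hx t => ?_⟩
  · refine hg.comp_continuous ρ.continuous fun p => ?_
    rcases h1 p with h | h
    · exact Or.inl h
    · exact Or.inr ⟨h, trivial⟩
  · change g (ρ (x, 0)) = _
    rw [h2]
    exact e1 rfl
  · change g (ρ (x, t)) = _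
    rw [h3 x hx]
    exact e2 (x := (x, t)) ⟨hx, trivial⟩

/-- The pair `(x, r)` is a point of an `(m+1)`-cube whose boundary consists of the faces `r = 0` and
`r = 1`, where `v₀` and `v₁` are prescribed, and of the part over the boundary of the `m`-cube,
where `w` is. So this is `cube_hep` in dimension `m + 1`, with homotopy parameter `s`. -/
theorem cube_hep_prod {m : ℕ} (f v₀ v₁ : C((Cu m) × I, B)) (w : (Cu m) → I → I → B)
    (hw : ContinuousOn (fun p : (Cu m) × I × I => w p.1 p.2.1 p.2.2)
      (Cube.boundary (Fin m) ×ˢ Set.univ))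
    (h0 : ∀ x, v₀ (x, 0) = f (x, 0)) (h1 : ∀ x, v₁ (x, 0) = f (x, 1))
    (hf : ∀ x ∈ Cube.boundary (Fin m), ∀ r, w x r 0 = f (x, r))
    (hw0 : ∀ x ∈ Cube.boundary (Fin m), ∀ s, w x 0 s = v₀ (x, s))
    (hw1 : ∀ x ∈ Cube.boundary (Fin m), ∀ s, w x 1 s = v₁ (x, s)) :
    ∃ F : C((Cu m) × I × I, B), (∀ x r, F (x, r, 0) = f (x, r)) ∧
      (∀ x s, F (x, 0, s) = v₀ (x, s)) ∧ (∀ x s, F (x, 1, s) = v₁ (x, s)) ∧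
      ∀ x ∈ Cube.boundary (Fin m), ∀ r s, F (x, r, s) = w x r s := by
  classical
  let c : C((Cu m) × I, Cu (m + 1)) :=
    { toFun := fun p => Fin.cons p.2 p.1
      continuous_toFun := continuous_pi (Fin.cases (by simpa using continuous_snd)
        fun i => by simp only [Fin.cons_succ]; fun_prop) }
  let d : C(Cu (m + 1), (Cu m) × I) := ⟨fun z => (Fin.tail z, z 0), by
    refine Continuous.prodMk (continuous_pi fun i => continuous_apply _) (continuous_apply _)⟩
  have hcd : ∀ p, d (c p) = p := fun p => by simp [c, d]
  let h : (Cu (m + 1)) → I → B := fun z s =>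
    if z 0 = 0 then v₀ (Fin.tail z, s) else if z 0 = 1 then v₁ (Fin.tail z, s)
      else w (Fin.tail z) (z 0) s
  let S0 : Set ((Cu (m + 1)) × I) := {q | q.1 0 = 0}
  let S1 : Set ((Cu (m + 1)) × I) := {q | q.1 0 = 1}
  let S2 : Set ((Cu (m + 1)) × I) := {q | Fin.tail q.1 ∈ Cube.boundary (Fin m)}
  have htail : Continuous fun q : (Cu (m + 1)) × I => (Fin.tail q.1 : Cu m) :=
    continuous_pi fun i => (continuous_apply _).comp continuous_fst
  have hz : Continuous fun q : (Cu (m + 1)) × I => q.1 0 :=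
    (continuous_apply _).comp continuous_fst
  have E0 : Set.EqOn (Function.uncurry h) (fun q => v₀ (Fin.tail q.1, q.2)) S0 :=
    fun q hq => if_pos hq
  have E1 : Set.EqOn (Function.uncurry h) (fun q => v₁ (Fin.tail q.1, q.2)) S1 := by
    rintro q (hq : q.1 0 = 1)
    simp [Function.uncurry, h, hq]
  have E2 : Set.EqOn (Function.uncurry h) (fun q => w (Fin.tail q.1) (q.1 0) q.2) S2 := by
    rintro q (hq : Fin.tail q.1 ∈ Cube.boundary (Fin m))
    simp only [Function.uncurry, h]
    split_ifs with a b
    · rw [a, hw0 _ hq]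
    · rw [b, hw1 _ hq]
    · rfl
  have hbd : ∀ z : Cu (m + 1), z ∈ Cube.boundary (Fin (m + 1)) ↔
      z 0 = 0 ∨ z 0 = 1 ∨ Fin.tail z ∈ Cube.boundary (Fin m) := by
    intro z
    simp only [Cube.boundary, Set.mem_ofPred_eq, Fin.exists_fin_succ, or_assoc]
    rfl
  have hsub : Cube.boundary (Fin (m + 1)) ×ˢ (Set.univ : Set I) ⊆ (S0 ∪ S1) ∪ S2 := by
    rintro ⟨z, s⟩ ⟨h, -⟩
    rcases (hbd z).1 h with h | h | h
    · exact Or.inl (Or.inl h)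
    · exact Or.inl (Or.inr h)
    · exact Or.inr h
  have cl0 : IsClosed S0 := isClosed_eq hz continuous_const
  have cl1 : IsClosed S1 := isClosed_eq hz continuous_const
  have cl2 : IsClosed S2 := (isClosed_boundary m).preimage htail
  have hc : ContinuousOn (Function.uncurry h) (Cube.boundary (Fin (m + 1)) ×ˢ Set.univ) := by
    refine ContinuousOn.mono ?_ hsub
    refine ContinuousOn.union_of_isClosed (ContinuousOn.union_of_isClosed ?_ ?_ cl0 cl1) ?_
      (cl0.union cl1) cl2
    · exact (v₀.continuous.comp (htail.prodMk continuous_snd)).continuousOn.congr E0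
    · exact (v₁.continuous.comp (htail.prodMk continuous_snd)).continuousOn.congr E1
    · refine ContinuousOn.congr ?_ E2
      exact hw.comp (htail.prodMk (hz.prodMk continuous_snd)).continuousOn
        fun q hq => ⟨hq, trivial⟩
  obtain ⟨F, F0, F1⟩ := cube_hep (f.comp d) h hc (by
    intro z hz
    change h z 0 = f (Fin.tail z, z 0)
    simp only [h]
    split_ifs with a b
    · rw [a, h0]
    · rw [b, h1]
    · rcases (hbd z).1 hz with h | h | h
      · exact absurd h a
      · exact absurd h b
      · rw [hf _ h])
  refine ⟨F.comp ⟨fun p => (c (p.1, p.2.1), p.2.2), by fun_prop⟩, fun x r => ?_, fun x s => ?_,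
    fun x s => ?_, fun x hx r s => ?_⟩
  · change F (c (x, r), 0) = _
    rw [F0]
    change f (d (c (x, r))) = _
    rw [hcd]
  · change F (c (x, 0), s) = _
    rw [F1 _ ((hbd _).2 (by simp [c]))]
    simp [h, c]
  · change F (c (x, 1), s) = _
    rw [F1 _ ((hbd _).2 (by simp [c]))]
    simp [h, c]
  · change F (c (x, r), s) = _
    rw [F1 _ ((hbd _).2 (by simp [c, hx]))]
    exact (E2 (x := (c (x, r), s)) (by simpa [S2, c] using hx)).trans (by simp [c])

/-- Transport of homotopies relative to the boundary along a pair of homotopies that agree on the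
boundary. -/
theorem cube_transport {m : ℕ} (θ θ' : C((Cu m) × I, B))
    (hθ : ∀ x ∈ Cube.boundary (Fin m), ∀ s, θ' (x, s) = θ (x, s))
    (F : C((Cu m) × I, B)) (F0 : ∀ x, F (x, 0) = θ (x, 0)) (F1 : ∀ x, F (x, 1) = θ' (x, 0))
    (Fb : ∀ x ∈ Cube.boundary (Fin m), ∀ r, F (x, r) = θ (x, 0)) :
    ∃ F' : C((Cu m) × I, B), (∀ x, F' (x, 0) = θ (x, 1)) ∧ (∀ x, F' (x, 1) = θ' (x, 1)) ∧
      ∀ x ∈ Cube.boundary (Fin m), ∀ r, F' (x, r) = θ (x, 1) := by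
  -- Over the boundary `F` does not depend on `r`, so the side values can be taken independent of
  -- `r` too; the face `s = 1` of the filling is the transported homotopy.
  obtain ⟨K, -, K1, K2, K3⟩ := cube_hep_prod F θ θ' (fun x _ s => θ (x, s))
    (by fun_prop) (fun x => (F0 x).symm) (fun x => (F1 x).symm) (fun x hx r => (Fb x hx r).symm)
    (fun _ _ _ => rfl) (fun x hx s => (hθ x hx s).symm)
  exact ⟨K.comp ⟨fun p => (p.1, p.2, 1), by fun_prop⟩, fun x => K1 x 1, fun x => K2 x 1,
    fun x hx r => K3 x hx r 1⟩

end CubeHEP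

/-! ### Weak equivalences -/

section WeakEquivalenceBasics

open unitInterval

local notation "Cu" m => Fin m → unitInterval

section RelHomotopic

variable {A B : Type*} [TopologicalSpace A] [TopologicalSpace B]

/-- The maps `p` and `q` are homotopic relative to the boundary of the cube. -/
def RelHomotopic {m : ℕ} (p q : C(Cu m, B)) : Prop :=
  ∃ F : C((Cu m) × I, B), (∀ x, F (x, 0) = p x) ∧ (∀ x, F (x, 1) = q x) ∧
    ∀ x ∈ Cube.boundary (Fin m), ∀ r, F (x, r) = p x

theorem relHomotopic_iff {m : ℕ} (p q : C(Cu m, B)) :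
    RelHomotopic p q ↔ p.HomotopicRel q (Cube.boundary (Fin m)) := by
  constructor
  · rintro ⟨F, h0, h1, hb⟩
    exact ⟨⟨⟨F.comp ⟨Prod.swap, continuous_swap⟩, h0, h1⟩, fun t x hx => hb x hx t⟩⟩
  · rintro ⟨F⟩
    exact ⟨F.toContinuousMap.comp ⟨Prod.swap, continuous_swap⟩, fun x => F.apply_zero x,
      fun x => F.apply_one x, fun x hx t => F.prop t x hx⟩

theorem RelHomotopic.refl {m : ℕ} (p : C(Cu m, B)) : RelHomotopic p p :=
  (relHomotopic_iff _ _).2 (.refl _)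

theorem RelHomotopic.symm {m : ℕ} {p q : C(Cu m, B)} (h : RelHomotopic p q) : RelHomotopic q p :=
  (relHomotopic_iff _ _).2 ((relHomotopic_iff _ _).1 h).symm

theorem RelHomotopic.map {m : ℕ} {p q : C(Cu m, A)} (h : RelHomotopic p q) (f : C(A, B)) :
    RelHomotopic (f.comp p) (f.comp q) := by
  obtain ⟨F, h0, h1, hb⟩ := h
  exact ⟨f.comp F, fun x => congrArg f (h0 x), fun x => congrArg f (h1 x),
    fun x hx r => congrArg f (hb x hx r)⟩

/-- Transport of relative homotopies along homotopies with the same restriction to the boundary. -/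
theorem RelHomotopic.transport {m : ℕ} {p p' q q' : C(Cu m, B)} (h : RelHomotopic p p')
    (θ θ' : C((Cu m) × I, B)) (h0 : ∀ x, θ (x, 0) = p x) (h1 : ∀ x, θ (x, 1) = q x)
    (h0' : ∀ x, θ' (x, 0) = p' x) (h1' : ∀ x, θ' (x, 1) = q' x)
    (hb : ∀ x ∈ Cube.boundary (Fin m), ∀ s, θ' (x, s) = θ (x, s)) : RelHomotopic q q' := by
  obtain ⟨F, F0, F1, Fb⟩ := h
  obtain ⟨F', a, b, c⟩ := cube_transport θ θ' hb F (fun x => (F0 x).trans (h0 x).symm)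
    (fun x => (F1 x).trans (h0' x).symm) fun x hx r => (Fb x hx r).trans (h0 x).symm
  exact ⟨F', fun x => (a x).trans (h1 x), fun x => (b x).trans (h1' x),
    fun x hx r => (c x hx r).trans (h1 x)⟩

end RelHomotopic

/-- A homotopy, run backwards. -/
def homotopyRev {A B : Type*} [TopologicalSpace A] [TopologicalSpace B] (h : C(A × I, B)) :
    C(A × I, B) := h.comp ⟨fun p => (p.1, unitInterval.symm p.2), by fun_prop⟩

theorem homotopyRev_apply {A B : Type*} [TopologicalSpace A] [TopologicalSpace B] (h : C(A × I, B))
    (a : A) (t : I) : homotopyRev h (a, t) = h (a, unitInterval.symm t) := rfl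

variable {A B D : Type u} [TopologicalSpace A] [TopologicalSpace B] [TopologicalSpace D]

/-- `f` induces an injection on `π_n(-, a)`. -/
def PiInj (f : C(A, B)) (n : ℕ) (a : A) : Prop :=
  ∀ p p' : C(Cu n, A), (∀ x ∈ Cube.boundary (Fin n), p x = a) →
    (∀ x ∈ Cube.boundary (Fin n), p' x = a) → RelHomotopic (f.comp p) (f.comp p') →
      RelHomotopic p p'

/-- `f` induces a surjection on `π_n(-, a)`. -/
def PiSurj (f : C(A, B)) (n : ℕ) (a : A) : Prop :=
  ∀ q : C(Cu n, B), (∀ x ∈ Cube.boundary (Fin n), q x = f a) →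
    ∃ p : C(Cu n, A), (∀ x ∈ Cube.boundary (Fin n), p x = a) ∧ RelHomotopic (f.comp p) q

theorem piMap_injective_iff (f : C(A, B)) (n : ℕ) (a : A) :
    Function.Injective (piMap f n a) ↔ PiInj f n a := by
  constructor
  · intro h p p' hp hp' hr
    have e : piMap f n a (Quotient.mk _ ⟨p, hp⟩) = piMap f n a (Quotient.mk _ ⟨p', hp'⟩) :=
      Quotient.sound ((relHomotopic_iff _ _).1 hr)
    exact (relHomotopic_iff _ _).2 (Quotient.exact (h e))
  · rintro h ⟨p, hp⟩ ⟨p', hp'⟩ e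
    exact Quotient.sound ((relHomotopic_iff _ _).1 (h p p' hp hp'
      ((relHomotopic_iff _ _).2 (Quotient.exact e))))

theorem piMap_surjective_iff (f : C(A, B)) (n : ℕ) (a : A) :
    Function.Surjective (piMap f n a) ↔ PiSurj f n a := by
  constructor
  · intro h q hq
    obtain ⟨⟨p, hp⟩, e⟩ := h (Quotient.mk _ ⟨q, hq⟩)
    exact ⟨p, hp, (relHomotopic_iff _ _).2 (Quotient.exact e)⟩
  · rintro h ⟨q, hq⟩
    obtain ⟨p, hp, e⟩ := h q hq
    exact ⟨Quotient.mk _ ⟨p, hp⟩, Quotient.sound ((relHomotopic_iff _ _).1 e)⟩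

theorem pi0Map_injective_iff (f : C(A, B)) :
    Function.Injective (pi0Map f) ↔ ∀ a a', Joined (f a) (f a') → Joined a a' := by
  constructor
  · intro h a a' hr
    have e : pi0Map f (Quotient.mk _ a) = pi0Map f (Quotient.mk _ a') := Quotient.sound hr
    exact Quotient.exact (h e)
  · rintro h ⟨a⟩ ⟨a'⟩ e
    exact Quotient.sound (h a a' (Quotient.exact e))

theorem pi0Map_surjective_iff (f : C(A, B)) :
    Function.Surjective (pi0Map f) ↔ ∀ b, ∃ a, Joined (f a) b := by
  constructor
  · intro h b
    obtain ⟨⟨a⟩, e⟩ := h (Quotient.mk _ b)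
    exact ⟨a, Quotient.exact e⟩
  · rintro h ⟨b⟩
    obtain ⟨a, e⟩ := h b
    exact ⟨Quotient.mk _ a, Quotient.sound e⟩

theorem isWeakEquiv_iff (f : C(A, B)) : IsWeakEquiv f ↔
    ((∀ a a', Joined (f a) (f a') → Joined a a') ∧ ∀ b, ∃ a, Joined (f a) b) ∧
      ∀ (n : ℕ) (a : A), PiInj f (n + 1) a ∧ PiSurj f (n + 1) a := by
  simp only [IsWeakEquiv, Function.Bijective, pi0Map_injective_iff, pi0Map_surjective_iff,
    piMap_injective_iff, piMap_surjective_iff]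

theorem piMap_comp (g : C(B, D)) (f : C(A, B)) (n : ℕ) (a : A) :
    piMap (g.comp f) n a = piMap g n (f a) ∘ piMap f n a := by
  funext x
  induction x using Quotient.inductionOn
  rfl

theorem pi0Map_comp (g : C(B, D)) (f : C(A, B)) : pi0Map (g.comp f) = pi0Map g ∘ pi0Map f := by
  funext x
  induction x using Quotient.inductionOn
  rfl

namespace IsWeakEquiv

theorem comp {g : C(B, D)} {f : C(A, B)} (hg : IsWeakEquiv g) (hf : IsWeakEquiv f) :
    IsWeakEquiv (g.comp f) := by
  refine ⟨?_, fun n a => ?_⟩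
  · rw [pi0Map_comp]
    exact hg.1.comp hf.1
  · rw [piMap_comp]
    exact (hg.2 n (f a)).comp (hf.2 n a)

theorem of_comp_left {g : C(B, D)} {f : C(A, B)} (hg : IsWeakEquiv g)
    (h : IsWeakEquiv (g.comp f)) : IsWeakEquiv f := by
  refine ⟨?_, fun n a => ?_⟩
  · have h1 := h.1
    rw [pi0Map_comp] at h1
    exact (Function.Bijective.of_comp_iff' hg.1 _).1 h1
  · have h1 := h.2 n a
    rw [piMap_comp] at h1
    exact (Function.Bijective.of_comp_iff' (hg.2 n (f a)) _).1 h1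

/-- The homotopy moves the base point `f a` to `g a` along a path. No change-of-base-point
isomorphism is constructed: relative homotopies are transported directly along homotopies that agree
on the boundary. -/
theorem of_homotopy {f g : C(A, B)} (hf : IsWeakEquiv f) (h : C(A × I, B))
    (h0 : ∀ a, h (a, 0) = f a) (h1 : ∀ a, h (a, 1) = g a) : IsWeakEquiv g := by
  have hj : ∀ a, Joined (f a) (g a) := fun a =>
    ⟨⟨h.comp ⟨fun t => (a, t), by fun_prop⟩, h0 a, h1 a⟩⟩
  rw [isWeakEquiv_iff] at hf ⊢
  obtain ⟨⟨hi, hs⟩, hn⟩ := hf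
  refine ⟨⟨fun a a' e => hi a a' (((hj a).trans e).trans (hj a').symm), fun b => ?_⟩,
    fun n a => ⟨fun p p' hp hp' e => ?_, fun q hq => ?_⟩⟩
  · obtain ⟨a, ha⟩ := hs b
    exact ⟨a, (hj a).symm.trans ha⟩
  · refine (hn n a).1 p p' hp hp' ?_
    let θ : C(Cu (n + 1), A) → C((Cu (n + 1)) × I, B) := fun p =>
      h.comp ⟨fun y => (p y.1, unitInterval.symm y.2), by fun_prop⟩
    refine e.transport (θ p) (θ p') ?_ ?_ ?_ ?_ ?_ <;> intro x
    · simp [θ, h1]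
    · simp [θ, h0]
    · simp [θ, h1]
    · simp [θ, h0]
    · intro hx s
      simp [θ, hp x hx, hp' x hx]
  · obtain ⟨θ, θ0, θ1⟩ := cube_hep q (fun _ s => h (a, unitInterval.symm s)) (by fun_prop)
      (fun x hx => by simp [h1, hq x hx])
    obtain ⟨p, hp, hr⟩ := (hn n a).2 (θ.comp ⟨fun x => (x, 1), by fun_prop⟩)
      (fun x hx => by simp [θ1 x hx, h0])
    refine ⟨p, hp, ?_⟩
    refine hr.transport (h.comp ⟨fun y => (p y.1, y.2), by fun_prop⟩) (homotopyRev θ)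
      ?_ ?_ ?_ ?_ ?_ <;> intro x
    · simp [h0]
    · simp [h1]
    · simp [homotopyRev_apply]
    · simp [homotopyRev_apply, θ0]
    · intro hx s
      simp [homotopyRev_apply, θ1 x hx, hp x hx]

theorem id : IsWeakEquiv (ContinuousMap.id A) := by
  rw [isWeakEquiv_iff]
  exact ⟨⟨fun _ _ h => h, fun b => ⟨b, .refl _⟩⟩, fun n a => ⟨fun _ _ _ _ h => h,
    fun q hq => ⟨q, hq, .refl _⟩⟩⟩

/-- If `fg` and `gf` are weak equivalences, then so is `f`. -/
theorem of_comp_comp {f : C(A, B)} {g : C(B, A)} (h : IsWeakEquiv (g.comp f))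
    (h' : IsWeakEquiv (f.comp g)) : IsWeakEquiv f := by
  have key : ∀ {X Y Z W : Type u} (f : X → Y) (g : Y → Z) (k : Z → W),
      Function.Bijective (g ∘ f) → Function.Bijective (k ∘ g) → Function.Bijective f := by
    intro X Y Z W f g k h1 h2
    have hg : Function.Bijective g := ⟨h2.1.of_comp, h1.2.of_comp⟩
    exact (Function.Bijective.of_comp_iff' hg f).1 h1
  refine ⟨?_, fun n a => ?_⟩
  · refine key (pi0Map f) (pi0Map g) (pi0Map f) ?_ ?_
    · rw [← pi0Map_comp]; exact h.1
    · rw [← pi0Map_comp]; exact h'.1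
  · refine key (piMap f (n + 1) a) (piMap g (n + 1) (f a)) (piMap f (n + 1) (g (f a))) ?_ ?_
    · rw [← piMap_comp]; exact h.2 n a
    · rw [← piMap_comp]; exact h'.2 n (f a)

theorem of_homotopyEquiv {f : C(A, B)} {g : C(B, A)} (h : C(A × I, A)) (k : C(B × I, B))
    (h0 : ∀ a, h (a, 0) = a) (h1 : ∀ a, h (a, 1) = g (f a))
    (k0 : ∀ b, k (b, 0) = b) (k1 : ∀ b, k (b, 1) = f (g b)) : IsWeakEquiv f :=
  of_comp_comp (IsWeakEquiv.id.of_homotopy h h0 h1) (IsWeakEquiv.id.of_homotopy k k0 k1)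

/-- If `fp` is a weak equivalence and `p` is a homotopy equivalence, then `f` is a weak
equivalence. -/
theorem of_comp_right {f : C(B, D)} {p : C(A, B)} {r : C(B, A)} (hf : IsWeakEquiv (f.comp p))
    (hr : IsWeakEquiv r) (h : C(B × I, B)) (h0 : ∀ b, h (b, 0) = b)
    (h1 : ∀ b, h (b, 1) = p (r b)) : IsWeakEquiv f :=
  (hf.comp hr).of_homotopy (f.comp (homotopyRev h))
    (fun b => by simp [homotopyRev_apply, h1]) (fun b => by simp [homotopyRev_apply, h0])

/-- Push a lifting problem for `f` forward along `i` and `j`, solve it for `f'`, and bring the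
solution back along `r` and `s`. -/
theorem retract {A' B' : Type u} [TopologicalSpace A'] [TopologicalSpace B'] {f : C(A, B)}
    {f' : C(A', B')} (hf : IsWeakEquiv f') (i : C(A, A')) (r : C(A', A)) (j : C(B, B'))
    (s : C(B', B)) (hi : ∀ a, r (i a) = a) (hj : ∀ b, s (j b) = b)
    (e : ∀ a, f' (i a) = j (f a)) (e' : ∀ a, f (r a) = s (f' a)) : IsWeakEquiv f := by
  rw [isWeakEquiv_iff] at hf ⊢
  obtain ⟨⟨hin, hs⟩, hn⟩ := hf
  have hi' : r.comp i = ContinuousMap.id A := ContinuousMap.ext hi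
  have e1 : f'.comp i = j.comp f := ContinuousMap.ext e
  have e2 : f.comp r = s.comp f' := ContinuousMap.ext e'
  refine ⟨⟨fun a a' h => ?_, fun b => ?_⟩, fun n a => ⟨fun p p' hp hp' h => ?_, fun q hq => ?_⟩⟩
  · have h1 : Joined (f' (i a)) (f' (i a')) := by
      rw [e, e]
      exact h.map j.continuous
    have h2 := (hin _ _ h1).map r.continuous
    rwa [hi, hi] at h2
  · obtain ⟨a, ha⟩ := hs (j b)
    refine ⟨r a, ?_⟩
    rw [e']
    have h2 := ha.map s.continuous
    rwa [hj] at h2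
  · have h1 : RelHomotopic (f'.comp (i.comp p)) (f'.comp (i.comp p')) := by
      rw [← ContinuousMap.comp_assoc, ← ContinuousMap.comp_assoc, e1]
      exact h.map j
    have h2 := ((hn n (i a)).1 _ _ (fun x hx => congrArg i (hp x hx))
      (fun x hx => congrArg i (hp' x hx)) h1).map r
    rwa [← ContinuousMap.comp_assoc, ← ContinuousMap.comp_assoc, hi'] at h2
  · obtain ⟨p, hp, h⟩ := (hn n (i a)).2 (j.comp q) (fun x hx => by simp [hq x hx, e])
    refine ⟨r.comp p, fun x hx => by simp [hp x hx, hi], ?_⟩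
    have h2 := h.map s
    rwa [← ContinuousMap.comp_assoc, ← e2, ← ContinuousMap.comp_assoc,
      (ContinuousMap.ext hj : s.comp j = ContinuousMap.id B)] at h2

end IsWeakEquiv

end WeakEquivalenceBasics

/-! ### The homotopy extension and lifting property -/

section HELP

open unitInterval

local notation "Cu" m => Fin m → unitInterval

variable {A B : Type u} [TopologicalSpace A] [TopologicalSpace B]

/-- A map `a` on the boundary of a cube, a map `b` on the cube, and a homotopy `H` from `b` to
`f ∘ a` on the boundary can be extended to the cube. -/
def HasExtension (f : C(A, B)) {m : ℕ} (a : (Cu m) → A) (b : C(Cu m, B)) (H : (Cu m) → I → B) :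
    Prop :=
  ∃ (a' : C(Cu m, A)) (H' : C((Cu m) × I, B)), (∀ x ∈ Cube.boundary (Fin m), a' x = a x) ∧
    (∀ x, H' (x, 0) = b x) ∧ (∀ x, H' (x, 1) = f (a' x)) ∧
    ∀ x ∈ Cube.boundary (Fin m), ∀ s, H' (x, s) = H x s

/-- The homotopy extension and lifting property of `f` with respect to the `m`-cube. -/
def HELP (f : C(A, B)) (m : ℕ) : Prop :=
  ∀ (a : (Cu m) → A) (b : C(Cu m, B)) (H : (Cu m) → I → B),
    ContinuousOn a (Cube.boundary (Fin m)) →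
    ContinuousOn (Function.uncurry H) (Cube.boundary (Fin m) ×ˢ Set.univ) →
    (∀ x ∈ Cube.boundary (Fin m), H x 0 = b x) →
    (∀ x ∈ Cube.boundary (Fin m), H x 1 = f (a x)) → HasExtension f a b H

theorem HasExtension.congr {f : C(A, B)} {m : ℕ} {a a₁ : (Cu m) → A} {b b₁ : C(Cu m, B)}
    {H H₁ : (Cu m) → I → B} (h : HasExtension f a b H)
    (ha : ∀ x ∈ Cube.boundary (Fin m), a x = a₁ x) (hb : ∀ x, b x = b₁ x)
    (hH : ∀ x ∈ Cube.boundary (Fin m), ∀ s, H x s = H₁ x s) : HasExtension f a₁ b₁ H₁ := by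
  obtain ⟨a', H', h1, h2, h3, h4⟩ := h
  exact ⟨a', H', fun x hx => (h1 x hx).trans (ha x hx), fun x => (h2 x).trans (hb x), h3,
    fun x hx s => (h4 x hx s).trans (hH x hx s)⟩

/-- Extension problems may be deformed. -/
theorem HasExtension.of_homotopy {f : C(A, B)} {m : ℕ} (α : (Cu m) → I → A)
    (hα : ContinuousOn (Function.uncurry α) (Cube.boundary (Fin m) ×ˢ Set.univ))
    (β : C((Cu m) × I, B)) (Θ : (Cu m) → I → I → B)
    (hΘ : ContinuousOn (fun p : (Cu m) × I × I => Θ p.1 p.2.1 p.2.2)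
      (Cube.boundary (Fin m) ×ˢ Set.univ))
    (hΘ0 : ∀ x ∈ Cube.boundary (Fin m), ∀ s, Θ x s 0 = β (x, s))
    (hΘ1 : ∀ x ∈ Cube.boundary (Fin m), ∀ s, Θ x s 1 = f (α x s))
    (h : HasExtension f (fun x => α x 1) (β.comp ⟨fun x => (x, 1), by fun_prop⟩)
      (fun x u => Θ x 1 u)) :
    HasExtension f (fun x => α x 0) (β.comp ⟨fun x => (x, 0), by fun_prop⟩)
      (fun x u => Θ x 0 u) := by
  obtain ⟨a₁, H₁, h1, h2, h3, h4⟩ := h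
  -- The problem at `s = 1` is solved by `a₁` and `H₁`. Running the deformation backwards, `α` is
  -- extended over the cube starting from `a₁`; then `H₁`, the reversed `β` and `f ∘ α'` are three
  -- faces of a box, which is filled, and the opposite face solves the problem at `s = 0`.
  obtain ⟨α', hα0, hα1⟩ := cube_hep a₁ (fun x s => α x (unitInterval.symm s))
    (hα.comp (f := fun p : (Cu m) × I => (p.1, unitInterval.symm p.2)) (by fun_prop)
      fun p hp => ⟨hp.1, trivial⟩) (fun x hx => by simp [h1 x hx])
  obtain ⟨F, F0, F1, F2, F3⟩ := cube_hep_prod H₁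
    (homotopyRev β) (f.comp α') (fun x r s => Θ x (unitInterval.symm s) r)
    (hΘ.comp (f := fun p : (Cu m) × I × I => (p.1, unitInterval.symm p.2.2, p.2.1)) (by fun_prop)
      fun p hp => ⟨hp.1, trivial⟩)
    (fun x => by simp [homotopyRev_apply, h2]) (fun x => by simp [hα0, h3])
    (fun x hx r => by simp [h4 x hx]) (fun x hx s => by simp [homotopyRev_apply, hΘ0 x hx])
    (fun x hx s => by simp [hΘ1 x hx, hα1 x hx])
  refine ⟨α'.comp ⟨fun x => (x, 1), by fun_prop⟩, F.comp ⟨fun p => (p.1, p.2, 1), by fun_prop⟩,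
    fun x hx => ?_, fun x => ?_, fun x => ?_, fun x hx s => ?_⟩
  · simp [hα1 x hx]
  · simp [F1, homotopyRev_apply]
  · simp [F2]
  · simp [F3 x hx]

/-- It suffices to solve problems with a constant homotopy: extend `H` to `β` on the cube and deform
the problem along `H x (max s u)`, which is `H` for `s = 0` and independent of `u` for `s = 1`. -/
theorem help_of_strict {f : C(A, B)} {m : ℕ}
    (h : ∀ (a : (Cu m) → A) (b : C(Cu m, B)), ContinuousOn a (Cube.boundary (Fin m)) →
      (∀ x ∈ Cube.boundary (Fin m), b x = f (a x)) → HasExtension f a b fun x _ => b x) :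
    HELP f m := by
  intro a b H ha hH h0 h1
  obtain ⟨β, β0, β1⟩ := cube_hep b H hH h0
  refine (HasExtension.of_homotopy (fun x _ => a x) ?_ β (fun x s u => H x (max s u)) ?_ ?_ ?_
    ((h a (β.comp ⟨fun x => (x, 1), by fun_prop⟩) ha ?_).congr ?_ ?_ ?_)).congr ?_ ?_ ?_
  · exact ha.comp continuousOn_fst fun p hp => hp.1
  · exact hH.comp (f := fun p : (Cu m) × I × I => (p.1, max p.2.1 p.2.2)) (by fun_prop)
      fun p hp => ⟨hp.1, trivial⟩
  · intro x hx s
    rw [β1 x hx]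
    congr 1
    exact max_eq_left s.2.1
  · intro x hx s
    rw [← h1 x hx]
    congr 1
    exact max_eq_right s.2.2
  · intro x hx
    exact (β1 x hx 1).trans (h1 x hx)
  · exact fun _ _ => rfl
  · exact fun _ => rfl
  · intro x hx s
    refine (β1 x hx 1).trans ?_
    congr 1
    exact (max_eq_left (a := (1 : I)) s.2.2).symm
  · exact fun _ _ => rfl
  · exact β0
  · intro x hx s
    congr 1
    exact max_eq_right s.2.1

/-! ### Cubes of dimension `m + 1` as paths of `m`-cubes. -/

section Cube

theorem mem_boundary_succ {m : ℕ} (z : Cu (m + 1)) : z ∈ Cube.boundary (Fin (m + 1)) ↔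
    z 0 = 0 ∨ z 0 = 1 ∨ Fin.tail z ∈ Cube.boundary (Fin m) := by
  simp only [Cube.boundary, Set.mem_ofPred_eq, Fin.exists_fin_succ, or_assoc]
  rfl

@[fun_prop]
theorem continuous_cubeTail {m : ℕ} : Continuous fun z : Cu (m + 1) => (Fin.tail z : Cu m) :=
  continuous_pi fun _ => continuous_apply _

theorem continuous_cubeCons {m : ℕ} : Continuous fun p : I × (Cu m) => (Fin.cons p.1 p.2 : Cu (m + 1)) :=
  continuous_pi (Fin.cases (by simpa using continuous_fst)
    fun _ => by simp only [Fin.cons_succ]; fun_prop)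

theorem continuous_cubeCons_right {m : ℕ} (t : I) :
    Continuous fun x : Cu m => (Fin.cons t x : Cu (m + 1)) :=
  continuous_cubeCons.comp (f := fun x : Cu m => (t, x)) (by fun_prop)

open Topology.Homotopy

variable {X : Type u} [TopologicalSpace X] {m : ℕ} {x₀ : X}

/-- A path in the space of `m`-fold loops, as a map on the `(m+1)`-cube. -/
def pathToCube {p q : Ω^ (Fin m) X x₀} (γ : Path p q) : C(Cu (m + 1), X) where
  toFun z := γ (z 0) (Fin.tail z)
  continuous_toFun := by fun_prop

theorem pathToCube_relHomotopic {p q : Ω^ (Fin m) X x₀} {γ γ' : Path p q} (h : γ.Homotopic γ') :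
    RelHomotopic (pathToCube γ) (pathToCube γ') := by
  obtain ⟨F⟩ := h
  refine ⟨⟨fun y => F (y.2, y.1 0) (Fin.tail y.1), by fun_prop⟩, fun x => ?_, fun x => ?_,
    fun x hx r => ?_⟩
  · simp [pathToCube]
  · simp [pathToCube]
  · rcases (mem_boundary_succ x).1 hx with h | h | h
    · simp [pathToCube, h]
    · simp [pathToCube, h]
    · exact ((F (r, x 0)).2 _ h).trans ((γ (x 0)).2 _ h).symm

theorem path_homotopic_of_cube {p q : Ω^ (Fin m) X x₀} {γ γ' : Path p q}
    (h : RelHomotopic (pathToCube γ) (pathToCube γ')) : γ.Homotopic γ' := by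
  obtain ⟨F, F0, F1, Fb⟩ := h
  have hF : ∀ (t s : I) (x : Cu m), x ∈ Cube.boundary (Fin m) → F (Fin.cons t x, s) = x₀ := by
    intro t s x hx
    rw [Fb _ ((mem_boundary_succ _).2 (Or.inr (Or.inr (by simpa using hx))))]
    exact (γ t).2 _ (by simpa using hx)
  refine ⟨⟨⟨⟨fun y => ⟨⟨fun x => F (Fin.cons y.2 x, y.1), ?_⟩, fun x hx => hF _ _ x hx⟩, ?_⟩,
    fun t => ?_, fun t => ?_⟩, fun s t ht => ?_⟩⟩
  · exact F.continuous.comp ((continuous_cubeCons_right y.2).prodMk continuous_const)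
  · refine Continuous.subtype_mk (ContinuousMap.continuous_of_continuous_uncurry _ ?_) _
    exact F.continuous.comp ((continuous_cubeCons.comp
      (f := fun z : (I × I) × (Cu m) => (z.1.2, z.2)) (by fun_prop)).prodMk (by fun_prop))
  · ext x
    exact (F0 _).trans (by simp [pathToCube])
  · ext x
    exact (F1 _).trans (by simp [pathToCube])
  · ext x
    rcases ht with rfl | rfl
    · refine (Fb _ ((mem_boundary_succ _).2 (Or.inl rfl)) _).trans ?_
      simp [pathToCube]
    · refine (Fb _ ((mem_boundary_succ _).2 (Or.inr (Or.inl rfl))) _).trans ?_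
      simp [pathToCube]

theorem exists_path_of_cube {p q : Ω^ (Fin m) X x₀} (g : C(Cu (m + 1), X))
    (h0 : ∀ x, g (Fin.cons 0 x) = p x) (h1 : ∀ x, g (Fin.cons 1 x) = q x)
    (hb : ∀ z : Cu (m + 1), Fin.tail z ∈ Cube.boundary (Fin m) → g z = x₀) :
    ∃ γ : Path p q, pathToCube γ = g := by
  refine ⟨⟨⟨fun t => ⟨⟨fun x => g (Fin.cons t x), ?_⟩, fun x hx => hb _ (by simpa using hx)⟩, ?_⟩,
    ?_, ?_⟩, ?_⟩
  · exact g.continuous.comp (continuous_cubeCons_right t)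
  · refine Continuous.subtype_mk (ContinuousMap.continuous_of_continuous_uncurry _ ?_) _
    exact g.continuous.comp continuous_cubeCons
  · ext x; exact h0 x
  · ext x; exact h1 x
  · ext z
    change g (Fin.cons (z 0) (Fin.tail z)) = g z
    rw [Fin.cons_self_tail]

end Cube

/-- Take any path `a` from `u₀` to `u₁` and correct it by a lift of the loop `b · (F a)⁻¹`. -/
theorem exists_path_lift {U V : Type u} [TopologicalSpace U] [TopologicalSpace V] (F : C(U, V))
    {u₀ u₁ : U} (hj : Joined u₀ u₁)
    (hl : ∀ l : Path (F u₀) (F u₀), ∃ l' : Path u₀ u₀, (l'.map F.continuous).Homotopic l)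
    (b : Path (F u₀) (F u₁)) : ∃ a : Path u₀ u₁, (a.map F.continuous).Homotopic b := by
  obtain ⟨a⟩ := hj
  obtain ⟨l, hl⟩ := hl (b.trans (a.map F.continuous).symm)
  refine ⟨l.trans a, ?_⟩
  rw [Path.map_trans]
  refine (hl.hcomp (.refl _)).trans ?_
  refine Path.Homotopic.trans ⟨Path.Homotopy.transAssoc _ _ _⟩ ?_
  refine Path.Homotopic.trans (Path.Homotopic.hcomp (.refl _)
    (Path.Homotopic.symm ⟨Path.Homotopy.reflSymmTrans _⟩)) ?_
  exact ⟨Path.Homotopy.transRefl _⟩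

theorem relHomotopic_zero_iff (p q : C(Cu 0, B)) :
    RelHomotopic p q ↔ Joined (p Fin.elim0) (q Fin.elim0) := by
  constructor
  · rintro ⟨F, h0, h1, -⟩
    exact ⟨⟨F.comp ⟨fun t => (Fin.elim0, t), by fun_prop⟩, h0 _, h1 _⟩⟩
  · rintro ⟨γ⟩
    refine ⟨⟨fun y => γ y.2, by fun_prop⟩, fun x => ?_, fun x => ?_, ?_⟩
    · obtain rfl : x = Fin.elim0 := Subsingleton.elim _ _
      simp
    · obtain rfl : x = Fin.elim0 := Subsingleton.elim _ _
      simp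
    · rintro x ⟨i, -⟩
      exact i.elim0

/-- The union `J` of all faces except `z 0 = 1` is contractible within itself. Deforming the
extension problem along the contraction makes `a` constant on `J`, so that only the top face carries
information. -/
theorem help_succ_of_based {f : C(A, B)} {m : ℕ}
    (h : ∀ (a : (Cu (m + 1)) → A) (b : C(Cu (m + 1), B)) (a₀ : A),
      ContinuousOn a (Cube.boundary (Fin (m + 1))) →
      (∀ x ∈ Cube.boundary (Fin (m + 1)), b x = f (a x)) →
      (∀ z : Cu (m + 1), (z 0 = 0 ∨ Fin.tail z ∈ Cube.boundary (Fin m)) → a z = a₀) →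
      HasExtension f a b fun x _ => b x) :
    HELP f (m + 1) := by
  classical
  refine help_of_strict fun a b ha hab => ?_
  obtain ⟨ρ, ρ1, ρ2, ρ3⟩ := exists_cube_retraction m
  -- Shrink the cube linearly to the corner `0`, then retract onto `J` by `ρ`, with the coordinate
  -- `z 0` in the role of the homotopy parameter. Thus `c` stays in `J`, is the identity on `J` at
  -- time `0`, and is constant at time `1`.
  let c : (Cu (m + 1)) × I → Cu (m + 1) := fun y =>
    Fin.cons (ρ (fun i => unitInterval.symm y.2 * Fin.tail y.1 i, unitInterval.symm y.2 * y.1 0)).2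
      (ρ (fun i => unitInterval.symm y.2 * Fin.tail y.1 i, unitInterval.symm y.2 * y.1 0)).1
  have hc : Continuous c := by
    refine continuous_cubeCons.comp (f := fun y : (Cu (m + 1)) × I =>
      (ρ (fun i => unitInterval.symm y.2 * Fin.tail y.1 i, unitInterval.symm y.2 * y.1 0)).swap) ?_
    refine continuous_swap.comp (ρ.continuous.comp (Continuous.prodMk ?_ ?_))
    · refine continuous_pi fun i => Continuous.mul (by fun_prop) ?_
      exact (continuous_apply _).comp continuous_fst
    · exact Continuous.mul (by fun_prop) ((continuous_apply _).comp continuous_fst)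
  have hcJ : ∀ y, c y 0 = 0 ∨ Fin.tail (c y) ∈ Cube.boundary (Fin m) := by
    intro y
    simp only [c, Fin.cons_zero, Fin.tail_cons]
    exact ρ1 _
  have hc0 : ∀ z : Cu (m + 1), (z 0 = 0 ∨ Fin.tail z ∈ Cube.boundary (Fin m)) → c (z, 0) = z := by
    intro z hz
    have : ρ (Fin.tail z, z 0) = (Fin.tail z, z 0) := by
      rcases hz with h | h
      · rw [h, ρ2]
      · exact ρ3 _ h _
    simp only [c, unitInterval.symm_zero, one_mul]
    rw [show (fun i => Fin.tail z i) = Fin.tail z from rfl, this]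
    exact Fin.cons_self_tail z
  have hc1 : ∀ z, c (z, 1) = fun _ => 0 := by
    intro z
    simp only [c, unitInterval.symm_one, zero_mul]
    rw [ρ2]
    funext i
    refine Fin.cases rfl (fun i => rfl) i
  have hcb : ∀ y, c y ∈ Cube.boundary (Fin (m + 1)) := fun y => by
    rcases hcJ y with h | h
    · exact (mem_boundary_succ _).2 (Or.inl h)
    · exact (mem_boundary_succ _).2 (Or.inr (Or.inr h))
  have hac : Continuous fun y => a (c y) := ha.comp_continuous hc hcb
  have htop : ∀ x : Cu m, (Fin.cons 1 x : Cu (m + 1)) ∈ Cube.boundary (Fin (m + 1)) := fun x =>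
    (mem_boundary_succ _).2 (Or.inr (Or.inl rfl))
  have hcons : Continuous fun x : Cu m => (Fin.cons 1 x : Cu (m + 1)) :=
    continuous_cubeCons_right 1
  -- On the top face the deformation is known only over the boundary of that face; it is extended
  -- from there, starting at `a`.
  obtain ⟨T, T0, T1⟩ := cube_hep (B := A) ⟨fun x : Cu m => a (Fin.cons 1 x),
    ha.comp_continuous hcons htop⟩ (fun x s => a (c (Fin.cons 1 x, s)))
    (Continuous.continuousOn (hac.comp ((hcons.comp continuous_fst).prodMk continuous_snd)))
    (fun x hx => congrArg a (hc0 _ (Or.inr (by simpa using hx))))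
  let α : (Cu (m + 1)) → I → A := fun z s => if z 0 = 1 then T (Fin.tail z, s) else a (c (z, s))
  have hαJ : ∀ z : Cu (m + 1), (z 0 = 0 ∨ Fin.tail z ∈ Cube.boundary (Fin m)) → ∀ s,
      α z s = a (c (z, s)) := by
    intro z hz s
    by_cases h : z 0 = 1
    · have hz' : Fin.tail z ∈ Cube.boundary (Fin m) := by
        rcases hz with h' | h'
        · rw [h] at h'
          exact absurd h' one_ne_zero
        · exact h'
      simp only [α, h, if_true]
      rw [T1 _ hz', ← h, Fin.cons_self_tail]
    · simp [α, h]
  have hα : ContinuousOn (Function.uncurry α) (Cube.boundary (Fin (m + 1)) ×ˢ Set.univ) := by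
    let S0 : Set ((Cu (m + 1)) × I) := {q | q.1 0 = 1}
    let S1 : Set ((Cu (m + 1)) × I) := {q | q.1 0 = 0 ∨ Fin.tail q.1 ∈ Cube.boundary (Fin m)}
    have hz : Continuous fun q : (Cu (m + 1)) × I => q.1 0 :=
      (continuous_apply _).comp continuous_fst
    refine ContinuousOn.mono (s := S0 ∪ S1) (ContinuousOn.union_of_isClosed ?_ ?_ ?_ ?_) ?_
    · refine (T.continuous.comp (f := fun q : (Cu (m + 1)) × I => (Fin.tail q.1, q.2))
        (by fun_prop)).continuousOn.congr fun q hq => ?_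
      exact if_pos hq
    · exact hac.continuousOn.congr fun q hq => hαJ q.1 hq q.2
    · exact isClosed_eq hz continuous_const
    · exact (isClosed_eq hz continuous_const).union
        ((isClosed_boundary m).preimage (f := fun q : (Cu (m + 1)) × I => Fin.tail q.1)
          (by fun_prop))
    · rintro ⟨z, s⟩ ⟨h, -⟩
      rcases (mem_boundary_succ z).1 h with h | h | h
      · exact Or.inr (Or.inl h)
      · exact Or.inl h
      · exact Or.inr (Or.inr h)
  have hα0 : ∀ z ∈ Cube.boundary (Fin (m + 1)), α z 0 = a z := by
    intro z hz
    rcases (mem_boundary_succ z).1 hz with h | h | h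
    · rw [hαJ z (Or.inl h), hc0 z (Or.inl h)]
    · simp only [α, h, if_true]
      rw [T0]
      change a (Fin.cons 1 (Fin.tail z)) = a z
      rw [← h, Fin.cons_self_tail]
    · rw [hαJ z (Or.inr h), hc0 z (Or.inr h)]
  obtain ⟨β, β0, β1⟩ := cube_hep b (fun z s => f (α z s)) (f.continuous.comp_continuousOn hα)
    (fun z hz => by rw [hα0 z hz, hab z hz])
  refine (HasExtension.of_homotopy α hα β (fun x s _ => β (x, s)) (by fun_prop) (fun _ _ _ => rfl)
    (fun x hx s => β1 x hx s) ?_).congr hα0 β0 fun x hx s => β0 x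
  refine h _ _ (a fun _ => 0) ?_ ?_ ?_
  · exact hα.comp (f := fun z => (z, 1)) (by fun_prop) fun z hz => ⟨hz, trivial⟩
  · exact fun x hx => β1 x hx 1
  · intro z hz
    rw [hαJ z hz, hc1]

/-- After the reduction to based problems, the top face of `a` is an `m`-fold loop `p₁` at `a₀`, and
`b` is a path of `m`-fold loops from the constant loop to `f ∘ p₁`. The problem is to lift this path
up to homotopy: injectivity on `π_m` joins the end points upstairs, and surjectivity on `π_{m+1}`
lifts loops, as `exists_path_lift` requires. -/
theorem IsWeakEquiv.help {f : C(A, B)} (hf : IsWeakEquiv f) (m : ℕ) : HELP f m := by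
  rw [isWeakEquiv_iff] at hf
  obtain ⟨⟨hi, hs⟩, hn⟩ := hf
  rcases m with _ | m
  · intro a b H _ _ _ _
    obtain ⟨a', ⟨γ⟩⟩ := hs (b Fin.elim0)
    refine ⟨ContinuousMap.const _ a', ⟨fun y => γ.symm y.2, by fun_prop⟩, ?_, fun x => ?_,
      fun x => ?_, ?_⟩
    · rintro x ⟨i, -⟩
      exact i.elim0
    · obtain rfl : x = Fin.elim0 := Subsingleton.elim _ _
      simp
    · simp
    · rintro x ⟨i, -⟩
      exact i.elim0
  refine help_succ_of_based fun a b a₀ ha hab haJ => ?_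
  have htop : ∀ x : Cu m, (Fin.cons 1 x : Cu (m + 1)) ∈ Cube.boundary (Fin (m + 1)) := fun x =>
    (mem_boundary_succ _).2 (Or.inr (Or.inl rfl))
  have hcons : Continuous fun x : Cu m => (Fin.cons 1 x : Cu (m + 1)) :=
    continuous_cubeCons_right 1
  let F : C(GenLoop (Fin m) A a₀, GenLoop (Fin m) B (f a₀)) :=
    { toFun := fun p => ⟨f.comp p.1, fun y hy => congrArg f (p.2 y hy)⟩
      continuous_toFun := Continuous.subtype_mk
        ((ContinuousMap.continuous_postcomp f).comp continuous_subtype_val) _ }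
  let p₁ : GenLoop (Fin m) A a₀ := ⟨⟨fun x => a (Fin.cons 1 x), ha.comp_continuous hcons htop⟩,
    fun x hx => haJ _ (Or.inr (by simpa using hx))⟩
  have hb0 : ∀ z : Cu (m + 1), (z 0 = 0 ∨ Fin.tail z ∈ Cube.boundary (Fin m)) → b z = f a₀ := by
    intro z hz
    rw [hab z, haJ z hz]
    rcases hz with h | h
    · exact (mem_boundary_succ z).2 (Or.inl h)
    · exact (mem_boundary_succ z).2 (Or.inr (Or.inr h))
  obtain ⟨bp, hbp⟩ := exists_path_of_cube (p := F GenLoop.const) (q := F p₁) b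
    (fun x => hb0 _ (Or.inl rfl)) (fun x => hab _ (htop x)) (fun z hz => hb0 z (Or.inr hz))
  have hpath : ∀ {p q : GenLoop (Fin m) A a₀} (γ : Path p q),
      pathToCube (γ.map F.continuous) = f.comp (pathToCube γ) := fun γ => rfl
  -- The map `b` itself is a null homotopy of `f ∘ p₁` relative to the boundary. For `m = 0`
  -- injectivity on path components replaces that on `π_m`.
  have hj : Joined (GenLoop.const : GenLoop (Fin m) A a₀) p₁ := by
    have hr : RelHomotopic (f.comp (GenLoop.const : GenLoop (Fin m) A a₀).1) (f.comp p₁.1) := by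
      refine ⟨b.comp ⟨fun y => Fin.cons y.2 y.1, continuous_cubeCons.comp continuous_swap⟩,
        fun x => hb0 _ (Or.inl rfl), fun x => hab _ (htop x), fun x hx r => hb0 _ (Or.inr ?_)⟩
      simpa using hx
    have hr' : RelHomotopic (GenLoop.const : GenLoop (Fin m) A a₀).1 p₁.1 := by
      rcases m with _ | m
      · rw [relHomotopic_zero_iff] at hr ⊢
        exact hi _ _ hr
      · exact (hn m a₀).1 _ _ (fun _ _ => rfl) p₁.2 hr
    obtain ⟨K, K0, K1, Kb⟩ := hr'
    obtain ⟨γ, -⟩ := exists_path_of_cube (p := GenLoop.const) (q := p₁)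
      (K.comp ⟨fun z => (Fin.tail z, z 0), by fun_prop⟩) (fun x => K0 x) (fun x => K1 x)
      (fun z hz => Kb _ hz _)
    exact ⟨γ⟩
  obtain ⟨γ, hγ⟩ := exists_path_lift F hj (fun l => by
    obtain ⟨p, hp, hr⟩ := (hn m a₀).2 (pathToCube l) (fun z hz => by
      rcases (mem_boundary_succ z).1 hz with h | h | h
      · change l (z 0) _ = _
        rw [h, l.source]
        rfl
      · change l (z 0) _ = _
        rw [h, l.target]
        rfl
      · exact (l (z 0)).2 _ h)
    obtain ⟨l', hl'⟩ := exists_path_of_cube (p := GenLoop.const) (q := GenLoop.const) p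
      (fun x => hp _ ((mem_boundary_succ _).2 (Or.inl rfl)))
      (fun x => hp _ ((mem_boundary_succ _).2 (Or.inr (Or.inl rfl))))
      (fun z hz => hp _ ((mem_boundary_succ _).2 (Or.inr (Or.inr hz))))
    refine ⟨l', path_homotopic_of_cube ?_⟩
    rw [hpath, hl']
    exact hr) bp
  have hγ' := pathToCube_relHomotopic hγ
  rw [hpath, hbp] at hγ'
  obtain ⟨K, K0, K1, Kb⟩ := hγ'.symm
  refine ⟨pathToCube γ, K, fun z hz => ?_, K0, K1, Kb⟩
  rcases (mem_boundary_succ z).1 hz with h | h | h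
  · change γ (z 0) _ = _
    rw [h, γ.source, haJ z (Or.inl h)]
    rfl
  · change γ (z 0) _ = _
    rw [h, γ.target]
    change a (Fin.cons 1 (Fin.tail z)) = a z
    rw [← h, Fin.cons_self_tail]
  · rw [haJ z (Or.inr h)]
    exact (γ (z 0)).2 _ h

/-- A relative homotopy from `f ∘ p` to `f ∘ p'` is a map on the `(n+1)`-cube with a given lift on
the boundary; extending the lift proves injectivity on `π_n`, and on path components for `n = 0`.
Surjectivity is the case of a constant map on the boundary. -/
theorem isWeakEquiv_of_help {f : C(A, B)} (hs : ∀ b, ∃ a, Joined (f a) b)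
    (hf : ∀ m, HELP f m) : IsWeakEquiv f := by
  classical
  have hinj : ∀ n a, PiInj f n a := by
    intro n a₀ p p' hp hp' hr
    obtain ⟨F, F0, F1, Fb⟩ := hr
    let a : (Cu (n + 1)) → A := fun z =>
      if z 0 = 0 then p (Fin.tail z) else if z 0 = 1 then p' (Fin.tail z) else a₀
    have hz : Continuous fun q : (Cu (n + 1)) => q 0 := continuous_apply _
    have e0 : ∀ z : Cu (n + 1), z 0 = 0 → a z = p (Fin.tail z) := fun z h => if_pos h
    have e1 : ∀ z : Cu (n + 1), z 0 = 1 → a z = p' (Fin.tail z) := fun z h => by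
      simp [a, h]
    have e2 : ∀ z : Cu (n + 1), Fin.tail z ∈ Cube.boundary (Fin n) → a z = a₀ := fun z h => by
      simp only [a, hp _ h, hp' _ h, ite_self]
    have ha : ContinuousOn a (Cube.boundary (Fin (n + 1))) := by
      refine ContinuousOn.mono (s := ({z | z 0 = 0} ∪ {z | z 0 = 1}) ∪
        {z : Cu (n + 1) | (Fin.tail z : Cu n) ∈ Cube.boundary (Fin n)}) ?_ ?_
      · have c0 : IsClosed {z : Cu (n + 1) | z 0 = 0} := isClosed_eq hz continuous_const
        have c1 : IsClosed {z : Cu (n + 1) | z 0 = 1} := isClosed_eq hz continuous_const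
        refine ContinuousOn.union_of_isClosed (ContinuousOn.union_of_isClosed ?_ ?_ c0 c1) ?_
          (c0.union c1) ((isClosed_boundary n).preimage continuous_cubeTail)
        · exact (p.continuous.comp continuous_cubeTail).continuousOn.congr e0
        · exact (p'.continuous.comp continuous_cubeTail).continuousOn.congr e1
        · exact continuousOn_const.congr e2
      · intro z h
        rcases (mem_boundary_succ z).1 h with h | h | h
        · exact Or.inl (Or.inl h)
        · exact Or.inl (Or.inr h)
        · exact Or.inr h
    have hb : Continuous fun z : Cu (n + 1) => F (Fin.tail z, z 0) := by fun_prop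
    have hab : ∀ z ∈ Cube.boundary (Fin (n + 1)), F (Fin.tail z, z 0) = f (a z) := by
      intro z h
      rcases (mem_boundary_succ z).1 h with h | h | h
      · rw [e0 z h, h, F0]; rfl
      · rw [e1 z h, h, F1]; rfl
      · rw [e2 z h, Fb _ h]
        exact congrArg f (hp _ h)
    obtain ⟨a', -, ha', -, -, -⟩ := hf (n + 1) a ⟨_, hb⟩ (fun z _ => F (Fin.tail z, z 0)) ha
      (by fun_prop) (fun _ _ => rfl) hab
    refine ⟨a'.comp ⟨fun y => Fin.cons y.2 y.1, continuous_cubeCons.comp continuous_swap⟩,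
      fun x => ?_, fun x => ?_, fun x hx r => ?_⟩
    · exact (ha' _ ((mem_boundary_succ _).2 (Or.inl rfl))).trans (e0 _ rfl)
    · exact (ha' _ ((mem_boundary_succ _).2 (Or.inr (Or.inl rfl)))).trans (e1 _ rfl)
    · refine (ha' _ ((mem_boundary_succ _).2 (Or.inr (Or.inr ?_)))).trans
        ((e2 _ ?_).trans (hp x hx).symm)
      · simpa using hx
      · simpa using hx
  rw [isWeakEquiv_iff]
  refine ⟨⟨fun a a' h => ?_, hs⟩, fun n a => ⟨hinj _ a, fun q hq => ?_⟩⟩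
  · have := hinj 0 a (ContinuousMap.const _ a) (ContinuousMap.const _ a')
      (by rintro x ⟨i, -⟩; exact i.elim0) (by rintro x ⟨i, -⟩; exact i.elim0)
      ((relHomotopic_zero_iff _ _).2 h)
    exact (relHomotopic_zero_iff _ _).1 this
  · obtain ⟨p, H', hp, h0, h1, hb⟩ := hf (n + 1) (fun _ => a) q (fun x _ => q x) (by fun_prop)
      (by fun_prop) (fun _ _ => rfl) hq
    exact ⟨p, hp, RelHomotopic.symm ⟨H', h0, h1, hb⟩⟩

end HELP

/-! ### Products, and weak equivalences are local on the target -/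

section LocalToGlobal

open unitInterval

local notation "Cu" m => Fin m → unitInterval

/-- Extension problems for a product map are solved one coordinate at a time. -/
theorem IsWeakEquiv.piMap {ι : Type} {A B : ι → Type u} [∀ i, TopologicalSpace (A i)]
    [∀ i, TopologicalSpace (B i)] (f : ∀ i, C(A i, B i)) (hf : ∀ i, IsWeakEquiv (f i)) :
    IsWeakEquiv (ContinuousMap.mk (fun (x : ∀ i, A i) i => f i (x i)) (by fun_prop)) := by
  refine isWeakEquiv_of_help (fun b => ?_) fun m a b H ha hH h0 h1 => ?_
  · choose a ha using fun i => ((isWeakEquiv_iff (f i)).1 (hf i)).1.2 (b i)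
    exact ⟨a, ⟨Path.pi fun i => (ha i).somePath⟩⟩
  · have key : ∀ i, HasExtension (f i) (fun x => a x i)
        ((ContinuousMap.mk (fun y : ∀ i, B i => y i) (continuous_apply i)).comp b)
        (fun x s => H x s i) := fun i => (hf i).help m _ _ _
      ((continuous_apply i).comp_continuousOn ha) ((continuous_apply i).comp_continuousOn hH)
      (fun x hx => congrFun (h0 x hx) i) fun x hx => congrFun (h1 x hx) i
    choose a' H' e1 e2 e3 e4 using key
    exact ⟨⟨fun x i => a' i x, by fun_prop⟩, ⟨fun x i => H' i x, by fun_prop⟩,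
      fun x hx => funext fun i => e1 i x hx, fun x => funext fun i => e2 i x,
      fun x => funext fun i => e3 i x, fun x hx s => funext fun i => e4 i x hx s⟩

theorem IsWeakEquiv.prodMap {A B A' B' : Type u} [TopologicalSpace A] [TopologicalSpace B]
    [TopologicalSpace A'] [TopologicalSpace B'] {f : C(A, B)} {g : C(A', B')}
    (hf : IsWeakEquiv f) (hg : IsWeakEquiv g) : IsWeakEquiv (f.prodMap g) := by
  refine isWeakEquiv_of_help (fun b => ?_) fun m a b H ha hH h0 h1 => ?_
  · obtain ⟨a, ⟨γ⟩⟩ := ((isWeakEquiv_iff f).1 hf).1.2 b.1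
    obtain ⟨a', ⟨γ'⟩⟩ := ((isWeakEquiv_iff g).1 hg).1.2 b.2
    exact ⟨(a, a'), ⟨γ.prod γ'⟩⟩
  · obtain ⟨a', H', e1, e2, e3, e4⟩ := hf.help m (fun x => (a x).1)
      (ContinuousMap.fst.comp b) (fun x s => (H x s).1) (continuous_fst.comp_continuousOn ha)
      (continuous_fst.comp_continuousOn hH) (fun x hx => congrArg Prod.fst (h0 x hx))
      fun x hx => congrArg Prod.fst (h1 x hx)
    obtain ⟨a'', H'', e1', e2', e3', e4'⟩ := hg.help m (fun x => (a x).2)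
      (ContinuousMap.snd.comp b) (fun x s => (H x s).2) (continuous_snd.comp_continuousOn ha)
      (continuous_snd.comp_continuousOn hH) (fun x hx => congrArg Prod.snd (h0 x hx))
      fun x hx => congrArg Prod.snd (h1 x hx)
    exact ⟨a'.prodMk a'', H'.prodMk H'', fun x hx => Prod.ext (e1 x hx) (e1' x hx),
      fun x => Prod.ext (e2 x) (e2' x), fun x => Prod.ext (e3 x) (e3' x),
      fun x hx s => Prod.ext (e4 x hx s) (e4' x hx s)⟩

variable {P Q : Type u} [TopologicalSpace P] [TopologicalSpace Q]

/-- The property for the restriction of `f` over `V`, in a form that refers to `P` and `Q` only. The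
control `H' p ∈ V` allows local solutions to be assembled over an open cover. -/
theorem IsWeakEquiv.hasExtension_mem {f : C(P, Q)} {V : Set Q}
    (hf : IsWeakEquiv (f.restrictPreimage V)) {m : ℕ} (a : (Cu m) → P) (b : C(Cu m, Q))
    (H : (Cu m) → I → Q) (ha : ContinuousOn a (Cube.boundary (Fin m)))
    (hH : ContinuousOn (Function.uncurry H) (Cube.boundary (Fin m) ×ˢ Set.univ))
    (h0 : ∀ x ∈ Cube.boundary (Fin m), H x 0 = b x)
    (h1 : ∀ x ∈ Cube.boundary (Fin m), H x 1 = f (a x)) (hb : ∀ x, b x ∈ V)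
    (hV : ∀ x ∈ Cube.boundary (Fin m), ∀ s, H x s ∈ V) :
    ∃ (a' : C(Cu m, P)) (H' : C((Cu m) × I, Q)), (∀ x ∈ Cube.boundary (Fin m), a' x = a x) ∧
      (∀ x, H' (x, 0) = b x) ∧ (∀ x, H' (x, 1) = f (a' x)) ∧
      (∀ x ∈ Cube.boundary (Fin m), ∀ s, H' (x, s) = H x s) ∧ ∀ p, H' p ∈ V := by
  classical
  obtain ⟨p₀, -⟩ := ((isWeakEquiv_iff _).1 hf).1.2 (⟨b fun _ => 0, hb _⟩ : V)
  have haV : ∀ x ∈ Cube.boundary (Fin m), f (a x) ∈ V := fun x hx => by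
    rw [← h1 x hx]
    exact hV x hx 1
  -- Off the boundary the data may leave `V`; there they are replaced by arbitrary values in `V`,
  -- which is harmless since only the values on the boundary count.
  let a₁ : (Cu m) → f ⁻¹' V := fun x => if h : f (a x) ∈ V then ⟨a x, h⟩ else p₀
  let H₁ : (Cu m) → I → V := fun x s => if h : H x s ∈ V then ⟨H x s, h⟩ else ⟨b x, hb x⟩
  have ea : ∀ x ∈ Cube.boundary (Fin m), (a₁ x : P) = a x := fun x hx => by
    simp [a₁, haV x hx]
  have eH : ∀ x ∈ Cube.boundary (Fin m), ∀ s, (H₁ x s : Q) = H x s := fun x hx s => by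
    simp [H₁, hV x hx s]
  obtain ⟨a', H', e1, e2, e3, e4⟩ := hf.help m a₁ ⟨fun x => ⟨b x, hb x⟩, by fun_prop⟩ H₁
    (by
      rw [Topology.IsInducing.subtypeVal.continuousOn_iff]
      exact ha.congr ea)
    (by
      rw [Topology.IsInducing.subtypeVal.continuousOn_iff]
      exact hH.congr fun p hp => eH p.1 hp.1 p.2)
    (fun x hx => Subtype.ext ((eH x hx 0).trans (h0 x hx)))
    (fun x hx => Subtype.ext ((eH x hx 1).trans ((h1 x hx).trans (congrArg f (ea x hx).symm))))
  refine ⟨⟨fun x => (a' x : P), by fun_prop⟩, ⟨fun x => (H' x : Q), by fun_prop⟩,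
    fun x hx => ?_, fun x => ?_, fun x => ?_, fun x hx s => ?_, fun p => (H' p).2⟩
  · exact (congrArg Subtype.val (e1 x hx)).trans (ea x hx)
  · exact congrArg Subtype.val (e2 x)
  · exact congrArg Subtype.val (e3 x)
  · exact (congrArg Subtype.val (e4 x hx s)).trans (eH x hx s)

/-! ### Subdivision of cubes into boxes. -/

section Box

variable {k : ℕ}

/-- The boundary of the box `[l, u]`, a cube of dimension the number of `i` with `l i < u i`. -/
def boxBoundary (l u : Fin k → ℕ) : Set (Fin k → ℝ) :=
  {y | (∀ i, (l i : ℝ) ≤ y i ∧ y i ≤ u i) ∧ ∃ i, l i < u i ∧ (y i = l i ∨ y i = u i)}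

/-- The box `[l, u]`. -/
def box (l u : Fin k → ℕ) : Set (Fin k → ℝ) := {y | ∀ i, (l i : ℝ) ≤ y i ∧ y i ≤ u i}

theorem isClosed_box (l u : Fin k → ℕ) : IsClosed (box l u) := by
  have : box l u = ⋂ i, ({y | (l i : ℝ) ≤ y i} ∩ {y | y i ≤ (u i : ℝ)}) := by
    ext y; simp [box]
  rw [this]
  exact isClosed_iInter fun i => (isClosed_le continuous_const (continuous_apply i)).inter
    (isClosed_le (continuous_apply i) continuous_const)

theorem isClosed_boxBoundary (l u : Fin k → ℕ) : IsClosed (boxBoundary l u) := by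
  have : boxBoundary l u = box l u ∩ ⋃ i, ⋃ _ : l i < u i,
      ({y | y i = (l i : ℝ)} ∪ {y | y i = (u i : ℝ)}) := by
    ext y; simp [box, boxBoundary]
  rw [this]
  exact (isClosed_box l u).inter (isClosed_iUnion_of_finite fun i => isClosed_iUnion_of_finite
    fun _ => (isClosed_eq (continuous_apply i) continuous_const).union
      (isClosed_eq (continuous_apply i) continuous_const))

/-- Controlled extension problems on the box `[l, u]` are solvable. -/
def BoxExtension (f : C(P, Q)) (b : (Fin k → ℝ) → Q) (W : (Fin k → ℝ) → Set Q)
    (l u : Fin k → ℕ) : Prop :=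
  ∀ (a : (Fin k → ℝ) → P) (H : (Fin k → ℝ) → I → Q), ContinuousOn a (boxBoundary l u) →
    ContinuousOn (Function.uncurry H) (boxBoundary l u ×ˢ Set.univ) →
    (∀ y ∈ boxBoundary l u, H y 0 = b y) → (∀ y ∈ boxBoundary l u, H y 1 = f (a y)) →
    (∀ y ∈ boxBoundary l u, ∀ s, H y s ∈ W y) →
    ∃ (a' : (Fin k → ℝ) → P) (H' : (Fin k → ℝ) → I → Q), ContinuousOn a' (box l u) ∧
      ContinuousOn (Function.uncurry H') (box l u ×ˢ Set.univ) ∧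
      (∀ y ∈ boxBoundary l u, a' y = a y) ∧ (∀ y ∈ boxBoundary l u, ∀ s, H' y s = H y s) ∧
      (∀ y ∈ box l u, H' y 0 = b y) ∧ (∀ y ∈ box l u, H' y 1 = f (a' y)) ∧
      ∀ y ∈ box l u, ∀ s, H' y s ∈ W y

/-- Solve first on the wall `y i = c`, then on the two halves, whose boundaries are made up of the
wall and of parts of the old boundary. The two solutions agree on the wall and can be glued. The
control `W` depends on the point only, so the solution on the wall is admissible for both halves. -/
theorem BoxExtension.cut {f : C(P, Q)} {b : (Fin k → ℝ) → Q} {W : (Fin k → ℝ) → Set Q}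
    {l u : Fin k → ℕ} (i : Fin k) (c : ℕ) (hl : l i < c) (hu : c < u i)
    (h₀ : BoxExtension f b W (Function.update l i c) (Function.update u i c))
    (h₁ : BoxExtension f b W l (Function.update u i c))
    (h₂ : BoxExtension f b W (Function.update l i c) u) : BoxExtension f b W l u := by
  classical
  intro a H ha hH h0 h1 hW
  have hlc : (l i : ℝ) < c := by exact_mod_cast hl
  have huc : (c : ℝ) < u i := by exact_mod_cast hu
  have hupd : ∀ (v : Fin k → ℕ) (j : Fin k), ((Function.update v i c j : ℕ) : ℝ) =
      if j = i then (c : ℝ) else v j := by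
    intro v j
    by_cases h : j = i
    · subst h; simp
    · simp [h]
  have box0 : ∀ y, y ∈ box (Function.update l i c) (Function.update u i c) ↔
      y ∈ box l u ∧ y i = c := by
    intro y
    simp only [box, Set.mem_ofPred_eq, hupd]
    constructor
    · intro h
      have hi := h i
      simp only [if_true] at hi
      have e : y i = c := le_antisymm hi.2 hi.1
      refine ⟨fun j => ?_, e⟩
      by_cases hj : j = i
      · subst hj; rw [e]; exact ⟨hlc.le, huc.le⟩
      · simpa [hj] using h j
    · rintro ⟨h, e⟩ j
      by_cases hj : j = i
      · subst hj; simp [e]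
      · simpa [hj] using h j
  have box1 : ∀ y, y ∈ box l (Function.update u i c) ↔ y ∈ box l u ∧ y i ≤ c := by
    intro y
    simp only [box, Set.mem_ofPred_eq, hupd]
    constructor
    · intro h
      have hi := h i
      simp only [if_true] at hi
      refine ⟨fun j => ?_, hi.2⟩
      by_cases hj : j = i
      · subst hj; exact ⟨hi.1, hi.2.trans huc.le⟩
      · simpa [hj] using h j
    · rintro ⟨h, e⟩ j
      by_cases hj : j = i
      · subst hj; simp [e, (h j).1]
      · simpa [hj] using h j
  have box2 : ∀ y, y ∈ box (Function.update l i c) u ↔ y ∈ box l u ∧ c ≤ y i := by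
    intro y
    simp only [box, Set.mem_ofPred_eq, hupd]
    constructor
    · intro h
      have hi := h i
      simp only [if_true] at hi
      refine ⟨fun j => ?_, hi.1⟩
      by_cases hj : j = i
      · subst hj; exact ⟨hlc.le.trans hi.1, hi.2⟩
      · simpa [hj] using h j
    · rintro ⟨h, e⟩ j
      by_cases hj : j = i
      · subst hj; simp [e, (h j).2]
      · simpa [hj] using h j
  have memb : ∀ (l u : Fin k → ℕ) (y : Fin k → ℝ), y ∈ boxBoundary l u ↔
      y ∈ box l u ∧ ∃ i, l i < u i ∧ (y i = l i ∨ y i = u i) := fun _ _ _ => Iff.rfl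
  have bd0 : ∀ y, y ∈ boxBoundary (Function.update l i c) (Function.update u i c) ↔
      y ∈ boxBoundary l u ∧ y i = c := by
    intro y
    rw [memb, memb, box0]
    constructor
    · rintro ⟨⟨h, e⟩, j, hj, hy⟩
      refine ⟨⟨h, j, ?_⟩, e⟩
      have hji : j ≠ i := by rintro rfl; simp at hj
      simpa [hji] using And.intro hj hy
    · rintro ⟨⟨h, j, hj, hy⟩, e⟩
      refine ⟨⟨h, e⟩, j, ?_⟩
      have hji : j ≠ i := by
        rintro rfl
        rcases hy with hy | hy <;> rw [e] at hy
        · exact absurd hy hlc.ne'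
        · exact absurd hy huc.ne
      simpa [hji] using And.intro hj hy
  have bd1 : ∀ y, y ∈ boxBoundary l (Function.update u i c) ↔
      (y ∈ boxBoundary l u ∧ y i ≤ c) ∨
        y ∈ box (Function.update l i c) (Function.update u i c) := by
    intro y
    rw [memb, memb, box0, box1]
    constructor
    · rintro ⟨⟨h, e⟩, j, hj, hy⟩
      by_cases hji : j = i
      · subst hji
        rcases hy with hy | hy
        · exact Or.inl ⟨⟨h, j, hl.trans hu, Or.inl hy⟩, e⟩
        · exact Or.inr ⟨h, by simpa using hy⟩
      · exact Or.inl ⟨⟨h, j, by simpa [hji] using And.intro hj hy⟩, e⟩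
    · rintro (⟨⟨h, j, hj, hy⟩, e⟩ | ⟨h, e⟩)
      · refine ⟨⟨h, e⟩, j, ?_⟩
        by_cases hji : j = i
        · subst hji
          refine ⟨by simpa using hl, ?_⟩
          rcases hy with hy | hy
          · exact Or.inl hy
          · exact absurd (hy ▸ e) (not_le.2 huc)
        · simpa [hji] using And.intro hj hy
      · exact ⟨⟨h, e.le⟩, i, by simpa using hl, Or.inr (by simpa using e)⟩
  have bd2 : ∀ y, y ∈ boxBoundary (Function.update l i c) u ↔
      (y ∈ boxBoundary l u ∧ c ≤ y i) ∨
        y ∈ box (Function.update l i c) (Function.update u i c) := by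
    intro y
    rw [memb, memb, box0, box2]
    constructor
    · rintro ⟨⟨h, e⟩, j, hj, hy⟩
      by_cases hji : j = i
      · subst hji
        rcases hy with hy | hy
        · exact Or.inr ⟨h, by simpa using hy⟩
        · exact Or.inl ⟨⟨h, j, hl.trans hu, Or.inr hy⟩, e⟩
      · exact Or.inl ⟨⟨h, j, by simpa [hji] using And.intro hj hy⟩, e⟩
    · rintro (⟨⟨h, j, hj, hy⟩, e⟩ | ⟨h, e⟩)
      · refine ⟨⟨h, e⟩, j, ?_⟩
        by_cases hji : j = i
        · subst hji
          refine ⟨by simpa using hu, ?_⟩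
          rcases hy with hy | hy
          · exact absurd (hy ▸ e) (not_le.2 hlc)
          · exact Or.inr hy
        · simpa [hji] using And.intro hj hy
      · exact ⟨⟨h, e.ge⟩, i, by simpa using hu, Or.inl (by simpa using e)⟩
  obtain ⟨a₀, H₀, ca₀, cH₀, ea₀, eH₀, s₀, t₀, w₀⟩ := h₀ a H
    (ha.mono fun y hy => ((bd0 y).1 hy).1)
    (hH.mono (Set.prod_mono (fun y hy => ((bd0 y).1 hy).1) subset_rfl))
    (fun y hy => h0 y ((bd0 y).1 hy).1) (fun y hy => h1 y ((bd0 y).1 hy).1)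
    (fun y hy => hW y ((bd0 y).1 hy).1)
  let R₀ := box (Function.update l i c) (Function.update u i c)
  have clR₀ : IsClosed R₀ := isClosed_box _ _
  let α : (Fin k → ℝ) → P := fun y => if y ∈ R₀ then a₀ y else a y
  let η : (Fin k → ℝ) → I → Q := fun y s => if y ∈ R₀ then H₀ y s else H y s
  have hα0 : ∀ y ∈ R₀, α y = a₀ y := fun y hy => if_pos hy
  have hη0 : ∀ y ∈ R₀, ∀ s, η y s = H₀ y s := fun y hy s => if_pos hy
  have hα : ∀ y ∈ boxBoundary l u, α y = a y := by
    intro y hy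
    by_cases h : y ∈ R₀
    · rw [hα0 y h, ea₀ y ((bd0 y).2 ⟨hy, ((box0 y).1 h).2⟩)]
    · exact if_neg h
  have hη : ∀ y ∈ boxBoundary l u, ∀ s, η y s = H y s := by
    intro y hy s
    by_cases h : y ∈ R₀
    · rw [hη0 y h, eH₀ y ((bd0 y).2 ⟨hy, ((box0 y).1 h).2⟩)]
    · exact if_neg h
  have cα : ContinuousOn α (boxBoundary l u ∪ R₀) :=
    (ha.congr hα).union_of_isClosed (ca₀.congr hα0) (isClosed_boxBoundary _ _) clR₀
  have cη : ContinuousOn (Function.uncurry η) ((boxBoundary l u ∪ R₀) ×ˢ Set.univ) := by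
    rw [Set.union_prod]
    exact (hH.congr fun p hp => hη p.1 hp.1 p.2).union_of_isClosed
      (cH₀.congr fun p hp => hη0 p.1 hp.1 p.2)
      ((isClosed_boxBoundary _ _).prod isClosed_univ) (clR₀.prod isClosed_univ)
  have hη00 : ∀ y ∈ boxBoundary l u ∪ R₀, η y 0 = b y := by
    rintro y (hy | hy)
    · rw [hη y hy, h0 y hy]
    · rw [hη0 y hy, s₀ y hy]
  have hη1 : ∀ y ∈ boxBoundary l u ∪ R₀, η y 1 = f (α y) := by
    rintro y (hy | hy)
    · rw [hη y hy, h1 y hy, hα y hy]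
    · rw [hη0 y hy, t₀ y hy, hα0 y hy]
  have hηW : ∀ y ∈ boxBoundary l u ∪ R₀, ∀ s, η y s ∈ W y := by
    rintro y (hy | hy) s
    · rw [hη y hy]; exact hW y hy s
    · rw [hη0 y hy]; exact w₀ y hy s
  have sub1 : boxBoundary l (Function.update u i c) ⊆ boxBoundary l u ∪ R₀ := fun y hy =>
    ((bd1 y).1 hy).imp (fun h => h.1) fun h => h
  have sub2 : boxBoundary (Function.update l i c) u ⊆ boxBoundary l u ∪ R₀ := fun y hy =>
    ((bd2 y).1 hy).imp (fun h => h.1) fun h => h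
  obtain ⟨a₁, H₁, ca₁, cH₁, ea₁, eH₁, s₁, t₁, w₁⟩ := h₁ α η (cα.mono sub1)
    (cη.mono (Set.prod_mono sub1 subset_rfl)) (fun y hy => hη00 y (sub1 hy))
    (fun y hy => hη1 y (sub1 hy)) (fun y hy => hηW y (sub1 hy))
  obtain ⟨a₂, H₂, ca₂, cH₂, ea₂, eH₂, s₂, t₂, w₂⟩ := h₂ α η (cα.mono sub2)
    (cη.mono (Set.prod_mono sub2 subset_rfl)) (fun y hy => hη00 y (sub2 hy))
    (fun y hy => hη1 y (sub2 hy)) (fun y hy => hηW y (sub2 hy))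
  let A' : (Fin k → ℝ) → P := fun y => if y i ≤ c then a₁ y else a₂ y
  let H' : (Fin k → ℝ) → I → Q := fun y s => if y i ≤ c then H₁ y s else H₂ y s
  have A1 : ∀ y ∈ box l (Function.update u i c), A' y = a₁ y := fun y hy =>
    if_pos ((box1 y).1 hy).2
  have H1' : ∀ y ∈ box l (Function.update u i c), ∀ s, H' y s = H₁ y s := fun y hy s =>
    if_pos ((box1 y).1 hy).2
  have A2 : ∀ y ∈ box (Function.update l i c) u, A' y = a₂ y := fun y hy => by
    by_cases h : y i ≤ c
    · have hR : y ∈ R₀ := (box0 y).2 ⟨((box2 y).1 hy).1, le_antisymm h ((box2 y).1 hy).2⟩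
      rw [show A' y = a₁ y from if_pos h, ea₁ y ((bd1 y).2 (Or.inr hR)),
        ea₂ y ((bd2 y).2 (Or.inr hR))]
    · exact if_neg h
  have H2' : ∀ y ∈ box (Function.update l i c) u, ∀ s, H' y s = H₂ y s := fun y hy s => by
    by_cases h : y i ≤ c
    · have hR : y ∈ R₀ := (box0 y).2 ⟨((box2 y).1 hy).1, le_antisymm h ((box2 y).1 hy).2⟩
      rw [show H' y s = H₁ y s from if_pos h, eH₁ y ((bd1 y).2 (Or.inr hR)),
        eH₂ y ((bd2 y).2 (Or.inr hR))]
    · exact if_neg h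
  have hcov : ∀ y ∈ box l u, y ∈ box l (Function.update u i c) ∨
      y ∈ box (Function.update l i c) u := fun y hy =>
    (le_total (y i) c).imp (fun h => (box1 y).2 ⟨hy, h⟩) fun h => (box2 y).2 ⟨hy, h⟩
  refine ⟨A', H', ?_, ?_, ?_, ?_, ?_, ?_, ?_⟩
  · exact ((ca₁.congr A1).union_of_isClosed (ca₂.congr A2) (isClosed_box _ _)
      (isClosed_box _ _)).mono hcov
  · refine ContinuousOn.mono (s := box l (Function.update u i c) ×ˢ Set.univ ∪
      box (Function.update l i c) u ×ˢ Set.univ) ?_ ?_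
    · exact (cH₁.congr fun p hp => H1' p.1 hp.1 p.2).union_of_isClosed
        (cH₂.congr fun p hp => H2' p.1 hp.1 p.2) ((isClosed_box _ _).prod isClosed_univ)
        ((isClosed_box _ _).prod isClosed_univ)
    · rintro p ⟨hp, -⟩
      exact (hcov _ hp).imp (fun h => ⟨h, trivial⟩) fun h => ⟨h, trivial⟩
  · intro y hy
    rcases le_total (y i) c with h | h
    · rw [A1 y ((box1 y).2 ⟨hy.1, h⟩), ea₁ y ((bd1 y).2 (Or.inl ⟨hy, h⟩)), hα y hy]
    · rw [A2 y ((box2 y).2 ⟨hy.1, h⟩), ea₂ y ((bd2 y).2 (Or.inl ⟨hy, h⟩)), hα y hy]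
  · intro y hy s
    rcases le_total (y i) c with h | h
    · rw [H1' y ((box1 y).2 ⟨hy.1, h⟩), eH₁ y ((bd1 y).2 (Or.inl ⟨hy, h⟩)), hη y hy]
    · rw [H2' y ((box2 y).2 ⟨hy.1, h⟩), eH₂ y ((bd2 y).2 (Or.inl ⟨hy, h⟩)), hη y hy]
  · intro y hy
    rcases hcov y hy with h | h
    · rw [H1' y h, s₁ y h]
    · rw [H2' y h, s₂ y h]
  · intro y hy
    rcases hcov y hy with h | h
    · rw [H1' y h, t₁ y h, A1 y h]
    · rw [H2' y h, t₂ y h, A2 y h]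
  · intro y hy s
    rcases hcov y hy with h | h
    · rw [H1' y h]; exact w₁ y h s
    · rw [H2' y h]; exact w₂ y h s

/-- Induction on the sum of the lengths of the edges: an edge of length at least `2` is cut at `l i
+ 1`, and the wall and both halves have a smaller sum. -/
theorem BoxExtension.of_small {f : C(P, Q)} {b : (Fin k → ℝ) → Q} {W : (Fin k → ℝ) → Set Q}
    (N : ℕ) (h : ∀ l u : Fin k → ℕ, (∀ i, l i ≤ u i) → (∀ i, u i ≤ l i + 1) → (∀ i, u i ≤ N) →
      BoxExtension f b W l u) (l u : Fin k → ℕ) (hlu : ∀ i, l i ≤ u i) (huN : ∀ i, u i ≤ N) :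
    BoxExtension f b W l u := by
  obtain ⟨n, hn⟩ : ∃ n, ∑ i, (u i - l i) = n := ⟨_, rfl⟩
  induction n using Nat.strong_induction_on generalizing l u with
  | _ n ih =>
    by_cases hs : ∀ i, u i ≤ l i + 1
    · exact h l u hlu hs huN
    · push Not at hs
      obtain ⟨i, hi⟩ := hs
      have key : ∀ l' u' : Fin k → ℕ, (∀ j, j ≠ i → u' j = u j ∧ l' j = l j) →
          u' i - l' i < u i - l i → l' i ≤ u' i → u' i ≤ N → BoxExtension f b W l' u' := by
        intro l' u' hj hlt hle hN
        refine ih (∑ i, (u' i - l' i)) ?_ l' u' (fun j => ?_) (fun j => ?_) rfl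
        · rw [← hn]
          refine Finset.sum_lt_sum (fun j _ => ?_) ⟨i, Finset.mem_univ _, hlt⟩
          by_cases hji : j = i
          · subst hji; exact hlt.le
          · rw [(hj j hji).1, (hj j hji).2]
        · by_cases hji : j = i
          · subst hji; exact hle
          · rw [(hj j hji).1, (hj j hji).2]; exact hlu j
        · by_cases hji : j = i
          · subst hji; exact hN
          · rw [(hj j hji).1]; exact huN j
      have := huN i
      refine BoxExtension.cut i (l i + 1) (by omega) hi (key _ _ (fun j hj => by simp [hj]) ?_ ?_ ?_)
        (key _ _ (fun j hj => by simp [hj]) ?_ ?_ ?_) (key _ _ (fun j hj => by simp [hj]) ?_ ?_ ?_)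
        <;> (try simp) <;> (try omega)

/-- Let `V` be the intersection of the sets `O (τ c)` over the grid cubes `c` that contain the box.
The control `W` forces all data into `V`, where the hypothesis on `f` solves the problem. A point of
the box off its boundary lies in no further grid cubes, so a solution in `V` satisfies the control
there as well. -/
theorem boxExtension_of_small {f : C(P, Q)} {b : (Fin k → ℝ) → Q} (hb : Continuous b) {N : ℕ}
    (hN : 0 < N) {ι : Type*} {O : ι → Set Q}
    (hO : ∀ s : Finset ι, s.Nonempty → IsWeakEquiv (f.restrictPreimage (⋂ i ∈ s, O i)))
    (τ : (Fin k → Fin N) → ι)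
    (hσ : ∀ (c : Fin k → Fin N) (y : Fin k → ℝ), (∀ i, (c i : ℝ) ≤ y i ∧ y i ≤ c i + 1) →
      b y ∈ O (τ c))
    (l u : Fin k → ℕ) (hlu : ∀ i, l i ≤ u i) (hul : ∀ i, u i ≤ l i + 1) (huN : ∀ i, u i ≤ N) :
    BoxExtension f b (fun y => {q | ∀ c : Fin k → Fin N,
      (∀ i, (c i : ℝ) ≤ y i ∧ y i ≤ c i + 1) → q ∈ O (τ c)}) l u := by
  classical
  intro a H ha hH h0 h1 hW
  let s : Finset (Fin k → Fin N) := Finset.univ.filter fun c => ∀ i, (c i : ℕ) ≤ l i ∧ u i ≤ c i + 1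
  have hs : (s.image τ).Nonempty := by
    -- If `l i = N`, there is no grid cube beginning at `l i`, and the last one is taken.
    refine Finset.Nonempty.image ⟨fun i => ⟨min (l i) (N - 1), by omega⟩, ?_⟩ _
    simp only [s, Finset.mem_filter, Finset.mem_univ, true_and]
    intro i
    have := hlu i; have := hul i; have := huN i
    omega
  let V : Set Q := ⋂ i ∈ s.image τ, O i
  have hV : ∀ q, q ∈ V ↔ ∀ c ∈ s, q ∈ O (τ c) := by
    intro q
    simp only [V, Set.mem_iInter, Finset.mem_image]
    exact ⟨fun h c hc => h _ ⟨c, hc, rfl⟩, by rintro h _ ⟨c, hc, rfl⟩; exact h c hc⟩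
  have hsbox : ∀ c ∈ s, ∀ y ∈ box l u, ∀ i, (c i : ℝ) ≤ y i ∧ y i ≤ c i + 1 := by
    intro c hc y hy i
    simp only [s, Finset.mem_filter, Finset.mem_univ, true_and] at hc
    have e1 : (((c i : ℕ)) : ℝ) ≤ l i := by exact_mod_cast (hc i).1
    have e2 : (u i : ℝ) ≤ ((c i : ℕ)) + 1 := by exact_mod_cast (hc i).2
    exact ⟨e1.trans (hy i).1, (hy i).2.trans e2⟩
  have hbV : ∀ y ∈ box l u, b y ∈ V := fun y hy => (hV _).2 fun c hc => hσ c y (hsbox c hc y hy)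
  let J := {i : Fin k // l i < u i}
  let e : Fin (Fintype.card J) ≃ J := (Fintype.equivFin J).symm
  let φ : (Cu (Fintype.card J)) → Fin k → ℝ := fun x i =>
    if h : l i < u i then l i + (x (e.symm ⟨i, h⟩) : ℝ) else l i
  have hφ : Continuous φ := by
    refine continuous_pi fun i => ?_
    by_cases h : l i < u i
    · simp only [φ, h, dif_pos]
      fun_prop
    · simp only [φ, h, dif_neg, not_false_eq_true]
      fun_prop
  let ψ : (Fin k → ℝ) → Cu (Fintype.card J) := fun y j =>
    Set.projIcc 0 1 zero_le_one (y (e j).1 - l (e j).1)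
  have hψ : Continuous ψ := continuous_pi fun j => continuous_projIcc.comp (by fun_prop)
  have hu : ∀ i, l i < u i → (u i : ℝ) = l i + 1 := fun i h => by
    have : u i = l i + 1 := le_antisymm (hul i) h
    rw [this]; push_cast; ring
  have hu' : ∀ i, ¬ l i < u i → (u i : ℝ) = l i := fun i h => by
    have : u i = l i := le_antisymm (not_lt.1 h) (hlu i)
    rw [this]
  have hφbox : ∀ x, φ x ∈ box l u := by
    intro x i
    by_cases h : l i < u i
    · simp only [φ, h, dif_pos, hu i h]
      constructor <;> linarith [(x (e.symm ⟨i, h⟩)).2.1, (x (e.symm ⟨i, h⟩)).2.2]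
    · simp only [φ, h, dif_neg, not_false_eq_true, hu' i h]
      exact ⟨le_rfl, le_rfl⟩
  have hφψ : ∀ y ∈ box l u, φ (ψ y) = y := by
    intro y hy
    funext i
    have hyi := hy i
    by_cases h : l i < u i
    · simp only [φ, ψ, h, dif_pos, Equiv.apply_symm_apply]
      rw [hu i h] at hyi
      rw [Set.projIcc_of_mem zero_le_one (x := y i - l i) ⟨by linarith, by linarith⟩]
      simp
    · simp only [φ, h, dif_neg, not_false_eq_true]
      rw [hu' i h] at hyi
      exact le_antisymm hyi.1 hyi.2
  have hφb : ∀ x ∈ Cube.boundary (Fin (Fintype.card J)), φ x ∈ boxBoundary l u := by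
    rintro x ⟨j, hj⟩
    refine ⟨hφbox x, (e j).1, (e j).2, ?_⟩
    have : φ x (e j).1 = l (e j).1 + (x j : ℝ) := by
      simp only [φ, (e j).2, dif_pos, Subtype.coe_eta, Equiv.symm_apply_apply]
    rw [this, hu _ (e j).2]
    rcases hj with hj | hj <;> simp [hj]
  have hψb : ∀ y ∈ boxBoundary l u, ψ y ∈ Cube.boundary (Fin (Fintype.card J)) := by
    rintro y ⟨hy, i, hi, hyi⟩
    refine ⟨e.symm ⟨i, hi⟩, ?_⟩
    simp only [ψ, Equiv.apply_symm_apply]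
    rcases hyi with hyi | hyi
    · left; rw [hyi]; simp
    · right; rw [hyi, hu i hi]; simp
  -- Edges of the box have length `0` or `1`. A grid cube containing a point that is interior in all
  -- edges of length `1` contains the whole box.
  have hWV : ∀ y ∈ box l u, y ∉ boxBoundary l u → ∀ q ∈ V, ∀ c : Fin k → Fin N,
      (∀ i, (c i : ℝ) ≤ y i ∧ y i ≤ c i + 1) → q ∈ O (τ c) := by
    intro y hy hyb q hq c hc
    refine (hV q).1 hq c ?_
    simp only [s, Finset.mem_filter, Finset.mem_univ, true_and]
    intro i
    have hyi := hy i
    have hci := hc i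
    by_cases h : l i < u i
    · have n1 : y i ≠ l i := fun e => hyb ⟨hy, i, h, Or.inl e⟩
      have n2 : y i ≠ u i := fun e => hyb ⟨hy, i, h, Or.inr e⟩
      have l1 := lt_of_le_of_ne hyi.1 n1.symm
      have l2 := lt_of_le_of_ne hyi.2 n2
      have m1 : ((c i : ℕ) : ℝ) < (u i : ℝ) := lt_of_le_of_lt hci.1 l2
      have m2 : (l i : ℝ) < ((c i : ℕ) : ℝ) + 1 := lt_of_lt_of_le l1 hci.2
      have m1' : (c i : ℕ) < u i := by exact_mod_cast m1
      have m2' : l i < (c i : ℕ) + 1 := by exact_mod_cast m2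
      have := hul i
      omega
    · have hlu' := hu' i h
      have m1 : ((c i : ℕ) : ℝ) ≤ (u i : ℝ) := hci.1.trans hyi.2
      have m2 : (l i : ℝ) ≤ ((c i : ℕ) : ℝ) + 1 := hyi.1.trans hci.2
      have m1' : (c i : ℕ) ≤ u i := by exact_mod_cast m1
      have m2' : l i ≤ (c i : ℕ) + 1 := by exact_mod_cast m2
      have := hlu i
      omega
  obtain ⟨a', H', e1, e2, e3, e4, e5⟩ := (hO _ hs).hasExtension_mem (fun x => a (φ x))
    ⟨fun x => b (φ x), hb.comp hφ⟩ (fun x s => H (φ x) s)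
    (ha.comp hφ.continuousOn hφb)
    (hH.comp (f := fun p : (Cu (Fintype.card J)) × I => (φ p.1, p.2)) (by fun_prop)
      fun p hp => ⟨hφb p.1 hp.1, trivial⟩)
    (fun x hx => h0 _ (hφb x hx)) (fun x hx => h1 _ (hφb x hx)) (fun x => hbV _ (hφbox x))
    (fun x hx t => (hV _).2 fun c hc => hW _ (hφb x hx) t c (hsbox c hc _ (hφbox x)))
  have hH'b : ∀ y ∈ boxBoundary l u, ∀ t, H' (ψ y, t) = H y t := fun y hy t => by
    rw [e4 _ (hψb y hy), hφψ y hy.1]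
  refine ⟨fun y => a' (ψ y), fun y t => H' (ψ y, t), by fun_prop, by fun_prop, fun y hy => ?_,
    hH'b, fun y hy => ?_, fun y hy => e3 _, fun y hy t c hc => ?_⟩
  · change a' (ψ y) = a y
    rw [e1 _ (hψb y hy), hφψ y hy.1]
  · change H' (ψ y, 0) = b y
    rw [e2]
    change b (φ (ψ y)) = b y
    rw [hφψ y hy]
  · by_cases hyb : y ∈ boxBoundary l u
    · change H' (ψ y, t) ∈ _
      rw [hH'b y hyb]
      exact hW y hyb t c hc
    · exact hWV y hy hyb _ (e5 _) c hc

end Box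

/-- Being a weak equivalence is local on the target. -/
theorem isWeakEquiv_of_open_cover {ι : Type*} (f : C(P, Q)) (O : ι → Set Q)
    (hopen : ∀ i, IsOpen (O i)) (hcov : ∀ q, ∃ i, q ∈ O i)
    (hO : ∀ s : Finset ι, s.Nonempty → IsWeakEquiv (f.restrictPreimage (⋂ i ∈ s, O i))) :
    IsWeakEquiv f := by
  refine isWeakEquiv_of_help (fun q => ?_) fun k => help_of_strict fun a b ha hab => ?_
  · obtain ⟨i, hi⟩ := hcov q
    have hq : q ∈ ⋂ j ∈ ({i} : Finset ι), O j := by simpa using hi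
    obtain ⟨p, hp⟩ := ((isWeakEquiv_iff _).1 (hO {i} (by simp))).1.2 ⟨q, hq⟩
    exact ⟨p.1, hp.map continuous_subtype_val⟩
  obtain ⟨δ, hδ, hball⟩ := lebesgue_number_lemma_of_metric (s := (Set.univ : Set (Cu k)))
    isCompact_univ (fun i => (hopen i).preimage b.continuous) (fun x _ => by simpa using hcov (b x))
  obtain ⟨n, hn⟩ := exists_nat_one_div_lt hδ
  let N := n + 1
  have hNpos : (0 : ℝ) < N := by positivity
  have hN : 1 / (N : ℝ) < δ := by simpa [N] using hn
  let φ : (Fin k → ℝ) → Cu k := fun y i => Set.projIcc 0 1 zero_le_one (y i / N)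
  have hφ : Continuous φ := continuous_pi fun i => continuous_projIcc.comp (by fun_prop)
  let ψ : (Cu k) → Fin k → ℝ := fun x i => (x i : ℝ) * N
  have hψ : Continuous ψ := by fun_prop
  have hφψ : ∀ x, φ (ψ x) = x := fun x => by
    funext i
    simp only [φ, ψ]
    rw [mul_div_cancel_right₀ _ hNpos.ne', Set.projIcc_val]
  -- Edges of length `1 / N < δ` keep a grid cube inside the `δ`-ball about its lowest corner, so
  -- `b` maps the grid cube `c` into the single member `O (τ c)` of the cover.
  choose τ hτ using fun c : Fin k → Fin N => hball (φ fun i => c i) trivial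
  have hσ : ∀ (c : Fin k → Fin N) (y : Fin k → ℝ), (∀ i, (c i : ℝ) ≤ y i ∧ y i ≤ c i + 1) →
      b (φ y) ∈ O (τ c) := by
    intro c y hy
    refine hτ c (Metric.mem_ball.2 (lt_of_le_of_lt ?_ hN))
    refine (dist_pi_le_iff (by positivity)).2 fun i => ?_
    refine le_trans (b := |y i / N - c i / N|) ?_ ?_
    · exact Set.abs_projIcc_sub_projIcc zero_le_one
    · rw [← sub_div, abs_div, abs_of_pos hNpos]
      refine div_le_div_of_nonneg_right ?_ hNpos.le
      rw [abs_le]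
      constructor <;> linarith [(hy i).1, (hy i).2]
  have hbox := BoxExtension.of_small N (boxExtension_of_small (hb := b.continuous.comp hφ)
    (N := N) (by omega) hO τ hσ) (fun _ : Fin k => 0) (fun _ => N) (fun _ => by omega)
    (fun _ => le_rfl)
  have hφb : ∀ y ∈ boxBoundary (fun _ : Fin k => 0) (fun _ => N), φ y ∈ Cube.boundary (Fin k) := by
    rintro y ⟨-, i, -, hi⟩
    refine ⟨i, ?_⟩
    simp only [φ]
    rcases hi with hi | hi
    · left; rw [hi]; simp
    · right; rw [hi, div_self hNpos.ne']; simp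
  have hψbox : ∀ x, ψ x ∈ box (fun _ : Fin k => 0) (fun _ => N) := fun x i => by
    simp only [ψ]
    push_cast
    exact ⟨mul_nonneg (x i).2.1 hNpos.le, mul_le_of_le_one_left hNpos.le (x i).2.2⟩
  have hψb : ∀ x ∈ Cube.boundary (Fin k), ψ x ∈ boxBoundary (fun _ : Fin k => 0) (fun _ => N) := by
    rintro x ⟨i, hi⟩
    refine ⟨hψbox x, i, by simp [N], ?_⟩
    rcases hi with hi | hi <;> simp [ψ, hi]
  obtain ⟨a', H', ca', cH', ea, eH, e0, e1, -⟩ := hbox (fun y => a (φ y)) (fun y _ => b (φ y))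
    (ha.comp hφ.continuousOn hφb) (by fun_prop) (fun _ _ => rfl)
    (fun y hy => hab _ (hφb y hy)) (fun y hy s c hc => hσ c y hc)
  refine ⟨⟨fun x => a' (ψ x), ca'.comp_continuous hψ hψbox⟩, ⟨fun p => H' (ψ p.1) p.2,
    cH'.comp_continuous (f := fun p : (Cu k) × I => (ψ p.1, p.2)) (by fun_prop)
      fun p => ⟨hψbox _, trivial⟩⟩, fun x hx => ?_, fun x => ?_, fun x => ?_, fun x hx s => ?_⟩
  · change a' (ψ x) = _
    rw [ea _ (hψb x hx), hφψ]
  · change H' (ψ x) 0 = _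
    rw [e0 _ (hψbox x)]
    change b (φ (ψ x)) = _
    rw [hφψ]
  · exact e1 _ (hψbox x)
  · change H' (ψ x) s = _
    rw [eH _ (hψb x hx), hφψ]

end LocalToGlobal

/-! ### Maps that are continuous on compact Hausdorff test spaces -/

section TestSpaces

open unitInterval

/-- `g` is continuous on compact Hausdorff test spaces; equivalently, it is continuous for the
compactly generated topology of `A`. -/
def KCont {A B : Type u} [TopologicalSpace A] [TopologicalSpace B] (g : A → B) : Prop :=
  ∀ (K : Type u) [TopologicalSpace K] [CompactSpace K] [T2Space K] (p : K → A),
    Continuous p → Continuous fun k => g (p k)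

section

variable {A B D : Type u} [TopologicalSpace A] [TopologicalSpace B] [TopologicalSpace D]

theorem Continuous.kCont {g : A → B} (h : Continuous g) : KCont g := fun _ _ _ _ _ hp => h.comp hp

theorem KCont.comp {g : B → D} {f : A → B} (hg : KCont g) (hf : KCont f) :
    KCont fun a => g (f a) := fun K _ _ _ p hp => hg K _ (hf K p hp)

theorem KCont.continuous [CompactlyGeneratedSpace A] {g : A → B} (h : KCont g) : Continuous g :=
  continuous_from_compactlyGeneratedSpace g h

/-- Exponential law: `a ↦ g (a, ·)` is a map to `C(T, B)` whose continuity can be tested on compact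
spaces, and it can be uncurried because `T` is compact Hausdorff. Hence a product with a compact
Hausdorff factor needs no change of topology. -/
theorem KCont.continuous_prod_compact [CompactlyGeneratedSpace A] {T : Type u} [TopologicalSpace T]
    [CompactSpace T] [T2Space T] {g : A × T → B} (h : KCont g) : Continuous g := by
  have h1 : ∀ a, Continuous fun t => g (a, t) := fun a => h T (fun t => (a, t)) (by fun_prop)
  have h2 : Continuous fun a => (⟨fun t => g (a, t), h1 a⟩ : C(T, B)) :=
    continuous_from_compactlyGeneratedSpace _ fun K _ _ _ p hp =>
      ContinuousMap.continuous_of_continuous_uncurry _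
        (h (K × T) (fun y => (p y.1, y.2)) (by fun_prop))
  exact (ContinuousMap.continuous_uncurry_of_continuous ⟨_, h2⟩)

theorem KCont.continuous_prod_interval [CompactlyGeneratedSpace A] {g : A × I → B} (h : KCont g) :
    Continuous g := by
  have h1 : KCont fun y : A × ULift.{u} I => g (y.1, y.2.down) :=
    h.comp (Continuous.kCont (by fun_prop : Continuous fun y : A × ULift.{u} I => (y.1, y.2.down)))
  exact h1.continuous_prod_compact.comp
    (by fun_prop : Continuous fun y : A × I => (y.1, ULift.up.{u} y.2))

instance [CompactlyGeneratedSpace A] : CompactlyGeneratedSpace (A × I) :=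
  compactlyGeneratedSpace_of_continuous_maps fun _ h =>
    KCont.continuous_prod_interval fun K _ _ _ _ hp => h K _ hp

theorem KCont.continuous_prod_cube [CompactlyGeneratedSpace A] {n : ℕ} {g : A × (Fin n → I) → B}
    (h : KCont g) : Continuous g := by
  have h1 : KCont fun y : A × ULift.{u} (Fin n → I) => g (y.1, y.2.down) :=
    h.comp (Continuous.kCont
      (by fun_prop : Continuous fun y : A × ULift.{u} (Fin n → I) => (y.1, y.2.down)))
  exact h1.continuous_prod_compact.comp
    (by fun_prop : Continuous fun y : A × (Fin n → I) => (y.1, ULift.up.{u} y.2))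

instance [CompactlyGeneratedSpace A] {n : ℕ} : CompactlyGeneratedSpace (A × (Fin n → I)) :=
  compactlyGeneratedSpace_of_continuous_maps fun _ h =>
    KCont.continuous_prod_cube fun K _ _ _ _ hp => h K _ hp

theorem CompactlyGeneratedSpace.subtype_of_isClosed [CompactlyGeneratedSpace A] {s : Set A}
    (hs : IsClosed s) : CompactlyGeneratedSpace s := by
  refine compactlyGeneratedSpace_of_isClosed fun t ht => ?_
  rw [hs.isClosedEmbedding_subtypeVal.isClosed_iff_image_isClosed]
  refine CompactlyGeneratedSpace.isClosed' fun K _ _ _ f hf => ?_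
  have hS : IsClosed (f ⁻¹' s) := hs.preimage hf
  have : CompactSpace (f ⁻¹' s) := isCompact_iff_compactSpace.1 hS.isCompact
  have h1 := ht (f ⁻¹' s : Set K) (fun k => (⟨f k.1, k.2⟩ : s)) (by fun_prop)
  have h2 := hS.isClosedEmbedding_subtypeVal.isClosedMap _ h1
  convert h2 using 1
  ext k
  constructor
  · rintro ⟨y, hy, e⟩
    exact ⟨⟨k, by rw [Set.mem_preimage, ← e]; exact y.2⟩, by
      have : (⟨f k, by rw [← e]; exact y.2⟩ : s) = y := Subtype.ext e.symm
      simpa [this] using hy, rfl⟩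
  · rintro ⟨y, hy, rfl⟩
    exact ⟨_, hy, rfl⟩

theorem Kify.continuous_of_compact' {T : Type} [TopologicalSpace T] [CompactSpace T] [T2Space T]
    {f : T → A} (hf : Continuous f) : Continuous fun t => Kify.of (f t) :=
  (Kify.continuous_of_compact (K := ULift.{u} T) (f := fun t => f t.down)
    (by fun_prop)).comp continuous_uliftUp

/-- The map of compactly generated spaces given by `f`. -/
def Kify.map (f : A → B) (hf : KCont f) : C(Kify A, Kify B) where
  toFun a := Kify.of (f a.get)
  continuous_toFun := Kify.continuous_dom fun K _ _ _ g hg =>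
    Kify.continuous_of_compact (hf K g hg)

/-- Cubes and their cylinders are compact Hausdorff, so maps from them into a space and into its
compactly generated refinement are the same. -/
theorem isWeakEquiv_kifyGet : IsWeakEquiv (⟨Kify.get, Kify.continuous_get⟩ : C(Kify A, A)) := by
  rw [isWeakEquiv_iff]
  have hr : ∀ {n : ℕ} (p p' : C(Fin n → I, Kify A)),
      RelHomotopic ((⟨Kify.get, Kify.continuous_get⟩ : C(Kify A, A)).comp p)
        ((⟨Kify.get, Kify.continuous_get⟩ : C(Kify A, A)).comp p') → RelHomotopic p p' := by
    rintro n p p' ⟨F, h0, h1, hb⟩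
    exact ⟨⟨fun y => Kify.of (F y), Kify.continuous_of_compact' F.continuous⟩,
      fun x => congrArg Kify.of (h0 x), fun x => congrArg Kify.of (h1 x),
      fun x hx r => congrArg Kify.of (hb x hx r)⟩
  refine ⟨⟨fun a a' ⟨γ⟩ => ⟨⟨⟨fun t => Kify.of (γ t), Kify.continuous_of_compact' γ.continuous⟩,
    congrArg Kify.of γ.source, congrArg Kify.of γ.target⟩⟩, fun b => ⟨Kify.of b, .refl _⟩⟩,
    fun n a => ⟨fun p p' _ _ h => hr p p' h, fun q hq =>
      ⟨⟨fun x => Kify.of (q x), Kify.continuous_of_compact' q.continuous⟩,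
        fun x hx => congrArg Kify.of (hq x hx), .refl _⟩⟩⟩

/-- Surjectivity of `f` makes every base point of `B` the image of one of `A`, so no transport
between base points is needed. -/
theorem IsWeakEquiv.of_comp_surjective {g : C(B, D)} {f : C(A, B)} (hf : IsWeakEquiv f)
    (hs : Function.Surjective f) (h : IsWeakEquiv (g.comp f)) : IsWeakEquiv g := by
  refine ⟨?_, fun n b => ?_⟩
  · have h1 := h.1
    rw [pi0Map_comp] at h1
    exact (Function.Bijective.of_comp_iff _ hf.1).1 h1
  · obtain ⟨a, rfl⟩ := hs b
    have h1 := h.2 n a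
    rw [piMap_comp] at h1
    exact (Function.Bijective.of_comp_iff _ (hf.2 n a)).1 h1

omit [TopologicalSpace A] in
theorem Kify.get_surjective : Function.Surjective (Kify.get : Kify A → A) := fun a => ⟨⟨a⟩, rfl⟩

theorem isWeakEquiv_of_kify {f : C(A, B)} (h : IsWeakEquiv (Kify.map f f.continuous.kCont)) :
    IsWeakEquiv f :=
  IsWeakEquiv.of_comp_surjective isWeakEquiv_kifyGet Kify.get_surjective
    (show IsWeakEquiv (f.comp ⟨Kify.get, Kify.continuous_get⟩) from isWeakEquiv_kifyGet.comp h)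

/-- A homotopy equivalence all of whose data are continuous on compact Hausdorff test spaces is a
weak equivalence. -/
theorem isWeakEquiv_of_kHomotopyEquiv {f : C(A, B)} {g : B → A} (hg : KCont g) (h : A → I → A)
    (hh : KCont fun p : A × I => h p.1 p.2) (k : B → I → B)
    (hk : KCont fun p : B × I => k p.1 p.2)
    (h0 : ∀ a, h a 0 = a) (h1 : ∀ a, h a 1 = g (f a))
    (k0 : ∀ b, k b 0 = b) (k1 : ∀ b, k b 1 = f (g b)) : IsWeakEquiv f := by
  refine isWeakEquiv_of_kify (IsWeakEquiv.of_homotopyEquiv (g := Kify.map g hg)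
    ⟨fun p => Kify.of (h p.1.get p.2), ?_⟩ ⟨fun p => Kify.of (k p.1.get p.2), ?_⟩
    (fun a => congrArg Kify.of (h0 _)) (fun a => congrArg Kify.of (h1 _))
    (fun a => congrArg Kify.of (k0 _)) (fun a => congrArg Kify.of (k1 _)))
  · refine KCont.continuous_prod_interval fun K _ _ _ p hp => Kify.continuous_of_compact ?_
    exact hh K (fun k => ((p k).1.get, (p k).2))
      ((Kify.continuous_get.comp (continuous_fst.comp hp)).prodMk (continuous_snd.comp hp))
  · refine KCont.continuous_prod_interval fun K _ _ _ p hp => Kify.continuous_of_compact ?_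
    exact hk K (fun k => ((p k).1.get, (p k).2))
      ((Kify.continuous_get.comp (continuous_fst.comp hp)).prodMk (continuous_snd.comp hp))

theorem isWeakEquiv_of_kInverse {f : C(A, B)} {g : B → A} (hg : KCont g) (h : ∀ a, g (f a) = a)
    (k : ∀ b, f (g b) = b) : IsWeakEquiv f :=
  isWeakEquiv_of_kHomotopyEquiv hg (fun a _ => a) (Continuous.kCont (by fun_prop)) (fun b _ => b)
    (Continuous.kCont (by fun_prop)) (fun _ => rfl) (fun a => (h a).symm) (fun _ => rfl)
    fun b => (k b).symm

end

/-- A product of quotient maps of compactly generated spaces is a quotient map in the compactly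
generated sense. -/
theorem kCont_of_isQuotientMap_pi {ι : Type} [Finite ι] {A B : ι → Type u}
    [∀ i, TopologicalSpace (A i)] [∀ i, TopologicalSpace (B i)]
    [∀ i, CompactlyGeneratedSpace (A i)] {p : ∀ i, A i → B i} (hp : ∀ i, IsQuotientMap (p i))
    {Z : Type u} [TopologicalSpace Z] {g : (∀ i, B i) → Z}
    (h : KCont fun a : ∀ i, A i => g fun i => p i (a i)) : KCont g := by
  classical
  have := Fintype.ofFinite ι
  -- The set `F` contains the coordinates not yet known to lift through `p i`; they are removed one
  -- at a time.
  have key : ∀ (F : Finset ι) (K : Type u) [TopologicalSpace K] [CompactSpace K] [T2Space K]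
      (v : K → ∀ i, B i), Continuous v →
      (∀ i ∉ F, ∃ w : K → A i, Continuous w ∧ ∀ k, v k i = p i (w k)) →
      Continuous fun k => g (v k) := by
    intro F
    induction F using Finset.induction_on with
    | empty =>
      intro K _ _ _ v hv hw
      choose w hwc hw using fun i => hw i (Finset.notMem_empty i)
      have := h K (fun k i => w i k) (by fun_prop)
      refine this.congr fun k => ?_
      exact congrArg g (funext fun i => (hw i k).symm)
    | insert i F hi ih =>
      intro K _ _ _ v hv hw
      have step : ∀ (L : Type u) [TopologicalSpace L] [CompactSpace L] [T2Space L] (u : L → A i),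
          Continuous u → Continuous fun y : L × K =>
            g (Function.update (v y.2) i (p i (u y.1))) := by
        intro L _ _ _ u hu
        refine ih (L × K) (fun y => Function.update (v y.2) i (p i (u y.1))) ?_ ?_
        · refine Continuous.update (hv.comp continuous_snd) i
            ((hp i).continuous.comp (hu.comp continuous_fst))
        · intro j hj
          by_cases hji : j = i
          · subst hji
            exact ⟨fun y => u y.1, by fun_prop, fun y => by simp⟩
          · obtain ⟨w, hwc, hw⟩ := hw j (by simp [hji, hj])
            exact ⟨fun y => w y.2, by fun_prop, fun y => by simp [hji, hw]⟩
      have hc : ∀ b : B i, Continuous fun k => g (Function.update (v k) i b) := by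
        intro b
        obtain ⟨a, rfl⟩ := (hp i).surjective b
        exact (step PUnit (fun _ => a) (by fun_prop)).comp
          (by fun_prop : Continuous fun k : K => (PUnit.unit, k))
      -- Free the coordinate `i` and regard the rest as a map to `C(K, Z)`. Its continuity can be
      -- checked after composition with the quotient map `p i`, where the coordinate does lift.
      let q : B i → C(K, Z) := fun b => ⟨_, hc b⟩
      have hq : Continuous q := by
        rw [(hp i).continuous_iff]
        exact continuous_from_compactlyGeneratedSpace _ fun L _ _ _ u hu =>
          ContinuousMap.continuous_of_continuous_uncurry _ (step L u hu)
      have h1 : Continuous fun k => q (v k i) k :=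
        (hq.comp ((continuous_apply i).comp hv)).eval continuous_id
      refine h1.congr fun k => ?_
      change g (Function.update (v k) i (v k i)) = _
      rw [Function.update_eq_self]
  intro K _ _ _ v hv
  exact key Finset.univ K v hv fun i hi => absurd (Finset.mem_univ i) hi

/-- The coincidence set of two maps from a compact Hausdorff space to `X` is closed. -/
def KHausdorff (X : Type u) [TopologicalSpace X] : Prop :=
  ∀ (K : Type u) [TopologicalSpace K] [CompactSpace K] [T2Space K] (f g : K → X),
    Continuous f → Continuous g → IsClosed {k | f k = g k}

/-! ### The weak Hausdorff condition in terms of coincidence sets. -/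

section

variable {X Y : Type u} [TopologicalSpace X] [TopologicalSpace Y]

/-- If `u k₀ ≠ v k₀`, the fibres of `u ⊔ v` over these two points are disjoint closed sets in the
compact Hausdorff space `K ⊔ K`, with disjoint open neighbourhoods `U` and `V`. The images of the
complements are closed, and off their preimages an equality `u k = v k` would put one point into
both `U` and `V`. -/
theorem WeakHausdorffSpace.kHausdorff [WeakHausdorffSpace X] : KHausdorff X := by
  intro K _ _ _ u v hu hv
  have himg : ∀ (L : Type u) [TopologicalSpace L] [CompactSpace L] [T2Space L] (f : L → X),
      Continuous f → ∀ S : Set L, IsClosed S → IsClosed (f '' S) := by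
    intro L _ _ _ f hf S hS
    have : CompactSpace S := isCompact_iff_compactSpace.1 hS.isCompact
    have h := WeakHausdorffSpace.isClosed_range S (fun s => f s.1) (by fun_prop)
    rwa [show Set.range (fun s : S => f s.1) = f '' S by
      rw [Set.image_eq_range]] at h
  have hpt : ∀ x : X, IsClosed ({x} : Set X) := fun x => by
    have h := WeakHausdorffSpace.isClosed_range PUnit (fun _ => x) continuous_const
    rwa [Set.range_const] at h
  rw [← isOpen_compl_iff, isOpen_iff_mem_nhds]
  intro k₀ hk₀
  have hne : u k₀ ≠ v k₀ := hk₀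
  let f : K ⊕ K → X := Sum.elim u v
  have hf : Continuous f := hu.sumElim hv
  obtain ⟨U, V, hU, hV, hxU, hyV, hUV⟩ := normal_separation
    ((hpt (u k₀)).preimage hf) ((hpt (v k₀)).preimage hf)
    (Set.disjoint_left.2 fun z hz hz' => hne (hz.symm.trans hz'))
  have c1 := himg _ f hf _ hU.isClosed_compl
  have c2 := himg _ f hf _ hV.isClosed_compl
  refine Filter.mem_of_superset (((c1.preimage hu).isOpen_compl.inter
    (c2.preimage hv).isOpen_compl).mem_nhds ⟨?_, ?_⟩) ?_
  · rintro ⟨z, hz, e⟩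
    exact hz (hxU e)
  · rintro ⟨z, hz, e⟩
    exact hz (hyV e)
  · rintro k ⟨h1, h2⟩ (e : u k = v k)
    have m1 : Sum.inl k ∈ U := by
      by_contra h
      exact h1 ⟨Sum.inl k, h, rfl⟩
    have m2 : Sum.inl k ∈ V := by
      by_contra h
      exact h2 ⟨Sum.inl k, h, e⟩
    exact Set.disjoint_left.1 hUV m1 m2

/-- The preimage of the range of `f` under a test map `g` is the projection of a coincidence set in
a compact product, hence compact. -/
theorem KHausdorff.weakHausdorff [CompactlyGeneratedSpace X] (h : KHausdorff X) :
    WeakHausdorffSpace X where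
  isClosed_range K _ _ _ f hf := by
    refine CompactlyGeneratedSpace.isClosed' fun L _ _ _ g hg => ?_
    have h1 := h (L × K) (fun y => g y.1) (fun y => f y.2) (by fun_prop) (by fun_prop)
    have h2 := h1.isCompact.image continuous_fst
    convert h2.isClosed using 1
    ext l
    simp only [Set.mem_preimage, Set.mem_range, Set.mem_image, Set.mem_ofPred_eq, Prod.exists,
      exists_and_right, exists_eq_right]
    exact ⟨fun ⟨k, hk⟩ => ⟨k, hk.symm⟩, fun ⟨k, hk⟩ => ⟨k, hk.symm⟩⟩

theorem KHausdorff.of_injective (h : KHausdorff Y) {i : X → Y} (hi : Continuous i)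
    (hinj : Function.Injective i) : KHausdorff X := by
  intro K _ _ _ f g hf hg
  have := h K _ _ (hi.comp hf) (hi.comp hg)
  convert this using 1
  ext k
  exact hinj.eq_iff.symm

theorem KHausdorff.pi {ι : Type*} {X : ι → Type u} [∀ i, TopologicalSpace (X i)]
    (h : ∀ i, KHausdorff (X i)) {Y : Type u} [TopologicalSpace Y] {e : Y → ∀ i, X i}
    (he : ∀ i, Continuous fun y => e y i) (hinj : Function.Injective e) : KHausdorff Y := by
  intro K _ _ _ f g hf hg
  have : {k | f k = g k} = ⋂ i, {k | e (f k) i = e (g k) i} := by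
    ext k
    simp only [Set.mem_ofPred_eq, Set.mem_iInter]
    rw [← funext_iff]
    exact hinj.eq_iff.symm
  rw [this]
  exact isClosed_iInter fun i => h i K _ _ ((he i).comp hf) ((he i).comp hg)

theorem KHausdorff.isClosed_eq [CompactlyGeneratedSpace X] (h : KHausdorff Y) {f g : X → Y}
    (hf : Continuous f) (hg : Continuous g) : IsClosed {x | f x = g x} :=
  CompactlyGeneratedSpace.isClosed' fun K _ _ _ _ hp => h K _ _ (hf.comp hp) (hg.comp hp)

/-- The quotient of a compactly generated space by a closed equivalence relation is weak
Hausdorff. -/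
theorem KHausdorff.of_isQuotientMap [CompactlyGeneratedSpace X] {p : X → Y} (hp : IsQuotientMap p)
    (h : ∀ (K : Type u) [TopologicalSpace K] [CompactSpace K] [T2Space K] (f g : K → X),
      Continuous f → Continuous g → IsClosed {k | p (f k) = p (g k)}) : KHausdorff Y := by
  -- Inequality of two points is a map to `Prop` with the Sierpiński topology, whose continuity
  -- expresses openness. It descends along `p × p` in the compactly generated sense.
  have key : KCont fun b : Fin 2 → Y => ULift.up.{u} (b 0 ≠ b 1) := by
    refine kCont_of_isQuotientMap_pi (A := fun _ => X) (p := fun _ => p) (fun _ => hp) ?_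
    intro K _ _ _ f hf
    refine continuous_uliftUp.comp (continuous_Prop.2 ?_)
    exact (h K (fun k => f k 0) (fun k => f k 1) (by fun_prop) (by fun_prop)).isOpen_compl
  intro K _ _ _ f g hf hg
  have h1 := key K (fun k => ![f k, g k]) (continuous_pi fun i => by fin_cases i <;> assumption)
  have h2 := continuous_Prop.1 (continuous_uliftDown.comp h1)
  exact ⟨h2⟩

end

end TestSpaces

/-! ### The category `Π` as a category of partial injections -/

namespace PiHom

variable {k l m n : ℕ}

theorem ext' {φ ψ : PiHom m n} (h : ∀ i j, φ.1 i = some j ↔ ψ.1 i = some j) : φ = ψ :=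
  Subtype.ext (funext fun i => Option.ext fun j => h i j)

theorem inj (φ : PiHom m n) {i i' : Fin m} {j : Fin n} (h : φ.1 i = some j)
    (h' : φ.1 i' = some j) : i = i' := BasedMap.isPi_iff.1 φ.2 j i i' h h'

theorem comp_eq_some {φ : PiHom m n} {ψ : PiHom l m} {i : Fin l} {j : Fin n} :
    (φ.comp ψ).1 i = some j ↔ ∃ k, ψ.1 i = some k ∧ φ.1 k = some j :=
  Option.bind_eq_some_iff

theorem id_eq_some {i j : Fin n} : (PiHom.id n).1 i = some j ↔ i = j := by
  simp [PiHom.id]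

theorem ofPerm_eq_some {σ : Equiv.Perm (Fin n)} {i j : Fin n} :
    (ofPerm σ).1 i = some j ↔ σ i = j := by
  simp [ofPerm]

theorem skip_eq_some {i : Fin (n + 1)} {k : Fin n} {j : Fin (n + 1)} :
    (skip i).1 k = some j ↔ i.succAbove k = j := by
  simp [skip]

theorem delta_eq_some {i k : Fin n} {j : Fin 1} : (delta i).1 k = some j ↔ k = i := by
  obtain rfl := Fin.fin_one_eq_zero j
  simp [delta]

theorem zero_eq_some {i : Fin m} {j : Fin n} : (zero m n).1 i = some j ↔ False := by
  simp [zero]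

open Classical in
/-- The partial injection inverse to `φ`. -/
noncomputable def transpose (φ : PiHom m n) : PiHom n m :=
  ⟨fun j => if h : ∃ i, φ.1 i = some j then some h.choose else none,
    BasedMap.isPi_iff.2 fun i j j' h h' => by
      split_ifs at h h' with h1 h2
      have e1 := h1.choose_spec
      have e2 := h2.choose_spec
      rw [Option.some_inj.1 h] at e1
      rw [Option.some_inj.1 h'] at e2
      exact Option.some_inj.1 (e1.symm.trans e2)⟩

theorem transpose_eq_some {φ : PiHom m n} {i : Fin m} {j : Fin n} :
    φ.transpose.1 j = some i ↔ φ.1 i = some j := by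
  classical
  constructor
  · intro h
    change (if h : ∃ i, φ.1 i = some j then some h.choose else none) = _ at h
    split_ifs at h with h1
    have e1 := h1.choose_spec
    rwa [Option.some_inj.1 h] at e1
  · intro h
    have h1 : ∃ i, φ.1 i = some j := ⟨i, h⟩
    change (if h : ∃ i, φ.1 i = some j then some h.choose else none) = _
    rw [dif_pos h1, φ.inj h1.choose_spec h]

open Classical in
/-- The partial identity of `𝐧` with domain `S`. -/
noncomputable def restr (S : Set (Fin n)) : PiHom n n :=
  ⟨fun i => if i ∈ S then some i else none, BasedMap.isPi_iff.2 fun j i i' h h' => by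
    split_ifs at h h'
    rw [Option.some_inj.1 h, Option.some_inj.1 h']⟩

theorem restr_eq_some {S : Set (Fin n)} {i j : Fin n} :
    (restr S).1 i = some j ↔ i = j ∧ i ∈ S := by
  classical
  change (if i ∈ S then some i else none) = _ ↔ _
  split_ifs with h <;> simp [h]

/-- The injective maps. -/
def IsInj (φ : PiHom m n) : Prop := ∀ i, ∃ j, φ.1 i = some j

/-- The image of a morphism, without the base point. -/
def range (φ : PiHom m n) : Set (Fin n) := {j | ∃ i, φ.1 i = some j}

theorem mem_range {φ : PiHom m n} {j : Fin n} : j ∈ φ.range ↔ ∃ i, φ.1 i = some j := Iff.rfl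

theorem comp_assoc (φ : PiHom m n) (ψ : PiHom l m) (χ : PiHom k l) :
    (φ.comp ψ).comp χ = φ.comp (ψ.comp χ) := Subtype.ext (BasedMap.comp_assoc _ _ _)

theorem id_comp (φ : PiHom m n) : (PiHom.id n).comp φ = φ := by
  apply ext'
  simp [comp_eq_some, id_eq_some]

theorem transpose_transpose (φ : PiHom m n) : φ.transpose.transpose = φ := by
  apply ext'
  simp [transpose_eq_some]

theorem transpose_comp (φ : PiHom m n) (ψ : PiHom l m) :
    (φ.comp ψ).transpose = ψ.transpose.comp φ.transpose := by
  apply ext'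
  simp [transpose_eq_some, comp_eq_some, and_comm]

theorem transpose_restr (S : Set (Fin n)) : (restr S).transpose = restr S := by
  apply ext'
  simp only [transpose_eq_some, restr_eq_some]
  grind

theorem transpose_ofPerm (σ : Equiv.Perm (Fin n)) : (ofPerm σ).transpose = ofPerm σ⁻¹ := by
  apply ext'
  simp only [transpose_eq_some, ofPerm_eq_some, Equiv.Perm.inv_eq_iff_eq]
  grind

theorem transpose_comp_self (φ : PiHom m n) (h : φ.IsInj) :
    φ.transpose.comp φ = PiHom.id m := by
  apply ext'
  simp only [comp_eq_some, transpose_eq_some, id_eq_some]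
  intro i j
  constructor
  · rintro ⟨k, h1, h2⟩
    exact φ.inj h1 h2
  · rintro rfl
    obtain ⟨k, hk⟩ := h i
    exact ⟨k, hk, hk⟩

theorem comp_transpose_self (φ : PiHom m n) : φ.comp φ.transpose = restr φ.range := by
  apply ext'
  simp only [comp_eq_some, transpose_eq_some, restr_eq_some, mem_range]
  intro i j
  constructor
  · rintro ⟨k, h1, h2⟩
    exact ⟨Option.some_inj.1 (h1.symm.trans h2), k, h1⟩
  · rintro ⟨rfl, k, hk⟩
    exact ⟨k, hk, hk⟩

theorem transpose_comp_eq_restr (φ : PiHom m n) :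
    φ.transpose.comp φ = restr φ.transpose.range := by
  conv_lhs => rw [← φ.transpose_transpose]
  rw [transpose_transpose φ]
  have := comp_transpose_self φ.transpose
  rwa [transpose_transpose] at this

theorem restr_comp {φ : PiHom m n} {S : Set (Fin n)} (h : φ.range ⊆ S) :
    (restr S).comp φ = φ := by
  apply ext'
  simp only [comp_eq_some, restr_eq_some]
  intro i j
  constructor
  · rintro ⟨k, h1, rfl, -⟩
    exact h1
  · exact fun h1 => ⟨j, h1, rfl, h ⟨i, h1⟩⟩

theorem comp_restr {φ : PiHom m n} {S : Set (Fin m)} (h : φ.transpose.range ⊆ S) :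
    φ.comp (restr S) = φ := by
  rw [← (φ.comp (restr S)).transpose_transpose, transpose_comp, transpose_restr, restr_comp h,
    transpose_transpose]

theorem restr_comp_restr (S T : Set (Fin n)) : (restr S).comp (restr T) = restr (S ∩ T) := by
  apply ext'
  simp only [comp_eq_some, restr_eq_some]
  grind

theorem restr_comm (S T : Set (Fin n)) :
    (restr S).comp (restr T) = (restr T).comp (restr S) := by
  rw [restr_comp_restr, restr_comp_restr, Set.inter_comm]

theorem comp_transpose_comp (φ : PiHom m n) : φ.comp (φ.transpose.comp φ) = φ := by
  rw [← comp_assoc, comp_transpose_self, restr_comp le_rfl]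

theorem IsInj.comp {φ : PiHom m n} {ψ : PiHom l m} (hφ : φ.IsInj) (hψ : ψ.IsInj) :
    (φ.comp ψ).IsInj := by
  intro i
  obtain ⟨j, hj⟩ := hψ i
  obtain ⟨k, hk⟩ := hφ j
  exact ⟨k, comp_eq_some.2 ⟨j, hj, hk⟩⟩

theorem isInj_ofPerm (σ : Equiv.Perm (Fin n)) : (ofPerm σ).IsInj := fun i => ⟨σ i, rfl⟩

theorem isInj_skip (i : Fin (n + 1)) : (skip i).IsInj := fun k => ⟨i.succAbove k, rfl⟩

theorem IsInj.le {φ : PiHom m n} (h : φ.IsInj) : m ≤ n := by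
  choose f hf using h
  have : Function.Injective f := fun i i' e => φ.inj (hf i) (by rw [e]; exact hf i')
  simpa using Fintype.card_le_of_injective f this

/-- An injective endomorphism is a permutation. -/
theorem IsInj.exists_ofPerm {φ : PiHom n n} (h : φ.IsInj) : ∃ σ, φ = ofPerm σ := by
  choose f hf using h
  have : Function.Injective f := fun i i' e => φ.inj (hf i) (by rw [e]; exact hf i')
  refine ⟨Equiv.ofBijective f (Finite.injective_iff_bijective.1 this), Subtype.ext ?_⟩
  funext i
  exact hf i

/-- Two injective maps with the same image differ by a permutation. -/
theorem IsInj.exists_eq_comp_ofPerm {φ ψ : PiHom m n} (hψ : ψ.IsInj)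
    (h : φ.range = ψ.range) : ∃ σ, ψ = φ.comp (ofPerm σ) := by
  have h1 : (φ.transpose.comp ψ).IsInj := by
    intro i
    obtain ⟨j, hj⟩ := hψ i
    obtain ⟨k, hk⟩ : j ∈ φ.range := h ▸ ⟨i, hj⟩
    exact ⟨k, comp_eq_some.2 ⟨j, hj, transpose_eq_some.2 hk⟩⟩
  obtain ⟨σ, hσ⟩ := h1.exists_ofPerm
  refine ⟨σ, ?_⟩
  rw [← hσ, ← comp_assoc, comp_transpose_self, restr_comp (h ▸ le_rfl)]

/-- Every subset is the image of an injective map. -/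
theorem exists_isInj_range (S : Set (Fin n)) : ∃ (q : ℕ) (φ : PiHom q n), φ.IsInj ∧ φ.range = S := by
  classical
  let e := Fintype.equivFin S
  refine ⟨_, ⟨fun i => some (e.symm i).1, BasedMap.isPi_iff.2 fun j i i' h h' => ?_⟩,
    fun i => ⟨_, rfl⟩, ?_⟩
  · exact e.symm.injective (Subtype.ext (Option.some_inj.1 (h.trans h'.symm)))
  · ext j
    constructor
    · rintro ⟨i, hi⟩
      rw [← Option.some_inj.1 hi]
      exact (e.symm i).2
    · intro hj
      exact ⟨e ⟨j, hj⟩, by simp⟩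

/-- The number of elements of the support of a based map. -/
noncomputable def supportCard (S : Set (Fin n)) : ℕ := (exists_isInj_range S).choose

/-- An injection with image `S`. -/
noncomputable def inc (S : Set (Fin n)) : PiHom (supportCard S) n :=
  (exists_isInj_range S).choose_spec.choose

theorem isInj_inc (S : Set (Fin n)) : (inc S).IsInj :=
  (exists_isInj_range S).choose_spec.choose_spec.1

theorem range_inc (S : Set (Fin n)) : (inc S).range = S :=
  (exists_isInj_range S).choose_spec.choose_spec.2

theorem range_skip (i : Fin (n + 1)) : (skip i).range = {i}ᶜ := by
  ext j
  simp only [mem_range, skip_eq_some, Set.mem_compl_iff, Set.mem_singleton_iff]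
  exact Fin.exists_succAbove_eq_iff

theorem comp_zero (φ : PiHom m n) : φ.comp (zero l m) = zero l n :=
  ext' fun i j => by simp [comp_eq_some, zero_eq_some]

instance : Finite (PiHom m n) := Subtype.finite

end PiHom

namespace PiDiagram

variable {G : Type v} [Group G] (X : PiDiagram.{u} G)

theorem map_map {k m n : ℕ} (φ : PiHom m n) (ψ : PiHom k m) (x : X.obj k) :
    X.map φ (X.map ψ x) = X.map (φ.comp ψ) x := (X.map_comp φ ψ x).symm

/-- Every functor on `Π` splits the injections. This makes sets of degenerate points fixed sets of
idempotents and provides the retractions used below. -/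
theorem map_transpose_map {m n : ℕ} {φ : PiHom m n} (h : φ.IsInj) (x : X.obj m) :
    X.map φ.transpose (X.map φ x) = x := by
  rw [map_map, φ.transpose_comp_self h, X.map_id]

end PiDiagram

/-- A map on a compact space is continuous if it is so on the clopen pieces on which finitely many
maps to disjoint unions take values in one summand. -/
theorem continuous_of_sigma_probes {J : Type} [Finite J] {ι : J → Type} {A : ∀ j, ι j → Type u}
    [∀ j i, TopologicalSpace (A j i)] {K : Type u} [TopologicalSpace K] [CompactSpace K] [T2Space K]
    {Y : Type*} [TopologicalSpace Y] (g : ∀ j, K → Σ i, A j i) (hg : ∀ j, Continuous (g j))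
    {F : K → Y}
    (h : ∀ (i : ∀ j, ι j) (V : Type u) [TopologicalSpace V] [CompactSpace V] [T2Space V]
      (e : V → K) (a : ∀ j, V → A j (i j)), Continuous e → (∀ j, Continuous (a j)) →
      (∀ j v, g j (e v) = ⟨i j, a j v⟩) → Continuous fun v => F (e v)) : Continuous F := by
  refine continuous_iff_continuousAt.2 fun k₀ => ?_
  have hcl : IsClopen (⋂ j, g j ⁻¹' Set.range (Sigma.mk (g j k₀).1)) :=
    isClopen_iInter_of_finite fun j =>
      ⟨isClosed_range_sigmaMk.preimage (hg j), isOpen_range_sigmaMk.preimage (hg j)⟩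
  have : CompactSpace (⋂ j, g j ⁻¹' Set.range (Sigma.mk (g j k₀).1) : Set K) :=
    isCompact_iff_compactSpace.1 hcl.1.isCompact
  have hv : ∀ j, ∀ k : (⋂ j, g j ⁻¹' Set.range (Sigma.mk (g j k₀).1) : Set K),
      ∃ a : A j (g j k₀).1, Sigma.mk (g j k₀).1 a = g j k.1 :=
    fun j k => Set.mem_iInter.1 k.2 j
  choose v hv using hv
  have hvc : ∀ j, Continuous (v j) := fun j => by
    rw [(Topology.IsEmbedding.sigmaMk (σ := A j) (i := (g j k₀).1)).continuous_iff]
    exact ((hg j).comp continuous_subtype_val).congr fun k => (hv j k).symm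
  have h1 := h (fun j => (g j k₀).1) _ Subtype.val v continuous_subtype_val hvc
    fun j k => (hv j k).symm
  exact (continuousOn_iff_continuous_domRestrict.2 h1).continuousAt
    (hcl.2.mem_nhds (Set.mem_iInter.2 fun j => ⟨(g j k₀).2, rfl⟩))

theorem continuous_of_sigma_probe {ι : Type} {A : ι → Type u}
    [∀ i, TopologicalSpace (A i)] {K : Type u} [TopologicalSpace K] [CompactSpace K] [T2Space K]
    {Y : Type*} [TopologicalSpace Y] {g : K → Σ i, A i} (hg : Continuous g)
    {F : K → Y}
    (h : ∀ (i : ι) (V : Type u) [TopologicalSpace V] [CompactSpace V] [T2Space V]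
      (e : V → K) (a : V → A i), Continuous e → Continuous a →
      (∀ v, g (e v) = ⟨i, a v⟩) → Continuous fun v => F (e v)) : Continuous F :=
  continuous_of_sigma_probes (J := Unit) (A := fun _ => A) (fun _ => g) (fun _ => hg)
    fun i V _ _ _ e a he ha hge => h (i ()) V e (a ()) he (ha ()) (hge ())

theorem KHausdorff.sigma {ι : Type} {A : ι → Type u} [∀ i, TopologicalSpace (A i)]
    (h : ∀ i, KHausdorff (A i)) : KHausdorff (Σ i, A i) := by
  intro K _ _ _ f g hf hg
  have : Continuous fun k => f k ≠ g k := by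
    refine continuous_of_sigma_probe hf fun i V _ _ _ e a he ha hfe => ?_
    refine continuous_of_sigma_probe (hg.comp he) fun i' V' _ _ _ e' a' he' ha' hge => ?_
    simp only [hfe, Function.comp_apply] at hge ⊢
    simp only [hge]
    by_cases hi : i = i'
    · subst hi
      refine continuous_Prop.2 ?_
      have := (h i V' _ _ (ha.comp he') ha').isOpen_compl
      convert this using 2
      ext v
      simp
    · have : ∀ v, ((⟨i, a (e' v)⟩ : Σ i, A i) ≠ ⟨i', a' v⟩) = True := fun v =>
        eq_true fun e => hi (congrArg Sigma.fst e)
      simp only [this]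
      exact continuous_const
  exact ⟨continuous_Prop.1 this⟩

theorem KHausdorff.kify {X : Type u} [TopologicalSpace X] (h : KHausdorff X) :
    KHausdorff (Kify X) :=
  h.of_injective Kify.continuous_get fun a b e => by cases a; cases b; exact congrArg _ e

/-! ### Composites of morphisms of `𝒟` with morphisms of `Π`. -/

namespace BasedMap

variable {m n q : ℕ}

/-- The bijection of index sets given by a bijection of fibres. -/
def enumEquiv {χ : BasedMap m n} {χ' : BasedMap q l} {j : Fin n} {j' : Fin l}
    (e : χ.Fiber j ≃ χ'.Fiber j') : Fin (χ.card j) ≃ Fin (χ'.card j') :=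
  (χ.enum j).trans (e.trans (χ'.enum j').symm)

theorem enum_enumEquiv {χ : BasedMap m n} {χ' : BasedMap q l} {j : Fin n} {j' : Fin l}
    (e : χ.Fiber j ≃ χ'.Fiber j') (x : Fin (χ.card j)) :
    χ'.enum j' (enumEquiv e x) = e (χ.enum j x) := by
  simp [enumEquiv]

theorem enum_finCongr {α β : BasedMap m n} (h : α = β) (j : Fin n) (x : Fin (α.card j)) :
    (β.enum j (finCongr (congrArg (fun φ => BasedMap.card φ j) h) x)).1 = (α.enum j x).1 := by
  subst h
  rfl

end BasedMap

namespace GOperad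

variable {G : Type v} [Group G] {C : GOperad.{u} G}

theorem γ_piElt {k : ℕ} (c : C.obj k) (a : Fin k → ℕ) (ha : ∀ s, a s ≤ 1) (h1 : ∀ s, a s = 1)
    {N : ℕ} (P : Fin N ≃ Fin (∑ s, a s)) (Q : Fin N ≃ Fin k)
    (hPQ : ∀ x, (finSigmaFinEquiv.symm (P x)).1 = Q x) :
    C.perm P (C.γ c fun s => C.piElt (a s) (ha s)) = C.perm Q c := by
  obtain rfl : a = fun _ => 1 := funext h1
  change C.perm P (C.γ c fun _ => C.one) = _
  rw [C.γ_one_right, ← C.perm_trans]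
  congr 1
  ext1 x
  rw [← hPQ]
  rfl

namespace DHom

variable {k m n q : ℕ}

/-- The composite `f ∘ ψ` for a morphism `ψ` of `Π`. -/
def precomp (f : C.DHom m n) (ψ : PiHom k m) : C.DHom k n := f.comp (C.incl ψ)

/-- The composite `φ ∘ f` for a morphism `φ` of `Π`. -/
def postcomp (φ : PiHom n m) (f : C.DHom k n) : C.DHom k m := (C.incl φ).comp f

theorem fn_precomp (f : C.DHom m n) (ψ : PiHom k m) : (f.precomp ψ).fn = f.fn.comp ψ.1 := rfl

theorem fn_postcomp (φ : PiHom n m) (f : C.DHom k n) : (postcomp φ f).fn = φ.1.comp f.fn := rfl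

theorem fn_smul (g : G) (f : C.DHom m n) : (g • f).fn = f.fn := rfl

theorem fn_precomp_eq_some {f : C.DHom m n} {ψ : PiHom k m} {i : Fin k} {j : Fin n} :
    (f.precomp ψ).fn i = some j ↔ ∃ l, ψ.1 i = some l ∧ f.fn l = some j :=
  Option.bind_eq_some_iff

theorem fn_postcomp_eq_some {φ : PiHom n m} {f : C.DHom k n} {i : Fin k} {j : Fin m} :
    (postcomp φ f).fn i = some j ↔ ∃ l, f.fn i = some l ∧ φ.1 l = some j :=
  Option.bind_eq_some_iff

theorem precomp_precomp (f : C.DHom m n) (ψ : PiHom k m) (χ : PiHom q k) :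
    (f.precomp ψ).precomp χ = f.precomp (ψ.comp χ) := by
  rw [precomp, precomp, comp_assoc, incl_comp_incl, precomp]

theorem postcomp_postcomp {l : ℕ} (φ : PiHom n m) (χ : PiHom l n) (f : C.DHom k l) :
    postcomp φ (postcomp χ f) = postcomp (φ.comp χ) f := by
  rw [postcomp, postcomp, ← comp_assoc, incl_comp_incl, postcomp]

theorem postcomp_precomp {l : ℕ} (φ : PiHom n m) (f : C.DHom l n) (ψ : PiHom k l) :
    (postcomp φ f).precomp ψ = postcomp φ (f.precomp ψ) := comp_assoc _ _ _

theorem smul_precomp (g : G) (f : C.DHom m n) (ψ : PiHom k m) :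
    g • f.precomp ψ = (g • f).precomp ψ := by
  rw [precomp, ← smul_comp, smul_incl, precomp]

theorem smul_postcomp (g : G) (φ : PiHom n m) (f : C.DHom k n) :
    g • postcomp φ f = postcomp φ (g • f) := by
  rw [postcomp, ← smul_comp, smul_incl, postcomp]

theorem continuous_precomp (ψ : PiHom k m) :
    Continuous fun f : C.DHom m n => f.precomp ψ := by
  refine Kify.continuous_sigma fun φ K _ _ _ c hc => Kify.continuous_of_compact
    (f := fun x => (precomp (Kify.of ⟨φ, c x⟩) ψ).get) ?_
  refine (continuous_sigmaMk (σ := fun φ : BasedMap k n => ∀ j, C.obj (φ.card j))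
    (i := φ.comp ψ.1)).comp (f := fun k j => C.perm (φ.blockPerm ψ.1 j)
    (C.γ (c k j) fun s => (C.incl ψ).op (φ.enum j s).1))
    (continuous_pi fun j => (C.continuous_perm _).comp ?_)
  exact C.continuous_γ.comp (Kify.continuous_of_compact
    (f := fun x => (c x j, fun s => (C.incl ψ).op (φ.enum j s).1))
    (((continuous_apply j).comp hc).prodMk continuous_const))

theorem continuous_postcomp (φ : PiHom n m) :
    Continuous fun f : C.DHom k n => postcomp φ f := continuous_comp _

theorem isClopen_fn (T : Set (BasedMap m n)) : IsClopen {f : C.DHom m n | f.fn ∈ T} := by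
  have : ∀ T : Set (BasedMap m n), IsOpen {f : C.DHom m n | f.fn ∈ T} := by
    intro T
    have h : IsOpen {p : Σ φ : BasedMap m n, ∀ j, C.obj (φ.card j) | p.1 ∈ T} := by
      rw [isOpen_sigma_iff]
      intro φ
      by_cases hφ : φ ∈ T <;> simp [hφ]
    exact h.preimage Kify.continuous_get
  exact ⟨⟨this Tᶜ⟩, this T⟩

variable (C) in
theorem kHausdorff (m n : ℕ) : KHausdorff (C.DHom m n) :=
  (KHausdorff.sigma fun _ => KHausdorff.pi
    (fun _ => WeakHausdorffSpace.kHausdorff) (e := fun y => y) continuous_apply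
    Function.injective_id).kify

/-- If `ψ` hits all of the fibre of `f` over `j`, every input of `f.op j` receives the unit element,
and the right unit law leaves only the renumbering `Q`. -/
theorem op_precomp (f : C.DHom m n) (ψ : PiHom k m) (j : Fin n)
    (Q : Fin ((f.precomp ψ).fn.card j) ≃ Fin (f.fn.card j))
    (hQ : ∀ x, ψ.1 ((f.precomp ψ).fn.enum j x).1 = some (f.fn.enum j (Q x)).1) :
    (f.precomp ψ).op j = C.perm Q (f.op j) := by
  have h1 : ∀ s, ψ.1.card (f.fn.enum j s).1 = 1 := by
    intro s
    refine le_antisymm (ψ.2 _) (Fintype.card_pos_iff.2 ⟨⟨((f.precomp ψ).fn.enum j (Q.symm s)).1, ?_⟩⟩)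
    rw [hQ, Equiv.apply_symm_apply]
  refine C.γ_piElt (f.op j) _ (fun s => ψ.2 _) h1 (f.fn.blockPerm ψ.1 j) Q fun x => ?_
  apply (f.fn.enum j).injective
  apply Subtype.ext
  have h2 := BasedMap.label_blockPerm f.fn ψ.1 j x
  have h3 := hQ x
  rw [show ((f.precomp ψ).fn.enum j x).1 = _ from h2.symm] at h3
  exact Option.some_inj.1 ((ψ.1.enum _ _).2.symm.trans h3)

theorem ext_op {f h : C.DHom m n} (e : f.fn = h.fn)
    (e' : ∀ j (Q : Fin (f.fn.card j) ≃ Fin (h.fn.card j)),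
      (∀ x, (f.fn.enum j x).1 = (h.fn.enum j (Q x)).1) → f.op j = C.perm Q (h.op j)) : f = h :=
  ext' e fun j => e' j _ fun x => (BasedMap.enum_finCongr e j x).symm

/-- Restriction to a subset containing the support does nothing. -/
theorem precomp_restr (f : C.DHom m n) (S : Set (Fin m)) (h : ∀ i j, f.fn i = some j → i ∈ S) :
    f.precomp (PiHom.restr S) = f := by
  refine ext_op (funext fun i => Option.ext fun j => ?_) fun j Q hQ =>
    op_precomp f _ j Q fun x => ?_
  · rw [fn_precomp_eq_some]
    simp only [PiHom.restr_eq_some]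
    constructor
    · rintro ⟨l, ⟨rfl, -⟩, h1⟩
      exact h1
    · exact fun h1 => ⟨i, ⟨rfl, h i j h1⟩, h1⟩
  · rw [PiHom.restr_eq_some]
    exact ⟨hQ x, hQ x ▸ h _ _ (f.fn.enum j (Q x)).2⟩

theorem precomp_id (f : C.DHom m n) : f.precomp (PiHom.id m) = f := by
  have h := f.precomp_restr Set.univ fun _ _ _ => trivial
  rwa [show PiHom.restr Set.univ = PiHom.id m from
    PiHom.ext' fun i j => by simp [PiHom.restr_eq_some, PiHom.id_eq_some]] at h

theorem postcomp_id (f : C.DHom m n) : postcomp (PiHom.id n) f = f := id_comp f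

theorem op_delta (f : C.DHom m n) (j : Fin n)
    (Q : Fin ((postcomp (PiHom.delta j) f).fn.card 0) ≃ Fin (f.fn.card j))
    (hQ : ∀ x, ((postcomp (PiHom.delta j) f).fn.enum 0 x).1 = (f.fn.enum j (Q x)).1) :
    (postcomp (PiHom.delta j) f).op 0 = C.perm Q (f.op j) := by
  have h1 : (PiHom.delta j).1.card 0 = 1 :=
    Fintype.card_eq_one_iff.2 ⟨⟨j, PiHom.delta_eq_some.2 rfl⟩,
      fun x => Subtype.ext (PiHom.delta_eq_some.1 x.2)⟩
  exact perm_γ_one f j ((PiHom.delta j).2 0) h1 (fun s => ((PiHom.delta j).1.enum 0 s).1)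
    (fun s => PiHom.delta_eq_some.1 ((PiHom.delta j).1.enum 0 s).2) _ Q fun x =>
      (BasedMap.label_blockPerm _ _ 0 x).trans (hQ x)

theorem fn_delta {f : C.DHom m n} {j : Fin n} {i : Fin m} :
    (postcomp (PiHom.delta j) f).fn i = some 0 ↔ f.fn i = some j := by
  simp [fn_postcomp_eq_some, PiHom.delta_eq_some]

theorem perm_injective {a b : ℕ} (e : Fin a ≃ Fin b) : Function.Injective (C.perm e) := by
  intro c d h
  have := congrArg (C.perm e.symm) h
  rwa [← C.perm_trans, ← C.perm_trans, Equiv.symm_trans_self, C.perm_refl, C.perm_refl] at this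

/-- A morphism is determined by its coordinates. -/
theorem ext_delta {f h : C.DHom m n}
    (e : ∀ j, postcomp (PiHom.delta j) f = postcomp (PiHom.delta j) h) : f = h := by
  have hfn : f.fn = h.fn := funext fun i => Option.ext fun j => by
    rw [← fn_delta, e, fn_delta]
  obtain ⟨φ, c⟩ := f
  obtain ⟨ψ, d⟩ := h
  change φ = ψ at hfn
  subst hfn
  congr 2
  funext j
  have key : ∀ p : C.DHom m 1, p = postcomp (PiHom.delta j) ⟨⟨φ, d⟩⟩ →
      ∀ Q : Fin (p.fn.card 0) ≃ Fin (φ.card j),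
      (∀ x, (p.fn.enum 0 x).1 = (φ.enum j (Q x)).1) → p.op 0 = C.perm Q (d j) := by
    rintro _ rfl Q hQ
    exact op_delta ⟨⟨φ, d⟩⟩ j Q hQ
  let E : (postcomp (PiHom.delta j) (⟨⟨φ, c⟩⟩ : C.DHom m n)).fn.Fiber 0 ≃ φ.Fiber j :=
    Equiv.subtypeEquivRight fun i => fn_delta (f := (⟨⟨φ, c⟩⟩ : C.DHom m n))
  have hE : ∀ x, ((postcomp (PiHom.delta j) (⟨⟨φ, c⟩⟩ : C.DHom m n)).fn.enum 0 x).1 =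
      (φ.enum j (BasedMap.enumEquiv E x)).1 := fun x => by
    rw [BasedMap.enum_enumEquiv]
    rfl
  exact perm_injective _ ((op_delta ⟨⟨φ, c⟩⟩ j _ hE).symm.trans (key _ (e j) _ hE))

/-- The set of those elements not sent to the base point. -/
def supp (f : C.DHom m n) : Set (Fin m) := {i | f.fn i ≠ none}

theorem mem_supp {f : C.DHom m n} {i : Fin m} : i ∈ f.supp ↔ ∃ j, f.fn i = some j :=
  Option.ne_none_iff_exists'

theorem precomp_restr_supp (f : C.DHom m n) : f.precomp (PiHom.restr f.supp) = f :=
  f.precomp_restr _ fun _ j h => mem_supp.2 ⟨j, h⟩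

theorem mem_supp_precomp {f : C.DHom m n} {ψ : PiHom k m} {i : Fin k} :
    i ∈ (f.precomp ψ).supp ↔ ∃ l, ψ.1 i = some l ∧ l ∈ f.supp := by
  simp only [mem_supp, fn_precomp_eq_some]
  grind

/-- Nothing but the base point is sent to the base point. -/
def IsEffective (f : C.DHom m n) : Prop := ∀ i, i ∈ f.supp

/-- Effective morphisms have neighbourhoods that are disjoint from their translates by
permutations. -/
theorem exists_slim (hC : C.IsSigmaFree) (f : C.DHom m n) (hf : f.IsEffective) :
    ∃ U : Set (C.DHom m n), IsOpen U ∧ f ∈ U ∧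
      ∀ e ∈ U, ∀ σ, e.precomp (PiHom.ofPerm σ) ∈ U → σ = 1 := by
  obtain ⟨φ, c⟩ := f
  choose U hU hc hd using fun j => hC _ (c j)
  -- The neighbourhood consists of the morphisms with the same underlying based map `φ` and
  -- components in the sets given by Σ-freeness.
  refine ⟨Kify.get ⁻¹' (Sigma.mk φ '' Set.univ.pi U),
    (isOpenMap_sigmaMk _ (isOpen_set_pi Set.finite_univ fun j _ => hU j)).preimage
      Kify.continuous_get, ⟨c, fun j _ => hc j, rfl⟩, ?_⟩
  rintro ⟨φ', e₀⟩ ⟨e, he', h'⟩ σ ⟨d, hd', h''⟩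
  cases h'
  have hφ : φ = φ.comp (PiHom.ofPerm σ).1 := congrArg Sigma.fst h''
  let E : ∀ j, φ.Fiber j ≃ φ.Fiber j := fun j =>
    σ.subtypeEquiv fun i => by rw [show φ (σ i) = φ.comp (PiHom.ofPerm σ).1 i from rfl, ← hφ]
  have key : ∀ p : C.DHom m n, p = ⟨⟨φ, d⟩⟩ → p = precomp ⟨⟨φ, e⟩⟩ (PiHom.ofPerm σ) →
      ∀ j, d j = C.perm (BasedMap.enumEquiv (E j)) (e j) := by
    intro p hp hp' j
    have h1 := op_precomp (⟨⟨φ, e⟩⟩ : C.DHom m n) (PiHom.ofPerm σ) j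
    rw [← hp', hp] at h1
    refine h1 _ fun x => ?_
    rw [BasedMap.enum_enumEquiv]
    rfl
  -- If both `e` and `e σ` lie in the neighbourhood, `σ` preserves the fibres of `φ`, and Σ-freeness
  -- makes it trivial on each. As `φ` is effective, the fibres exhaust all elements.
  have hone : ∀ j, BasedMap.enumEquiv (E j) = 1 := by
    intro j
    by_contra hne
    refine Set.disjoint_left.1 (hd j _ hne) (hd' j trivial) ⟨e j, he' j trivial, ?_⟩
    exact (key ⟨⟨φ, d⟩⟩ rfl (congrArg Kify.of h'') j).symm
  ext1 i
  obtain ⟨j, hj⟩ := mem_supp.1 (hf i)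
  have h1 := BasedMap.enum_enumEquiv (E j) ((φ.enum j).symm ⟨i, hj⟩)
  rw [hone, Equiv.apply_symm_apply] at h1
  simp only [Equiv.Perm.coe_one, id_eq, Equiv.apply_symm_apply] at h1
  exact (congrArg Subtype.val h1).symm

/-! ### Morphisms with given coordinates -/

/-- The condition that the fibres over `1` of based maps to `𝟏` are disjoint. -/
def DisjointFibers (φ : Fin n → BasedMap m 1) : Prop :=
  ∀ i j j', φ j i = some 0 → φ j' i = some 0 → j = j'

open Classical in
/-- The based map with given fibres. -/
noncomputable def glueFn (φ : Fin n → BasedMap m 1) : BasedMap m n := fun i =>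
  if h : ∃ j, φ j i = some 0 then some h.choose else none

theorem glueFn_eq_some {φ : Fin n → BasedMap m 1} (h : DisjointFibers φ) {i : Fin m} {j : Fin n} :
    glueFn φ i = some j ↔ φ j i = some 0 := by
  unfold glueFn
  split_ifs with h1
  · rw [Option.some_inj]
    exact ⟨fun e => e ▸ h1.choose_spec, fun e => h i _ _ h1.choose_spec e⟩
  · exact ⟨fun e => by simp at e, fun e => absurd ⟨j, e⟩ h1⟩

/-- The bijection of the fibres of `glueFn φ` with the given ones. -/
noncomputable def glueEquiv {φ : Fin n → BasedMap m 1} (h : DisjointFibers φ) (j : Fin n) :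
    Fin ((glueFn φ).card j) ≃ Fin ((φ j).card 0) :=
  BasedMap.enumEquiv (Equiv.subtypeEquivRight fun _ => glueFn_eq_some h)

theorem enum_glueEquiv {φ : Fin n → BasedMap m 1} (h : DisjointFibers φ) (j : Fin n)
    (x : Fin ((glueFn φ).card j)) :
    ((φ j).enum 0 (glueEquiv h j x)).1 = ((glueFn φ).enum j x).1 := by
  rw [glueEquiv, BasedMap.enum_enumEquiv]
  rfl

/-- The morphism with given coordinates. -/
noncomputable def glue (f : Fin n → C.DHom m 1) (h : DisjointFibers fun j => (f j).fn) :
    C.DHom m n :=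
  ⟨⟨glueFn fun j => (f j).fn, fun j => C.perm (glueEquiv h j) ((f j).op 0)⟩⟩

theorem delta_glue (f : Fin n → C.DHom m 1) (h : DisjointFibers fun j => (f j).fn) (j : Fin n) :
    postcomp (PiHom.delta j) (glue f h) = f j := by
  have h0 : ∀ i, (postcomp (PiHom.delta j) (glue f h)).fn i = some 0 ↔ (f j).fn i = some 0 :=
    fun i => fn_delta.trans (glueFn_eq_some h)
  refine ext_op (funext fun i => Option.ext fun j' => ?_) fun j' Q hQ => ?_
  · obtain rfl := Fin.fin_one_eq_zero j'
    exact h0 i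
  · obtain rfl := Fin.fin_one_eq_zero j'
    let E : Fin ((glue f h).fn.card j) ≃ Fin ((f j).fn.card 0) := glueEquiv h j
    have h1 := op_delta (glue f h) j (Q.trans E.symm) fun x => by
      rw [hQ, Equiv.trans_apply]
      refine Eq.trans ?_ (enum_glueEquiv h j (E.symm (Q x)))
      exact congrArg (fun y => ((f j).fn.enum 0 y).1) (E.apply_symm_apply (Q x)).symm
    rw [h1, show (glue f h).op j = C.perm E ((f j).op 0) from rfl,
      ← C.perm_trans, Equiv.trans_assoc, Equiv.symm_trans_self, Equiv.trans_refl]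

theorem continuous_glue {K : Type u} [TopologicalSpace K] [CompactSpace K] [T2Space K]
    {f : K → Fin n → C.DHom m 1} (hf : Continuous f) (h : ∀ k, DisjointFibers fun j => (f k j).fn) :
    Continuous fun k => glue (f k) (h k) := by
  refine continuous_of_sigma_probes (J := Fin n)
    (A := fun _ (φ : BasedMap m 1) => ∀ j, C.obj (φ.card j)) (fun j k => (f k j).get)
    (fun j => Kify.continuous_get.comp ((continuous_apply j).comp hf))
    fun φ V _ _ _ e a he ha hfe => ?_
  have key : ∀ (p : Fin n → C.DHom m 1) (hp : DisjointFibers fun j => (p j).fn)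
      (c : ∀ j j', C.obj ((φ j).card j')) (hφ : DisjointFibers φ), (∀ j, (p j).get = ⟨φ j, c j⟩) →
      glue p hp = ⟨⟨glueFn φ, fun j => C.perm (glueEquiv hφ j) (c j 0)⟩⟩ := by
    intro p hp c hφ hpc
    obtain rfl : p = fun j => ⟨⟨φ j, c j⟩⟩ := funext fun j => congrArg Kify.of (hpc j)
    rfl
  by_cases hV : Nonempty V
  · obtain ⟨v₀⟩ := hV
    have hφ : DisjointFibers φ := by
      have := h (e v₀)
      rwa [show (fun j => (f (e v₀) j).fn) = φ from
        funext fun j => congrArg Sigma.fst (hfe j v₀)] at this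
    refine (Kify.continuous_of_compact (f := fun v => (⟨glueFn φ, fun j =>
      C.perm (glueEquiv hφ j) (a j v 0)⟩ : Σ φ : BasedMap m n, ∀ j, C.obj (φ.card j))) ?_).congr
      fun v => (key _ (h (e v)) (fun j => a j v) hφ fun j => hfe j v).symm
    exact continuous_sigmaMk.comp (continuous_pi fun j => (C.continuous_perm _).comp
      ((continuous_apply 0).comp (ha j)))
  · rw [not_nonempty_iff] at hV
    exact continuous_of_discreteTopology

end DHom

end GOperad

theorem CompactlyGeneratedSpace.subtype_of_isOpen {A : Type u} [TopologicalSpace A]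
    [CompactlyGeneratedSpace A] {s : Set A} (hs : IsOpen s) : CompactlyGeneratedSpace s := by
  refine compactlyGeneratedSpace_of_isOpen fun t ht => ?_
  rw [hs.isOpenEmbedding_subtypeVal.isOpen_iff_image_isOpen]
  refine CompactlyGeneratedSpace.isOpen' fun K _ _ _ f hf => ?_
  rw [isOpen_iff_mem_nhds]
  rintro k ⟨y, hy, hyk⟩
  have hk : f ⁻¹' s ∈ 𝓝 k := (hs.preimage hf).mem_nhds (by rw [Set.mem_preimage, ← hyk]; exact y.2)
  obtain ⟨L, hL, hLs, hLc⟩ := local_compact_nhds hk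
  have : CompactSpace L := isCompact_iff_compactSpace.1 hLc
  have h1 := ht L (fun l => (⟨f l.1, hLs l.2⟩ : s)) (by fun_prop)
  obtain ⟨W, hW, hWe⟩ := isOpen_induced_iff.1 h1
  have hkL : k ∈ L := mem_of_mem_nhds hL
  have hkW : k ∈ W := by
    have : (⟨k, hkL⟩ : L) ∈ Subtype.val ⁻¹' W := by
      rw [hWe]
      have : (⟨f k, hLs hkL⟩ : s) = y := Subtype.ext hyk.symm
      simpa [this] using hy
    exact this
  filter_upwards [hL, hW.mem_nhds hkW] with l hl hlW
  have : (⟨l, hl⟩ : L) ∈ (fun l : L => (⟨f l.1, hLs l.2⟩ : s)) ⁻¹' t := by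
    rw [← hWe]
    exact hlW
  exact ⟨_, this, rfl⟩

/-! ### Representatives of points of `𝔻X`, and continuity of maps out of it. -/

namespace GOperad

variable {G : Type v} [Group G] {C : GOperad.{u} G}

namespace DHom

variable {q n : ℕ}

/-- The action of `G × Σ_n` on `𝒟(𝐪, 𝐧)`. -/
instance prodAction : MulAction (G × Equiv.Perm (Fin n)) (C.DHom q n) where
  smul p f := postcomp (PiHom.ofPerm p.2) (p.1 • f)
  one_smul f := by
    change postcomp (PiHom.ofPerm 1) ((1 : G) • f) = f
    rw [_root_.one_smul, PiHom.ofPerm_one, postcomp_id]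
  mul_smul p q f := by
    change postcomp (PiHom.ofPerm (p.2 * q.2)) ((p.1 * q.1) • f) =
      postcomp (PiHom.ofPerm p.2) (p.1 • postcomp (PiHom.ofPerm q.2) (q.1 • f))
    rw [PiHom.ofPerm_mul, ← postcomp_postcomp, mul_smul, smul_postcomp]

theorem prod_smul_def (p : G × Equiv.Perm (Fin n)) (f : C.DHom q n) :
    p • f = postcomp (PiHom.ofPerm p.2) (p.1 • f) := rfl

theorem prod_smul_precomp {k : ℕ} (p : G × Equiv.Perm (Fin n)) (f : C.DHom q n) (ψ : PiHom k q) :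
    (p • f).precomp ψ = p • f.precomp ψ := by
  rw [prod_smul_def, prod_smul_def, postcomp_precomp, smul_precomp]

theorem continuous_prod_smul (p : G × Equiv.Perm (Fin n)) :
    Continuous fun f : C.DHom q n => p • f :=
  (continuous_postcomp _).comp (continuous_const_smul p.1)

theorem supp_prod_smul (p : G × Equiv.Perm (Fin n)) (f : C.DHom q n) : (p • f).supp = f.supp := by
  ext i
  simp only [prod_smul_def, mem_supp, fn_postcomp_eq_some, PiHom.ofPerm_eq_some]
  exact ⟨fun ⟨j, l, h, _⟩ => ⟨l, h⟩, fun ⟨j, h⟩ => ⟨_, j, h, rfl⟩⟩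

theorem IsEffective.prod_smul {f : C.DHom q n} (h : f.IsEffective)
    (p : G × Equiv.Perm (Fin n)) : (p • f).IsEffective := fun i =>
  (supp_prod_smul p f).symm ▸ h i

/-- Continuity can be tested on the pieces on which the underlying based map is constant. -/
theorem continuous_of_fn {K : Type u} [TopologicalSpace K] [CompactSpace K] [T2Space K]
    {f : K → C.DHom q n} (hf : Continuous f) {Y : Type*} [TopologicalSpace Y] {F : K → Y}
    (h : ∀ (φ : BasedMap q n) (V : Type u) [TopologicalSpace V] [CompactSpace V] [T2Space V]
      (e : V → K), Continuous e → (∀ v, (f (e v)).fn = φ) → Continuous fun v => F (e v)) :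
    Continuous F :=
  continuous_of_sigma_probe (Kify.continuous_get.comp hf) fun φ V _ _ _ e _ he _ hfe =>
    h φ V e he fun v => congrArg Sigma.fst (hfe v)

end DHom

namespace DObj

variable {X : PiDiagram.{u} G} {p q n : ℕ} {Y : Type u} [TopologicalSpace Y]

/-- The class of `(f, x)`. -/
def mk (f : C.DHom q n) (x : X.obj q) : C.DObj X n := Quot.mk _ ⟨⟨q, (f, x)⟩⟩

theorem mk_precomp (f : C.DHom q n) (ψ : PiHom p q) (x : X.obj p) :
    mk (f.precomp ψ) x = mk f (X.map ψ x) := Quot.sound (DRel.mk f ψ x)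

theorem prod_smul_mk (p : G × Equiv.Perm (Fin n)) (f : C.DHom q n) (x : X.obj q) :
    HSMul.hSMul (β := (C.D X).obj n) (γ := (C.D X).obj n) p (mk f x) = mk (p • f) (p.1 • x) := rfl

theorem map_mk {m : ℕ} (φ : PiHom n m) (f : C.DHom q n) (x : X.obj q) :
    (C.D X).map φ (mk f x) = mk (DHom.postcomp φ f) x := rfl

theorem exists_eq_mk (z : C.DObj X n) : ∃ (q : ℕ) (f : C.DHom q n) (x : X.obj q), z = mk f x := by
  obtain ⟨⟨⟨q, f, x⟩⟩⟩ := z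
  exact ⟨q, f, x, rfl⟩

/-- The morphism `f` equals `f ∘ ι ∘ ιᵀ`, where `ι` is an injection whose image is the support of
`f`; moving `ιᵀ` across to `x` discards the coordinates sent to the base point. -/
theorem exists_effective_precomp (f : C.DHom q n) (x : X.obj q) :
    ∃ (p : ℕ) (ψ : PiHom p q) (y : X.obj p), (f.precomp ψ).IsEffective ∧
      mk f x = mk (f.precomp ψ) y := by
  refine ⟨_, PiHom.inc f.supp, X.map (PiHom.inc f.supp).transpose x, fun i => ?_, ?_⟩
  · obtain ⟨j, hj⟩ := PiHom.isInj_inc f.supp i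
    exact DHom.mem_supp_precomp.2 ⟨j, hj, PiHom.range_inc f.supp ▸ ⟨i, hj⟩⟩
  · rw [← mk_precomp, DHom.precomp_precomp, PiHom.comp_transpose_self, PiHom.range_inc,
      DHom.precomp_restr_supp]

theorem exists_effective_rep (z : C.DObj X n) :
    ∃ (q : ℕ) (f : C.DHom q n) (x : X.obj q), f.IsEffective ∧ z = mk f x := by
  obtain ⟨q, f, x, rfl⟩ := z.exists_eq_mk
  obtain ⟨p, ψ, y, h, e⟩ := exists_effective_precomp f x
  exact ⟨p, _, y, h, e⟩

theorem continuous_desc_isOpen {V : Set (C.DObj X n)} (hV : IsOpen V) {g : V → Y}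
    (h : ∀ (q : ℕ) (K : Type u) [TopologicalSpace K] [CompactSpace K] [T2Space K]
      (f : K → C.DHom q n) (x : K → X.obj q) (_ : Continuous f) (_ : Continuous x)
      (hm : ∀ k, mk (f k) (x k) ∈ V), Continuous fun k => g ⟨mk (f k) (x k), hm k⟩) :
    Continuous g := by
  have hq : IsQuotientMap (Quot.mk (C.DRel X n)) := isQuotientMap_quot_mk
  have hq' := hq.restrictPreimage_isOpen hV
  rw [hq'.continuous_iff]
  have : CompactlyGeneratedSpace (Quot.mk (C.DRel X n) ⁻¹' V) :=
    CompactlyGeneratedSpace.subtype_of_isOpen (hV.preimage hq.continuous)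
  refine continuous_from_compactlyGeneratedSpace _ fun K _ _ _ p hp => ?_
  refine continuous_of_sigma_probe (g := fun k => (p k).1.get)
    (Kify.continuous_get.comp (continuous_subtype_val.comp hp)) fun q W _ _ _ e a he ha hpe => ?_
  have hm : ∀ w, mk (a w).1 (a w).2 ∈ V := fun w => by
    have h1 := (p (e w)).2
    rwa [Set.mem_preimage, show (p (e w)).1 = ⟨⟨q, a w⟩⟩ from congrArg Kify.of (hpe w)] at h1
  refine (h q W (fun w => (a w).1) (fun w => (a w).2) (by fun_prop) (by fun_prop) hm).congr
    fun w => ?_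
  refine congrArg g (Subtype.ext ?_)
  exact congrArg (fun y => Quot.mk (C.DRel X n) (Kify.of y)) (hpe w).symm

theorem isOpen_iff {V : Set (C.DObj X n)} :
    IsOpen V ↔ ∀ (q : ℕ) (K : Type u) [TopologicalSpace K] [CompactSpace K] [T2Space K]
      (f : K → C.DHom q n) (x : K → X.obj q), Continuous f → Continuous x →
      IsOpen {k | mk (f k) (x k) ∈ V} := by
  refine ⟨fun h q K _ _ _ f x hf hx => h.preimage (continuous_mk hf hx), fun h => ?_⟩
  have : Continuous fun z : C.DObj X n => ULift.up.{u} (z ∈ V) :=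
    continuous_desc fun q K _ _ _ f x hf hx =>
      continuous_uliftUp.comp (continuous_Prop.2 (h q K f x hf hx))
  exact continuous_Prop.1 (continuous_uliftDown.comp this)

/-- Whether the quotient map stays one after multiplication with `A` is not at issue: on a test
space `T` the map is curried to `V → C(T, Y)`, where the quotient property of `𝔻X` applies. -/
theorem kCont_desc_isOpen_prod {V : Set (C.DObj X n)} (hV : IsOpen V) {A : Type u}
    [TopologicalSpace A] {g : V → A → Y}
    (h : ∀ (q : ℕ) (K : Type u) [TopologicalSpace K] [CompactSpace K] [T2Space K]
      (f : K → C.DHom q n) (x : K → X.obj q) (a : K → A) (_ : Continuous f) (_ : Continuous x)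
      (_ : Continuous a) (hm : ∀ k, mk (f k) (x k) ∈ V),
      Continuous fun k => g ⟨mk (f k) (x k), hm k⟩ (a k)) :
    KCont fun p : V × A => g p.1 p.2 := by
  intro T _ _ _ p hp
  have ha : Continuous fun t => (p t).2 := by fun_prop
  have hc : ∀ v : V, Continuous fun t => g v (p t).2 := by
    rintro ⟨v, hv⟩
    obtain ⟨q, f, x, rfl⟩ := v.exists_eq_mk
    exact h q T (fun _ => f) (fun _ => x) _ (by fun_prop) (by fun_prop) ha fun _ => hv
  have hC : Continuous fun v : V => (⟨fun t => g v (p t).2, hc v⟩ : C(T, Y)) := by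
    refine continuous_desc_isOpen hV fun q K _ _ _ f x hf hx hm => ?_
    refine ContinuousMap.continuous_of_continuous_uncurry _ ?_
    exact h q (K × T) (fun y => f y.1) (fun y => x y.1) (fun y => (p y.2).2) (by fun_prop)
      (by fun_prop) (by fun_prop) fun y => hm y.1
  exact (hC.comp (continuous_fst.comp hp)).eval continuous_id

theorem kCont_desc_prod {A : Type u} [TopologicalSpace A] {g : C.DObj X n → A → Y}
    (h : ∀ (q : ℕ) (K : Type u) [TopologicalSpace K] [CompactSpace K] [T2Space K]
      (f : K → C.DHom q n) (x : K → X.obj q) (a : K → A), Continuous f → Continuous x →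
      Continuous a → Continuous fun k => g (mk (f k) (x k)) (a k)) :
    KCont fun p : C.DObj X n × A => g p.1 p.2 :=
  (kCont_desc_isOpen_prod (V := Set.univ) isOpen_univ (g := fun z a => g z.1 a)
    fun q K _ _ _ f x a hf hx ha _ => h q K f x a hf hx ha).comp
    (f := fun p : C.DObj X n × A => ((⟨p.1, trivial⟩ : (Set.univ : Set (C.DObj X n))), p.2))
    (Continuous.kCont (by fun_prop))

theorem continuous_desc_interval {g : C.DObj X n → unitInterval → Y}
    (h : ∀ (q : ℕ) (K : Type u) [TopologicalSpace K] [CompactSpace K] [T2Space K]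
      (f : K → C.DHom q n) (x : K → X.obj q) (a : K → unitInterval), Continuous f → Continuous x →
      Continuous a → Continuous fun k => g (mk (f k) (x k)) (a k)) :
    Continuous fun p : C.DObj X n × unitInterval => g p.1 p.2 :=
  ((kCont_desc_prod (A := ULift.{u} unitInterval) (g := fun z a => g z a.down)
    fun q K _ _ _ f x a hf hx ha => h q K f x _ hf hx (continuous_uliftDown.comp ha)).comp
    (f := fun p : C.DObj X n × unitInterval => (p.1, ULift.up.{u} p.2))
    (Continuous.kCont (by fun_prop))).continuous_prod_interval

/-! ### Maps out of `𝔻X` given by maps that are natural with respect to injections -/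

section

variable {Y : Type*} (F : ∀ q, C.DHom q n → X.obj q → Y)

/-- `F` is compatible with the relation given by the injections in `Π`. -/
def InjCompat : Prop := ∀ (p q : ℕ) (f : C.DHom q n) (ψ : PiHom p q) (x : X.obj p), ψ.IsInj →
  f.IsEffective → F p (f.precomp ψ) x = F q f (X.map ψ x)

/-- The map given by its values on the classes of `(f, x)` with `f` effective. -/
noncomputable def injDesc {F : ∀ q, C.DHom q n → X.obj q → Y} (hF : InjCompat F) :
    C.DObj X n → Y :=
  Quot.lift (fun y => F _ (y.get.2.1.precomp (PiHom.inc y.get.2.1.supp))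
    (X.map (PiHom.inc y.get.2.1.supp).transpose y.get.2.2)) (by
    rintro _ _ ⟨f, ψ, x⟩
    change F _ ((f.precomp ψ).precomp (PiHom.inc (f.precomp ψ).supp))
      (X.map (PiHom.inc (f.precomp ψ).supp).transpose x) =
      F _ (f.precomp (PiHom.inc f.supp)) (X.map (PiHom.inc f.supp).transpose (X.map ψ x))
    generalize hS : (f.precomp ψ).supp = S
    have hι := PiHom.isInj_inc f.supp
    have hr := PiHom.range_inc f.supp
    have hι' := PiHom.isInj_inc S
    have hr' := PiHom.range_inc S
    generalize PiHom.inc S = ι' at *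
    generalize PiHom.inc f.supp = ι at *
    -- Between the supports of `f ψ` and of `f` the morphism `ψ` is injective. Compatibility with
    -- this one injection implies invariance under the relation for an arbitrary `ψ`.
    have hθ : ((ι.transpose.comp ψ).comp ι').IsInj := by
      intro i
      obtain ⟨j, hj⟩ := hι' i
      have hjS : j ∈ (f.precomp ψ).supp := by
        rw [hS, ← hr']
        exact ⟨i, hj⟩
      obtain ⟨l, hl, hlf⟩ := DHom.mem_supp_precomp.1 hjS
      rw [← hr] at hlf
      obtain ⟨t, ht⟩ := hlf
      exact ⟨t, PiHom.comp_eq_some.2 ⟨j, hj, PiHom.comp_eq_some.2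
        ⟨l, hl, PiHom.transpose_eq_some.2 ht⟩⟩⟩
    have heff : (f.precomp ι).IsEffective := fun i => by
      obtain ⟨j, hj⟩ := hι i
      exact DHom.mem_supp_precomp.2 ⟨j, hj, hr ▸ ⟨i, hj⟩⟩
    have h1 := hF _ _ (f.precomp ι) _ (X.map ι'.transpose x) hθ heff
    rw [DHom.precomp_precomp, ← PiHom.comp_assoc, ← PiHom.comp_assoc, PiHom.comp_transpose_self,
      hr, PiHom.comp_assoc, ← DHom.precomp_precomp, DHom.precomp_restr_supp,
      ← DHom.precomp_precomp, X.map_map, PiHom.comp_assoc, PiHom.comp_transpose_self, hr',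
      PiHom.comp_restr] at h1
    · rw [h1, X.map_map]
    · rintro i ⟨j, hj⟩
      obtain ⟨l, h2, h3⟩ := PiHom.comp_eq_some.1 (PiHom.transpose_eq_some.1 hj)
      rw [← hS]
      exact DHom.mem_supp_precomp.2 ⟨l, h2, hr ▸ ⟨j, PiHom.transpose_eq_some.1 h3⟩⟩)

variable {F}

theorem injDesc_mk (hF : InjCompat F) {f : C.DHom q n} (hf : f.IsEffective) (x : X.obj q) :
    injDesc hF (mk f x) = F q f x := by
  refine (hF _ _ f (PiHom.inc f.supp) _ (PiHom.isInj_inc _) hf).trans ?_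
  rw [X.map_map, PiHom.comp_transpose_self, PiHom.range_inc,
    show f.supp = Set.univ from Set.eq_univ_of_forall hf,
    show PiHom.restr Set.univ = PiHom.id q from
      PiHom.ext' fun i j => by simp [PiHom.restr_eq_some, PiHom.id_eq_some], X.map_id]

/-- The support of `f k` is locally constant in `k`, and therefore so is the injection used to
choose an effective representative. The parameter `s` allows whole families of maps, that is,
homotopies. -/
theorem continuous_injDesc_probe {ι : Type u} [TopologicalSpace Y] {F : ι → ∀ q, C.DHom q n → X.obj q → Y}
    (hF : ∀ s, InjCompat (F s)) {K : Type u} [TopologicalSpace K] [CompactSpace K] [T2Space K]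
    {f : K → C.DHom q n} {x : K → X.obj q} (s : K → ι) (hf : Continuous f) (hx : Continuous x)
    (h : ∀ (p : ℕ) (V : Type u) [TopologicalSpace V] [CompactSpace V] [T2Space V]
      (e : V → K) (f' : V → C.DHom p n) (x' : V → X.obj p), Continuous e →
      Continuous f' → Continuous x' → Continuous fun v => F (s (e v)) p (f' v) (x' v)) :
    Continuous fun k => injDesc (hF (s k)) (mk (f k) (x k)) := by
  refine DHom.continuous_of_fn hf fun φ V _ _ _ e he hφ => ?_
  let S : Set (Fin q) := {i | φ i ≠ none}
  have hS : ∀ v, (f (e v)).supp = S := fun v => by rw [DHom.supp, hφ]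
  refine (h _ V e (fun v => (f (e v)).precomp (PiHom.inc S))
    (fun v => X.map (PiHom.inc S).transpose (x (e v))) he
    ((DHom.continuous_precomp _).comp (hf.comp he))
    ((X.map _).continuous.comp (hx.comp he))).congr fun v => ?_
  rw [← hS v]
  rfl

end

end DObj

end GOperad

/-! ### Homotopies on Reedy cofibrant diagrams -/

section


namespace PiHom

variable {p q : ℕ}

theorem range_comp_skip {i : Fin (q + 2)} {a : Fin (q + 1)} :
    ((skip i).comp (skip a)).range = {i, i.succAbove a}ᶜ := by
  ext j
  simp only [mem_range, comp_eq_some, skip_eq_some, Set.mem_compl_iff, Set.mem_insert_iff,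
    Set.mem_singleton_iff, not_or]
  constructor
  · rintro ⟨k, l, rfl, rfl⟩
    exact ⟨Fin.succAbove_ne _ _, fun e => Fin.succAbove_ne _ _ (Fin.succAbove_right_injective e)⟩
  · rintro ⟨h1, h2⟩
    obtain ⟨l, rfl⟩ := Fin.exists_succAbove_eq h1
    obtain ⟨k, rfl⟩ := Fin.exists_succAbove_eq (show l ≠ a from fun e => h2 (e ▸ rfl))
    exact ⟨k, _, rfl, rfl⟩

/-- Both ways of omitting two elements have the same image, so they differ by a permutation, which
is absorbed into `θ'`. -/
theorem exists_skip_comp_skip {i j : Fin (q + 2)} (h : i ≠ j) :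
    ∃ (θ θ' : PiHom q (q + 1)), θ.IsInj ∧ θ'.IsInj ∧ (skip i).comp θ = (skip j).comp θ' ∧
      ((skip i).comp θ).range = {i, j}ᶜ := by
  obtain ⟨a, ha⟩ := Fin.exists_succAbove_eq h.symm
  obtain ⟨b, hb⟩ := Fin.exists_succAbove_eq h
  have h1 : ((skip j).comp (skip b)).range = ((skip i).comp (skip a)).range := by
    rw [range_comp_skip, range_comp_skip, ha, hb, Set.pair_comm]
  obtain ⟨σ, hσ⟩ := IsInj.exists_eq_comp_ofPerm ((isInj_skip i).comp (isInj_skip a)) h1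
  refine ⟨skip a, (skip b).comp (ofPerm σ), isInj_skip a, (isInj_skip b).comp (isInj_ofPerm σ),
    ?_, ?_⟩
  · rw [hσ, comp_assoc]
  · rw [range_comp_skip, ha]

theorem eq_skip_comp {ψ : PiHom p (q + 1)} {i : Fin (q + 1)} (h : i ∉ ψ.range) :
    ψ = (skip i).comp ((skip i).transpose.comp ψ) := by
  rw [← comp_assoc, comp_transpose_self, restr_comp]
  rw [range_skip]
  rintro j hj rfl
  exact h hj

theorem IsInj.of_comp {φ : PiHom p q} {r : ℕ} {ψ : PiHom q r} (h : (ψ.comp φ).IsInj) :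
    φ.IsInj := fun i => by
  obtain ⟨j, hj⟩ := h i
  obtain ⟨k, hk, -⟩ := comp_eq_some.1 hj
  exact ⟨k, hk⟩

theorem exists_notMem_range {ψ : PiHom p (q + 1)} (h : p ≤ q) : ∃ i, i ∉ ψ.range := by
  by_contra! hc
  choose f hf using hc
  have : Function.Injective f := fun i j e =>
    Option.some_inj.1 ((hf i).symm.trans (by rw [e]; exact hf j))
  have := Fintype.card_le_of_injective f this
  simp at this
  omega

end PiHom

namespace PiDiagram

variable {G : Type v} [Group G] {X : PiDiagram.{u} G}

/-- The image of `ψ` is the fixed set of the idempotent `ψ ψᵀ`; hence it is closed when coincidence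
sets are closed. -/
theorem mem_range_map_iff {p q : ℕ} {ψ : PiHom p q} {x : X.obj q} :
    x ∈ Set.range (X.map ψ) ↔ X.map (ψ.comp ψ.transpose) x = x := by
  constructor
  · rintro ⟨y, rfl⟩
    rw [map_map, PiHom.comp_assoc, PiHom.comp_transpose_comp]
  · intro h
    rw [X.map_comp] at h
    exact ⟨_, h⟩

theorem isClosed_range_map (hX : ∀ n, KHausdorff (X.obj n)) {p q : ℕ} (ψ : PiHom p q) :
    IsClosed (Set.range (X.map ψ)) := by
  have := (hX q).isClosed_eq (X.map (ψ.comp ψ.transpose)).continuous continuous_id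
  convert this using 1
  ext x
  exact mem_range_map_iff

theorem isClosed_latching (hX : ∀ n, KHausdorff (X.obj n)) (q : ℕ) : IsClosed (X.latching q) := by
  cases q with
  | zero => exact isClosed_empty
  | succ q => exact isClosed_iUnion_of_finite fun i => isClosed_range_map hX _

theorem map_mem_latching {q : ℕ} (ψ : PiHom q (q + 1)) (x : X.obj q) :
    X.map ψ x ∈ X.latching (q + 1) := by
  obtain ⟨i, hi⟩ := PiHom.exists_notMem_range (ψ := ψ) le_rfl
  rw [PiHom.eq_skip_comp hi, X.map_comp]
  exact Set.mem_iUnion.2 ⟨i, _, rfl⟩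

section

variable {Z : ℕ → Type u} [∀ q, TopologicalSpace (Z q)]
  [∀ q, MulAction (G × Equiv.Perm (Fin q)) (Z q)]

variable (X Z) in
/-- Data that tell how the values of a homotopy `X_q × unitInterval → Z_q` at the degenerate points are
determined by its values in lower degrees. -/
structure Insertion where
  /-- the value at `(ψ x, s)` for a homotopy with value `z` at `(x, s)` -/
  ins : ∀ {p q : ℕ}, PiHom p q → unitInterval → X.obj p → Z p → Z q
  kCont_ins : ∀ {p q : ℕ} (ψ : PiHom p q), ψ.IsInj →
    KCont fun y : (X.obj p × unitInterval) × Z p => ins ψ y.1.2 y.1.1 y.2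
  ins_comp : ∀ {p q r : ℕ} (φ : PiHom q r) (ψ : PiHom p q), φ.IsInj → ψ.IsInj → ∀ s x z,
    ins (φ.comp ψ) s x z = ins φ s (X.map ψ x) (ins ψ s x z)
  ins_ofPerm : ∀ {q : ℕ} (σ : Equiv.Perm (Fin q)) s (x : X.obj q) z,
    ins (PiHom.ofPerm σ) s x z = ((1, σ) : G × Equiv.Perm (Fin q)) • z
  ins_smul : ∀ {p q : ℕ} (ψ : PiHom p q) (g : G) s x z, ψ.IsInj →
    ins ψ s (g • x) (((g, 1) : G × Equiv.Perm (Fin p)) • z) =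
      ((g, 1) : G × Equiv.Perm (Fin q)) • ins ψ s x z

variable [∀ q, ContinuousConstSMul (G × Equiv.Perm (Fin q)) (Z q)]
  [∀ q, CompactlyGeneratedSpace (Z q)] [∀ q, WeakHausdorffSpace (Z q)]

/-- On the latching space the values are dictated by degree `q`. A point in the images of two
different `skip i` and `skip j` is degenerate in both coordinates at once, hence comes from degree
`q - 1`, where `ins_comp` shows that both prescriptions agree. The result is continuous on each of
finitely many closed pieces, and Reedy cofibrancy extends it to all of `X_{q+1}`. -/
theorem Insertion.extend_step (D : Insertion X Z) (hX : ∀ n, KHausdorff (X.obj n))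
    (hR : X.IsReedyCofibrant) (q : ℕ) (H : C(X.obj q × unitInterval, Z q))
    (H' : C(X.obj (q - 1) × unitInterval, Z (q - 1)))
    (hHs : ∀ g x s, H (g • x, s) = ((g, 1) : G × Equiv.Perm (Fin q)) • H (x, s))
    (hHp : ∀ (σ : Equiv.Perm (Fin q)) x s,
      H (X.map (PiHom.ofPerm σ) x, s) = ((1, σ) : G × Equiv.Perm (Fin q)) • H (x, s))
    (hH : ∀ (ψ : PiHom (q - 1) q), ψ.IsInj → ∀ x s, H (X.map ψ x, s) = D.ins ψ s x (H' (x, s)))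
    (F : C(X.obj (q + 1), Z (q + 1)))
    (hFs : ∀ (p : G × Equiv.Perm (Fin (q + 1))) x, F (p • x) = p • F x)
    (hF : ∀ (ψ : PiHom q (q + 1)), ψ.IsInj → ∀ x, F (X.map ψ x) = D.ins ψ 0 x (H (x, 0))) :
    ∃ K : C(X.obj (q + 1) × unitInterval, Z (q + 1)),
      (∀ (p : G × Equiv.Perm (Fin (q + 1))) x s, K (p • x, s) = p • K (x, s)) ∧
      (∀ x, K (x, 0) = F x) ∧
      ∀ (ψ : PiHom q (q + 1)), ψ.IsInj → ∀ x s, K (X.map ψ x, s) = D.ins ψ s x (H (x, s)) := by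
  have indep : ∀ (i j : Fin (q + 1)) (x y : X.obj q) (s : unitInterval),
      X.map (PiHom.skip i) x = X.map (PiHom.skip j) y →
      D.ins (PiHom.skip i) s x (H (x, s)) = D.ins (PiHom.skip j) s y (H (y, s)) := by
    intro i j x y s hxy
    have hinj : ∀ (i : Fin (q + 1)) (x y : X.obj q),
        X.map (PiHom.skip i) x = X.map (PiHom.skip i) y → x = y := fun i x y h => by
      have := congrArg (X.map (PiHom.skip i).transpose) h
      rwa [map_transpose_map _ (PiHom.isInj_skip i),
        map_transpose_map _ (PiHom.isInj_skip i)] at this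
    by_cases hij : i = j
    · subst hij
      rw [hinj i x y hxy]
    · obtain _ | q := q
      · exact absurd (Subsingleton.elim (α := Fin 1) i j) hij
      obtain ⟨θ, θ', hθ, hθ', he, hr⟩ := PiHom.exists_skip_comp_skip hij
      -- The point is fixed by the partial identities that omit `i` and `j`, hence by their product,
      -- which belongs to the image of `skip i ∘ θ`. So it comes from a point two degrees lower.
      have key : X.map (((PiHom.skip i).comp θ).comp ((PiHom.skip i).comp θ).transpose)
          (X.map (PiHom.skip i) x) = X.map (PiHom.skip i) x := by
        rw [PiHom.comp_transpose_self, hr]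
        have h1 : PiHom.restr ({i, j}ᶜ : Set (Fin (q + 2))) =
            (PiHom.restr {i}ᶜ).comp (PiHom.restr {j}ᶜ) := by
          rw [PiHom.restr_comp_restr]
          congr 1
          ext k
          simp
        rw [h1, X.map_comp, hxy, X.map_map (PiHom.restr {j}ᶜ),
          PiHom.restr_comp (PiHom.range_skip j).le, ← hxy, X.map_map (PiHom.restr {i}ᶜ),
          PiHom.restr_comp (PiHom.range_skip i).le]
      rw [X.map_comp] at key
      set w := X.map ((PiHom.skip i).comp θ).transpose (X.map (PiHom.skip i) x) with hw
      have hx : x = X.map θ w := by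
        refine hinj i _ _ ?_
        rw [X.map_map, key]
      have hy : y = X.map θ' w := by
        refine hinj j _ _ ?_
        rw [X.map_map, ← he, key, hxy]
      rw [hx, hy, hH θ hθ, hH θ' hθ', ← D.ins_comp _ _ (PiHom.isInj_skip i) hθ,
        ← D.ins_comp _ _ (PiHom.isInj_skip j) hθ', he]
  have hA : IsClosed (X.latching (q + 1)) := isClosed_latching hX _
  have : CompactlyGeneratedSpace (X.latching (q + 1)) :=
    CompactlyGeneratedSpace.subtype_of_isClosed hA
  have hmem : ∀ a : X.latching (q + 1), ∃ i : Fin (q + 1), a.1 ∈ Set.range (X.map (PiHom.skip i)) :=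
    fun a => Set.mem_iUnion.1 a.2
  choose ι hι using hmem
  let φ : Fin (q + 1) → X.latching (q + 1) × unitInterval → Z (q + 1) := fun i a =>
    D.ins (PiHom.skip i) a.2 (X.map (PiHom.skip i).transpose a.1.1)
      (H (X.map (PiHom.skip i).transpose a.1.1, a.2))
  have hφ : ∀ i, Continuous (φ i) := fun i => by
    refine ((D.kCont_ins (PiHom.skip i) (PiHom.isInj_skip i)).comp (Continuous.kCont
      (g := fun a : X.latching (q + 1) × unitInterval => (((X.map (PiHom.skip i).transpose a.1.1, a.2),
        H (X.map (PiHom.skip i).transpose a.1.1, a.2)) : (X.obj q × unitInterval) × Z q)) ?_)).continuous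
    fun_prop
  let h : X.latching (q + 1) × unitInterval → Z (q + 1) := fun a => φ (ι a.1) a
  have hh : ∀ (i : Fin (q + 1)) (x : X.obj q) (s : unitInterval) (hx : X.map (PiHom.skip i) x ∈ X.latching (q + 1)),
      h (⟨_, hx⟩, s) = D.ins (PiHom.skip i) s x (H (x, s)) := by
    intro i x s hx
    refine indep _ _ _ _ s ?_
    rw [X.map_map]
    exact mem_range_map_iff.1 (hι _)
  have hφh : ∀ i (a : X.latching (q + 1) × unitInterval), a.1.1 ∈ Set.range (X.map (PiHom.skip i)) →
      h a = φ i a := by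
    rintro i ⟨⟨_, ha⟩, s⟩ ⟨x, rfl⟩
    rw [hh]
    simp only [φ]
    rw [map_transpose_map _ (PiHom.isInj_skip i)]
  have hc : Continuous h := by
    refine LocallyFinite.continuous
      (f := fun i : Fin (q + 1) => {a : X.latching (q + 1) × unitInterval |
        a.1.1 ∈ Set.range (X.map (PiHom.skip i))}) (locallyFinite_of_finite _)
      (Set.eq_univ_of_forall fun a => Set.mem_iUnion.2 ⟨_, hι a.1⟩)
      (fun i => (isClosed_range_map hX _).preimage (by fun_prop)) fun i => ?_
    exact (hφ i).continuousOn.congr fun a ha => hφh i a ha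
  have hhψ : ∀ (ψ : PiHom q (q + 1)), ψ.IsInj → ∀ x s (hx : X.map ψ x ∈ X.latching (q + 1)),
      h (⟨_, hx⟩, s) = D.ins ψ s x (H (x, s)) := by
    intro ψ hψ x s hx
    obtain ⟨i, hi⟩ := PiHom.exists_notMem_range (ψ := ψ) le_rfl
    have e := PiHom.eq_skip_comp hi
    generalize (PiHom.skip i).transpose.comp ψ = ψ' at e
    subst e
    obtain ⟨σ, rfl⟩ := hψ.of_comp.exists_ofPerm
    have e1 : (⟨_, hx⟩ : X.latching (q + 1)) =
        ⟨X.map (PiHom.skip i) (X.map (PiHom.ofPerm σ) x), by rwa [← X.map_comp]⟩ :=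
      Subtype.ext (X.map_comp _ _ _)
    rw [e1, hh, D.ins_comp _ _ (PiHom.isInj_skip i) (PiHom.isInj_ofPerm σ), hHp, D.ins_ofPerm]
  obtain ⟨K, hK1, hK2, hK3⟩ := hR (q + 1) (Z (q + 1)) F ⟨h, hc⟩ hFs (by
    rintro ⟨g, σ⟩ ⟨a, haA⟩ ha s
    obtain ⟨i, x, rfl⟩ := Set.mem_iUnion.1 haA
    have e1 : (⟨_, ha⟩ : X.latching (q + 1)) =
        ⟨X.map ((PiHom.ofPerm σ).comp (PiHom.skip i)) (g • x),
          map_mem_latching _ _⟩ := by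
      exact Subtype.ext ((congrArg (X.map (PiHom.ofPerm σ)) (X.map_smul _ g x).symm).trans
        (X.map_comp _ _ _).symm)
    change h _ = _ • h _
    rw [e1, hhψ _ ((PiHom.isInj_ofPerm σ).comp (PiHom.isInj_skip i)), hh,
      D.ins_comp _ _ (PiHom.isInj_ofPerm σ) (PiHom.isInj_skip i), hHs,
      D.ins_smul _ _ _ _ _ (PiHom.isInj_skip i), D.ins_ofPerm, smul_smul]
    simp) (by
    rintro ⟨a, haA⟩
    obtain ⟨i, x, rfl⟩ := Set.mem_iUnion.1 haA
    exact (hh i x 0 haA).trans (hF _ (PiHom.isInj_skip i) x).symm)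
  refine ⟨K, hK1, hK2, fun ψ hψ x s => ?_⟩
  rw [← hhψ ψ hψ x s (map_mem_latching ψ x)]
  exact hK3 ⟨_, _⟩ s

/-- Homotopies on Reedy cofibrant diagrams can be constructed with prescribed behaviour at
degenerate points. -/
theorem Insertion.exists_homotopy (D : Insertion X Z) (hX : ∀ n, KHausdorff (X.obj n))
    (hR : X.IsReedyCofibrant) (F : ∀ q, C(X.obj q, Z q))
    (hFs : ∀ q g x, F q (g • x) = ((g, 1) : G × Equiv.Perm (Fin q)) • F q x)
    (hF : ∀ (p q : ℕ) (ψ : PiHom p q), ψ.IsInj → ∀ x, F q (X.map ψ x) = D.ins ψ 0 x (F p x)) :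
    ∃ H : ∀ q, C(X.obj q × unitInterval, Z q),
      (∀ q g x s, H q (g • x, s) = ((g, 1) : G × Equiv.Perm (Fin q)) • H q (x, s)) ∧
      (∀ q x, H q (x, 0) = F q x) ∧
      ∀ (p q : ℕ) (ψ : PiHom p q), ψ.IsInj → ∀ x s,
        H q (X.map ψ x, s) = D.ins ψ s x (H p (x, s)) := by
  -- Besides equivariance, the induction must remember that the values at degenerate points come
  -- from a map one degree lower: the next step needs this for well-definedness. For `q = 0` the
  -- index `q - 1` is `0`, and the condition concerns permutations only.
  let Good : ∀ q, C(X.obj q × unitInterval, Z q) → Prop := fun q H =>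
    (∀ g x s, H (g • x, s) = ((g, 1) : G × Equiv.Perm (Fin q)) • H (x, s)) ∧
    (∀ (σ : Equiv.Perm (Fin q)) x s,
      H (X.map (PiHom.ofPerm σ) x, s) = ((1, σ) : G × Equiv.Perm (Fin q)) • H (x, s)) ∧
    (∀ x, H (x, 0) = F q x) ∧
    ∃ H' : C(X.obj (q - 1) × unitInterval, Z (q - 1)), ∀ (ψ : PiHom (q - 1) q), ψ.IsInj → ∀ x s,
      H (X.map ψ x, s) = D.ins ψ s x (H' (x, s))
  have hFp : ∀ q (σ : Equiv.Perm (Fin q)) x,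
      F q (X.map (PiHom.ofPerm σ) x) = ((1, σ) : G × Equiv.Perm (Fin q)) • F q x := fun q σ x => by
    rw [hF _ _ _ (PiHom.isInj_ofPerm σ), D.ins_ofPerm]
  have hFsp : ∀ q (p : G × Equiv.Perm (Fin q)) x, F q (p • x) = p • F q x := by
    rintro q ⟨g, σ⟩ x
    rw [prod_smul_def, hFp, hFs, smul_smul]
    simp
  have h0 : Good 0 ((F 0).comp ContinuousMap.fst) := by
    refine ⟨fun g x s => hFs 0 g x, fun σ x s => hFp 0 σ x, fun x => rfl,
      (F 0).comp ContinuousMap.fst, fun ψ hψ x s => ?_⟩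
    obtain ⟨σ, rfl⟩ := PiHom.IsInj.exists_ofPerm (φ := (ψ : PiHom 0 0)) hψ
    exact (hFp 0 σ x).trans (D.ins_ofPerm σ s x _).symm
  have step : ∀ q (H : {H // Good q H}), ∃ K : {K // Good (q + 1) K},
      ∀ (ψ : PiHom q (q + 1)), ψ.IsInj → ∀ x s,
        K.1 (X.map ψ x, s) = D.ins ψ s x (H.1 (x, s)) := by
    rintro q ⟨H, hHs, hHp, hH0, H', hH'⟩
    obtain ⟨K, hK1, hK2, hK3⟩ := D.extend_step hX hR q H H' hHs hHp hH' (F (q + 1))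
      (hFsp (q + 1)) fun ψ hψ x => by rw [hF _ _ ψ hψ, hH0]
    refine ⟨⟨K, fun g x s => ?_, fun σ x s => ?_, hK2, H, hK3⟩, hK3⟩
    · have h1 := hK1 (g, 1) x s
      rwa [prod_smul_def, PiHom.ofPerm_one, X.map_id] at h1
    · have h1 := hK1 (1, σ) x s
      rwa [prod_smul_def, _root_.one_smul] at h1
  choose next hnext using step
  let S : ∀ q, {H // Good q H} := fun q => Nat.rec ⟨_, h0⟩ next q
  refine ⟨fun q => (S q).1, fun q => (S q).2.1, fun q => (S q).2.2.2.1, fun p q => ?_⟩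
  induction q with
  | zero =>
    intro ψ hψ x s
    obtain rfl : p = 0 := Nat.le_zero.1 hψ.le
    obtain ⟨σ, rfl⟩ := hψ.exists_ofPerm
    rw [(S 0).2.2.1, D.ins_ofPerm]
  | succ q ih =>
    intro ψ hψ x s
    by_cases hp : p ≤ q
    · obtain ⟨i, hi⟩ := PiHom.exists_notMem_range (ψ := ψ) hp
      have e := PiHom.eq_skip_comp hi
      generalize (PiHom.skip i).transpose.comp ψ = ψ' at e
      subst e
      have hψ' := hψ.of_comp
      rw [X.map_comp, D.ins_comp _ _ (PiHom.isInj_skip i) hψ', ← ih ψ' hψ']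
      exact hnext q (S q) _ (PiHom.isInj_skip i) _ s
    · obtain rfl : p = q + 1 := le_antisymm hψ.le (by omega)
      obtain ⟨σ, rfl⟩ := hψ.exists_ofPerm
      rw [(S (q + 1)).2.2.1, D.ins_ofPerm]

end

end PiDiagram

end

/-! ### The diagram `W X` -/

namespace PiDiagram

variable {G : Type v} [Group G] {X Y : PiDiagram.{u} G} {k m n p q : ℕ}

instance (X : PiDiagram.{u} G) (n : ℕ) :
    ContinuousConstSMul (G × Equiv.Perm (Fin n)) (X.obj n) where
  continuous_const_smul p := (X.map (PiHom.ofPerm p.2)).continuous.comp (continuous_const_smul p.1)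

/-- The coordinates `t` moved along `φ`, with value `d` at the elements not in the image. -/
noncomputable def moveCoords (φ : PiHom m n) (d : unitInterval) (t : Fin m → unitInterval) :
    Fin n → unitInterval := fun j => (φ.transpose.1 j).elim d t

theorem moveCoords_of_eq {φ : PiHom m n} {i : Fin m} {j : Fin n} (h : φ.1 i = some j)
    (d : unitInterval) (t : Fin m → unitInterval) : moveCoords φ d t j = t i := by
  rw [moveCoords, PiHom.transpose_eq_some.2 h, Option.elim_some]

theorem moveCoords_of_notMem {φ : PiHom m n} {j : Fin n} (h : j ∉ φ.range)
    (d : unitInterval) (t : Fin m → unitInterval) : moveCoords φ d t j = d := by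
  have : φ.transpose.1 j = none := Option.eq_none_iff_forall_ne_some.2 fun i hi =>
    h ⟨i, PiHom.transpose_eq_some.1 hi⟩
  rw [moveCoords, this, Option.elim_none]

theorem moveCoords_comp (φ : PiHom m n) (ψ : PiHom k m) (d : unitInterval)
    (t : Fin k → unitInterval) :
    moveCoords (φ.comp ψ) d t = moveCoords φ d (moveCoords ψ d t) := by
  funext j
  simp only [moveCoords, PiHom.transpose_comp]
  change (Option.bind (φ.transpose.1 j) ψ.transpose.1).elim d t = _
  cases φ.transpose.1 j <;> rfl

theorem moveCoords_id (d : unitInterval) (t : Fin n → unitInterval) :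
    moveCoords (PiHom.id n) d t = t :=
  funext fun _ => moveCoords_of_eq (PiHom.id_eq_some.2 rfl) d t

theorem continuous_moveCoords (φ : PiHom m n) :
    Continuous fun p : unitInterval × (Fin m → unitInterval) => moveCoords φ p.1 p.2 := by
  refine continuous_pi fun j => ?_
  simp only [moveCoords]
  cases φ.transpose.1 j with
  | none => exact continuous_fst
  | some i => exact (continuous_apply i).comp continuous_snd

theorem map_restr_map_of_eq {φ : PiHom m n} {i : Fin m} {j : Fin n} (h : φ.1 i = some j)
    {x : X.obj m} (hx : X.map (PiHom.restr {i}ᶜ) x = x) :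
    X.map (PiHom.restr {j}ᶜ) (X.map φ x) = X.map φ x := by
  have e : (PiHom.restr {j}ᶜ).comp φ = φ.comp (PiHom.restr {i}ᶜ) := by
    apply PiHom.ext'
    intro a b
    simp only [PiHom.comp_eq_some, PiHom.restr_eq_some, Set.mem_compl_iff, Set.mem_singleton_iff]
    constructor
    · rintro ⟨c, hc, rfl, hcj⟩
      refine ⟨a, ⟨rfl, ?_⟩, hc⟩
      rintro rfl
      exact hcj (Option.some_inj.1 (hc.symm.trans h))
    · rintro ⟨c, ⟨rfl, hc⟩, hb⟩
      exact ⟨b, hb, rfl, by rintro rfl; exact hc (φ.inj hb h)⟩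
  rw [X.map_map, e, X.map_comp, hx]

theorem map_restr_map_of_notMem {φ : PiHom m n} {j : Fin n} (h : j ∉ φ.range) (x : X.obj m) :
    X.map (PiHom.restr {j}ᶜ) (X.map φ x) = X.map φ x := by
  rw [X.map_map, PiHom.restr_comp]
  rintro i hi rfl
  exact h hi

variable (X) in
/-- The points `(x, t)` of `X_n × I^n` such that `x` is degenerate in all coordinates `i` with
`tᵢ ≠ 0`. -/
abbrev WObj (n : ℕ) : Type u :=
  {p : X.obj n × (Fin n → unitInterval) // ∀ i, p.2 i ≠ 0 → X.map (PiHom.restr {i}ᶜ) p.1 = p.1}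

/-- Move a point of `W X` along `φ`, with the new coordinates equal to `d`. -/
noncomputable def WObj.move (φ : PiHom m n) (d : unitInterval) (z : X.WObj m) : X.WObj n :=
  ⟨(X.map φ z.1.1, moveCoords φ d z.1.2), fun j hj => by
    by_cases h : j ∈ φ.range
    · obtain ⟨i, hi⟩ := h
      exact map_restr_map_of_eq hi (z.2 i fun e => hj ((moveCoords_of_eq hi _ _).trans e))
    · exact map_restr_map_of_notMem h _⟩

theorem WObj.move_comp (φ : PiHom m n) (ψ : PiHom k m) (d : unitInterval) (z : X.WObj k) :
    move (φ.comp ψ) d z = move φ d (move ψ d z) :=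
  Subtype.ext (Prod.ext (X.map_comp _ _ _) (moveCoords_comp _ _ _ _))

theorem WObj.move_id (d : unitInterval) (z : X.WObj n) : move (PiHom.id n) d z = z :=
  Subtype.ext (Prod.ext (X.map_id _) (moveCoords_id _ _))

theorem WObj.move_ofPerm (σ : Equiv.Perm (Fin n)) (d d' : unitInterval) (z : X.WObj n) :
    move (PiHom.ofPerm σ) d z = move (PiHom.ofPerm σ) d' z := by
  refine Subtype.ext (Prod.ext rfl (funext fun j => ?_))
  have h : (PiHom.ofPerm σ).1 (σ⁻¹ j) = some j := PiHom.ofPerm_eq_some.2 (by simp)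
  exact (moveCoords_of_eq h _ _).trans (moveCoords_of_eq h _ _).symm

theorem WObj.continuous_move (φ : PiHom m n) :
    Continuous fun p : unitInterval × X.WObj m => move φ p.1 p.2 := by
  refine Continuous.subtype_mk (Continuous.prodMk ?_ ?_) _
  · exact (X.map φ).continuous.comp
      (continuous_fst.comp (continuous_subtype_val.comp continuous_snd))
  · exact (continuous_moveCoords φ).comp (continuous_fst.prodMk
      (continuous_snd.comp (continuous_subtype_val.comp continuous_snd)))

theorem isClosed_WObj (hX : ∀ n, KHausdorff (X.obj n)) (n : ℕ) :
    IsClosed {p : X.obj n × (Fin n → unitInterval) |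
      ∀ i, p.2 i ≠ 0 → X.map (PiHom.restr {i}ᶜ) p.1 = p.1} := by
  have : ∀ i, IsClosed {p : X.obj n × (Fin n → unitInterval) |
      p.2 i = 0 ∨ X.map (PiHom.restr {i}ᶜ) p.1 = p.1} := fun i => by
    refine IsClosed.union (isClosed_eq (by fun_prop) continuous_const) ?_
    exact ((hX n).isClosed_eq (X.map _).continuous continuous_id).preimage continuous_fst
  convert isClosed_iInter this using 1
  ext p
  simp only [Set.mem_ofPred_eq, Set.mem_iInter]
  exact forall_congr' fun i => by tauto

instance : MulAction G (X.WObj n) where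
  smul g z := ⟨(g • z.1.1, z.1.2), fun i hi => by rw [X.map_smul, z.2 i hi]⟩
  one_smul z := Subtype.ext (Prod.ext (one_smul G _) rfl)
  mul_smul g h z := Subtype.ext (Prod.ext (mul_smul g h _) rfl)

theorem WObj.move_smul (φ : PiHom m n) (d : unitInterval) (g : G) (z : X.WObj m) :
    move φ d (g • z) = g • move φ d z := Subtype.ext (Prod.ext (X.map_smul _ _ _) rfl)

variable (X) in
/-- The diagram `W X`, in which the maps in `Π` insert coordinates `1`. -/
noncomputable def W (hX : ∀ n, KHausdorff (X.obj n)) : PiDiagram.{u} G where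
  obj := X.WObj
  cg _ := CompactlyGeneratedSpace.subtype_of_isClosed (isClosed_WObj hX _)
  cont_act _ := ⟨fun g => Continuous.subtype_mk (((continuous_const_smul g).comp
    (continuous_fst.comp continuous_subtype_val)).prodMk
      (continuous_snd.comp continuous_subtype_val)) _⟩
  map φ := ⟨WObj.move φ 1, (WObj.continuous_move φ).comp (continuous_const.prodMk continuous_id)⟩
  map_smul φ g z := WObj.move_smul φ 1 g z
  map_id := WObj.move_id 1
  map_comp φ ψ := WObj.move_comp φ ψ 1

variable (X) in
/-- The projection `W X → X`. -/
noncomputable def WProj (hX : ∀ n, KHausdorff (X.obj n)) : Hom (X.W hX) X where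
  app n := ⟨fun z : X.WObj n => z.1.1, continuous_fst.comp continuous_subtype_val⟩
  app_smul _ _ _ := rfl
  naturality _ _ := rfl

/-- The map `W X → W Y` given by `f : X → Y`. -/
noncomputable def WMap (f : Hom X Y) (hX : ∀ n, KHausdorff (X.obj n))
    (hY : ∀ n, KHausdorff (Y.obj n)) : Hom (X.W hX) (Y.W hY) where
  app n := ⟨fun z : X.WObj n => ⟨(f.app n z.1.1, z.1.2), fun i hi => by
      rw [← f.naturality, z.2 i hi]⟩,
    Continuous.subtype_mk (((f.app n).continuous.comp
      (continuous_fst.comp continuous_subtype_val)).prodMk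
        (continuous_snd.comp continuous_subtype_val)) _⟩
  app_smul _ _ _ := Subtype.ext (Prod.ext (f.app_smul _ _ _) rfl)
  naturality _ _ := Subtype.ext (Prod.ext (f.naturality _ _) rfl)

theorem W_kHausdorff (hX : ∀ n, KHausdorff (X.obj n)) (n : ℕ) : KHausdorff ((X.W hX).obj n) := by
  intro K _ _ _ f g hf hg
  have h1 := hX n K (fun k => (f k : X.WObj n).1.1) (fun k => (g k : X.WObj n).1.1)
    ((X.WProj hX).app n |>.continuous.comp hf) ((X.WProj hX).app n |>.continuous.comp hg)
  have h2 : Continuous fun z : X.WObj n => z.1.2 := continuous_snd.comp continuous_subtype_val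
  have h3 : IsClosed {k | (f k : X.WObj n).1.2 = (g k : X.WObj n).1.2} :=
    isClosed_eq (h2.comp hf) (h2.comp hg)
  convert h1.inter h3 using 1
  ext k
  exact Subtype.ext_iff.trans Prod.ext_iff

theorem W_prod_smul {hX : ∀ n, KHausdorff (X.obj n)} (p : G × Equiv.Perm (Fin n))
    (z : (X.W hX).obj n) (d : unitInterval) :
    p • z = WObj.move (PiHom.ofPerm p.2) d (p.1 • (z : X.WObj n)) :=
  WObj.move_ofPerm _ _ _ _

theorem moveCoords_const (φ : PiHom m n) (d : unitInterval) :
    moveCoords φ d (fun _ => d) = fun _ => d := by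
  funext j
  simp only [moveCoords]
  cases φ.transpose.1 j <;> rfl

/-- A homotopy from the zero section of `W X → X` to a map that is natural with respect to the
injections in `Π`. -/
theorem exists_W_homotopy (hX : ∀ n, KHausdorff (X.obj n)) (hR : X.IsReedyCofibrant) :
    ∃ H : ∀ q, C(X.obj q × unitInterval, X.WObj q),
      (∀ q (g : G) x s, H q (g • x, s) = g • H q (x, s)) ∧
      (∀ q x, H q (x, 0) = ⟨(x, fun _ => 0), fun _ h => absurd rfl h⟩) ∧
      ∀ (p q : ℕ) (ψ : PiHom p q), ψ.IsInj → ∀ x s,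
        H q (X.map ψ x, s) = WObj.move ψ s (H p (x, s)) := by
  have : ∀ n, WeakHausdorffSpace ((X.W hX).obj n) := fun n => (W_kHausdorff hX n).weakHausdorff
  have hs : ∀ q (g : G) (z : (X.W hX).obj q),
      ((g, 1) : G × Equiv.Perm (Fin q)) • z = g • z := fun q g z => by
    rw [prod_smul_def, PiHom.ofPerm_one, (X.W hX).map_id]
  -- At time `s` the inserted coordinates are `s`. For `s = 0` the zero section obeys this rule, and
  -- for `s = 1` the rule is naturality with respect to the maps of `W X`.
  let D : Insertion X (X.W hX).obj :=
    { ins := fun ψ s _ z => WObj.move (X := X) ψ s z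
      kCont_ins := fun ψ _ => Continuous.kCont ((WObj.continuous_move (X := X) ψ).comp
        ((continuous_snd.comp continuous_fst).prodMk continuous_snd))
      ins_comp := fun φ ψ _ _ s _ z => WObj.move_comp φ ψ s z
      ins_ofPerm := fun σ s x z => by
        rw [W_prod_smul _ _ s, _root_.one_smul]
      ins_smul := fun ψ g s _ z _ => (congrArg (WObj.move (X := X) ψ s) (hs _ g z)).trans
        ((WObj.move_smul ψ s g z).trans
          (hs _ g (WObj.move (X := X) ψ s z)).symm) }
  obtain ⟨H, h1, h2, h3⟩ := D.exists_homotopy hX hR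
    (fun q => ⟨fun x => (⟨(x, fun _ => 0), fun _ h => absurd rfl h⟩ : X.WObj q),
      Continuous.subtype_mk (by fun_prop) _⟩)
    (fun q g x => by rw [hs]; rfl)
    (fun p q ψ _ x => Subtype.ext (Prod.ext rfl (moveCoords_const ψ 0).symm))
  exact ⟨H, fun q g x s => (h1 q g x s).trans (hs q g _), h2, h3⟩

end PiDiagram

/-! ### The homotopy equivalence between `𝔻 W X` and `𝔻 X`. -/

namespace GOperad

variable {G : Type v} [Group G] {C : GOperad.{u} G} {X Z : PiDiagram.{u} G}

open PiDiagram

/-- A homotopy that is natural with respect to the injections in `Π` induces a homotopy after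
application of `𝔻`. -/
theorem exists_D_homotopy (Φ : ∀ q, C(X.obj q × unitInterval, Z.obj q))
    (hs : ∀ q (g : G) x s, Φ q (g • x, s) = g • Φ q (x, s))
    (hΦ : ∀ (p q : ℕ) (ψ : PiHom p q), ψ.IsInj → ∀ x s, Φ q (X.map ψ x, s) = Z.map ψ (Φ p (x, s)))
    (n : ℕ) : ∃ E : C((C.D X).obj n × unitInterval, (C.D Z).obj n),
      (∀ (p : G × Equiv.Perm (Fin n)) z s, E (p • z, s) = p • E (z, s)) ∧
      ∀ (q : ℕ) (f : C.DHom q n) (x : X.obj q) s, f.IsEffective →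
        E (DObj.mk f x, s) = DObj.mk f (Φ q (x, s)) := by
  have hF : ∀ s : unitInterval, DObj.InjCompat (C := C) (X := X) (n := n)
      fun q f x => DObj.mk f (Φ q (x, s)) := by
    intro s p q f ψ x hψ _
    change DObj.mk (f.precomp ψ) (Φ p (x, s)) = DObj.mk f (Φ q (X.map ψ x, s))
    rw [DObj.mk_precomp, hΦ p q ψ hψ]
  have hc : Continuous fun y : C.DObj X n × unitInterval => DObj.injDesc (hF y.2) y.1 := by
    refine DObj.continuous_desc_interval (g := fun z s => DObj.injDesc (hF s) z)
      fun q K _ _ _ f x s hf hx hs => ?_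
    refine DObj.continuous_injDesc_probe (ι := ULift.{u} unitInterval) (fun s => hF s.down)
      (fun k => ULift.up (s k)) hf hx fun p V _ _ _ e f' x' he hf' hx' => ?_
    exact DObj.continuous_mk (x := fun v => Φ p (x' v, s (e v))) hf'
      ((Φ p).continuous.comp (hx'.prodMk (hs.comp he)))
  let E : C((C.D X).obj n × unitInterval, (C.D Z).obj n) := ⟨_, hc⟩
  have hE : ∀ (q : ℕ) (f : C.DHom q n) (x : X.obj q) s, f.IsEffective →
      E (DObj.mk f x, s) = DObj.mk f (Φ q (x, s)) := fun q f x s hf => DObj.injDesc_mk (hF s) hf x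
  refine ⟨E, fun p z s => ?_, hE⟩
  obtain ⟨q, f, x, hf, rfl⟩ := DObj.exists_effective_rep (C := C) (X := X) z
  refine (hE q (p • f) (p.1 • x) s (hf.prod_smul p)).trans ?_
  rw [hE q f x s hf, hs]
  rfl

/-- `𝔻 W X → 𝔻 X` is an equivariant homotopy equivalence if `X` is Reedy cofibrant. -/
theorem exists_D_WProj_inverse (hX : ∀ n, KHausdorff (X.obj n)) (hR : X.IsReedyCofibrant) (n : ℕ) :
    ∃ (r : C((C.D X).obj n, (C.D (X.W hX)).obj n))
      (h : C((C.D X).obj n × unitInterval, (C.D X).obj n))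
      (h' : C((C.D (X.W hX)).obj n × unitInterval, (C.D (X.W hX)).obj n)),
      (∀ (p : G × Equiv.Perm (Fin n)) z, r (p • z) = p • r z) ∧
      (∀ (p : G × Equiv.Perm (Fin n)) z s, h (p • z, s) = p • h (z, s)) ∧
      (∀ (p : G × Equiv.Perm (Fin n)) z s, h' (p • z, s) = p • h' (z, s)) ∧
      (∀ z, h (z, 0) = z) ∧ (∀ z, h (z, 1) = (C.DMap (X.WProj hX)).app n (r z)) ∧
      (∀ z, h' (z, 0) = z) ∧ (∀ z, h' (z, 1) = r ((C.DMap (X.WProj hX)).app n z)) := by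
  obtain ⟨H, hHs, hH0, hH⟩ := exists_W_homotopy hX hR
  -- the homotopy on `X`
  obtain ⟨h, h1, h2⟩ := exists_D_homotopy (C := C) (X := X) (Z := X)
    (fun q => ⟨fun y => (H q y).1.1,
      continuous_fst.comp (continuous_subtype_val.comp (H q).continuous)⟩)
    (fun q g x s => by
      change (H q (g • x, s)).1.1 = g • (H q (x, s)).1.1
      rw [hHs]
      rfl)
    (fun p q ψ hψ x s => by
      change (H q (X.map ψ x, s)).1.1 = X.map ψ (H p (x, s)).1.1
      rw [hH p q ψ hψ]
      rfl) n
  obtain ⟨r, r1, r2⟩ := exists_D_homotopy (C := C) (X := X) (Z := X.W hX)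
    (fun q => (H q).comp ⟨fun y => (y.1, 1), by fun_prop⟩)
    (fun q g x s => hHs q g x 1) (fun p q ψ hψ x s => hH p q ψ hψ x 1) n
  -- the homotopy on `W X`
  obtain ⟨a, b, ha0, hb0, ha1, hb1, hab⟩ : ∃ a b : C(unitInterval, unitInterval),
      a 0 = 0 ∧ b 0 = 1 ∧ a 1 = 1 ∧ b 1 = 0 ∧ ∀ s, a s = 1 ∨ b s = 1 := by
    refine ⟨⟨fun s => Set.projIcc 0 1 zero_le_one (2 * s.1),
      continuous_projIcc.comp (by fun_prop)⟩, ⟨fun s => Set.projIcc 0 1 zero_le_one (2 - 2 * s.1),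
      continuous_projIcc.comp (by fun_prop)⟩, ?_, ?_, ?_, ?_, fun s => ?_⟩
    · exact Set.projIcc_of_le_left zero_le_one (by simp)
    · exact Set.projIcc_of_right_le zero_le_one (by norm_num)
    · exact Set.projIcc_of_right_le zero_le_one (by norm_num)
    · exact Set.projIcc_of_le_left zero_le_one (by norm_num)
    · rcases le_total s.1 (1 / 2) with hs | hs
      · exact Or.inr (Set.projIcc_of_right_le zero_le_one (by linarith))
      · exact Or.inl (Set.projIcc_of_right_le zero_le_one (by linarith))
  -- A coordinate with `tᵢ ≠ 0` may remain nonzero, so `x` must stay degenerate in it throughout the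
  -- homotopy in order to remain in `W X`.
  have hdeg : ∀ (q : ℕ) (x : X.obj q) (i : Fin q) (s : unitInterval),
      X.map (PiHom.restr {i}ᶜ) x = x →
      X.map (PiHom.restr {i}ᶜ) (H q (x, s)).1.1 = (H q (x, s)).1.1 := by
    intro q x i s hx
    obtain ⟨r, φ, hφ, hr⟩ := PiHom.exists_isInj_range ({i}ᶜ : Set (Fin q))
    rw [← hr, ← PiHom.comp_transpose_self, X.map_comp] at hx
    rw [← hx, hH _ _ φ hφ]
    refine map_restr_map_of_notMem ?_ _
    simp [hr]
  obtain ⟨h', h1', h2'⟩ := exists_D_homotopy (C := C) (X := X.W hX) (Z := X.W hX)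
    (fun q => ⟨fun y => (⟨((H q ((y.1 : X.WObj q).1.1, a y.2)).1.1, fun i =>
        max ((H q ((y.1 : X.WObj q).1.1, a y.2)).1.2 i) (b y.2 * (y.1 : X.WObj q).1.2 i)),
        fun i hi => by
          by_cases h0 : (H q ((y.1 : X.WObj q).1.1, a y.2)).1.2 i = 0
          · refine hdeg q _ i _ ((y.1 : X.WObj q).2 i fun h => hi ?_)
            simp only [h0, h, mul_zero, max_self]
          · exact (H q ((y.1 : X.WObj q).1.1, a y.2)).2 i h0⟩ : X.WObj q), by
      have e : Continuous fun y : (X.W hX).obj q × unitInterval => (y.1 : X.WObj q).1 :=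
        (continuous_subtype_val (p := fun p : X.obj q × (Fin q → unitInterval) =>
          ∀ i, p.2 i ≠ 0 → X.map (PiHom.restr {i}ᶜ) p.1 = p.1)).comp continuous_fst
      have e1 : Continuous fun y : (X.W hX).obj q × unitInterval =>
          (H q ((y.1 : X.WObj q).1.1, a y.2)).1 := continuous_subtype_val.comp
        ((H q).continuous.comp ((continuous_fst.comp e).prodMk (a.continuous.comp continuous_snd)))
      refine Continuous.subtype_mk ((continuous_fst.comp e1).prodMk (continuous_pi fun i => ?_)) _
      exact ((continuous_apply i).comp (continuous_snd.comp e1)).max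
        ((b.continuous.comp continuous_snd).mul
          ((continuous_apply i).comp (continuous_snd.comp e)))⟩)
    (fun q g x s => by
      refine Subtype.ext ?_
      change ((H q (g • (x : X.WObj q).1.1, a s)).1.1, fun i =>
        max ((H q (g • (x : X.WObj q).1.1, a s)).1.2 i) (b s * (x : X.WObj q).1.2 i)) = _
      rw [hHs]
      rfl)
    (fun p q ψ hψ x s => by
      refine Subtype.ext ?_
      change ((H q (X.map ψ (x : X.WObj p).1.1, a s)).1.1, fun i =>
        max ((H q (X.map ψ (x : X.WObj p).1.1, a s)).1.2 i)
          (b s * moveCoords ψ 1 (x : X.WObj p).1.2 i)) = _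
      rw [hH p q ψ hψ]
      refine Prod.ext rfl (funext fun i => ?_)
      change max (moveCoords ψ (a s) _ i) (b s * moveCoords ψ 1 _ i) = moveCoords ψ 1 _ i
      by_cases hi : i ∈ ψ.range
      · obtain ⟨j, hj⟩ := hi
        rw [moveCoords_of_eq hj, moveCoords_of_eq hj, moveCoords_of_eq hj]
        rfl
      · rw [moveCoords_of_notMem hi, moveCoords_of_notMem hi, moveCoords_of_notMem hi, mul_one]
        rcases hab s with h | h <;> rw [h]
        · exact max_eq_left unitInterval.le_one'
        · exact max_eq_right unitInterval.le_one') n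
  refine ⟨r.comp ⟨fun z => (z, 0), by fun_prop⟩, h, h', fun p z => r1 p z 0, h1, h1', ?_, ?_, ?_, ?_⟩
  · intro z
    obtain ⟨q, f, x, hf, rfl⟩ := DObj.exists_effective_rep (C := C) (X := X) z
    rw [h2 q f x 0 hf]
    change DObj.mk f (H q (x, 0)).1.1 = _
    rw [hH0]
  · intro z
    obtain ⟨q, f, x, hf, rfl⟩ := DObj.exists_effective_rep (C := C) (X := X) z
    rw [h2 q f x 1 hf]
    change _ = (C.DMap (X.WProj hX)).app n (r (DObj.mk f x, 0))
    rw [r2 q f x 0 hf]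
    rfl
  · intro z
    obtain ⟨q, f, x, hf, rfl⟩ := DObj.exists_effective_rep (C := C) (X := X.W hX) z
    rw [h2' q f x 0 hf]
    refine congrArg (DObj.mk f) (Subtype.ext ?_)
    change ((H q ((x : X.WObj q).1.1, a 0)).1.1, fun i =>
        max ((H q ((x : X.WObj q).1.1, a 0)).1.2 i) (b 0 * (x : X.WObj q).1.2 i)) = _
    rw [ha0, hb0, hH0]
    refine Prod.ext rfl (funext fun i => ?_)
    change max 0 (1 * _) = _
    rw [one_mul]
    exact max_eq_right unitInterval.nonneg'
  · intro z
    obtain ⟨q, f, x, hf, rfl⟩ := DObj.exists_effective_rep (C := C) (X := X.W hX) z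
    rw [h2' q f x 1 hf]
    change _ = r (DObj.mk f (x : X.WObj q).1.1, 0)
    rw [r2 q f _ 0 hf]
    refine congrArg (DObj.mk f) (Subtype.ext ?_)
    change ((H q ((x : X.WObj q).1.1, a 1)).1.1, fun i =>
        max ((H q ((x : X.WObj q).1.1, a 1)).1.2 i) (b 1 * (x : X.WObj q).1.2 i)) =
      (H q ((x : X.WObj q).1.1, 1)).1
    rw [ha1, hb1]
    refine Prod.ext rfl (funext fun i => ?_)
    change max _ (0 * _) = _
    rw [zero_mul]
    exact max_eq_left unitInterval.nonneg'

end GOperad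

/-! ### Charts for `𝔻 W X` -/

/-- Continuity on a compact space can be tested on compact spaces mapping to the members of an open
cover. -/
theorem continuous_of_open_cover_compact {K : Type u} [TopologicalSpace K] [CompactSpace K]
    [T2Space K] {Y : Type*} [TopologicalSpace Y] {F : K → Y} {ι : Type*} (O : ι → Set K)
    (hO : ∀ i, IsOpen (O i)) (hcov : ∀ k, ∃ i, k ∈ O i)
    (h : ∀ (i : ι) (V : Type u) [TopologicalSpace V] [CompactSpace V] [T2Space V] (e : V → K),
      Continuous e → (∀ v, e v ∈ O i) → Continuous fun v => F (e v)) : Continuous F := by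
  refine continuous_iff_continuousAt.2 fun k => ?_
  obtain ⟨i, hi⟩ := hcov k
  obtain ⟨L, hL, hLO, hLc⟩ := local_compact_nhds ((hO i).mem_nhds hi)
  have : CompactSpace L := isCompact_iff_compactSpace.1 hLc
  exact (continuousOn_iff_continuous_domRestrict.2
    (h i L Subtype.val continuous_subtype_val fun v => hLO v.2)).continuousAt hL

namespace PiHom

variable {p q r : ℕ}

theorem IsInj.ncard_range {φ : PiHom p q} (h : φ.IsInj) : φ.range.ncard = p := by
  choose f hf using h
  have hinj : Function.Injective f := fun i i' e => φ.inj (hf i) (by rw [e]; exact hf i')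
  have : φ.range = f '' Set.univ := by
    ext j
    simp only [mem_range, Set.image_univ, Set.mem_range]
    exact exists_congr fun i => ⟨fun e => Option.some_inj.1 ((hf i).symm.trans e), fun e => e ▸ hf i⟩
  rw [this, Set.ncard_image_of_injective _ hinj, Set.ncard_univ, Nat.card_eq_fintype_card,
    Fintype.card_fin]

theorem IsInj.range_subset {φ : PiHom p r} {ψ : PiHom q r} (hφ : φ.IsInj) (hψ : ψ.IsInj)
    (hpq : p ≤ q) (h : ψ.range ⊆ φ.range) : φ.range ⊆ ψ.range :=
  (Set.eq_of_subset_of_ncard_le h (by rw [hφ.ncard_range, hψ.ncard_range]; exact hpq)).ge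

end PiHom

namespace PiDiagram

variable {G : Type v} [Group G] {X : PiDiagram.{u} G} {n p q : ℕ}

/-- The idempotents that omit single coordinates compose to the one that omits all of `A`, so
degeneracy in each coordinate separately is degeneracy in all at once. -/
theorem map_restr_compl_of_forall {x : X.obj n} {A : Set (Fin n)}
    (h : ∀ i ∈ A, X.map (PiHom.restr {i}ᶜ) x = x) : X.map (PiHom.restr Aᶜ) x = x := by
  have key : ∀ F : Finset (Fin n), (∀ i ∈ F, X.map (PiHom.restr {i}ᶜ) x = x) →
      X.map (PiHom.restr (F : Set (Fin n))ᶜ) x = x := by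
    classical
    intro F
    induction F using Finset.induction_on with
    | empty =>
      intro _
      have : PiHom.restr ((∅ : Finset (Fin n)) : Set (Fin n))ᶜ = PiHom.id n :=
        PiHom.ext' fun i j => by simp [PiHom.restr_eq_some, PiHom.id_eq_some]
      rw [this, X.map_id]
    | insert i F _ ih =>
      intro hF
      have : PiHom.restr ((insert i F : Finset (Fin n)) : Set (Fin n))ᶜ =
          (PiHom.restr {i}ᶜ).comp (PiHom.restr (F : Set (Fin n))ᶜ) := by
        rw [PiHom.restr_comp_restr, Finset.coe_insert, Set.insert_eq, Set.compl_union]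
      rw [this, X.map_comp, ih fun j hj => hF j (Finset.mem_insert_of_mem hj),
        hF i (Finset.mem_insert_self _ _)]
  have := key A.toFinite.toFinset fun i hi => h i (by simpa using hi)
  rwa [Set.Finite.coe_toFinset] at this

open Classical in
/-- Multiply the coordinates in `S` with `1 - s`. -/
noncomputable def WObj.scale (S : Set (Fin n)) (s : unitInterval) (z : X.WObj n) : X.WObj n :=
  ⟨(z.1.1, fun i => if i ∈ S then unitInterval.symm s * z.1.2 i else z.1.2 i), fun i hi => z.2 i fun e =>
    hi (by simp only [e, mul_zero, ite_self])⟩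

theorem WObj.scale_zero (S : Set (Fin n)) (z : X.WObj n) : WObj.scale S 0 z = z := by
  refine Subtype.ext (Prod.ext rfl (funext fun i => ?_))
  simp [WObj.scale]

theorem WObj.continuous_scale (S : Set (Fin n)) :
    Continuous fun y : unitInterval × X.WObj n => WObj.scale S y.1 y.2 := by
  have h : Continuous fun y : unitInterval × X.WObj n => y.2.1 :=
    continuous_subtype_val.comp continuous_snd
  refine Continuous.subtype_mk ((continuous_fst.comp h).prodMk (continuous_pi fun i => ?_)) _
  have h2 : Continuous fun y : unitInterval × X.WObj n => y.2.1.2 i :=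
    (continuous_apply i).comp (continuous_snd.comp h)
  by_cases hi : i ∈ S
  · simp only [hi, if_true]
    exact (unitInterval.continuous_symm.comp continuous_fst).mul h2
  · simp only [hi, if_false]
    exact h2

open Classical in
/-- The point `(ν x, t)` of `W X` with the coordinates in the image of `ν` replaced by `0`. -/
noncomputable def WObj.lowPoint (ν : PiHom q n) (x : X.obj q) (t : Fin n → unitInterval) : X.WObj n :=
  ⟨(X.map ν x, fun i => if i ∈ ν.range then 0 else t i), fun _ hi =>
    map_restr_map_of_notMem (fun h => hi (if_pos h)) x⟩

theorem WObj.continuous_lowPoint (ν : PiHom q n) :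
    Continuous fun y : X.obj q × (Fin n → unitInterval) => WObj.lowPoint ν y.1 y.2 := by
  refine Continuous.subtype_mk (((X.map ν).continuous.comp continuous_fst).prodMk
    (continuous_pi fun i => ?_)) _
  by_cases hi : i ∈ ν.range
  · simp only [hi, if_true]
    exact continuous_const
  · simp only [hi, if_false]
    exact (continuous_apply i).comp continuous_snd

theorem WObj.scale_val {S : Set (Fin n)} {s : unitInterval} {z : X.WObj n} {i : Fin n} :
    (i ∈ S → (WObj.scale S s z).1.2 i = unitInterval.symm s * z.1.2 i) ∧
      (i ∉ S → (WObj.scale S s z).1.2 i = z.1.2 i) :=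
  ⟨fun h => if_pos h, fun h => if_neg h⟩

theorem WObj.lowPoint_val {ν : PiHom q n} {x : X.obj q} {t : Fin n → unitInterval} {i : Fin n} :
    (i ∈ ν.range → (WObj.lowPoint ν x t).1.2 i = 0) ∧
      (i ∉ ν.range → (WObj.lowPoint ν x t).1.2 i = t i) :=
  ⟨fun h => if_pos h, fun h => if_neg h⟩

theorem WObj.move_scale {ψ : PiHom p n} {S : Set (Fin p)} {S' : Set (Fin n)}
    (h : ∀ i j, ψ.1 i = some j → (i ∈ S ↔ j ∈ S')) (h' : S' ⊆ ψ.range) (s : unitInterval)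
    (z : X.WObj p) : move ψ 1 (scale S s z) = scale S' s (move ψ 1 z) := by
  refine Subtype.ext (Prod.ext rfl (funext fun j => ?_))
  by_cases hj : j ∈ ψ.range
  · obtain ⟨i, hi⟩ := hj
    refine (moveCoords_of_eq hi _ _).trans ?_
    by_cases hS : i ∈ S
    · rw [scale_val.1 hS, scale_val.1 ((h i j hi).1 hS)]
      exact congrArg _ (moveCoords_of_eq hi _ _).symm
    · rw [scale_val.2 hS, scale_val.2 fun hc => hS ((h i j hi).2 hc)]
      exact (moveCoords_of_eq hi _ _).symm
  · rw [scale_val.2 fun hc => hj (h' hc)]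
    exact (moveCoords_of_notMem hj _ _).trans (moveCoords_of_notMem hj _ _).symm

theorem WObj.move_lowPoint (ψ : PiHom p n) (ν : PiHom q p) (x : X.obj q)
    (t : Fin p → unitInterval) :
    move ψ 1 (lowPoint ν x t) = lowPoint (ψ.comp ν) x (moveCoords ψ 1 t) := by
  refine Subtype.ext (Prod.ext (X.map_map _ _ _) (funext fun j => ?_))
  by_cases hj : j ∈ ψ.range
  · obtain ⟨i, hi⟩ := hj
    have e : j ∈ (ψ.comp ν).range ↔ i ∈ ν.range := by
      simp only [PiHom.mem_range, PiHom.comp_eq_some]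
      exact exists_congr fun k => ⟨fun ⟨i', hi', hj'⟩ => ψ.inj hj' hi ▸ hi', fun h => ⟨i, h, hi⟩⟩
    refine (moveCoords_of_eq hi _ _).trans ?_
    by_cases hν : i ∈ ν.range
    · rw [lowPoint_val.1 hν, lowPoint_val.1 (e.2 hν)]
    · rw [lowPoint_val.2 hν, lowPoint_val.2 fun hc => hν (e.1 hc)]
      exact (moveCoords_of_eq hi _ _).symm
  · rw [lowPoint_val.2]
    · exact (moveCoords_of_notMem hj _ _).trans (moveCoords_of_notMem hj _ _).symm
    · rintro ⟨i, hi⟩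
      obtain ⟨k, -, hk⟩ := PiHom.comp_eq_some.1 hi
      exact hj ⟨k, hk⟩

end PiDiagram

namespace GOperad

variable {G : Type v} [Group G] {C : GOperad.{u} G} {n p q r : ℕ}

open PiDiagram

/-- The image of the injection `ν` is the set of those elements `i` of the support of `f` for
which `tᵢ < a`, and no `tᵢ` is equal to `a`. -/
def IsLow (a : unitInterval) (f : C.DHom p n) (t : Fin p → unitInterval) (ν : PiHom q p) : Prop :=
  ν.IsInj ∧ ν.range ⊆ f.supp ∧ ∀ i ∈ f.supp, (i ∈ ν.range ∧ t i < a) ∨ (i ∉ ν.range ∧ a < t i)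

theorem IsLow.mem_iff {a : unitInterval} {f : C.DHom p n} {t : Fin p → unitInterval}
    {ν : PiHom q p} (h : IsLow a f t ν) {i : Fin p} : i ∈ ν.range ↔ i ∈ f.supp ∧ t i < a := by
  constructor
  · intro hi
    refine ⟨h.2.1 hi, ?_⟩
    rcases h.2.2 i (h.2.1 hi) with h1 | h1
    · exact h1.2
    · exact absurd hi h1.1
  · rintro ⟨h1, h2⟩
    rcases h.2.2 i h1 with h3 | h3
    · exact h3.1
    · exact absurd (h2.trans h3.2) (lt_irrefl _)

theorem IsLow.isEffective {a : unitInterval} {f : C.DHom p n} {t : Fin p → unitInterval}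
    {ν : PiHom q p} (h : IsLow a f t ν) : (f.precomp ν).IsEffective := fun i => by
  obtain ⟨j, hj⟩ := h.1 i
  exact DHom.mem_supp_precomp.2 ⟨j, hj, h.2.1 ⟨i, hj⟩⟩

/-- Coordinates inserted by `ψ` are `1`, above the threshold, so they never join the low ones. -/
theorem IsLow.push {a : unitInterval} (ha : a < 1) {f : C.DHom r n} {ψ : PiHom p r}
    {t : Fin p → unitInterval} {ν : PiHom q p} (h : IsLow a (f.precomp ψ) t ν) :
    IsLow a f (moveCoords ψ 1 t) (ψ.comp ν) := by
  have h1 : ∀ i ∈ ν.range, ∃ j, ψ.1 i = some j ∧ j ∈ f.supp := fun i hi =>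
    DHom.mem_supp_precomp.1 (h.2.1 hi)
  refine ⟨fun i => ?_, ?_, fun j hj => ?_⟩
  · obtain ⟨k, hk⟩ := h.1 i
    obtain ⟨j, hj, -⟩ := h1 k ⟨i, hk⟩
    exact ⟨j, PiHom.comp_eq_some.2 ⟨k, hk, hj⟩⟩
  · rintro j ⟨i, hi⟩
    obtain ⟨k, hk, hkj⟩ := PiHom.comp_eq_some.1 hi
    obtain ⟨j', hj', hs⟩ := h1 k ⟨i, hk⟩
    rwa [Option.some_inj.1 (hkj.symm.trans hj')]
  · by_cases hjψ : j ∈ ψ.range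
    · obtain ⟨k, hk⟩ := hjψ
      rw [moveCoords_of_eq hk]
      have e : j ∈ (ψ.comp ν).range ↔ k ∈ ν.range := by
        simp only [PiHom.mem_range, PiHom.comp_eq_some]
        exact exists_congr fun i => ⟨fun ⟨k', hk', hj'⟩ => ψ.inj hj' hk ▸ hk', fun hk' => ⟨k, hk', hk⟩⟩
      rw [e]
      exact h.2.2 k (DHom.mem_supp_precomp.2 ⟨j, hk, hj⟩)
    · refine Or.inr ⟨?_, ?_⟩
      · rintro ⟨i, hi⟩
        obtain ⟨k, -, hkj⟩ := PiHom.comp_eq_some.1 hi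
        exact hjψ ⟨k, hkj⟩
      · rwa [moveCoords_of_notMem hjψ]

/-- Conversely, a low coordinate cannot have been inserted, so the low coordinates all lie in the
image of `ψ` and can be moved back. -/
theorem IsLow.pull {a : unitInterval} (ha : a < 1) {f : C.DHom r n} {ψ : PiHom p r}
    {t : Fin p → unitInterval} {ν : PiHom q r} (h : IsLow a f (moveCoords ψ 1 t) ν) :
    IsLow a (f.precomp ψ) t (ψ.transpose.comp ν) ∧ ψ.comp (ψ.transpose.comp ν) = ν := by
  have h1 : ν.range ⊆ ψ.range := fun j hj => by
    by_contra hc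
    have := (h.mem_iff.1 hj).2
    rw [moveCoords_of_notMem hc] at this
    exact absurd (this.trans ha) (lt_irrefl _)
  have e : ∀ (k : Fin p) (j : Fin r), ψ.1 k = some j →
      (k ∈ (ψ.transpose.comp ν).range ↔ j ∈ ν.range) := by
    intro k j hk
    simp only [PiHom.mem_range, PiHom.comp_eq_some, PiHom.transpose_eq_some]
    exact exists_congr fun i => ⟨fun ⟨j', hj', hk'⟩ => by rwa [Option.some_inj.1 (hk.symm.trans hk')],
      fun hj => ⟨j, hj, hk⟩⟩
  refine ⟨⟨fun i => ?_, ?_, fun k hk => ?_⟩, ?_⟩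
  · obtain ⟨j, hj⟩ := h.1 i
    obtain ⟨k, hk⟩ := h1 ⟨i, hj⟩
    exact ⟨k, PiHom.comp_eq_some.2 ⟨j, hj, PiHom.transpose_eq_some.2 hk⟩⟩
  · rintro k ⟨i, hi⟩
    obtain ⟨j, hj, hkj⟩ := PiHom.comp_eq_some.1 hi
    exact DHom.mem_supp_precomp.2 ⟨j, PiHom.transpose_eq_some.1 hkj, h.2.1 ⟨i, hj⟩⟩
  · obtain ⟨j, hj, hjs⟩ := DHom.mem_supp_precomp.1 hk
    have := h.2.2 j hjs
    rwa [moveCoords_of_eq hj, ← e k j hj] at this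
  · rw [← PiHom.comp_assoc, PiHom.comp_transpose_self, PiHom.restr_comp h1]

theorem IsLow.smul {a : unitInterval} {f : C.DHom p n} {t : Fin p → unitInterval}
    {ν : PiHom q p} (h : IsLow a f t ν) (l : G × Equiv.Perm (Fin n)) : IsLow a (l • f) t ν := by
  rw [IsLow, DHom.supp_prod_smul]
  exact h

theorem isOpen_isLow {K : Type u} [TopologicalSpace K] {f : K → C.DHom p n}
    {t : K → Fin p → unitInterval} (hf : Continuous f) (ht : Continuous t) (a : unitInterval)
    (ν : PiHom q p) : IsOpen {k | IsLow a (f k) (t k) ν} := by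
  by_cases hν : ν.IsInj
  · have hs : ∀ i, IsClopen {k | i ∈ (f k).supp} := fun i =>
      (DHom.isClopen_fn {φ : BasedMap p n | φ i ≠ none}).preimage hf
    have e : {k | IsLow a (f k) (t k) ν} = ⋂ i, ({k | i ∈ ν.range → i ∈ (f k).supp} ∩
        {k | i ∈ (f k).supp → (i ∈ ν.range ∧ t k i < a) ∨ (i ∉ ν.range ∧ a < t k i)}) := by
      ext k
      simp only [IsLow, hν, true_and, Set.mem_iInter, Set.mem_inter_iff, Set.mem_ofPred_eq,
        forall_and]
      rfl
    have ht' : ∀ i, Continuous fun k => t k i := fun i => (continuous_apply i).comp ht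
    rw [e]
    refine isOpen_iInter_of_finite fun i => IsOpen.inter ?_ ?_
    · by_cases hi : i ∈ ν.range
      · simpa [hi] using (hs i).2
      · simp [hi]
    · have e2 : {k | i ∈ (f k).supp → (i ∈ ν.range ∧ t k i < a) ∨ (i ∉ ν.range ∧ a < t k i)} =
          {k | i ∈ (f k).supp}ᶜ ∪ {k | (i ∈ ν.range ∧ t k i < a) ∨ (i ∉ ν.range ∧ a < t k i)} := by
        ext k
        exact imp_iff_not_or
      rw [e2]
      refine (hs i).compl.2.union ?_
      by_cases hi : i ∈ ν.range
      · simpa [hi] using isOpen_lt (ht' i) continuous_const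
      · simpa [hi] using isOpen_lt continuous_const (ht' i)
  · convert isOpen_empty using 1
    ext k
    simp [IsLow, hν]

/-- The low part of a point of `𝔻 W X` below the threshold `a`, for all numberings. -/
def labels {X : PiDiagram.{u} G} {hX : ∀ n, KHausdorff (X.obj n)} {a : unitInterval} (ha : a < 1)
    (q : ℕ) : C.DObj (X.W hX) n → Set (C.DHom q n × X.obj q) :=
  Quot.lift (fun y => {e | ∃ ν : PiHom q y.get.1,
    IsLow a y.get.2.1 (y.get.2.2 : X.WObj _).1.2 ν ∧
      e = (y.get.2.1.precomp ν, X.map ν.transpose (y.get.2.2 : X.WObj _).1.1)}) (by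
    rintro _ _ ⟨f, ψ, z⟩
    ext e
    constructor
    · rintro ⟨ν, hν, rfl⟩
      have hν' : ν.transpose.comp (ψ.transpose.comp ψ) = ν.transpose := by
        rw [PiHom.transpose_comp_eq_restr, PiHom.comp_restr]
        rw [PiHom.transpose_transpose]
        intro i hi
        obtain ⟨j, hj, -⟩ := DHom.mem_supp_precomp.1 (hν.2.1 hi)
        exact ⟨j, PiHom.transpose_eq_some.2 hj⟩
      refine ⟨ψ.comp ν, hν.push ha, Prod.ext (f.precomp_precomp ψ ν) ?_⟩
      change X.map ν.transpose z.1.1 = X.map (ψ.comp ν).transpose (X.map ψ z.1.1)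
      rw [X.map_map, PiHom.transpose_comp, PiHom.comp_assoc, hν']
    · rintro ⟨ν, hν, rfl⟩
      obtain ⟨h1, h2⟩ := IsLow.pull ha (C := C) (f := f) (ψ := ψ) (t := z.1.2) hν
      refine ⟨ψ.transpose.comp ν, h1, Prod.ext ?_ ?_⟩
      · change f.precomp ν = (f.precomp ψ).precomp (ψ.transpose.comp ν)
        rw [f.precomp_precomp, h2]
      · change X.map ν.transpose (X.map ψ z.1.1) = X.map (ψ.transpose.comp ν).transpose z.1.1
        rw [X.map_map, PiHom.transpose_comp, PiHom.transpose_transpose])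

/-- The map on `𝔻 W X` that multiplies the coordinates below the threshold `a` with `1 - s`. -/
noncomputable def lowScale {X : PiDiagram.{u} G} {hX : ∀ n, KHausdorff (X.obj n)}
    {a : unitInterval} (ha : a < 1) (s : unitInterval) :
    C.DObj (X.W hX) n → C.DObj (X.W hX) n :=
  Quot.lift (fun y => DObj.mk (X := X.W hX) y.get.2.1 (WObj.scale
    {i | i ∈ y.get.2.1.supp ∧ (y.get.2.2 : X.WObj _).1.2 i < a} s y.get.2.2)) (by
    rintro _ _ ⟨f, ψ, z⟩
    refine (DObj.mk_precomp (X := X.W hX) f ψ (WObj.scale (X := X)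
      {i | i ∈ (f.precomp ψ).supp ∧ (z : X.WObj _).1.2 i < a} s z)).trans ?_
    refine congrArg (DObj.mk f) (WObj.move_scale (fun i j hi => ?_) (fun j hj => ?_) s z)
    · change i ∈ (f.precomp ψ).supp ∧ z.1.2 i < a ↔ j ∈ f.supp ∧ moveCoords ψ 1 z.1.2 j < a
      rw [moveCoords_of_eq hi, DHom.mem_supp_precomp]
      exact and_congr_left fun _ => ⟨fun ⟨l, h1, h2⟩ => Option.some_inj.1 (hi.symm.trans h1) ▸ h2,
        fun h => ⟨j, hi, h⟩⟩
    · by_contra hc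
      have h' : moveCoords ψ 1 z.1.2 j < a := hj.2
      rw [moveCoords_of_notMem hc] at h'
      exact absurd (h'.trans ha) (lt_irrefl _))

/-- The points of `𝔻 W X` obtained from a point of `𝔻 W T` by placing `x` at the coordinates below
the threshold `a`. -/
def place {X T : PiDiagram.{u} G} {hX : ∀ n, KHausdorff (X.obj n)} {hT : ∀ n, KHausdorff (T.obj n)}
    {a : unitInterval} (ha : a < 1) (U : Set (C.DHom q n)) (x : X.obj q) :
    C.DObj (T.W hT) n → Set (C.DObj (X.W hX) n) :=
  Quot.lift (fun y => {z | ∃ ν : PiHom q y.get.1,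
    IsLow a y.get.2.1 (y.get.2.2 : T.WObj _).1.2 ν ∧ y.get.2.1.precomp ν ∈ U ∧
      z = DObj.mk (X := X.W hX) y.get.2.1
        (WObj.lowPoint ν x (y.get.2.2 : T.WObj _).1.2)}) (by
    rintro _ _ ⟨f, ψ, w⟩
    have key : ∀ ν : PiHom q _, DObj.mk (X := X.W hX) (f.precomp ψ)
        (WObj.lowPoint ν x (w : T.WObj _).1.2) = DObj.mk (X := X.W hX) f
          (WObj.lowPoint (ψ.comp ν) x (moveCoords ψ 1 (w : T.WObj _).1.2)) := by
      intro ν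
      refine (DObj.mk_precomp (X := X.W hX) f ψ (WObj.lowPoint ν x (w : T.WObj _).1.2)).trans ?_
      exact congrArg (DObj.mk f) (WObj.move_lowPoint ψ ν x _)
    ext z
    constructor
    · rintro ⟨ν, hν, hU, rfl⟩
      refine ⟨ψ.comp ν, hν.push ha, ?_, key ν⟩
      exact (f.precomp_precomp ψ ν) ▸ hU
    · rintro ⟨ν, hν, hU, rfl⟩
      obtain ⟨h1, h2⟩ := IsLow.pull ha (C := C) (f := f) (ψ := ψ) (t := w.1.2) hν
      refine ⟨ψ.transpose.comp ν, h1, ?_, ?_⟩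
      · change (f.precomp ψ).precomp _ ∈ U
        rw [f.precomp_precomp, h2]
        exact hU
      · refine Eq.trans ?_ (key _).symm
        rw [h2]
        rfl)

end GOperad

namespace PiDiagram

variable (G : Type v) [Group G]

/-- The terminal diagram. -/
def terminal : PiDiagram.{u} G where
  obj _ := PUnit.{u + 1}
  act _ := { smul := fun _ _ => PUnit.unit, one_smul := fun _ => rfl, mul_smul := fun _ _ _ => rfl }
  cont_act _ := ⟨fun _ => continuous_const⟩
  map _ := ContinuousMap.const _ PUnit.unit
  map_smul _ _ _ := rfl
  map_id _ := rfl
  map_comp _ _ _ := rfl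

theorem terminal_kHausdorff (n : ℕ) : KHausdorff ((terminal.{u} G).obj n) := by
  intro K _ _ _ f g _ _
  convert isClosed_univ using 1
  exact Set.eq_univ_of_forall fun k => rfl

variable {G}

/-- The map to the terminal diagram. -/
def toTerminal (X : PiDiagram.{u} G) : Hom X (terminal G) where
  app _ := ContinuousMap.const _ PUnit.unit
  app_smul _ _ _ := rfl
  naturality _ _ := rfl

end PiDiagram

namespace GOperad

variable {G : Type v} [Group G] {C : GOperad.{u} G} {n p q r : ℕ}

open PiDiagram

theorem IsLow.range_eq {a : unitInterval} {f : C.DHom p n} {t : Fin p → unitInterval}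
    {ν : PiHom q p} (h : IsLow a f t ν) : ν.range = {i | i ∈ f.supp ∧ t i < a} :=
  Set.ext fun _ => h.mem_iff

/-- The sets of low coordinates for two thresholds are nested, so inclusion can be decided by
counting. This is why charts are compared by degree. -/
theorem IsLow.range_subset {a b : unitInterval} {f : C.DHom p n} {t : Fin p → unitInterval}
    {ν : PiHom q p} {ν' : PiHom r p} (h : IsLow a f t ν) (h' : IsLow b f t ν') (hqr : q ≤ r) :
    ν.range ⊆ ν'.range := by
  rcases le_total a b with hab | hab
  · exact fun i hi => h'.mem_iff.2 ⟨(h.mem_iff.1 hi).1, (h.mem_iff.1 hi).2.trans_le hab⟩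
  · exact h.1.range_subset h'.1 hqr
      fun i hi => h.mem_iff.2 ⟨(h'.mem_iff.1 hi).1, (h'.mem_iff.1 hi).2.trans_le hab⟩

theorem IsLow.of_le {a : unitInterval} {f : C.DHom p n} {t t' : Fin p → unitInterval}
    {ν : PiHom q p} (h : IsLow a f t ν) (h1 : ∀ i ∈ ν.range, t' i ≤ t i)
    (h2 : ∀ i ∉ ν.range, t' i = t i) : IsLow a f t' ν := by
  refine ⟨h.1, h.2.1, fun i hi => (h.2.2 i hi).imp ?_ ?_⟩
  · exact fun h3 => ⟨h3.1, (h1 i h3.1).trans_lt h3.2⟩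
  · exact fun h3 => ⟨h3.1, (h2 i h3.1).symm ▸ h3.2⟩

section

variable {X Y : PiDiagram.{u} G} {hX : ∀ n, KHausdorff (X.obj n)} {hY : ∀ n, KHausdorff (Y.obj n)}
  {a : unitInterval} (ha : a < 1)

theorem lowScale_mk (s : unitInterval) (f : C.DHom p n) (z : X.WObj p) :
    lowScale ha s (DObj.mk (X := X.W hX) f z) =
      DObj.mk (X := X.W hX) f (WObj.scale {i | i ∈ f.supp ∧ z.1.2 i < a} s z) := rfl

variable {ha}

/-- The set of low coordinates is determined by the point; only its numbering is free. -/
theorem eq_of_mem_labels {z : C.DObj (X.W hX) n} {e e' : C.DHom q n × X.obj q}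
    (h : e ∈ labels ha q z) (h' : e' ∈ labels ha q z) :
    ∃ σ, e' = (e.1.precomp (PiHom.ofPerm σ), X.map (PiHom.ofPerm σ⁻¹) e.2) := by
  obtain ⟨p, f, z, rfl⟩ := z.exists_eq_mk
  obtain ⟨ν, hν, rfl⟩ := h
  obtain ⟨ν', hν', rfl⟩ := h'
  obtain ⟨σ, rfl⟩ := hν'.1.exists_eq_comp_ofPerm (φ := ν) (hν.range_eq.trans hν'.range_eq.symm)
  refine ⟨σ, Prod.ext (f.precomp_precomp _ _).symm ?_⟩
  change X.map _ _ = X.map _ (X.map _ _)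
  rw [X.map_map, PiHom.transpose_comp, PiHom.transpose_ofPerm]

theorem isEffective_of_mem_labels {z : C.DObj (X.W hX) n} {e : C.DHom q n × X.obj q}
    (h : e ∈ labels ha q z) : e.1.IsEffective := by
  obtain ⟨p, f, z, rfl⟩ := z.exists_eq_mk
  obtain ⟨ν, hν, rfl⟩ := h
  exact hν.isEffective

theorem smul_mem_labels {z : (C.D (X.W hX)).obj n} {e : C.DHom q n × X.obj q}
    (h : e ∈ labels ha q z) (l : G × Equiv.Perm (Fin n)) :
    (l • e.1, l.1 • e.2) ∈ labels ha q (l • z) := by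
  obtain ⟨p, f, z, rfl⟩ := DObj.exists_eq_mk (C := C) (X := X.W hX) z
  obtain ⟨ν, hν, rfl⟩ := h
  exact ⟨ν, hν.smul l, Prod.ext (DHom.prod_smul_precomp l f ν).symm (X.map_smul _ _ _).symm⟩

theorem map_mem_labels (g : Hom X Y) {z : (C.D (X.W hX)).obj n} {e : C.DHom q n × X.obj q}
    (h : e ∈ labels ha q z) :
    (e.1, g.app q e.2) ∈ labels ha q ((C.DMap (WMap g hX hY)).app n z) := by
  obtain ⟨p, f, z, rfl⟩ := DObj.exists_eq_mk (C := C) (X := X.W hX) z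
  obtain ⟨ν, hν, rfl⟩ := h
  exact ⟨ν, hν, Prod.ext rfl (g.naturality _ _)⟩

theorem exists_mem_labels_of_map (g : Hom X Y) {z : (C.D (X.W hX)).obj n}
    {e : C.DHom q n × Y.obj q} (h : e ∈ labels ha q ((C.DMap (WMap g hX hY)).app n z)) :
    ∃ x, (e.1, x) ∈ labels ha q z := by
  obtain ⟨p, f, z, rfl⟩ := DObj.exists_eq_mk (C := C) (X := X.W hX) z
  obtain ⟨ν, hν, rfl⟩ := h
  exact ⟨_, ν, hν, rfl⟩

theorem lowScale_zero (z : C.DObj (X.W hX) n) : lowScale ha 0 z = z := by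
  obtain ⟨p, f, z, rfl⟩ := z.exists_eq_mk
  exact congrArg (DObj.mk (X := X.W hX) f) (WObj.scale_zero _ z)

theorem lowScale_smul (s : unitInterval) (l : G × Equiv.Perm (Fin n))
    (z : (C.D (X.W hX)).obj n) :
    (lowScale ha s (l • z) : (C.D (X.W hX)).obj n) =
      HSMul.hSMul (β := (C.D (X.W hX)).obj n) l (lowScale ha s z) := by
  obtain ⟨p, f, z, rfl⟩ := DObj.exists_eq_mk (C := C) (X := X.W hX) z
  refine (lowScale_mk ha s (l • f) (l.1 • (z : X.WObj p))).trans ?_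
  rw [DHom.supp_prod_smul]
  rfl

end

variable (C) in
/-- An open set `U` in `𝒟(𝐪, 𝐧)` with the property that `U ∩ Uσ = ∅` for all permutations
`σ ≠ 1`, and a homomorphism `ρ` with `ℓ e = e ρ(ℓ)` for all those `e ∈ U` whose orbit is fixed. -/
structure Chart (L : Subgroup (G × Equiv.Perm (Fin n))) where
  /-- the number of coordinates below the threshold -/
  deg : ℕ
  /-- the threshold -/
  a : unitInterval
  ha : a < 1
  /-- the open set -/
  U : Set (C.DHom deg n)
  isOpen_U : IsOpen U
  slim : ∀ e ∈ U, ∀ σ, e.precomp (PiHom.ofPerm σ) ∈ U → σ = 1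
  /-- the homomorphism -/
  ρ : L →* Equiv.Perm (Fin deg)
  adapted : ∀ e ∈ U, ∀ (l : L) σ, l.1 • e = e.precomp (PiHom.ofPerm σ) → σ = ρ l

namespace Chart

variable {L : Subgroup (G × Equiv.Perm (Fin n))} (c : C.Chart L) {X T : PiDiagram.{u} G}
  {hX : ∀ n, KHausdorff (X.obj n)} {hT : ∀ n, KHausdorff (T.obj n)}

/-- The homomorphism `L → G × Σ_q` with coordinates the inclusion and `ρ`. -/
def graphHom : L →* G × Equiv.Perm (Fin c.deg) :=
  ((MonoidHom.fst _ _).comp L.subtype).prod c.ρ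

/-- The domain of a chart. -/
def dom (c : C.Chart L) (hX : ∀ n, KHausdorff (X.obj n)) : Set (C.DObj (X.W hX) n) :=
  {z | ∃ e ∈ labels c.ha c.deg z, e.1 ∈ c.U}

theorem mk_mem_dom {f : C.DHom p n} {z : X.WObj p} :
    (DObj.mk (X := X.W hX) f z) ∈ c.dom hX ↔
      ∃ ν : PiHom c.deg p, IsLow c.a f z.1.2 ν ∧ f.precomp ν ∈ c.U :=
  ⟨fun ⟨_, ⟨ν, h1, h2⟩, h3⟩ => ⟨ν, h1, by rw [h2] at h3; exact h3⟩,
    fun ⟨ν, h1, h2⟩ => ⟨_, ⟨ν, h1, rfl⟩, h2⟩⟩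

theorem isOpen_low {K : Type u} [TopologicalSpace K] {f : K → C.DHom p n}
    {z : K → X.WObj p} (hf : Continuous f) (hz : Continuous z) (ν : PiHom c.deg p) :
    IsOpen {k | IsLow c.a (f k) (z k).1.2 ν ∧ (f k).precomp ν ∈ c.U} :=
  (isOpen_isLow hf (continuous_snd.comp (continuous_subtype_val.comp hz)) _ ν).inter
    (c.isOpen_U.preimage ((DHom.continuous_precomp ν).comp hf))

theorem isOpen_dom : IsOpen (c.dom hX) := by
  refine DObj.isOpen_iff.2 fun p K _ _ _ f z hf hz => ?_
  have : {k | DObj.mk (f k) (z k) ∈ c.dom hX} = ⋃ ν : PiHom c.deg p,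
      {k | IsLow c.a (f k) (z k : X.WObj p).1.2 ν ∧ (f k).precomp ν ∈ c.U} := by
    ext k
    rw [Set.mem_iUnion]
    exact c.mk_mem_dom
  rw [this]
  exact isOpen_iUnion fun ν => c.isOpen_low hf hz ν

/-- The conditions on a numbering `ν` are open, so on a test space `ν` may be assumed constant. -/
theorem kCont_dom_prod {A Y : Type u} [TopologicalSpace A] [TopologicalSpace Y]
    {g : c.dom hX → A → Y}
    (h : ∀ (p : ℕ) (ν : PiHom c.deg p) (K : Type u) [TopologicalSpace K] [CompactSpace K]
      [T2Space K] (f : K → C.DHom p n) (z : K → X.WObj p) (a : K → A) (_ : Continuous f)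
      (_ : Continuous z) (_ : Continuous a) (hν : ∀ k, IsLow c.a (f k) (z k).1.2 ν)
      (hU : ∀ k, (f k).precomp ν ∈ c.U),
      Continuous fun k => g ⟨DObj.mk (X := X.W hX) (f k) (z k),
        c.mk_mem_dom.2 ⟨ν, hν k, hU k⟩⟩ (a k)) :
    KCont fun p : c.dom hX × A => g p.1 p.2 := by
  refine DObj.kCont_desc_isOpen_prod c.isOpen_dom fun p K _ _ _ f z a hf hz ha hm => ?_
  refine continuous_of_open_cover_compact (fun ν : PiHom c.deg p =>
      {k | IsLow c.a (f k) (z k : X.WObj p).1.2 ν ∧ (f k).precomp ν ∈ c.U})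
    (fun ν => c.isOpen_low hf hz ν) (fun k => c.mk_mem_dom.1 (hm k))
    fun ν V _ _ _ e he hV => ?_
  exact h p ν V (fun v => f (e v)) (fun v => z (e v)) (fun v => a (e v)) (hf.comp he) (hz.comp he)
    (ha.comp he) (fun v => (hV v).1) fun v => (hV v).2

/-- The label of a point in the domain. -/
noncomputable def label (z : c.dom hX) : C.DHom c.deg n × X.obj c.deg := z.2.choose

theorem label_mem (z : c.dom hX) : c.label z ∈ labels c.ha c.deg z.1 := z.2.choose_spec.1

theorem label_mem_U (z : c.dom hX) : (c.label z).1 ∈ c.U := z.2.choose_spec.2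

/-- Two labels differ by a permutation, and the slim set `U` admits only the trivial one. -/
theorem label_unique {z : C.DObj (X.W hX) n} {e e' : C.DHom c.deg n × X.obj c.deg}
    (h : e ∈ labels c.ha c.deg z) (hU : e.1 ∈ c.U)
    (h' : e' ∈ labels c.ha c.deg z) (hU' : e'.1 ∈ c.U) : e = e' := by
  obtain ⟨σ, rfl⟩ := eq_of_mem_labels h h'
  obtain rfl := c.slim _ hU σ hU'
  rw [inv_one, PiHom.ofPerm_one, DHom.precomp_id, X.map_id]

theorem label_eq {z : c.dom hX} {e : C.DHom c.deg n × X.obj c.deg}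
    (h : e ∈ labels c.ha c.deg z.1) (hU : e.1 ∈ c.U) : c.label z = e :=
  c.label_unique (c.label_mem z) (c.label_mem_U z) h hU

instance : CompactlyGeneratedSpace (c.dom hX) :=
  CompactlyGeneratedSpace.subtype_of_isOpen c.isOpen_dom

theorem continuous_label_snd : Continuous fun z : c.dom hX => (c.label z).2 := by
  have := c.kCont_dom_prod (hX := hX) (A := PUnit.{u + 1}) (g := fun z _ => (c.label z).2)
    fun p ν K _ _ _ f z a hf hz ha hν hU => by
      refine ((X.map ν.transpose).continuous.comp (continuous_fst.comp
        (continuous_subtype_val.comp hz))).congr fun k => ?_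
      exact (congrArg Prod.snd (c.label_eq (z := ⟨DObj.mk (X := X.W hX) (f k) (z k), _⟩)
        (e := ((f k).precomp ν, X.map ν.transpose (z k : X.WObj p).1.1))
        (show _ ∈ labels c.ha c.deg (DObj.mk (X := X.W hX) (f k) (z k)) from ⟨ν, hν k, rfl⟩)
        (hU k))).symm
  exact (this.comp (f := fun z : c.dom hX => (z, PUnit.unit))
    (Continuous.kCont (by fun_prop))).continuous

/-- If `(e, x)` is the label of a point fixed by `l`, then `(l e, l x)` is again a label of it, so
it equals `(e σ, σ⁻¹ x)` for some `σ`. The chart identifies `σ` with `ρ l`, whence `ρ(l) l x = x`.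
-/
theorem label_fixed {z : (C.D (X.W hX)).obj n} (hz : ∀ l : L, l.1 • z = z) (hm : z ∈ c.dom hX)
    (l : L) : c.graphHom l • (c.label ⟨z, hm⟩).2 = (c.label ⟨z, hm⟩).2 := by
  have h1 := c.label_mem (hX := hX) ⟨z, hm⟩
  have hU := c.label_mem_U (hX := hX) ⟨z, hm⟩
  generalize c.label (hX := hX) ⟨z, hm⟩ = e at *
  have h2 := smul_mem_labels h1 l.1
  rw [hz l] at h2
  obtain ⟨σ, hσ⟩ := eq_of_mem_labels h1 h2
  have h3 := congrArg Prod.fst hσ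
  have h4 : l.1.1 • e.2 = X.map (PiHom.ofPerm σ⁻¹) e.2 := congrArg Prod.snd hσ
  obtain rfl := c.adapted e.1 hU l σ h3
  change X.map (PiHom.ofPerm (c.ρ l)) (l.1.1 • e.2) = e.2
  rw [h4, X.map_map, ← PiHom.ofPerm_mul, mul_inv_cancel, PiHom.ofPerm_one, X.map_id]

theorem place_subsingleton {x : X.obj c.deg} {w : C.DObj (T.W hT) n}
    {z z' : C.DObj (X.W hX) n} (h : z ∈ place c.ha c.U x w) (h' : z' ∈ place c.ha c.U x w) :
    z = z' := by
  obtain ⟨p, f, w, rfl⟩ := w.exists_eq_mk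
  obtain ⟨ν, hν, hU, rfl⟩ := h
  obtain ⟨ν', hν', hU', rfl⟩ := h'
  obtain ⟨σ, rfl⟩ := hν'.1.exists_eq_comp_ofPerm (φ := ν) (hν.range_eq.trans hν'.range_eq.symm)
  rw [← DHom.precomp_precomp] at hU'
  obtain rfl := c.slim _ hU σ hU'
  rfl

theorem place_nonempty (x : X.obj c.deg) {w : C.DObj (T.W hT) n} (hw : w ∈ c.dom hT) :
    (place (hX := hX) c.ha c.U x w).Nonempty := by
  obtain ⟨p, f, w, rfl⟩ := w.exists_eq_mk
  obtain ⟨ν, hν, hU⟩ := c.mk_mem_dom.1 hw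
  exact ⟨_, ν, hν, hU, rfl⟩

/-- The point of `𝔻 W X` with label `x` over a given point of `𝔻 W T`. -/
noncomputable def put (hX : ∀ n, KHausdorff (X.obj n)) (w : c.dom hT) (x : X.obj c.deg) :
    C.DObj (X.W hX) n := (c.place_nonempty (hX := hX) x w.2).choose

theorem put_eq {w : c.dom hT} {x : X.obj c.deg} {z : C.DObj (X.W hX) n}
    (h : z ∈ place c.ha c.U x w.1) : c.put hX w x = z :=
  c.place_subsingleton (c.place_nonempty (hX := hX) x w.2).choose_spec h

theorem kCont_put : KCont fun y : c.dom hT × X.obj c.deg => c.put hX y.1 y.2 := by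
  refine c.kCont_dom_prod (A := X.obj c.deg) (g := fun w x => c.put hX w x)
    fun p ν K _ _ _ f z a hf hz ha hν hU => ?_
  refine (DObj.continuous_mk (X := X.W hX) (x := fun k => WObj.lowPoint ν (a k) (z k).1.2) hf
    ((WObj.continuous_lowPoint ν).comp (ha.prodMk (continuous_snd.comp
      (continuous_subtype_val.comp hz))))).congr fun k => ?_
  exact (c.put_eq (w := ⟨DObj.mk (X := T.W hT) (f k) (z k), _⟩)
    (show _ ∈ place c.ha c.U (a k) (DObj.mk (X := T.W hT) (f k) (z k)) from
      ⟨ν, hν k, hU k, rfl⟩)).symm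

theorem kCont_lowScale : KCont fun y : c.dom hX × unitInterval => lowScale c.ha y.2 y.1.1 := by
  have := c.kCont_dom_prod (hX := hX) (A := ULift.{u} unitInterval)
    (g := fun z s => lowScale c.ha s.down z.1) fun p ν K _ _ _ f z a hf hz ha hν hU => by
      refine (DObj.continuous_mk (X := X.W hX) (x := fun k => WObj.scale ν.range (a k).down (z k)) hf
        ((WObj.continuous_scale ν.range).comp
          ((continuous_uliftDown.comp ha).prodMk hz))).congr fun k => ?_
      rw [(hν k).range_eq]
      rfl
  exact this.comp (f := fun y : c.dom hX × unitInterval => (y.1, ULift.up.{u} y.2))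
    (Continuous.kCont (by fun_prop))

/-- The element `l` renumbers the low coordinates of `w` by a permutation which `adapted` identifies
through `ρ l`; since `x` is fixed by the image of `l` under `graphHom`, the renumbering is
compensated by the action of `l` on `x`. -/
theorem put_fixed {w : (C.D (T.W hT)).obj n} (hw : ∀ l : L, l.1 • w = w) (hm : w ∈ c.dom hT)
    {x : X.obj c.deg} (hx : ∀ l : L, c.graphHom l • x = x) (l : L) :
    HSMul.hSMul (β := (C.D (X.W hX)).obj n) l.1 (c.put hX ⟨w, hm⟩ x) = c.put hX ⟨w, hm⟩ x := by
  obtain ⟨p, f, w, rfl⟩ := DObj.exists_eq_mk (C := C) (X := T.W hT) w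
  obtain ⟨ν, hν, hU⟩ := c.mk_mem_dom.1 hm
  have hwl : DObj.mk (X := T.W hT) (l.1 • f) (HSMul.hSMul (β := T.WObj p) l.1.1 w) =
    DObj.mk (X := T.W hT) f w := hw l
  have h1 : (f.precomp ν, T.map ν.transpose (w : T.WObj p).1.1) ∈ labels c.ha c.deg
    (DObj.mk (X := T.W hT) f w) := ⟨ν, hν, rfl⟩
  rw [← hwl] at h1
  obtain ⟨ν', hν', he⟩ : ∃ ν' : PiHom c.deg p, IsLow c.a (l.1 • f) (w : T.WObj p).1.2 ν' ∧ _ := h1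
  have he1 : f.precomp ν = (l.1 • f).precomp ν' := congrArg Prod.fst he
  have hU' : (l.1 • f).precomp ν' ∈ c.U := he1 ▸ hU
  have h2 : c.put hX ⟨_, hm⟩ x = DObj.mk (X := X.W hX) (l.1 • f)
      (WObj.lowPoint ν' x (w : T.WObj p).1.2) := by
    refine c.put_eq ?_
    change _ ∈ place c.ha c.U x (DObj.mk (X := T.W hT) f w)
    rw [← hwl]
    exact ⟨ν', hν', hU', rfl⟩
  have h3 : c.put hX ⟨_, hm⟩ x = DObj.mk (X := X.W hX) f
      (WObj.lowPoint ν x (w : T.WObj p).1.2) :=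
    c.put_eq (show _ ∈ place c.ha c.U x (DObj.mk (X := T.W hT) f w) from ⟨ν, hν, hU, rfl⟩)
  have hrange : ν.range = ν'.range := by rw [hν.range_eq, hν'.range_eq, DHom.supp_prod_smul]
  obtain ⟨σ, hσ⟩ := hν'.1.exists_eq_comp_ofPerm (φ := ν) hrange
  have h4 : l.1 • f.precomp ν = (f.precomp ν).precomp (PiHom.ofPerm σ⁻¹) := by
    have h5 := he1
    rw [hσ, ← DHom.precomp_precomp, DHom.prod_smul_precomp] at h5
    conv_rhs => rw [h5]
    rw [DHom.precomp_precomp, ← PiHom.ofPerm_mul, mul_inv_cancel, PiHom.ofPerm_one,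
      DHom.precomp_id]
  have h6 := c.adapted _ hU l _ h4
  have h7 : X.map (PiHom.ofPerm σ) x = l.1.1 • x := by
    have h8 : X.map (PiHom.ofPerm (c.ρ l)) (l.1.1 • x) = x := hx l
    conv_lhs => rw [← h8]
    rw [X.map_map, ← PiHom.ofPerm_mul, ← h6, mul_inv_cancel, PiHom.ofPerm_one, X.map_id]
  refine Eq.trans ?_ h2.symm
  refine (congrArg (HSMul.hSMul (β := (C.D (X.W hX)).obj n) l.1) h3).trans ?_
  refine congrArg (DObj.mk (X := X.W hX) (l.1 • f)) (Subtype.ext (Prod.ext ?_ ?_))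
  · change l.1.1 • X.map ν x = X.map ν' x
    rw [hσ, ← X.map_map, h7, X.map_smul]
  · funext i
    change (WObj.lowPoint ν x (w : T.WObj p).1.2).1.2 i = (WObj.lowPoint ν' x (w : T.WObj p).1.2).1.2 i
    by_cases hi : i ∈ ν.range
    · rw [WObj.lowPoint_val.1 hi, WObj.lowPoint_val.1 (hrange ▸ hi)]
    · rw [WObj.lowPoint_val.2 hi, WObj.lowPoint_val.2 (hrange ▸ hi)]

end Chart

end GOperad

/-! ### The homotopy type of the domains of charts. -/

namespace PiDiagram.WObj

variable {G : Type v} [Group G] {X T : PiDiagram.{u} G} {n q : ℕ}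

theorem scale_le (S : Set (Fin n)) (s : unitInterval) (z : X.WObj n) (i : Fin n) :
    (scale S s z).1.2 i ≤ z.1.2 i := by
  by_cases hi : i ∈ S
  · rw [scale_val.1 hi]
    exact unitInterval.mul_le_right
  · rw [scale_val.2 hi]

theorem lowPoint_eq_scale (ν : PiHom q n) (x : X.obj q) (w : T.WObj n) (i : Fin n) :
    (lowPoint ν x w.1.2).1.2 i = (scale ν.range 1 w).1.2 i := by
  by_cases hi : i ∈ ν.range
  · rw [lowPoint_val.1 hi, scale_val.1 hi]
    simp
  · rw [lowPoint_val.2 hi, scale_val.2 hi]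

end PiDiagram.WObj

namespace GOperad

variable {G : Type v} [Group G] {C : GOperad.{u} G} {n p q r : ℕ}

open PiDiagram

namespace Chart

variable {L : Subgroup (G × Equiv.Perm (Fin n))} (c c' : C.Chart L) {X T : PiDiagram.{u} G}
  {hX : ∀ n, KHausdorff (X.obj n)} {hT : ∀ n, KHausdorff (T.obj n)}

theorem lowScale_mk_of_isLow {f : C.DHom p n} {z : X.WObj p} {ν : PiHom c.deg p}
    (hν : IsLow c.a f z.1.2 ν) (s : unitInterval) :
    lowScale c.ha s (DObj.mk (X := X.W hX) f z) =
      DObj.mk (X := X.W hX) f (WObj.scale ν.range s z) := by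
  rw [hν.range_eq]
  rfl

/-- The low coordinates of the chart of smaller degree are also low for the other one; decreasing
them moves no coordinate across the other threshold. -/
theorem lowScale_mem_dom {c c' : C.Chart L} (h : c.deg ≤ c'.deg) {z : C.DObj (X.W hX) n}
    (hz : z ∈ c.dom hX) (hz' : z ∈ c'.dom hX) (s : unitInterval) :
    lowScale c.ha s z ∈ c'.dom hX := by
  obtain ⟨p, f, z, rfl⟩ := z.exists_eq_mk
  obtain ⟨ν, hν, hU⟩ := c.mk_mem_dom.1 hz
  obtain ⟨ν', hν', hU'⟩ := c'.mk_mem_dom.1 hz'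
  have hsub := hν.range_subset hν' h
  rw [c.lowScale_mk_of_isLow hν]
  refine c'.mk_mem_dom.2 ⟨ν', hν'.of_le (fun i _ => WObj.scale_le _ _ _ i)
    fun i hi => WObj.scale_val.2 fun hi' => hi (hsub hi'), hU'⟩

theorem put_mk {f : C.DHom p n} {w : T.WObj p} {ν : PiHom c.deg p} (hν : IsLow c.a f w.1.2 ν)
    (hU : f.precomp ν ∈ c.U) (hm : DObj.mk (X := T.W hT) f w ∈ c.dom hT) (x : X.obj c.deg) :
    c.put hX ⟨DObj.mk (X := T.W hT) f w, hm⟩ x =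
      DObj.mk (X := X.W hX) f (WObj.lowPoint ν x w.1.2) :=
  c.put_eq (show _ ∈ place c.ha c.U x (DObj.mk (X := T.W hT) f w) from ⟨ν, hν, hU, rfl⟩)

theorem isLow_lowPoint {a b : unitInterval} {f : C.DHom p n} {t : Fin p → unitInterval}
    {ν : PiHom q p} {ν' : PiHom r p} (h : IsLow a f t ν) (h' : IsLow b f t ν') (hqr : q ≤ r)
    (x : X.obj q) : IsLow b f (WObj.lowPoint ν x t).1.2 ν' := by
  have hsub := h.range_subset h' hqr
  refine h'.of_le (fun i hi => ?_) fun i hi => WObj.lowPoint_val.2 fun hi' => hi (hsub hi')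
  by_cases hi' : i ∈ ν.range
  · rw [WObj.lowPoint_val.1 hi']
    exact unitInterval.nonneg'
  · rw [WObj.lowPoint_val.2 hi']

theorem put_mem_dom {c c' : C.Chart L} (h : c.deg ≤ c'.deg) {w : C.DObj (T.W hT) n}
    (hw : w ∈ c.dom hT) (hw' : w ∈ c'.dom hT) (x : X.obj c.deg) :
    c.put hX ⟨w, hw⟩ x ∈ c'.dom hX := by
  obtain ⟨p, f, w, rfl⟩ := w.exists_eq_mk
  obtain ⟨ν, hν, hU⟩ := c.mk_mem_dom.1 hw
  obtain ⟨ν', hν', hU'⟩ := c'.mk_mem_dom.1 hw'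
  rw [c.put_mk (w := w) hν hU]
  exact c'.mk_mem_dom.2 ⟨ν', isLow_lowPoint hν hν' h x, hU'⟩

theorem label_put (w : c.dom hT) (x : X.obj c.deg)
    (hm : c.put hX w x ∈ c.dom hX) : (c.label ⟨c.put hX w x, hm⟩).2 = x := by
  obtain ⟨w, hw⟩ := w
  obtain ⟨p, f, w, rfl⟩ := w.exists_eq_mk
  obtain ⟨ν, hν, hU⟩ := c.mk_mem_dom.1 hw
  have h1 : (f.precomp ν, x) ∈ labels c.ha c.deg (c.put hX ⟨DObj.mk (X := T.W hT) f w, hw⟩ x) := by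
    rw [c.put_mk (w := w) hν hU]
    refine ⟨ν, isLow_lowPoint hν hν le_rfl x, Prod.ext rfl ?_⟩
    exact (X.map_transpose_map hν.1 x).symm
  exact congrArg Prod.snd (c.label_eq (z := ⟨c.put hX ⟨DObj.mk (X := T.W hT) f w, hw⟩ x, hm⟩)
    (e := (f.precomp ν, x)) h1 hU)

/-- Membership depends only on the morphism and the coordinates `t`, which are the same for a point
and its image. -/
theorem map_mem_dom (g : Hom X T) {z : (C.D (X.W hX)).obj n} :
    (C.DMap (WMap g hX hT)).app n z ∈ c.dom hT ↔ z ∈ c.dom hX :=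
  ⟨fun ⟨_, he, hU⟩ => (exists_mem_labels_of_map g he).elim fun _ h => ⟨_, h, hU⟩,
    fun ⟨_, he, hU⟩ => ⟨_, map_mem_labels g he, hU⟩⟩

theorem label_map (g : Hom X T) {z : (C.D (X.W hX)).obj n} (hm : z ∈ c.dom hX)
    (hm' : (C.DMap (WMap g hX hT)).app n z ∈ c.dom hT) :
    c.label ⟨(C.DMap (WMap g hX hT)).app n z, hm'⟩ =
      ((c.label ⟨z, hm⟩).1, g.app _ (c.label ⟨z, hm⟩).2) :=
  c.label_eq (map_mem_labels g (c.label_mem ⟨z, hm⟩)) (c.label_mem_U ⟨z, hm⟩)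

/-- The map `𝔻 W X → 𝔻 W *` to the value at the terminal diagram. -/
noncomputable abbrev collapse (C : GOperad.{u} G) (hX : ∀ n, KHausdorff (X.obj n)) :
    Hom (C.D (X.W hX)) (C.D ((terminal.{u} G).W (terminal_kHausdorff G))) :=
  C.DMap (WMap X.toTerminal hX (terminal_kHausdorff G))

theorem collapse_put (w : c.dom (terminal_kHausdorff.{u} G)) (x : X.obj c.deg) :
    (collapse C hX).app n (c.put hX w x) = lowScale c.ha 1 w.1 := by
  obtain ⟨w, hw⟩ := w
  obtain ⟨p, f, w, rfl⟩ := w.exists_eq_mk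
  obtain ⟨ν, hν, hU⟩ := c.mk_mem_dom.1 hw
  rw [c.put_mk (w := w) hν hU, c.lowScale_mk_of_isLow hν]
  refine congrArg (DObj.mk (X := (terminal G).W _) f) (Subtype.ext (Prod.ext rfl (funext fun i => ?_)))
  exact WObj.lowPoint_eq_scale ν x (w : (terminal G).WObj p) i

/-- The coordinates above the threshold are nonzero, so `x` is degenerate in all of them and is
recovered from its restriction to the low ones. Putting the label back therefore only sets the low
coordinates to `0`. -/
theorem put_collapse {z : (C.D (X.W hX)).obj n} (hz : z ∈ c.dom hX)
    (hz' : (collapse C hX).app n z ∈ c.dom (terminal_kHausdorff.{u} G)) :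
    c.put hX ⟨(collapse C hX).app n z, hz'⟩ (c.label ⟨z, hz⟩).2 = lowScale c.ha 1 z := by
  obtain ⟨p, f, z, hf, rfl⟩ := DObj.exists_effective_rep (C := C) (X := X.W hX) z
  obtain ⟨ν, hν, hU⟩ := c.mk_mem_dom.1 hz
  have h1 : c.label ⟨DObj.mk (X := X.W hX) f z, hz⟩ =
      (f.precomp ν, X.map ν.transpose (z : X.WObj p).1.1) :=
    c.label_eq (show _ ∈ labels c.ha c.deg (DObj.mk (X := X.W hX) f z) from ⟨ν, hν, rfl⟩) hU
  rw [h1]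
  refine (c.put_mk (T := terminal G) (hX := hX) (f := f)
    (w := (WMap X.toTerminal hX (terminal_kHausdorff G)).app p z) hν hU hz' _).trans ?_
  refine Eq.trans ?_ (c.lowScale_mk_of_isLow hν 1).symm
  refine congrArg (DObj.mk (X := X.W hX) f) (Subtype.ext (Prod.ext ?_ (funext fun i => ?_)))
  · change X.map ν (X.map ν.transpose (z : X.WObj p).1.1) = (z : X.WObj p).1.1
    rw [X.map_map, PiHom.comp_transpose_self, ← compl_compl ν.range]
    refine map_restr_compl_of_forall fun i hi => (z : X.WObj p).2 i fun h0 => ?_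
    rcases hν.2.2 i (hf i) with h | h
    · exact hi h.1
    · rw [h0] at h
      exact absurd h.2 (not_lt.2 unitInterval.nonneg')
  · exact WObj.lowPoint_eq_scale ν _ (z : X.WObj p) i

/-- Over an intersection of the domains of charts, the fixed points of `𝔻 W X` are weakly equivalent
to the product of those for the terminal diagram and the fixed points of the space of labels. -/
theorem exists_isWeakEquiv_prod (s : Finset (C.Chart L)) (hc : c ∈ s)
    (hmin : ∀ c' ∈ s, c.deg ≤ c'.deg)
    (S : Set (MulAction.fixedPoints L ((C.D (X.W hX)).obj n)))
    (hS : ∀ z, z ∈ S ↔ ∀ c' ∈ s, z.1 ∈ c'.dom hX)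
    (S' : Set (MulAction.fixedPoints L
      ((C.D ((terminal.{u} G).W (terminal_kHausdorff G))).obj n)))
    (hS' : ∀ z, z ∈ S' ↔ ∀ c' ∈ s, z.1 ∈ c'.dom (terminal_kHausdorff G)) :
    ∃ Θ : C(S, S' × MulAction.fixedPoints c.graphHom.range (X.obj c.deg)), IsWeakEquiv Θ ∧
      ∀ z : S, (Θ z).1.1.1 = (collapse C hX).app n z.1.1 ∧
        ∀ hz, (Θ z).2.1 = (c.label ⟨z.1.1, hz⟩).2 := by
  have hdom : ∀ z : S, z.1.1 ∈ c.dom hX := fun z => (hS z.1).1 z.2 c hc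
  have hdom' : ∀ w : S', w.1.1 ∈ c.dom (terminal_kHausdorff G) := fun w => (hS' w.1).1 w.2 c hc
  have hfix : ∀ z : MulAction.fixedPoints L ((C.D (X.W hX)).obj n), ∀ l : L, l.1 • z.1 = z.1 :=
    fun z l => z.2 l
  have hfix' : ∀ z : MulAction.fixedPoints L
      ((C.D ((terminal.{u} G).W (terminal_kHausdorff G))).obj n), ∀ l : L, l.1 • z.1 = z.1 :=
    fun z l => z.2 l
  let col : MulAction.fixedPoints L ((C.D (X.W hX)).obj n) → MulAction.fixedPoints L
      ((C.D ((terminal.{u} G).W (terminal_kHausdorff G))).obj n) := fun z =>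
    ⟨(collapse C hX).app n z.1, fun l =>
      ((collapse C hX).app_prod_smul n l.1 z.1).symm.trans (congrArg _ (hfix z l))⟩
  have hcol : Continuous col :=
    Continuous.subtype_mk (((collapse C hX).app n).continuous.comp continuous_subtype_val) _
  have hlab : ∀ z : S, (c.label ⟨z.1.1, hdom z⟩).2 ∈
      MulAction.fixedPoints c.graphHom.range (X.obj c.deg) := by
    rintro z ⟨_, l, rfl⟩
    exact c.label_fixed (hfix z.1) (hdom z) l
  let Θ : C(S, S' × MulAction.fixedPoints c.graphHom.range (X.obj c.deg)) :=
    { toFun := fun z => (⟨col z.1, (hS' _).2 fun c' hc' => (c'.map_mem_dom _).2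
          ((hS z.1).1 z.2 c' hc')⟩, ⟨_, hlab z⟩)
      continuous_toFun := (Continuous.subtype_mk (hcol.comp continuous_subtype_val) _).prodMk
        (Continuous.subtype_mk (c.continuous_label_snd.comp (Continuous.subtype_mk
          (continuous_subtype_val.comp continuous_subtype_val) hdom)) hlab) }
  let put : S' × MulAction.fixedPoints c.graphHom.range (X.obj c.deg) → S := fun y =>
    ⟨⟨c.put hX ⟨y.1.1.1, hdom' y.1⟩ y.2.1, fun l => c.put_fixed (hfix' y.1.1) (hdom' y.1)
      (fun l => y.2.2 ⟨_, l, rfl⟩) l⟩, (hS _).2 fun c' hc' =>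
        put_mem_dom (hmin c' hc') (hdom' y.1) ((hS' y.1.1).1 y.1.2 c' hc') y.2.1⟩
  have hput : KCont put := fun K _ _ _ y hy => Continuous.subtype_mk (Continuous.subtype_mk
    (c.kCont_put (hX := hX) K (fun k => (⟨(y k).1.1.1, hdom' (y k).1⟩, (y k).2.1))
      ((Continuous.subtype_mk (by fun_prop) _).prodMk (by fun_prop))) _) _
  have hscale : ∀ {Z : PiDiagram.{u} G} {hZ : ∀ n, KHausdorff (Z.obj n)} (t : unitInterval)
      (z : (C.D (Z.W hZ)).obj n), (∀ l : L, l.1 • z = z) → ∀ l : L,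
      HSMul.hSMul (β := (C.D (Z.W hZ)).obj n) l.1 (lowScale c.ha t z) = lowScale c.ha t z :=
    fun t z hz l => (lowScale_smul t l.1 z).symm.trans (congrArg (lowScale c.ha t) (hz l))
  -- Both composites of `Θ` and `put` multiply the low coordinates with `0`, so scaling them with `1
  -- - t` connects the identity to each. Minimality of the degree keeps the deformation inside the
  -- domains of the other charts.
  let h : S → unitInterval → S := fun z t => ⟨⟨lowScale c.ha t z.1.1, fun l =>
    hscale t _ (hfix z.1) l⟩, (hS _).2 fun c' hc' =>
      lowScale_mem_dom (hmin c' hc') (hdom z) ((hS z.1).1 z.2 c' hc') t⟩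
  have hh : KCont fun p : S × unitInterval => h p.1 p.2 := fun K _ _ _ y hy =>
    Continuous.subtype_mk (Continuous.subtype_mk (c.kCont_lowScale (hX := hX) K
      (fun k => (⟨(y k).1.1.1, hdom (y k).1⟩, (y k).2))
      ((Continuous.subtype_mk (by fun_prop) _).prodMk (by fun_prop))) _) _
  let k : S' × MulAction.fixedPoints c.graphHom.range (X.obj c.deg) → unitInterval →
      S' × MulAction.fixedPoints c.graphHom.range (X.obj c.deg) := fun y t =>
    (⟨⟨lowScale c.ha t y.1.1.1, fun l => hscale t _ (hfix' y.1.1) l⟩, (hS' _).2 fun c' hc' =>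
      lowScale_mem_dom (hmin c' hc') (hdom' y.1) ((hS' y.1.1).1 y.1.2 c' hc') t⟩, y.2)
  have hk : KCont fun p : (S' × MulAction.fixedPoints c.graphHom.range (X.obj c.deg)) ×
      unitInterval => k p.1 p.2 := fun K _ _ _ y hy =>
    (Continuous.subtype_mk (Continuous.subtype_mk (c.kCont_lowScale
      (hX := terminal_kHausdorff.{u} G) K (fun k => (⟨(y k).1.1.1.1, hdom' (y k).1.1⟩, (y k).2))
      ((Continuous.subtype_mk (by fun_prop) _).prodMk (by fun_prop))) _) _).prodMk (by fun_prop)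
  refine ⟨Θ, isWeakEquiv_of_kHomotopyEquiv hput h hh k hk (fun z => ?_) (fun z => ?_)
    (fun y => ?_) (fun y => ?_), fun z => ⟨rfl, fun _ => rfl⟩⟩
  · exact Subtype.ext (Subtype.ext (lowScale_zero (ha := c.ha) z.1.1))
  · exact Subtype.ext (Subtype.ext (c.put_collapse (hdom z) _).symm)
  · exact Prod.ext (Subtype.ext (Subtype.ext (lowScale_zero (ha := c.ha) y.1.1.1))) rfl
  · exact Prod.ext (Subtype.ext (Subtype.ext (c.collapse_put ⟨y.1.1.1, hdom' y.1⟩ y.2.1).symm))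
      (Subtype.ext (c.label_put ⟨y.1.1.1, hdom' y.1⟩ y.2.1 _).symm)

end Chart

end GOperad

/-! ### Weak equivalences between values of `𝔻 W`. -/

namespace GOperad

variable {G : Type v} [Group G] {C : GOperad.{u} G} {n p q r : ℕ}

open PiDiagram

theorem IsSigmaFree.eq_of_precomp_eq (hC : C.IsSigmaFree) {e : C.DHom q n} (he : e.IsEffective)
    {σ τ : Equiv.Perm (Fin q)} (h : e.precomp (PiHom.ofPerm σ) = e.precomp (PiHom.ofPerm τ)) :
    σ = τ := by
  obtain ⟨U, -, hU, hs⟩ := DHom.exists_slim hC e he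
  have h1 : e.precomp (PiHom.ofPerm (σ * τ⁻¹)) = e := by
    rw [PiHom.ofPerm_mul, ← DHom.precomp_precomp, h, DHom.precomp_precomp, ← PiHom.ofPerm_mul,
      mul_inv_cancel, PiHom.ofPerm_one, DHom.precomp_id]
  exact mul_inv_eq_one.1 (hs e hU (σ * τ⁻¹) (h1.symm ▸ hU))

/-- A point has finitely many coordinates, so some threshold below `1` avoids them all. -/
theorem exists_isLow {f : C.DHom p n} (hf : f.IsEffective) (t : Fin p → unitInterval) :
    ∃ (a : unitInterval) (_ : a < 1) (q : ℕ) (ν : PiHom q p), IsLow a f t ν := by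
  obtain ⟨a, ha, hat⟩ := (Set.Ico_infinite (zero_lt_one (α := unitInterval))).exists_notMem_finite
    (Set.finite_range t)
  refine ⟨a, ha.2, _, PiHom.inc {i | t i < a}, PiHom.isInj_inc _, fun i _ => hf i, fun i _ => ?_⟩
  rw [PiHom.range_inc]
  rcases lt_trichotomy (t i) a with h | h | h
  · exact Or.inl ⟨h, h⟩
  · exact absurd ⟨i, h⟩ hat
  · exact Or.inr ⟨h.not_gt, h⟩

variable {L : Subgroup (G × Equiv.Perm (Fin n))} {X Y : PiDiagram.{u} G}
  {hX : ∀ n, KHausdorff (X.obj n)} {hY : ∀ n, KHausdorff (Y.obj n)}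

/-- Let `e` be the morphism of a label of `z`. Since `z` is fixed, `l e = e ρ(l)` for every `l`, and
freeness of the action of permutations on effective morphisms makes `ρ` a homomorphism. -/
theorem exists_chart [Finite G] (hC : C.IsSigmaFree) {z : (C.D (X.W hX)).obj n}
    (hz : ∀ l : L, l.1 • z = z) : ∃ c : C.Chart L, z ∈ c.dom hX := by
  obtain ⟨p, f, w, hf, rfl⟩ := DObj.exists_effective_rep (C := C) (X := X.W hX) z
  obtain ⟨a, ha, q, ν, hν⟩ := exists_isLow hf (w : X.WObj p).1.2
  have he : (f.precomp ν, X.map ν.transpose (w : X.WObj p).1.1) ∈ labels ha q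
    (DObj.mk (X := X.W hX) f w) := ⟨ν, hν, rfl⟩
  have heff := isEffective_of_mem_labels he
  generalize DObj.mk (X := X.W hX) f w = z at *
  generalize f.precomp ν = e, X.map ν.transpose (w : X.WObj p).1.1 = x at *
  obtain ⟨U, hU, heU, hslim⟩ := DHom.exists_slim hC e heff
  have h1 : ∀ l : L, ∃ σ, l.1 • e = e.precomp (PiHom.ofPerm σ) := by
    intro l
    have h2 := smul_mem_labels he l.1
    rw [hz l] at h2
    obtain ⟨σ, hσ⟩ := eq_of_mem_labels he h2
    exact ⟨σ, congrArg Prod.fst hσ⟩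
  choose ρ hρ using h1
  let ρ' : L →* Equiv.Perm (Fin q) := MonoidHom.mk' ρ fun l l' =>
    hC.eq_of_precomp_eq heff <| by
      have h3 : (l * l').1 • e = l.1 • l'.1 • e := mul_smul _ _ _
      rw [← hρ, h3, hρ l', ← DHom.prod_smul_precomp, hρ l, DHom.precomp_precomp, PiHom.ofPerm_mul]
  -- Shrink `U` so that `(l e) ρ(l)⁻¹` remains in it for all `l` of the finite group `L`. If then `l
  -- e = e σ`, both `e` and `e σ ρ(l)⁻¹` lie in `U`, so slimness gives `σ = ρ(l)`.
  refine ⟨⟨q, a, ha, U ∩ ⋂ l : L, {e | (l.1 • e).precomp (PiHom.ofPerm (ρ l)⁻¹) ∈ U}, ?_, ?_, ρ', ?_⟩,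
    _, he, heU, ?_⟩
  · refine hU.inter (isOpen_iInter_of_finite fun l => hU.preimage ?_)
    exact (DHom.continuous_precomp _).comp (DHom.continuous_prod_smul l.1)
  · exact fun e he σ hσ => hslim e he.1 σ hσ.1
  · intro e he l σ hσ
    have h2 : (l.1 • e).precomp (PiHom.ofPerm (ρ l)⁻¹) ∈ U := Set.mem_iInter.1 he.2 l
    rw [hσ, DHom.precomp_precomp, ← PiHom.ofPerm_mul] at h2
    exact mul_inv_eq_one.1 (hslim e he.1 _ h2)
  · refine Set.mem_iInter.2 fun l => ?_
    change (l.1 • e).precomp (PiHom.ofPerm (ρ l)⁻¹) ∈ U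
    rw [hρ, DHom.precomp_precomp, ← PiHom.ofPerm_mul, mul_inv_cancel, PiHom.ofPerm_one,
      DHom.precomp_id]
    exact heU

/-- If `f` is a weak equivalence on the fixed points of all the images of `L` in the groups
`G × Σ_q`, then `𝔻 W f` is a weak equivalence on the fixed points of `L`. -/
theorem isWeakEquiv_fixedMap_DMap_WMap [Finite G] (hC : C.IsSigmaFree) (f : Hom X Y)
    (hf : ∀ (q : ℕ) (ρ : L →* Equiv.Perm (Fin q)), IsWeakEquiv (fixedMap (f.app q)
      (f.app_prod_smul q) (((MonoidHom.fst _ _).comp L.subtype).prod ρ).range)) :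
    IsWeakEquiv (fixedMap ((C.DMap (WMap f hX hY)).app n)
      ((C.DMap (WMap f hX hY)).app_prod_smul n) L) := by
  refine isWeakEquiv_of_open_cover _ (fun c : C.Chart L => {z | z.1 ∈ c.dom hY})
    (fun c => c.isOpen_dom.preimage continuous_subtype_val)
    (fun z => exists_chart hC fun l => z.2 l) fun s hs => ?_
  -- On a finite intersection of domains the chart of least degree is used, for its deformation
  -- preserves the other domains.
  obtain ⟨c, hc, hmin⟩ := s.exists_min_image Chart.deg hs
  obtain ⟨Θ, hΘ, hΘ'⟩ := c.exists_isWeakEquiv_prod (hX := hX) s hc hmin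
    (fixedMap ((C.DMap (WMap f hX hY)).app n) ((C.DMap (WMap f hX hY)).app_prod_smul n) L ⁻¹'
      ⋂ c ∈ s, {z | z.1 ∈ c.dom hY})
    (fun z => by
      rw [Set.mem_preimage, Set.mem_iInter₂]
      exact forall₂_congr fun c' _ => c'.map_mem_dom f)
    {z | ∀ c' ∈ s, z.1 ∈ c'.dom (terminal_kHausdorff G)} (fun z => Iff.rfl)
  obtain ⟨Θ', hΘ1, hΘ2⟩ := c.exists_isWeakEquiv_prod (hX := hY) s hc hmin
    (⋂ c ∈ s, {z | z.1 ∈ c.dom hY}) (fun z => by rw [Set.mem_iInter₂]; rfl)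
    {z | ∀ c' ∈ s, z.1 ∈ c'.dom (terminal_kHausdorff G)} (fun z => Iff.rfl)
  refine hΘ1.of_comp_left ?_
  -- The factor for the terminal diagram is the same for `X` and `Y`; under the two product
  -- decompositions the map becomes the identity times `f` on labels.
  have h := (IsWeakEquiv.id.prodMap (hf c.deg c.ρ)).comp hΘ
  refine (congrArg IsWeakEquiv (ContinuousMap.ext fun z => ?_)).mp h
  have hz' : (fixedMap ((C.DMap (WMap f hX hY)).app n)
      ((C.DMap (WMap f hX hY)).app_prod_smul n) L z.1).1 ∈ c.dom hY := Set.mem_iInter₂.1 z.2 c hc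
  have hz : z.1.1 ∈ c.dom hX := (c.map_mem_dom f).1 hz'
  refine Prod.ext (Subtype.ext (Subtype.ext ?_)) (Subtype.ext ?_)
  · refine ((hΘ' z).1).trans (Eq.trans ?_ (hΘ2 _).1.symm)
    obtain ⟨p, f', w, h'⟩ := DObj.exists_eq_mk (C := C) (X := X.W hX) z.1.1
    change (Chart.collapse C hX).app n z.1.1 = (Chart.collapse C hY).app n ((C.DMap (WMap f hX hY)).app n z.1.1)
    rw [h']
    rfl
  · refine (congrArg (f.app c.deg) ((hΘ' z).2 hz)).trans (Eq.trans ?_ ((hΘ2 _).2 hz').symm)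
    exact (congrArg Prod.snd (c.label_map f hz hz')).symm

end GOperad

/-! ### Level equivalences and graphs of partially defined homomorphisms. -/

namespace PiHom

/-- A finite `M`-set embeds, as an `M`-set, into a finite `G`-set, for any inclusion `M → G`. -/
theorem exists_equivariant_embedding {G M : Type*} [Group G] [Finite G] [Group M] (j : M →* G)
    (hj : Function.Injective j) {q : ℕ} (ρ : M →* Equiv.Perm (Fin q)) :
    ∃ (N : ℕ) (α : G →* Equiv.Perm (Fin N)) (ι : PiHom q N), ι.IsInj ∧
      ∀ m, (ofPerm (α (j m))).comp ι = ι.comp (ofPerm (ρ m)) := by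
  classical
  have := Fintype.ofFinite G
  -- Functions on `G` with right translation, as in coinduction; the value `none` allows functions
  -- supported on the image of `M`, so that no equivariance condition needs to be imposed.
  let A := G → Option (Fin q)
  let e : A ≃ Fin (Fintype.card A) := Fintype.equivFin A
  let β : G →* Equiv.Perm A :=
    { toFun := fun g => ⟨fun φ x => φ (x * g), fun φ x => φ (x * g⁻¹),
        fun φ => funext fun x => by simp, fun φ => funext fun x => by simp⟩
      map_one' := Equiv.ext fun φ => funext fun x => by simp
      map_mul' := fun g h => Equiv.ext fun φ => funext fun x => by simp [mul_assoc] }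
  let α : G →* Equiv.Perm (Fin (Fintype.card A)) :=
    { toFun := fun g => e.permCongr (β g)
      map_one' := by rw [map_one]; ext; simp
      map_mul' := fun g h => by rw [map_mul]; ext; simp }
  -- The element `i` becomes its orbit function `m ↦ ρ m i` on the image of `M`, and `none`
  -- elsewhere.
  let ι : Fin q → A := fun i g => (Function.partialInv j g).map fun m => ρ m i
  have hp := hj.isPartialInv
  have hι : Function.Injective ι := fun i i' h => by
    have h1 := congrFun h 1
    have h2 : Function.partialInv j 1 = some 1 := (hp _ _).2 (map_one j)
    simpa [ι, h2] using h1
  have hβ : ∀ m i, β (j m) (ι i) = ι (ρ m i) := by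
    intro m i
    funext g
    change (Function.partialInv j (g * j m)).map _ = (Function.partialInv j g).map _
    refine Option.ext fun y => ?_
    simp only [Option.map_eq_some_iff]
    constructor
    · rintro ⟨m', h1, rfl⟩
      refine ⟨m' * m⁻¹, (hp _ _).2 ?_, by simp⟩
      rw [map_mul, (hp _ _).1 h1, map_inv, mul_inv_cancel_right]
    · rintro ⟨m', h1, rfl⟩
      refine ⟨m' * m, (hp _ _).2 ?_, by simp⟩
      rw [map_mul, (hp _ _).1 h1]
  refine ⟨_, α, ⟨fun i => some (e (ι i)), BasedMap.isPi_iff.2 fun k i i' h h' =>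
    hι (e.injective (Option.some_inj.1 (h.trans h'.symm)))⟩, fun i => ⟨_, rfl⟩, fun m => ?_⟩
  refine Subtype.ext (funext fun i => ?_)
  change some (e (β (j m) (e.symm (e (ι i))))) = some (e (ι (ρ m i)))
  rw [Equiv.symm_apply_apply, hβ]

end PiHom

section

variable {A B D : Type u} [TopologicalSpace A] [TopologicalSpace B] [TopologicalSpace D]
  {K : Type v} [Group K] [MulAction K A] [MulAction K B] [MulAction K D]

/-- A map of fixed point spaces is a weak equivalence if its composite with a map that has a homotopy
right inverse which is a weak equivalence on fixed points is one. -/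
theorem isWeakEquiv_fixedMap_of_comp_right {f : C(B, D)} (hf : ∀ (k : K) b, f (k • b) = k • f b)
    {p : C(A, B)} (hp : ∀ (k : K) a, p (k • a) = k • p a)
    {r : C(B, A)} (hr : ∀ (k : K) b, r (k • b) = k • r b) (h : C(B × unitInterval, B))
    (hh : ∀ (k : K) b t, h (k • b, t) = k • h (b, t)) (h0 : ∀ b, h (b, 0) = b)
    (h1 : ∀ b, h (b, 1) = p (r b)) {L : Subgroup K} (hL : IsWeakEquiv (fixedMap r hr L))
    (hfp : IsWeakEquiv ((fixedMap f hf L).comp (fixedMap p hp L))) :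
    IsWeakEquiv (fixedMap f hf L) :=
  hfp.of_comp_right hL
    ⟨fun y => ⟨h (y.1.1, y.2), fun l => (hh l.1 y.1.1 y.2).symm.trans
      (congrArg (fun b => h (b, y.2)) (y.1.2 l))⟩,
      Continuous.subtype_mk (h.continuous.comp (by fun_prop)) _⟩
    (fun b => Subtype.ext (h0 b.1)) fun b => Subtype.ext (h1 b.1)

/-- Equivariant homotopy equivalences are weak equivalences on fixed points. -/
theorem isWeakEquiv_fixedMap_of_homotopyEquiv {p : C(A, B)} (hp : ∀ (k : K) a, p (k • a) = k • p a)
    {r : C(B, A)} (hr : ∀ (k : K) b, r (k • b) = k • r b) (h : C(B × unitInterval, B))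
    (hh : ∀ (k : K) b t, h (k • b, t) = k • h (b, t)) (h0 : ∀ b, h (b, 0) = b)
    (h1 : ∀ b, h (b, 1) = p (r b)) (h' : C(A × unitInterval, A))
    (hh' : ∀ (k : K) a t, h' (k • a, t) = k • h' (a, t)) (h0' : ∀ a, h' (a, 0) = a)
    (h1' : ∀ a, h' (a, 1) = r (p a)) (L : Subgroup K) : IsWeakEquiv (fixedMap p hp L) :=
  IsWeakEquiv.of_homotopyEquiv (g := fixedMap r hr L)
    ⟨fun y => ⟨h' (y.1.1, y.2), fun l => (hh' l.1 y.1.1 y.2).symm.trans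
      (congrArg (fun b => h' (b, y.2)) (y.1.2 l))⟩,
      Continuous.subtype_mk (h'.continuous.comp (by fun_prop)) _⟩
    ⟨fun y => ⟨h (y.1.1, y.2), fun l => (hh l.1 y.1.1 y.2).symm.trans
      (congrArg (fun b => h (b, y.2)) (y.1.2 l))⟩,
      Continuous.subtype_mk (h.continuous.comp (by fun_prop)) _⟩
    (fun b => Subtype.ext (h0' b.1)) (fun b => Subtype.ext (h1' b.1))
    (fun b => Subtype.ext (h0 b.1)) fun b => Subtype.ext (h1 b.1)

end

namespace PiDiagram

variable {G : Type v} [Group G] {X Y : PiDiagram.{u} G}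

/-- A level equivalence is a weak equivalence on the fixed points of all subgroups `Λ` of `G × Σ_q` for
which the projection `Λ → G` is injective. -/
theorem Hom.IsLevelEquiv.isWeakEquiv_range [Finite G] {f : Hom X Y} (hf : f.IsLevelEquiv)
    {M : Type v} [Group M] (j : M →* G) (hj : Function.Injective j) {q : ℕ}
    (ρ : M →* Equiv.Perm (Fin q)) :
    IsWeakEquiv (fixedMap (f.app q) (f.app_prod_smul q) (j.prod ρ).range) := by
  obtain ⟨N, α, ι, hι, hα⟩ := PiHom.exists_equivariant_embedding j hj ρ
  have hα' : ∀ m, ι.transpose.comp (PiHom.ofPerm (α (j m))) =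
      (PiHom.ofPerm (ρ m)).comp ι.transpose := by
    intro m
    have h := congrArg PiHom.transpose (hα m⁻¹)
    rw [PiHom.transpose_comp, PiHom.transpose_comp, PiHom.transpose_ofPerm, PiHom.transpose_ofPerm,
      map_inv, map_inv, map_inv, inv_inv, inv_inv] at h
    exact h
  have hle : (j.prod (α.comp j)).range ≤ α.graph := by
    rintro _ ⟨m, rfl⟩
    exact rfl
  have key : ∀ Z : PiDiagram.{u} G, ∃ (i : C(MulAction.fixedPoints (j.prod ρ).range (Z.obj q),
      MulAction.fixedPoints (j.prod (α.comp j)).range (Z.obj N)))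
      (r : C(MulAction.fixedPoints (j.prod (α.comp j)).range (Z.obj N),
        MulAction.fixedPoints (j.prod ρ).range (Z.obj q))),
      (∀ a, (i a).1 = Z.map ι a.1) ∧ (∀ a, (r a).1 = Z.map ι.transpose a.1) := by
    intro Z
    have h1 : ∀ a : MulAction.fixedPoints (j.prod ρ).range (Z.obj q),
        Z.map ι a.1 ∈ MulAction.fixedPoints (j.prod (α.comp j)).range (Z.obj N) := by
      rintro a ⟨_, m, rfl⟩
      have h : Z.map (PiHom.ofPerm (ρ m)) (j m • a.1) = a.1 := a.2 ⟨_, m, rfl⟩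
      change Z.map (PiHom.ofPerm (α (j m))) (j m • Z.map ι a.1) = Z.map ι a.1
      rw [← Z.map_smul, Z.map_map, hα, ← Z.map_map, h]
    have h2 : ∀ a : MulAction.fixedPoints (j.prod (α.comp j)).range (Z.obj N),
        Z.map ι.transpose a.1 ∈ MulAction.fixedPoints (j.prod ρ).range (Z.obj q) := by
      rintro a ⟨_, m, rfl⟩
      have h : Z.map (PiHom.ofPerm (α (j m))) (j m • a.1) = a.1 := a.2 ⟨_, m, rfl⟩
      change Z.map (PiHom.ofPerm (ρ m)) (j m • Z.map ι.transpose a.1) = Z.map ι.transpose a.1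
      rw [← Z.map_smul, Z.map_map, ← hα', ← Z.map_map, h]
    exact ⟨⟨fun a => ⟨Z.map ι a.1, h1 a⟩, Continuous.subtype_mk
      ((Z.map ι).continuous.comp continuous_subtype_val) _⟩,
      ⟨fun a => ⟨Z.map ι.transpose a.1, h2 a⟩, Continuous.subtype_mk
      ((Z.map ι.transpose).continuous.comp continuous_subtype_val) _⟩, fun _ => rfl, fun _ => rfl⟩
  obtain ⟨i, r, hi, hr⟩ := key X
  obtain ⟨i', r', hi', hr'⟩ := key Y
  refine (hf N α _ hle).retract i r i' r' (fun a => Subtype.ext ?_) (fun a => Subtype.ext ?_)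
    (fun a => Subtype.ext ?_) (fun a => Subtype.ext ?_)
  · rw [hr, hi, X.map_transpose_map hι]
  · rw [hr', hi', Y.map_transpose_map hι]
  · rw [hi']
    exact (congrArg (f.app N) (hi a)).trans (f.naturality _ _)
  · rw [hr']
    exact (congrArg (f.app q) (hr a)).trans (f.naturality _ _)

/-- The `n`th power of the first component of a map. -/
def Hom.powerMap (f : Hom X Y) (n : ℕ) : C(X.Power n, Y.Power n) :=
  Kify.map (fun x i => f.app 1 (x i)) (Continuous.kCont (by fun_prop))

theorem Hom.powerMap_smul (f : Hom X Y) (n : ℕ) (p : G × Equiv.Perm (Fin n)) (x : X.Power n) :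
    f.powerMap n (p • x) = p • f.powerMap n x :=
  congrArg Kify.of (funext fun _ => f.app_smul _ _ _)

theorem Hom.segal_comp (f : Hom X Y) (n : ℕ) (x : X.obj n) :
    Y.segal n (f.app n x) = f.powerMap n (X.segal n x) :=
  congrArg Kify.of (funext fun _ => (f.naturality _ _).symm)

theorem prod_smul_one (p : G × Equiv.Perm (Fin 1)) (x : X.obj 1) : p • x = p.1 • x := by
  rw [prod_smul_def, Subsingleton.elim p.2 1, PiHom.ofPerm_one, X.map_id]

/-- The elements of `G × Σ_1` that are coordinates of elements of `L` which fix `i`. -/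
def isotropy {n : ℕ} (L : Subgroup (G × Equiv.Perm (Fin n))) (i : Fin n) :
    Subgroup (G × Equiv.Perm (Fin 1)) where
  carrier := {p | ∃ σ, (p.1, σ) ∈ L ∧ σ i = i}
  one_mem' := ⟨1, L.one_mem, rfl⟩
  mul_mem' := by
    rintro p p' ⟨σ, h, h1⟩ ⟨σ', h', h1'⟩
    exact ⟨σ * σ', L.mul_mem h h', by rw [Equiv.Perm.mul_apply, h1', h1]⟩
  inv_mem' := by
    rintro p ⟨σ, h, h1⟩
    exact ⟨σ⁻¹, L.inv_mem h, Equiv.Perm.inv_eq_iff_eq.2 h1.symm⟩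

/-- The relation of being in the same orbit of `L`. -/
def orbitSetoid {n : ℕ} (L : Subgroup (G × Equiv.Perm (Fin n))) : Setoid (Fin n) where
  r i j := ∃ l ∈ L, l.2 i = j
  iseqv := ⟨fun _ => ⟨1, L.one_mem, rfl⟩,
    fun ⟨l, hl, h⟩ => ⟨l⁻¹, L.inv_mem hl, Equiv.Perm.inv_eq_iff_eq.2 h.symm⟩,
    fun ⟨l, hl, h⟩ ⟨l', hl', h'⟩ => ⟨l' * l, L.mul_mem hl' hl, by
      rw [Prod.snd_mul, Equiv.Perm.mul_apply, h, h']⟩⟩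

/-- The fixed points of a power are a product of fixed points. -/
theorem exists_power_fixedPoints (X : PiDiagram.{u} G) {n : ℕ}
    (L : Subgroup (G × Equiv.Perm (Fin n))) :
    ∃ Φ : C(MulAction.fixedPoints L (X.Power n),
      ∀ o : Quotient (orbitSetoid L), MulAction.fixedPoints (isotropy L o.out) (X.obj 1)),
      IsWeakEquiv Φ ∧ ∀ x o, (Φ x o).1 = x.1.get o.out := by
  have hfix : ∀ (x : MulAction.fixedPoints L (X.Power n)) (l : G × Equiv.Perm (Fin n)), l ∈ L →
      ∀ i, l.1 • x.1.get (l.2⁻¹ i) = x.1.get i := fun x l hl i =>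
    congrFun (congrArg Kify.get (x.2 ⟨l, hl⟩)) i
  have hfix' : ∀ {i : Fin n} (y : MulAction.fixedPoints (isotropy L i) (X.obj 1))
      {l l' : G × Equiv.Perm (Fin n)}, l ∈ L → l' ∈ L → l.2 i = l'.2 i →
      l.1 • y.1 = l'.1 • y.1 := by
    intro i y l l' hl hl' h
    have h1 := y.2 ⟨(l'⁻¹.1 * l.1, 1), (l'⁻¹ * l).2, L.mul_mem (L.inv_mem hl') hl, by
      rw [Prod.snd_mul, Equiv.Perm.mul_apply, h]
      exact Equiv.symm_apply_apply _ _⟩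
    have h2 : (l'⁻¹.1 * l.1) • y.1 = y.1 := (prod_smul_one _ _).symm.trans h1
    rw [mul_smul, Prod.fst_inv, inv_smul_eq_iff] at h2
    exact h2
  have htr : ∀ i : Fin n, ∃ l ∈ L, l.2 (Quotient.mk (orbitSetoid L) i).out = i := fun i =>
    Quotient.mk_out (s := orbitSetoid L) i
  choose tr htr htr' using htr
  let Φ : C(MulAction.fixedPoints L (X.Power n),
      ∀ o : Quotient (orbitSetoid L), MulAction.fixedPoints (isotropy L o.out) (X.obj 1)) :=
    { toFun := fun x o => ⟨x.1.get o.out, by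
        rintro ⟨p, σ, hL, hσ⟩
        refine (prod_smul_one _ _).trans ?_
        have h := hfix x _ hL o.out
        rwa [show σ⁻¹ o.out = o.out from Equiv.Perm.inv_eq_iff_eq.2 hσ.symm] at h⟩
      continuous_toFun := continuous_pi fun o => Continuous.subtype_mk ((continuous_apply _).comp
        (Kify.continuous_get.comp continuous_subtype_val)) _ }
  have hy : ∀ (y : ∀ o : Quotient (orbitSetoid L),
      MulAction.fixedPoints (isotropy L o.out) (X.obj 1)) {o o'}, o = o' → (y o).1 = (y o').1 := by
    rintro y o _ rfl
    rfl
  -- A fixed point of the power is determined by its coordinates at representatives of the orbits,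
  -- which must be fixed by the isotropy groups; the other coordinates are obtained with the chosen
  -- transporters `tr i`.
  let Ψ : (∀ o : Quotient (orbitSetoid L), MulAction.fixedPoints (isotropy L o.out) (X.obj 1)) →
      MulAction.fixedPoints L (X.Power n) := fun y =>
    ⟨⟨fun i => (tr i).1 • (y (Quotient.mk _ i)).1⟩, by
      rintro ⟨l, hl⟩
      refine congrArg Kify.of (funext fun i => ?_)
      have ho : Quotient.mk (orbitSetoid L) (l.2⁻¹ i) = Quotient.mk (orbitSetoid L) i :=
        Quotient.sound ⟨l, hl, Equiv.apply_symm_apply _ _⟩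
      change l.1 • (tr (l.2⁻¹ i)).1 • (y (Quotient.mk _ (l.2⁻¹ i))).1 = (tr i).1 • (y _).1
      rw [hy y ho, ← mul_smul]
      refine hfix' (y (Quotient.mk _ i)) (l := l * tr (l.2⁻¹ i)) (L.mul_mem hl (htr _)) (htr i) ?_
      rw [Prod.snd_mul, Equiv.Perm.mul_apply, ← ho, htr', ho, htr']
      exact Equiv.apply_symm_apply _ _⟩
  refine ⟨Φ, isWeakEquiv_of_kInverse (g := Ψ) (fun K _ _ _ y hy => ?_) (fun x => ?_) (fun y => ?_),
    fun _ _ => rfl⟩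
  · refine Continuous.subtype_mk (Kify.continuous_of_compact (continuous_pi fun i => ?_)) _
    exact (continuous_const_smul _).comp (continuous_subtype_val.comp
      ((continuous_apply _).comp hy))
  · refine Subtype.ext (congrArg Kify.of (funext fun i => ?_))
    have h := hfix x (tr i) (htr i) i
    rwa [show (tr i).2⁻¹ i = _ from Equiv.Perm.inv_eq_iff_eq.2 (htr' i).symm] at h
  · refine funext fun o => Subtype.ext ?_
    change (tr o.out).1 • (y (Quotient.mk _ o.out)).1 = (y o).1
    rw [hy y o.out_eq]
    refine (hfix' (y o) (htr _) L.one_mem ?_).trans (one_smul _ _)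
    have h := htr' o.out
    rw [o.out_eq] at h
    exact h

/-- Powers of maps that are weak equivalences on fixed points have the same property. -/
theorem Hom.isWeakEquiv_powerMap (f : Hom X Y)
    (hf : ∀ H, IsWeakEquiv (fixedMap (f.app 1) (f.app_prod_smul 1) H)) {n : ℕ}
    (L : Subgroup (G × Equiv.Perm (Fin n))) :
    IsWeakEquiv (fixedMap (f.powerMap n) (f.powerMap_smul n) L) := by
  obtain ⟨Φ, hΦ, hΦ'⟩ := X.exists_power_fixedPoints L
  obtain ⟨Ψ, hΨ, hΨ'⟩ := Y.exists_power_fixedPoints L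
  refine hΨ.of_comp_left ?_
  have h := (IsWeakEquiv.piMap _ fun o : Quotient (orbitSetoid L) => hf (isotropy L o.out)).comp hΦ
  refine (congrArg IsWeakEquiv (ContinuousMap.ext fun x => ?_)).mp h
  refine funext fun o => Subtype.ext ?_
  exact (congrArg (f.app 1) (hΦ' x o)).trans 
    (hΨ' (fixedMap (f.powerMap n) (f.powerMap_smul n) L x) o).symm

end PiDiagram

/-! ### Level equivalences under `𝔻`. -/

namespace GOperad

open PiDiagram

variable {G : Type v} [Group G] {C : GOperad.{u} G} {n : ℕ} {X Y : PiDiagram.{u} G}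
  {hX : ∀ n, KHausdorff (X.obj n)} {hY : ∀ n, KHausdorff (Y.obj n)}

theorem isWeakEquiv_fixedMap_of_isLevelEquiv [Finite G] (hC : C.IsSigmaFree) {f : Hom X Y}
    (hf : f.IsLevelEquiv) (L : Subgroup (G × Equiv.Perm (Fin n)))
    (hL : ∀ l ∈ L, l.1 = 1 → l = 1) :
    IsWeakEquiv (fixedMap ((C.DMap (WMap f hX hY)).app n)
      ((C.DMap (WMap f hX hY)).app_prod_smul n) L) :=
  isWeakEquiv_fixedMap_DMap_WMap hC f fun _ ρ => hf.isWeakEquiv_range _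
    ((injective_iff_map_eq_one _).2 fun l h => Subtype.ext (hL l.1 l.2 h)) ρ

theorem eq_one_of_le_graph {α : G →* Equiv.Perm (Fin n)} {L : Subgroup (G × Equiv.Perm (Fin n))}
    (hL : L ≤ α.graph) (l : G × Equiv.Perm (Fin n)) (hl : l ∈ L) (h : l.1 = 1) : l = 1 :=
  Prod.ext h ((hL hl).symm.trans (by rw [h, map_one]; rfl))

theorem isWeakEquiv_fixedMap_WProj (hX : ∀ n, KHausdorff (X.obj n)) (hR : X.IsReedyCofibrant)
    (L : Subgroup (G × Equiv.Perm (Fin n))) :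
    IsWeakEquiv (fixedMap ((C.DMap (X.WProj hX)).app n) ((C.DMap (X.WProj hX)).app_prod_smul n) L)
    := by
  obtain ⟨r, h, h', hr, hh, hh', h0, h1, h0', h1'⟩ := exists_D_WProj_inverse (C := C) hX hR n
  exact isWeakEquiv_fixedMap_of_homotopyEquiv _ hr h hh h0 h1 h' hh' h0' h1' L

/-- For Reedy cofibrant `X`, a map out of `𝔻 X` may be tested after composition with the equivariant
homotopy equivalence `𝔻 W X → 𝔻 X`. -/
theorem isWeakEquiv_fixedMap_of_comp_WProj (hX : ∀ n, KHausdorff (X.obj n))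
    (hR : X.IsReedyCofibrant) {B : Type u} [TopologicalSpace B]
    [MulAction (G × Equiv.Perm (Fin n)) B] (g : C((C.D X).obj n, B))
    (hg : ∀ (p : G × Equiv.Perm (Fin n)) z, g (p • z) = p • g z)
    (L : Subgroup (G × Equiv.Perm (Fin n)))
    (h : IsWeakEquiv ((fixedMap g hg L).comp
      (fixedMap ((C.DMap (X.WProj hX)).app n) ((C.DMap (X.WProj hX)).app_prod_smul n) L))) :
    IsWeakEquiv (fixedMap g hg L) := by
  obtain ⟨r, k, k', hr, hk, hk', h0, h1, h0', h1'⟩ := exists_D_WProj_inverse (C := C) hX hR n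
  refine isWeakEquiv_fixedMap_of_comp_right _ ((C.DMap (X.WProj hX)).app_prod_smul n) hr k hk h0 h1
    ?_ h
  exact isWeakEquiv_fixedMap_of_homotopyEquiv _ ((C.DMap (X.WProj hX)).app_prod_smul n) k' hk'
    h0' h1' k hk h0 h1 L

/-- The functor `𝔻` preserves level equivalences of Reedy cofibrant diagrams. -/
theorem isLevelEquiv_DMap [Finite G] (hC : C.IsSigmaFree) {f : Hom X Y} (hX : ∀ n, KHausdorff (X.obj n))
    (hY : ∀ n, KHausdorff (Y.obj n)) (hXR : X.IsReedyCofibrant) (hYR : Y.IsReedyCofibrant)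
    (hf : f.IsLevelEquiv) : (C.DMap f).IsLevelEquiv := by
  intro n α L hL
  refine isWeakEquiv_fixedMap_of_comp_WProj hX hXR _ _ L ?_
  have h := (isWeakEquiv_fixedMap_WProj (C := C) (n := n) hY hYR L).comp
    (isWeakEquiv_fixedMap_of_isLevelEquiv (hX := hX) (hY := hY) hC hf L (eq_one_of_le_graph hL))
  refine (congrArg IsWeakEquiv (ContinuousMap.ext ?_)).mp h
  rintro ⟨z, hz⟩
  refine Subtype.ext ?_
  change (C.DMap (Y.WProj hY)).app n ((C.DMap (WMap f hX hY)).app n z) =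
    (C.DMap f).app n ((C.DMap (X.WProj hX)).app n z)
  obtain ⟨p, f', w, rfl⟩ := DObj.exists_eq_mk (C := C) (X := X.W hX) z
  rfl

end GOperad

/-- Equivariant maps with an inverse that is continuous on compact spaces are weak equivalences on
fixed points. -/
theorem isWeakEquiv_fixedMap_of_kInverse {A B : Type u} [TopologicalSpace A] [TopologicalSpace B]
    {K : Type v} [Group K] [MulAction K A] [MulAction K B] {f : C(A, B)}
    (hf : ∀ (k : K) a, f (k • a) = k • f a) {g : B → A} (hg : KCont g) (h : ∀ a, g (f a) = a)
    (h' : ∀ b, f (g b) = b) (L : Subgroup K) : IsWeakEquiv (fixedMap f hf L) := by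
  have hgL : ∀ b : MulAction.fixedPoints L B, g b.1 ∈ MulAction.fixedPoints L A := by
    intro b l
    have h1 : f (l.1 • g b.1) = b.1 := (hf _ _).trans ((congrArg _ (h' _)).trans (b.2 l))
    exact (h _).symm.trans (congrArg g h1)
  exact isWeakEquiv_of_kInverse (g := fun b => ⟨g b.1, hgL b⟩)
    (fun K _ _ _ b hb => Continuous.subtype_mk
      (hg K (fun k => (b k).1) (continuous_subtype_val.comp hb)) _)
    (fun a => Subtype.ext (h a.1)) fun b => Subtype.ext (h' b.1)

/-- Functions on families that are invariant under a relation in each coordinate factor through the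
quotients. -/
theorem Quot.eq_of_forall_mk_eq {ι α β : Type*} [Finite ι] {r : α → α → Prop} {F : (ι → α) → β}
    (hF : ∀ y y', (∀ i, y i = y' i ∨ r (y i) (y' i)) → F y = F y') {y y' : ι → α}
    (h : ∀ i, Quot.mk r (y i) = Quot.mk r (y' i)) : F y = F y' := by
  classical
  have := Fintype.ofFinite ι
  have key : ∀ s : Finset ι, F (fun i => if i ∈ s then y' i else y i) = F y := by
    intro s
    induction s using Finset.induction_on with
    | empty => simp
    | insert i s hi ih =>
      rw [← ih]
      let b : ι → α := fun k => if k ∈ s then y' k else y k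
      let l : Quot r → β := Quot.lift (fun a => F (Function.update b i a)) fun a a' haa' =>
        hF _ _ fun k => by
          by_cases hk : k = i
          · subst hk
            simp [haa']
          · simp [hk]
      have h1 : l (Quot.mk r (y' i)) = l (Quot.mk r (y i)) := congrArg l (h i).symm
      refine Eq.trans (congrArg F (funext fun k => ?_)) (h1.trans (congrArg F (funext fun k => ?_)))
      · by_cases hk : k = i
        · subst hk
          simp
        · simp [hk, b]
      · by_cases hk : k = i
        · subst hk
          simp [hi]
        · simp [hk, b]
  simpa using (key Finset.univ).symm

/-! ### Block sums in `Π`. -/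

namespace PiHom

variable {m n : ℕ}

theorem delta_comp_of_eq {φ : PiHom m n} {k : Fin m} {i : Fin n} (h : φ.1 k = some i) :
    (delta i).comp φ = delta k :=
  ext' fun l j => by
    rw [comp_eq_some, delta_eq_some]
    simp only [delta_eq_some]
    exact ⟨fun ⟨_, h1, h2⟩ => φ.inj (h2 ▸ h1) h, fun e => ⟨i, e ▸ h, rfl⟩⟩

theorem delta_comp_of_notMem {φ : PiHom m n} {i : Fin n} (h : i ∉ φ.range) :
    (delta i).comp φ = zero m 1 :=
  ext' fun l j => by
    rw [comp_eq_some, zero_eq_some]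
    simp only [delta_eq_some, iff_false]
    rintro ⟨k, h1, rfl⟩
    exact h ⟨l, h1⟩

/-- The inclusion of a block. -/
def blockInc (q : Fin n → ℕ) (j : Fin n) : PiHom (q j) (∑ j, q j) :=
  ⟨fun s => some (finSigmaFinEquiv ⟨j, s⟩), BasedMap.isPi_iff.2 fun _ s s' h h' => by
    have := finSigmaFinEquiv.injective (Option.some_inj.1 (h.trans h'.symm))
    simpa using this⟩

/-- The projection to a block. -/
noncomputable def blockProj (q : Fin n → ℕ) (j : Fin n) : PiHom (∑ j, q j) (q j) :=
  (blockInc q j).transpose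

theorem blockProj_eq_some {q : Fin n → ℕ} {j : Fin n} {w : Fin (∑ j, q j)} {s : Fin (q j)} :
    (blockProj q j).1 w = some s ↔ finSigmaFinEquiv ⟨j, s⟩ = w :=
  transpose_eq_some.trans Option.some_inj

/-- The sum of based maps. -/
def blockMapFn {q q' : Fin n → ℕ} (ψ : ∀ j, PiHom (q j) (q' j)) :
    BasedMap (∑ j, q j) (∑ j, q' j) := fun w =>
  ((ψ (finSigmaFinEquiv.symm w).1).1 (finSigmaFinEquiv.symm w).2).map fun s => finSigmaFinEquiv ⟨_, s⟩

theorem blockMapFn_eq_some {q q' : Fin n → ℕ} {ψ : ∀ j, PiHom (q j) (q' j)} {j : Fin n}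
    {s : Fin (q j)} {w : Fin (∑ j, q' j)} : blockMapFn ψ (finSigmaFinEquiv ⟨j, s⟩) = some w ↔
      ∃ t, (ψ j).1 s = some t ∧ finSigmaFinEquiv ⟨j, t⟩ = w := by
  have : ∀ p : (Σ j, Fin (q j)), p = ⟨j, s⟩ → ((((ψ p.1).1 p.2).map
      fun s => (finSigmaFinEquiv ⟨_, s⟩ : Fin (∑ j, q' j))) = some w ↔
        ∃ t, (ψ j).1 s = some t ∧ finSigmaFinEquiv ⟨j, t⟩ = w) := by
    rintro _ rfl
    exact Option.map_eq_some_iff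
  exact this _ (Equiv.symm_apply_apply _ _)

/-- The sum of morphisms of `Π`. -/
def blockMap {q q' : Fin n → ℕ} (ψ : ∀ j, PiHom (q j) (q' j)) : PiHom (∑ j, q j) (∑ j, q' j) :=
  ⟨blockMapFn ψ, BasedMap.isPi_iff.2 fun v w w' h h' => by
    obtain ⟨⟨j, s⟩, rfl⟩ := finSigmaFinEquiv.surjective w
    obtain ⟨⟨j', s'⟩, rfl⟩ := finSigmaFinEquiv.surjective w'
    obtain ⟨t, ht, rfl⟩ := blockMapFn_eq_some.1 h
    obtain ⟨t', ht', h2⟩ := blockMapFn_eq_some.1 h'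
    have h3 := finSigmaFinEquiv.injective h2
    obtain rfl : j' = j := congrArg Sigma.fst h3
    obtain rfl : t' = t := by simpa using h3
    rw [(ψ j').inj ht ht']⟩

theorem blockMap_eq_some {q q' : Fin n → ℕ} {ψ : ∀ j, PiHom (q j) (q' j)} {j : Fin n}
    {s : Fin (q j)} {w : Fin (∑ j, q' j)} : (blockMap ψ).1 (finSigmaFinEquiv ⟨j, s⟩) = some w ↔
      ∃ t, (ψ j).1 s = some t ∧ finSigmaFinEquiv ⟨j, t⟩ = w := blockMapFn_eq_some

theorem blockProj_comp_blockMap {q q' : Fin n → ℕ} (ψ : ∀ j, PiHom (q j) (q' j)) (j : Fin n) :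
    (blockProj q' j).comp (blockMap ψ) = (ψ j).comp (blockProj q j) :=
  ext' fun w t => by
    obtain ⟨⟨i, s⟩, rfl⟩ := finSigmaFinEquiv.surjective w
    simp only [comp_eq_some, blockProj_eq_some, blockMap_eq_some]
    constructor
    · rintro ⟨_, ⟨t', h1, rfl⟩, h2⟩
      have h3 := finSigmaFinEquiv.injective h2
      obtain rfl : j = i := congrArg Sigma.fst h3
      obtain rfl : t = t' := by simpa using h3
      exact ⟨s, rfl, h1⟩
    · rintro ⟨s', h1, h2⟩
      have h3 := finSigmaFinEquiv.injective h1
      obtain rfl : j = i := congrArg Sigma.fst h3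
      obtain rfl : s' = s := by simpa using h3
      exact ⟨_, ⟨t, h2, rfl⟩, rfl⟩

theorem delta_comp_blockProj {q : Fin n → ℕ} (j : Fin n) (s : Fin (q j)) :
    (delta s).comp (blockProj q j) = delta (finSigmaFinEquiv ⟨j, s⟩) :=
  delta_comp_of_eq (blockProj_eq_some.2 rfl)

end PiHom

/-! ### Diagrams with invertible Segal maps. -/

namespace PiDiagram

variable {G : Type v} [Group G]

/-- Inverses of the Segal maps. -/
structure Joins (Z : PiDiagram.{u} G) where
  /-- the inverse -/
  join : ∀ n, (Fin n → Z.obj 1) → Z.obj n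
  kCont_join : ∀ n, KCont (join n)
  map_join : ∀ {n : ℕ} (a : Fin n → Z.obj 1) (i : Fin n), Z.map (PiHom.delta i) (join n a) = a i
  join_map : ∀ {n : ℕ} (z : Z.obj n), join n (fun i => Z.map (PiHom.delta i) z) = z

namespace Joins

variable {Z : PiDiagram.{u} G} (J : Z.Joins) {n : ℕ} {q : Fin n → ℕ}

theorem ext_delta (J : Z.Joins) {z z' : Z.obj n}
    (h : ∀ i, Z.map (PiHom.delta i) z = Z.map (PiHom.delta i) z') : z = z' := by
  rw [← J.join_map z, ← J.join_map z', funext h]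

/-- An inverse of the Segal map for `n = 0` forces `Z_0` to have at most one point, and zero maps
factor through it. -/
theorem map_zero_eq (J : Z.Joins) {m m' : ℕ} (z : Z.obj m) (z' : Z.obj m') :
    Z.map (PiHom.zero m n) z = Z.map (PiHom.zero m' n) z' := by
  rw [← PiHom.comp_zero (l := m) (PiHom.zero 0 n), ← PiHom.comp_zero (l := m') (PiHom.zero 0 n),
    Z.map_comp, Z.map_comp]
  exact congrArg _ (J.ext_delta fun i => i.elim0)

/-- The point with given blocks of coordinates. -/
def joinBlocks (a : ∀ j, Z.obj (q j)) : Z.obj (∑ j, q j) :=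
  J.join _ fun w => Z.map (PiHom.delta (finSigmaFinEquiv.symm w).2) (a (finSigmaFinEquiv.symm w).1)

theorem map_blockProj (a : ∀ j, Z.obj (q j)) (j : Fin n) :
    Z.map (PiHom.blockProj q j) (J.joinBlocks a) = a j := by
  refine J.ext_delta fun s => ?_
  rw [Z.map_map, PiHom.delta_comp_blockProj, joinBlocks, J.map_join]
  have : ∀ p : (Σ j, Fin (q j)), p = ⟨j, s⟩ →
      Z.map (PiHom.delta p.2) (a p.1) = Z.map (PiHom.delta s) (a j) := by
    rintro _ rfl
    rfl
  exact this _ (Equiv.symm_apply_apply _ _)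

theorem ext_blockProj (J : Z.Joins) {z z' : Z.obj (∑ j, q j)}
    (h : ∀ j, Z.map (PiHom.blockProj q j) z = Z.map (PiHom.blockProj q j) z') : z = z' := by
  refine J.ext_delta fun w => ?_
  obtain ⟨⟨j, s⟩, rfl⟩ := finSigmaFinEquiv.surjective w
  rw [← PiHom.delta_comp_blockProj, Z.map_comp, Z.map_comp, h]

end Joins

end PiDiagram

namespace GOperad

variable {G : Type v} [Group G] {C : GOperad.{u} G} {n : ℕ}

open PiDiagram

section

variable {q : Fin n → ℕ}

theorem DHom.disjointFibers_blocks (f : ∀ j, C.DHom (q j) 1) :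
    DHom.DisjointFibers fun j => ((f j).precomp (PiHom.blockProj q j)).fn := by
  intro w j j' h h'
  obtain ⟨s, hs, -⟩ := DHom.fn_precomp_eq_some.1 h
  obtain ⟨s', hs', -⟩ := DHom.fn_precomp_eq_some.1 h'
  exact congrArg Sigma.fst (finSigmaFinEquiv.injective
    ((PiHom.blockProj_eq_some.1 hs).trans (PiHom.blockProj_eq_some.1 hs').symm))

/-- The morphism with given coordinates on blocks. -/
noncomputable def DHom.glueBlocks (f : ∀ j, C.DHom (q j) 1) : C.DHom (∑ j, q j) n :=
  DHom.glue (fun j => (f j).precomp (PiHom.blockProj q j)) (DHom.disjointFibers_blocks f)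

theorem DHom.delta_glueBlocks (f : ∀ j, C.DHom (q j) 1) (j : Fin n) :
    DHom.postcomp (PiHom.delta j) (DHom.glueBlocks f) = (f j).precomp (PiHom.blockProj q j) :=
  DHom.delta_glue _ _ j

end

variable {Z : PiDiagram.{u} G} (J : Z.Joins)

/-- The point of `𝔻 Z` with given coordinates. -/
noncomputable def joinPre (y : Fin n → C.PreD Z 1) : C.DObj Z n :=
  DObj.mk (DHom.glueBlocks fun j => (y j).get.2.1) (J.joinBlocks fun j => (y j).get.2.2)

theorem joinPre_congr {y y' : Fin n → C.PreD Z 1} (ψ : ∀ j, PiHom (y j).get.1 (y' j).get.1)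
    (h : ∀ j, (y j).get.2.1 = (y' j).get.2.1.precomp (ψ j))
    (h' : ∀ j, Z.map (ψ j) (y j).get.2.2 = (y' j).get.2.2) : joinPre J y = joinPre J y' := by
  have h1 : DHom.glueBlocks (fun j => (y j).get.2.1) =
      (DHom.glueBlocks fun j => (y' j).get.2.1).precomp (PiHom.blockMap ψ) := by
    refine DHom.ext_delta fun j => ?_
    rw [← DHom.postcomp_precomp, DHom.delta_glueBlocks, DHom.delta_glueBlocks, h,
      DHom.precomp_precomp, DHom.precomp_precomp, PiHom.blockProj_comp_blockMap]
  have h2 : Z.map (PiHom.blockMap ψ) (J.joinBlocks fun j => (y j).get.2.2) =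
      J.joinBlocks fun j => (y' j).get.2.2 := by
    refine J.ext_blockProj fun j => ?_
    rw [Z.map_map, PiHom.blockProj_comp_blockMap, Z.map_comp, J.map_blockProj, J.map_blockProj, h']
  rw [joinPre, h1, DObj.mk_precomp, h2]
  rfl

theorem joinPre_eq {y y' : Fin n → C.PreD Z 1}
    (h : ∀ j, (Quot.mk _ (y j) : C.DObj Z 1) = Quot.mk _ (y' j)) :
    joinPre J y = joinPre J y' := by
  refine Quot.eq_of_forall_mk_eq (fun y y' hy => ?_) h
  have hψ : ∀ j, ∃ ψ : PiHom (y j).get.1 (y' j).get.1,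
      (y j).get.2.1 = (y' j).get.2.1.precomp ψ ∧ Z.map ψ (y j).get.2.2 = (y' j).get.2.2 := by
    intro j
    rcases hy j with e | e
    · rw [e]
      exact ⟨PiHom.id _, (DHom.precomp_id _).symm, Z.map_id _⟩
    · generalize y j = a, y' j = b at e
      obtain ⟨f, ψ, x⟩ := e
      exact ⟨ψ, rfl, rfl⟩
  choose ψ h1 h2 using hψ
  exact joinPre_congr J ψ h1 h2

theorem map_delta_joinPre (y : Fin n → C.PreD Z 1) (j : Fin n) :
    (C.D Z).map (PiHom.delta j) (joinPre J y) = Quot.mk _ (y j) := by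
  change DObj.mk (DHom.postcomp (PiHom.delta j) (DHom.glueBlocks fun j => (y j).get.2.1))
    (J.joinBlocks fun j => (y j).get.2.2) = DObj.mk (y j).get.2.1 (y j).get.2.2
  rw [DHom.delta_glueBlocks, DObj.mk_precomp, J.map_blockProj]

/-- Gluing the coordinates of `f` produces a morphism `F` on `n` copies of `𝐪`, of which only the
copy of `i` in the block `f i` is in the support. So `F` and the `n`-fold join of `z` reduce to `f`
and `z` along an inclusion of the support. -/
theorem joinPre_delta {q : ℕ} (f : C.DHom q n) (z : Z.obj q) :
    joinPre J (fun j => ⟨q, (DHom.postcomp (PiHom.delta j) f, z)⟩) = DObj.mk f z := by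
  let Q : ℕ := ∑ _j : Fin n, q
  let F : C.DHom Q n := DHom.glueBlocks fun j => DHom.postcomp (PiHom.delta j) f
  -- The morphism `χ` sends `i` to its copy in the block `f i`, and to the base point if `f` does.
  -- It satisfies `F χ = f`, and its image contains the support of `F`.
  let χ : PiHom q Q := ⟨fun i => (f.fn i).map fun j => finSigmaFinEquiv ⟨j, i⟩,
    BasedMap.isPi_iff.2 fun w i i' h h' => by
      obtain ⟨j, -, rfl⟩ := Option.map_eq_some_iff.1 h
      obtain ⟨j', -, h2⟩ := Option.map_eq_some_iff.1 h'
      have h3 := finSigmaFinEquiv.injective h2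
      obtain rfl : j' = j := congrArg Sigma.fst h3
      simpa using h3.symm⟩
  have hχ : ∀ {i w}, χ.1 i = some w ↔ ∃ j, f.fn i = some j ∧ finSigmaFinEquiv ⟨j, i⟩ = w :=
    fun {_ _} => Option.map_eq_some_iff
  have hF : F.precomp χ = f := by
    refine DHom.ext_delta fun j => ?_
    rw [← DHom.postcomp_precomp, DHom.delta_glueBlocks, DHom.precomp_precomp]
    have h1 : (PiHom.blockProj (fun _ : Fin n => q) j).comp χ =
        PiHom.restr {i | f.fn i = some j} := by
      refine PiHom.ext' fun i k => ?_
      rw [PiHom.comp_eq_some, PiHom.restr_eq_some]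
      simp only [hχ, PiHom.blockProj_eq_some]
      constructor
      · rintro ⟨_, ⟨j', h1, rfl⟩, h2⟩
        have h3 := finSigmaFinEquiv.injective h2
        obtain rfl : j = j' := congrArg Sigma.fst h3
        obtain rfl : k = i := by simpa using h3
        exact ⟨rfl, h1⟩
      · rintro ⟨rfl, h⟩
        exact ⟨_, ⟨j, h, rfl⟩, rfl⟩
    rw [h1]
    refine DHom.precomp_restr _ _ fun i j' h => ?_
    obtain rfl := Fin.fin_one_eq_zero j'
    exact DHom.fn_delta.1 h
  have hsupp : F.precomp (χ.comp χ.transpose) = F := by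
    rw [PiHom.comp_transpose_self]
    refine F.precomp_restr _ fun w j h => ?_
    rw [← DHom.fn_delta, DHom.delta_glueBlocks, DHom.fn_precomp_eq_some] at h
    obtain ⟨s, h1, h2⟩ := h
    exact ⟨s, hχ.2 ⟨j, DHom.fn_delta.1 h2, PiHom.blockProj_eq_some.1 h1⟩⟩
  have hz : Z.map χ.transpose (J.joinBlocks fun _ : Fin n => z) = Z.map (PiHom.restr f.supp) z := by
    refine J.ext_delta fun i => ?_
    rw [Z.map_map, Z.map_map]
    by_cases hi : i ∈ f.supp
    · obtain ⟨j, hj⟩ := DHom.mem_supp.1 hi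
      rw [PiHom.delta_comp_of_eq (k := finSigmaFinEquiv ⟨j, i⟩)
          (PiHom.transpose_eq_some.2 (hχ.2 ⟨j, hj, rfl⟩)),
        PiHom.delta_comp_of_eq (k := i) (PiHom.restr_eq_some.2 ⟨rfl, hi⟩),
        ← PiHom.delta_comp_blockProj (q := fun _ => q), Z.map_comp, J.map_blockProj]
    · rw [PiHom.delta_comp_of_notMem, PiHom.delta_comp_of_notMem]
      · exact J.map_zero_eq _ _
      · rintro ⟨k, hk⟩
        obtain ⟨e, hk'⟩ := PiHom.restr_eq_some.1 hk
        exact hi (e ▸ hk')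
      · rintro ⟨w, hw⟩
        obtain ⟨j, hj, -⟩ := hχ.1 (PiHom.transpose_eq_some.1 hw)
        exact hi (DHom.mem_supp.2 ⟨j, hj⟩)
  change DObj.mk F (J.joinBlocks fun _ : Fin n => z) = DObj.mk f z
  rw [← hsupp, ← DHom.precomp_precomp, hF, DObj.mk_precomp, hz, ← DObj.mk_precomp,
    DHom.precomp_restr_supp]

theorem kCont_joinPre : KCont (joinPre (C := C) (n := n) J) := by
  intro K _ _ _ y hy
  refine continuous_of_sigma_probes (J := Fin n) (A := fun _ q => C.DHom q 1 × Z.obj q)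
    (fun j k => (y k j).get) (fun j => Kify.continuous_get.comp ((continuous_apply j).comp hy))
    fun q V _ _ _ e a he ha hye => ?_
  have h1 : ∀ v, joinPre J (y (e v)) = DObj.mk (DHom.glueBlocks fun j => (a j v).1)
      (J.joinBlocks fun j => (a j v).2) := by
    intro v
    have : y (e v) = fun j => Kify.of ⟨q j, a j v⟩ := funext fun j =>
      congrArg Kify.of (hye j v)
    rw [this]
    rfl
  simp only [h1]
  refine DObj.continuous_mk ?_ ?_
  · exact DHom.continuous_glue (f := fun v j => ((a j v).1).precomp (PiHom.blockProj q j))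
      (continuous_pi fun j => (DHom.continuous_precomp _).comp (continuous_fst.comp (ha j)))
      fun v => DHom.disjointFibers_blocks _
  · exact J.kCont_join _ V _ (continuous_pi fun w =>
      (Z.map _).continuous.comp (continuous_snd.comp (ha _)))

/-- If the Segal maps of `Z` have inverses, then those of `𝔻 Z` are weak equivalences on fixed
points. -/
theorem isWeakEquiv_segal_of_joins (J : Z.Joins) (L : Subgroup (G × Equiv.Perm (Fin n))) :
    IsWeakEquiv (fixedMap ((C.D Z).segal n) ((C.D Z).segal_smul n) L) := by
  -- The inverse is defined with chosen representatives. As it does not depend on the choice, its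
  -- continuity on compact test spaces can be checked before passing to the product of quotients.
  have hout : ∀ y : Fin n → C.PreD Z 1,
      joinPre J (fun j => (Quot.mk (C.DRel Z 1) (y j)).out) = joinPre J y := fun y =>
    joinPre_eq J fun j => Quot.out_eq _
  have hc : KCont fun w : Fin n → C.DObj Z 1 => joinPre J fun j => (w j).out := by
    refine kCont_of_isQuotientMap_pi (A := fun _ : Fin n => C.PreD Z 1)
      (p := fun _ => Quot.mk (C.DRel Z 1)) (fun _ => isQuotientMap_quot_mk) ?_
    simp only [hout]
    exact kCont_joinPre J
  refine isWeakEquiv_fixedMap_of_kInverse (A := (C.D Z).obj n) ((C.D Z).segal_smul n)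
    (g := fun w : (C.D Z).Power n => joinPre (C := C) J fun j => (w.get j).out)
    (hc.comp (Continuous.kCont Kify.continuous_get)) (fun z => ?_) (fun w => ?_) L
  · obtain ⟨q, f, x, rfl⟩ := DObj.exists_eq_mk (C := C) (X := Z) z
    exact (hout fun j => ⟨q, (DHom.postcomp (PiHom.delta j) f, x)⟩).trans (joinPre_delta J f x)
  · refine congrArg Kify.of (funext fun j => ?_)
    exact (map_delta_joinPre J _ j).trans (Quot.out_eq _)

end GOperad

/-! ### Comparison with the powers of `X_1`. -/

namespace PiDiagram

variable {G : Type v} [Group G] (X : PiDiagram.{u} G) (b : X.obj 1) (hb : ∀ g : G, g • b = b)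

/-- The diagonal action on the powers of `X_1`. -/
abbrev diagonalAction (n : ℕ) : MulAction G (X.Power n) where
  smul g x := ⟨fun i => g • x.get i⟩
  one_smul _ := congrArg Kify.of (funext fun _ => one_smul G _)
  mul_smul g h _ := congrArg Kify.of (funext fun _ => mul_smul g h _)

/-- The powers of `X_1`, with base point `b`. -/
noncomputable def powers : PiDiagram.{u} G where
  obj n := X.Power n
  act n := X.diagonalAction n
  cont_act n :=
    letI := X.diagonalAction n
    ⟨fun g => (Kify.map (fun (x : Fin n → X.obj 1) i => g • x i)
      (Continuous.kCont (continuous_pi fun i =>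
        (continuous_const_smul g).comp (continuous_apply i)))).continuous⟩
  map φ := Kify.map (fun x j => (φ.transpose.1 j).elim b x) (Continuous.kCont
    (continuous_pi fun j => by
      cases φ.transpose.1 j
      · exact continuous_const
      · exact continuous_apply _))
  map_smul φ g x := congrArg Kify.of (funext fun j => by
    change (φ.transpose.1 j).elim b (fun i => g • x.get i) = g • (φ.transpose.1 j).elim b x.get
    cases φ.transpose.1 j
    · exact (hb g).symm
    · rfl)
  map_id {n} x := congrArg Kify.of (funext fun j => by
    change ((PiHom.id n).transpose.1 j).elim b x.get = x.get j
    rw [show (PiHom.id n).transpose.1 j = some j from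
      PiHom.transpose_eq_some.2 (PiHom.id_eq_some.2 rfl)]
    rfl)
  map_comp φ ψ x := congrArg Kify.of (funext fun j => by
    rw [PiHom.transpose_comp]
    change ((φ.transpose.1 j).bind ψ.transpose.1).elim b x.get =
      (φ.transpose.1 j).elim b fun i => (ψ.transpose.1 i).elim b x.get
    cases φ.transpose.1 j <;> rfl)

variable {X b hb} {m n : ℕ}

theorem powers_map_of_eq {φ : PiHom m n} {i : Fin m} {j : Fin n} (h : φ.1 i = some j)
    (x : X.Power m) : ((X.powers b hb).map φ x : X.Power n).get j = x.get i := by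
  change (φ.transpose.1 j).elim b x.get = x.get i
  rw [PiHom.transpose_eq_some.2 h]
  rfl

theorem powers_map_of_notMem {φ : PiHom m n} {j : Fin n} (h : j ∉ φ.range) (x : X.Power m) :
    ((X.powers b hb).map φ x : X.Power n).get j = b := by
  change (φ.transpose.1 j).elim b x.get = b
  rw [show φ.transpose.1 j = none from Option.eq_none_iff_forall_ne_some.2 fun i hi =>
    h ⟨i, PiHom.transpose_eq_some.1 hi⟩]
  rfl

/-- The action coming from the functor on `Π` agrees with the one in the definition of special
diagrams, so that `X` special means that the Segal maps form a level equivalence. -/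
theorem powers_prodAction (n : ℕ) : (X.powers b hb).prodAction n = X.powerAction n := by
  refine MulAction.ext (funext fun p => funext fun x => ?_)
  refine congrArg Kify.of (funext fun j => ?_)
  exact powers_map_of_eq (b := b) (hb := hb) (φ := PiHom.ofPerm p.2) (i := p.2⁻¹ j)
    (PiHom.ofPerm_eq_some.2 (Equiv.apply_symm_apply _ _)) _

theorem powers_kHausdorff (hX : KHausdorff (X.obj 1)) (n : ℕ) :
    KHausdorff ((X.powers b hb).obj n) :=
  KHausdorff.pi (fun _ : Fin n => hX) (e := fun y : X.Power n => y.get)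
    (fun i => (continuous_apply i).comp Kify.continuous_get) fun _ _ h => congrArg Kify.of h

/-- The Segal maps, as a map of diagrams. -/
noncomputable def segalHom (h0 : ∀ x : X.obj 0, X.map (PiHom.zero 0 1) x = b)
    (hb : ∀ g : G, g • b = b) : Hom X (X.powers b hb) where
  app n := X.segal n
  app_smul n g x := congrArg Kify.of (funext fun _ => X.map_smul _ _ _)
  naturality {m n} φ x := congrArg Kify.of (funext fun j => by
    rw [X.map_map]
    by_cases hj : j ∈ φ.range
    · obtain ⟨i, hi⟩ := hj
      rw [PiHom.delta_comp_of_eq hi]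
      exact (powers_map_of_eq (b := b) (hb := hb) hi (X.segal m x)).symm
    · rw [PiHom.delta_comp_of_notMem hj, ← PiHom.comp_zero (PiHom.zero 0 1), X.map_comp, h0]
      exact (powers_map_of_notMem (b := b) (hb := hb) hj (X.segal m x)).symm)

theorem IsSpecial.isLevelEquiv (hX : X.IsSpecial)
    (h0 : ∀ x : X.obj 0, X.map (PiHom.zero 0 1) x = b) (hb : ∀ g : G, g • b = b) :
    (segalHom h0 hb).IsLevelEquiv := by
  intro n α
  have key : ∀ (i i' : MulAction (G × Equiv.Perm (Fin n)) (X.Power n)) (_ : i = i')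
      (h : ∀ p x, X.segal n (p • x) = i.toSMul.smul p (X.segal n x))
      (h' : ∀ p x, X.segal n (p • x) = i'.toSMul.smul p (X.segal n x)),
      @IsWeakEquivOver _ _ _ _ _ _ _ i' (X.segal n) h' α.graph →
        @IsWeakEquivOver _ _ _ _ _ _ _ i (X.segal n) h α.graph := by
    rintro i _ rfl h h' hw
    exact hw
  exact key _ _ (powers_prodAction (b := b) (hb := hb) n) _ _ (hX n α)

theorem powers_restr_compl {x : X.Power n} {i : Fin n} :
    (X.powers b hb).map (PiHom.restr {i}ᶜ) x = x ↔ x.get i = b := by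
  constructor
  · intro h
    rw [← powers_map_of_notMem (b := b) (hb := hb) (φ := PiHom.restr {i}ᶜ) (j := i) ?_ x]
    · exact (congrArg (fun y : X.Power n => y.get i) h).symm
    · rintro ⟨k, hk⟩
      obtain ⟨rfl, hk'⟩ := PiHom.restr_eq_some.1 hk
      exact hk' rfl
  · intro h
    refine congrArg Kify.of (funext fun j => ?_)
    by_cases hj : j = i
    · subst hj
      refine (powers_map_of_notMem (b := b) (hb := hb) (φ := PiHom.restr {j}ᶜ) (j := j) ?_ x).trans
        h.symm
      rintro ⟨k, hk⟩
      obtain ⟨rfl, hk'⟩ := PiHom.restr_eq_some.1 hk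
      exact hk' rfl
    · exact powers_map_of_eq (b := b) (hb := hb) (PiHom.restr_eq_some.2 ⟨rfl, hj⟩) x

/-- The Segal maps of `W` of the powers have inverses. -/
noncomputable def powersJoins (X : PiDiagram.{u} G) (b : X.obj 1) (hb : ∀ g : G, g • b = b)
    (hR : ∀ n, KHausdorff ((X.powers b hb).obj n)) : ((X.powers b hb).W hR).Joins where
  -- A point of `W` of the powers is a family of pairs `(xᵢ, tᵢ)` with `xᵢ = b` whenever `tᵢ ≠ 0`;
  -- this is a condition on each coordinate separately, so the coordinates can be chosen
  -- independently.
  join n a := (⟨((⟨fun i => ((a i : (X.powers b hb).WObj 1).1.1 : X.Power 1).get 0⟩ : X.Power n),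
    fun i => (a i : (X.powers b hb).WObj 1).1.2 0), fun i hi => powers_restr_compl.2
      (show ((a i : (X.powers b hb).WObj 1).1.1 : X.Power 1).get 0 = b from
        powers_restr_compl.1 ((a i : (X.powers b hb).WObj 1).2 0 hi))⟩ : (X.powers b hb).WObj n)
  kCont_join n K _ _ _ a ha := by
    have h : ∀ i, Continuous fun k => (a k i : (X.powers b hb).WObj 1).1 := fun i =>
      continuous_subtype_val.comp ((continuous_apply i).comp ha)
    refine Continuous.subtype_mk (Continuous.prodMk (Kify.continuous_of_compact
      (continuous_pi fun i => ?_)) (continuous_pi fun i => ?_)) _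
    · exact (continuous_apply (0 : Fin 1)).comp (Kify.continuous_get.comp (continuous_fst.comp (h i)))
    · exact (continuous_apply (0 : Fin 1)).comp (continuous_snd.comp (h i))
  map_join {n} a i := by
    have hd : (PiHom.delta i).1 i = some 0 := PiHom.delta_eq_some.2 rfl
    refine Subtype.ext (Prod.ext (congrArg Kify.of (funext fun k => ?_)) (funext fun k => ?_))
    · obtain rfl := Fin.fin_one_eq_zero k
      exact powers_map_of_eq (b := b) (hb := hb) hd _
    · obtain rfl := Fin.fin_one_eq_zero k
      exact moveCoords_of_eq hd _ _
  join_map {n} z := by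
    have hd : ∀ i : Fin n, (PiHom.delta i).1 i = some 0 := fun i => PiHom.delta_eq_some.2 rfl
    refine Subtype.ext (Prod.ext (congrArg Kify.of (funext fun k => ?_)) (funext fun k => ?_))
    · exact powers_map_of_eq (b := b) (hb := hb) (hd k) _
    · exact moveCoords_of_eq (hd k) _ _

end PiDiagram

/-! ### Special diagrams under `𝔻`. -/

namespace GOperad

variable {G : Type v} [Group G] {C : GOperad.{u} G}

open PiDiagram

/-- The functor `𝔻` preserves special Reedy cofibrant diagrams. -/
theorem isSpecial_D [Finite G] (hC : C.IsSigmaFree) {X : PiDiagram.{u} G}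
    (hX : ∀ n, KHausdorff (X.obj n)) (h0 : Nonempty (Unique (X.obj 0))) (hXR : X.IsReedyCofibrant)
    (hs : X.IsSpecial) : (C.D X).IsSpecial := by
  obtain ⟨h0⟩ := h0
  let b : X.obj 1 := X.map (PiHom.zero 0 1) default
  have hb : ∀ g : G, g • b = b := fun g => by
    rw [← X.map_smul, Subsingleton.elim (g • default) (default : X.obj 0)]
  have hb0 : ∀ x : X.obj 0, X.map (PiHom.zero 0 1) x = b := fun x => by
    rw [Subsingleton.elim x default]
  have hR : ∀ n, KHausdorff ((X.powers b hb).obj n) := powers_kHausdorff (hX 1)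
  have hlevel := hs.isLevelEquiv hb0 hb
  let F := C.DMap (WMap (segalHom hb0 hb) hX hR)
  let P := C.DMap (X.WProj hX)
  intro n α L hL
  -- In the naturality square of the Segal map for `F` the two maps induced by `F` are weak
  -- equivalences on fixed points, and so is the Segal map of the target, whose inverse is explicit.
  -- Subgroups of `G × Σ_1` cause no restriction since `Σ_1` is trivial.
  have h1 : IsWeakEquiv (fixedMap ((C.D (X.W hX)).segal n) ((C.D (X.W hX)).segal_smul n) L) := by
    refine IsWeakEquiv.of_comp_left (F.isWeakEquiv_powerMap (fun H => ?_) L) ?_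
    · exact isWeakEquiv_fixedMap_of_isLevelEquiv hC hlevel H fun l _ h =>
        Prod.ext h (Subsingleton.elim _ _)
    · have h2 := (isWeakEquiv_segal_of_joins (C := C) (powersJoins X b hb hR) L).comp
        (isWeakEquiv_fixedMap_of_isLevelEquiv (hX := hX) (hY := hR) hC hlevel L
          (eq_one_of_le_graph hL))
      refine (congrArg IsWeakEquiv (ContinuousMap.ext fun z => ?_)).mp h2
      exact Subtype.ext (F.segal_comp n z.1)
  refine isWeakEquiv_fixedMap_of_comp_WProj hX hXR _ _ L ?_
  have h3 := (P.isWeakEquiv_powerMap (fun H => isWeakEquiv_fixedMap_WProj hX hXR H) L).comp h1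
  refine (congrArg IsWeakEquiv (ContinuousMap.ext fun z => ?_)).mp h3
  exact Subtype.ext (P.segal_comp n z.1).symm

end GOperad

/-! ### The spaces `(𝔻X)_n` are weak Hausdorff -/

namespace GOperad

variable {G : Type v} [Group G] {C : GOperad.{u} G}

namespace DObj

variable {X : PiDiagram.{u} G} {p q r n : ℕ}

/-- The restriction of `x` to the support of `f`. -/
noncomputable def trim (f : C.DHom q n) (x : X.obj q) : X.obj q := X.map (PiHom.restr f.supp) x

theorem mk_trim (f : C.DHom q n) (x : X.obj q) : mk f (trim f x) = mk f x := by
  rw [trim, ← mk_precomp, DHom.precomp_restr_supp]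

theorem continuous_trim {K : Type u} [TopologicalSpace K] [CompactSpace K] [T2Space K]
    {f : K → C.DHom q n} {x : K → X.obj q} (hf : Continuous f) (hx : Continuous x) :
    Continuous fun k => trim (f k) (x k) := by
  refine DHom.continuous_of_fn hf fun φ V _ _ _ e he hφ => ?_
  refine ((X.map (PiHom.restr {i | φ i ≠ none})).continuous.comp (hx.comp he)).congr fun v => ?_
  rw [← hφ v]
  rfl

/-- `θ` exhibits the equality of the classes of `(f, x)` and `(f', x')`. -/
def Matches (f : C.DHom p n) (x : X.obj p) (f' : C.DHom q n) (x' : X.obj q) (θ : PiHom p q) :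
    Prop :=
  X.map θ (trim f x) = trim f' x' ∧ X.map θ.transpose (trim f' x') = trim f x ∧
    f.precomp (θ.transpose.comp θ) = f'.precomp θ

variable {f : C.DHom p n} {x : X.obj p} {f' : C.DHom q n} {x' : X.obj q} {f'' : C.DHom r n}
  {x'' : X.obj r}

theorem Matches.mk_eq {θ : PiHom p q} (h : Matches f x f' x' θ) : mk f x = mk f' x' := by
  rw [← mk_trim f, ← mk_trim f', ← h.1, ← mk_precomp, ← h.2.2, mk_precomp, X.map_comp, h.1, h.2.1]

theorem Matches.refl (f : C.DHom p n) (x : X.obj p) : Matches f x f x (PiHom.id p) := by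
  have h : (PiHom.id p).transpose = PiHom.id p := by
    rw [← PiHom.ofPerm_one, PiHom.transpose_ofPerm, inv_one]
  refine ⟨X.map_id _, ?_, ?_⟩
  · rw [h, X.map_id]
  · rw [h, PiHom.id_comp]

theorem Matches.symm {θ : PiHom p q} (h : Matches f x f' x' θ) :
    Matches f' x' f x θ.transpose := by
  refine ⟨h.2.1, ?_, ?_⟩
  · rw [PiHom.transpose_transpose, h.1]
  · rw [PiHom.transpose_transpose, ← DHom.precomp_precomp, ← h.2.2, DHom.precomp_precomp,
      PiHom.comp_assoc]
    have := PiHom.comp_transpose_comp θ.transpose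
    rw [PiHom.transpose_transpose] at this
    rw [this]

theorem Matches.trans {θ : PiHom p q} {η : PiHom q r} (h : Matches f x f' x' θ)
    (h' : Matches f' x' f'' x'' η) : Matches f x f'' x'' (η.comp θ) := by
  refine ⟨?_, ?_, ?_⟩
  · rw [X.map_comp, h.1, h'.1]
  · rw [PiHom.transpose_comp, X.map_comp, h'.2.1, h.2.1]
  · have h1 := h.symm.2.2
    rw [PiHom.transpose_transpose] at h1
    -- Both `θ θᵀ` and `ηᵀ η` are partial identities, hence commute.
    have h2 : (θ.comp θ.transpose).comp (η.transpose.comp (η.comp θ)) =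
        (η.transpose.comp η).comp θ := by
      rw [← PiHom.comp_assoc η.transpose, ← PiHom.comp_assoc, PiHom.comp_transpose_self,
        PiHom.transpose_comp_eq_restr, PiHom.restr_comm, PiHom.comp_assoc,
        ← PiHom.comp_transpose_self θ, PiHom.comp_assoc, PiHom.comp_transpose_comp]
    rw [PiHom.transpose_comp, PiHom.comp_assoc, ← DHom.precomp_precomp, ← h1,
      DHom.precomp_precomp, h2, ← DHom.precomp_precomp, h'.2.2, DHom.precomp_precomp]

theorem matches_precomp (f : C.DHom q n) (ψ : PiHom p q) (x : X.obj p) :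
    Matches (f.precomp ψ) x f (X.map ψ x) ψ := by
  refine ⟨?_, ?_, ?_⟩
  · rw [trim, trim, X.map_map, X.map_map]
    congr 2
    apply PiHom.ext'
    intro i j
    simp only [PiHom.comp_eq_some, PiHom.restr_eq_some, DHom.mem_supp_precomp]
    constructor
    · rintro ⟨_, ⟨rfl, l, hl, hs⟩, hj⟩
      obtain rfl := Option.some_inj.1 (hl.symm.trans hj)
      exact ⟨_, hl, rfl, hs⟩
    · rintro ⟨l, hl, rfl, hs⟩
      exact ⟨i, ⟨rfl, l, hl, hs⟩, hl⟩
  · rw [trim, trim, X.map_map, X.map_map]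
    congr 2
    apply PiHom.ext'
    intro i j
    simp only [PiHom.comp_eq_some, PiHom.restr_eq_some, DHom.mem_supp_precomp,
      PiHom.transpose_eq_some]
    constructor
    · rintro ⟨a, ha, _, ⟨rfl, hs⟩, hj⟩
      exact ⟨ψ.inj ha hj, _, ha, hs⟩
    · rintro ⟨rfl, l, hl, hs⟩
      exact ⟨l, hl, l, ⟨rfl, hs⟩, hl⟩
  · rw [DHom.precomp_precomp, PiHom.comp_transpose_comp]

/-- The relation of being matched by some `θ` contains the generating relation and is an equivalence
relation, because partial injections can be composed and transposed. So an arbitrary zigzag of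
relations collapses to a single `θ`, and for given degrees there are only finitely many of these. -/
theorem mk_eq_mk_iff : mk f x = mk f' x' ↔ ∃ θ, Matches f x f' x' θ := by
  refine ⟨fun h => ?_, fun ⟨θ, h⟩ => h.mk_eq⟩
  have key : ∀ y y' : C.PreD X n, Relation.EqvGen (C.DRel X n) y y' →
      ∃ θ, Matches y.get.2.1 y.get.2.2 y'.get.2.1 y'.get.2.2 θ := by
    intro y y' h
    induction h with
    | rel _ _ h =>
      obtain ⟨f, ψ, x⟩ := h
      exact ⟨ψ, matches_precomp f ψ x⟩
    | refl y => exact ⟨_, Matches.refl _ _⟩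
    | symm _ _ _ ih => exact ih.imp' _ fun _ h => h.symm
    | trans _ _ _ _ _ ih ih' =>
      obtain ⟨θ, h⟩ := ih
      obtain ⟨η, h'⟩ := ih'
      exact ⟨_, h.trans h'⟩
  exact key ⟨⟨p, (f, x)⟩⟩ ⟨⟨q, (f', x')⟩⟩ (Quot.eqvGen_exact h)

theorem isClosed_setOf_mk_eq (hX : ∀ n, KHausdorff (X.obj n)) {K : Type u} [TopologicalSpace K]
    [CompactSpace K] [T2Space K] {f : K → C.DHom p n} {x : K → X.obj p} {f' : K → C.DHom q n}
    {x' : K → X.obj q} (hf : Continuous f) (hx : Continuous x) (hf' : Continuous f')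
    (hx' : Continuous x') : IsClosed {k | mk (f k) (x k) = mk (f' k) (x' k)} := by
  have hfin : Finite (PiHom p q) := inferInstance
  have h : ∀ θ, IsClosed {k | Matches (f k) (x k) (f' k) (x' k) θ} := fun θ => by
    have h1 := continuous_trim hf hx
    have h2 := continuous_trim hf' hx'
    exact (hX q K _ _ ((X.map θ).continuous.comp h1) h2).inter
      ((hX p K _ _ ((X.map θ.transpose).continuous.comp h2) h1).inter
        (DHom.kHausdorff _ _ _ K _ _ ((DHom.continuous_precomp _).comp hf)
          ((DHom.continuous_precomp _).comp hf')))
  convert isClosed_iUnion_of_finite h using 1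
  ext k
  simp only [Set.mem_ofPred_eq, Set.mem_iUnion]
  exact mk_eq_mk_iff

/-- Equality of classes is a finite union of closed conditions on representatives, so `𝔻X` is a
quotient by a closed relation. -/
theorem kHausdorff (hX : ∀ n, KHausdorff (X.obj n)) (n : ℕ) : KHausdorff (C.DObj X n) := by
  refine KHausdorff.of_isQuotientMap (X := C.PreD X n) (p := Quot.mk (C.DRel X n))
    isQuotientMap_quot_mk fun K _ _ _ f g hf hg => ?_
  have : Continuous fun k => Quot.mk (C.DRel X n) (f k) ≠ Quot.mk (C.DRel X n) (g k) := by
    refine continuous_of_sigma_probe (Kify.continuous_get.comp hf)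
      fun p V _ _ _ e a he ha hfe => ?_
    refine continuous_of_sigma_probe (Kify.continuous_get.comp (hg.comp he))
      fun q V' _ _ _ e' a' he' ha' hge => ?_
    refine continuous_Prop.2 ?_
    have h := (isClosed_setOf_mk_eq hX (f := fun v => (a (e' v)).1) (x := fun v => (a (e' v)).2)
      (f' := fun v => (a' v).1) (x' := fun v => (a' v).2) (by fun_prop) (by fun_prop)
      (by fun_prop) (by fun_prop)).isOpen_compl
    convert h using 1
    ext v
    have h1 : f (e (e' v)) = ⟨⟨p, a (e' v)⟩⟩ := congrArg Kify.of (hfe (e' v))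
    have h2 : g (e (e' v)) = ⟨⟨q, a' v⟩⟩ := congrArg Kify.of (hge v)
    simp only [Set.mem_ofPred_eq, Set.mem_compl_iff, h1, h2]
    rfl
  exact ⟨continuous_Prop.1 this⟩

end DObj

namespace DHom

variable {q n : ℕ}

/-- All components lie in `C.obj 0`, which is a point. -/
theorem eq_of_fn_eq_none {f f' : C.DHom q n} (h : ∀ i, f.fn i = none) (h' : ∀ i, f'.fn i = none) :
    f = f' := by
  refine ext_op (funext fun i => (h i).trans (h' i).symm) fun j Q _ => ?_
  have h0 : f.fn.card j = 0 := Fintype.card_eq_zero_iff.2 ⟨fun x => by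
    have := x.2
    rw [h] at this
    exact absurd this (by simp)⟩
  have : Subsingleton (C.obj (f.fn.card j)) := by
    rw [h0]
    exact ⟨fun a b => (C.eq_nil a).trans (C.eq_nil b).symm⟩
  exact Subsingleton.elim _ _

end DHom

theorem nonempty_unique_D_zero {X : PiDiagram.{u} G} (h0 : Nonempty (Unique (X.obj 0))) :
    Nonempty (Unique ((C.D X).obj 0)) := by
  obtain ⟨h0⟩ := h0
  refine ⟨⟨⟨DObj.mk (C.incl (PiHom.id 0)) default⟩, fun z => ?_⟩⟩
  obtain ⟨q, f, x, rfl⟩ := DObj.exists_eq_mk (C := C) (X := X) z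
  have hn : ∀ {q : ℕ} (f : C.DHom q 0) i, f.fn i = none := fun f i =>
    Option.eq_none_iff_forall_ne_some.2 fun j => j.elim0
  have h1 : f = (C.incl (PiHom.id 0)).precomp (PiHom.zero q 0) :=
    DHom.eq_of_fn_eq_none (hn _) (hn _)
  rw [h1, DObj.mk_precomp]
  exact congrArg _ (Subsingleton.elim _ _)

end GOperad

/-! ### Extension of homotopies to `(𝔻X)_n` -/

namespace GOperad

variable {G : Type v} [Group G]

/-- The classes of the pairs `(f, x)` such that the based map underlying `f` is not in `T`. -/
def degenerate (C : GOperad.{u} G) (X : PiDiagram.{u} G) {n : ℕ} (T : ∀ q, Set (BasedMap q n)) :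
    Set ((C.D X).obj n) :=
  {z | ∃ (q : ℕ) (f : C.DHom q n) (x : X.obj q), f.fn ∉ T q ∧ z = DObj.mk f x}

/-- A homotopy extension problem for the inclusion of a set of degenerate points of `(𝔻X)_n`, with
`G × P` acting on `(𝔻X)_n` by means of `β : P → Σ_n`. -/
structure ExtensionProblem (C : GOperad.{u} G) (X : PiDiagram.{u} G) (n : ℕ) (P : Type) [Group P]
    (Y : Type u) [TopologicalSpace Y] [MulAction (G × P) Y] where
  /-- the action of `P` -/
  β : P →* Equiv.Perm (Fin n)
  /-- the nondegenerate based maps -/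
  T : ∀ q, Set (BasedMap q n)
  mem_T_of_comp : ∀ {p q : ℕ} {φ : BasedMap q n} (ψ : PiHom p q), φ.comp ψ.1 ∈ T p → φ ∈ T q
  comp_mem_T : ∀ {q : ℕ} {φ : BasedMap q n} (σ : Equiv.Perm (Fin n)), φ ∈ T q →
    (PiHom.ofPerm σ).1.comp φ ∈ T q
  /-- the map on `(𝔻X)_n` -/
  base : C((C.D X).obj n, Y)
  /-- the homotopy on the degenerate points -/
  htpy : C(C.degenerate X T × unitInterval, Y)
  base_smul : ∀ (k : G × P) z, base ((k.1, β k.2) • z) = k • base z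
  htpy_smul : ∀ (k : G × P) (z : C.degenerate X T) (hz : (k.1, β k.2) • z.1 ∈ C.degenerate X T) t,
    htpy (⟨(k.1, β k.2) • z.1, hz⟩, t) = k • htpy (z, t)
  htpy_zero : ∀ z : C.degenerate X T, htpy (z, 0) = base z.1

namespace ExtensionProblem

variable {C : GOperad.{u} G} {X : PiDiagram.{u} G} {n : ℕ} {P : Type} [Group P]
  {Y : Type u} [TopologicalSpace Y] [MulAction (G × P) Y] (E : ExtensionProblem C X n P Y)

/-- The nondegenerate morphisms in `𝒟(𝐪, 𝐧)`. -/
abbrev Src (q : ℕ) : Type u := {f : C.DHom q n // f.fn ∈ E.T q}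

theorem isOpen_src (q : ℕ) : IsOpen {f : C.DHom q n | f.fn ∈ E.T q} := (DHom.isClopen_fn _).2

instance (q : ℕ) : CompactlyGeneratedSpace (E.Src q) :=
  CompactlyGeneratedSpace.subtype_of_isOpen (E.isOpen_src q)

/-- The action of `p ∈ P` and of `ψ ∈ Π` on nondegenerate morphisms. -/
def Src.move {q : ℕ} (p : G × Equiv.Perm (Fin n)) (τ : Equiv.Perm (Fin q)) (f : E.Src q) :
    E.Src q :=
  ⟨p • f.1.precomp (PiHom.ofPerm τ), E.comp_mem_T p.2 (E.mem_T_of_comp (PiHom.ofPerm τ⁻¹) (by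
    rw [DHom.fn_smul, DHom.fn_precomp, BasedMap.comp_assoc]
    have : BasedMap.comp (PiHom.ofPerm τ).1 (PiHom.ofPerm τ⁻¹).1 = (PiHom.id q).1 := by
      rw [← PiHom.ofPerm_one, ← mul_inv_cancel τ]
      rfl
    rw [this]
    exact f.2))⟩

theorem Src.continuous_move {q : ℕ} (p : G × Equiv.Perm (Fin n)) (τ : Equiv.Perm (Fin q)) :
    Continuous (Src.move E p τ) :=
  Continuous.subtype_mk ((DHom.continuous_prod_smul p).comp
    ((DHom.continuous_precomp _).comp continuous_subtype_val)) _

theorem Src.move_move {q : ℕ} (p p' : G × Equiv.Perm (Fin n)) (τ τ' : Equiv.Perm (Fin q))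
    (f : E.Src q) : move E p τ (move E p' τ' f) = move E (p * p') (τ' * τ) f := by
  refine Subtype.ext ?_
  change p • (p' • f.1.precomp (PiHom.ofPerm τ')).precomp (PiHom.ofPerm τ) =
    (p * p') • f.1.precomp (PiHom.ofPerm (τ' * τ))
  rw [DHom.prod_smul_precomp, mul_smul, PiHom.ofPerm_mul, DHom.precomp_precomp]

theorem Src.move_one {q : ℕ} (f : E.Src q) : move E 1 1 f = f := by
  refine Subtype.ext ?_
  change (1 : G × Equiv.Perm (Fin n)) • f.1.precomp (PiHom.ofPerm 1) = f.1
  rw [_root_.one_smul, PiHom.ofPerm_one, DHom.precomp_id]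

/-- The `P`-maps from the nondegenerate morphisms to `Y`. -/
abbrev Maps (q : ℕ) : Type u :=
  {z : C(E.Src q, Y) // ∀ (p : P) (f : E.Src q),
    z (Src.move E (1, E.β p) 1 f) = ((1, p) : G × P) • z f}

/-- The space of `P`-maps from the nondegenerate morphisms to `Y`. -/
abbrev Val (q : ℕ) : Type u := Kify (E.Maps q)

theorem Val.ext {q : ℕ} {z z' : E.Val q} (h : ∀ f, z.get.1 f = z'.get.1 f) : z = z' := by
  cases z
  cases z'
  exact congrArg Kify.of (Subtype.ext (ContinuousMap.ext h))

theorem continuous_eval_probe {q : ℕ} {V : Type u} [TopologicalSpace V] [CompactSpace V] [T2Space V]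
    {z : V → E.Val q} {f : V → E.Src q} (hz : Continuous z) (hf : Continuous f) :
    Continuous fun v => (z v).get.1 (f v) := by
  have h1 : Continuous fun v => (z v).get.1.comp ⟨f, hf⟩ :=
    (ContinuousMap.continuous_precomp _).comp
      (continuous_subtype_val.comp (Kify.continuous_get.comp hz))
  exact h1.eval continuous_id

/-- Exponential law for `Val`: a family of maps is continuous once its evaluation is, tested on
compact spaces. -/
theorem continuous_val_of_probe {q : ℕ} {K : Type u} [TopologicalSpace K] [CompactSpace K]
    [T2Space K] {z : K → E.Val q}
    (h : ∀ (V : Type u) [TopologicalSpace V] [CompactSpace V] [T2Space V] (e : V → K)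
      (f : V → E.Src q), Continuous e → Continuous f →
      Continuous fun v => (z (e v)).get.1 (f v)) : Continuous z := by
  refine Kify.continuous_of_compact (f := fun k => (z k).get) (Continuous.subtype_mk
    (f := fun k => (z k).get.1) ?_ _)
  refine ContinuousMap.continuous_of_continuous_uncurry _ ?_
  have : KCont fun y : E.Src q × K => (z y.2).get.1 y.1 := fun V _ _ _ p hp =>
    h V (fun v => (p v).2) (fun v => (p v).1) (by fun_prop) (by fun_prop)
  exact this.continuous_prod_compact.comp continuous_swap

theorem Val.kHausdorff (hY : KHausdorff Y) (q : ℕ) : KHausdorff (E.Val q) :=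
  KHausdorff.pi (X := fun _ : E.Src q => Y) (fun _ => hY) (e := fun z f => z.get.1 f)
    (fun f => (ContinuousEvalConst.continuous_eval_const f).comp
      (continuous_subtype_val.comp Kify.continuous_get))
    fun _ _ h => Val.ext E fun f => congrFun h f

section

variable [ContinuousConstSMul (G × P) Y]

instance (q : ℕ) : MulAction (G × Equiv.Perm (Fin q)) (E.Val q) where
  smul k z := ⟨⟨⟨fun f => ((k.1, 1) : G × P) • z.get.1 (Src.move E (k.1⁻¹, 1) k.2 f),
    (continuous_const_smul _).comp (z.get.1.continuous.comp (Src.continuous_move E _ _))⟩,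
    fun p f => by
      change ((k.1, 1) : G × P) • z.get.1 (Src.move E _ _ (Src.move E _ _ f)) =
        ((1, p) : G × P) • ((k.1, 1) : G × P) • z.get.1 (Src.move E _ _ f)
      have := z.get.2 p (Src.move E (k.1⁻¹, 1) k.2 f)
      rw [Src.move_move] at this
      rw [Src.move_move, smul_smul, show ((1, p) : G × P) * (k.1, 1) = (k.1, 1) * (1, p) by simp,
        ← smul_smul, ← this]
      simp⟩⟩
  one_smul z := Val.ext E fun f => by
    change (1 : G × P) • z.get.1 (Src.move E ((1 : G)⁻¹, 1) 1 f) = _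
    rw [_root_.one_smul, inv_one]
    exact congrArg z.get.1 (Src.move_one E f)
  mul_smul k l z := Val.ext E fun f => by
    change ((k.1 * l.1, 1) : G × P) • z.get.1 (Src.move E ((k.1 * l.1)⁻¹, 1) (k.2 * l.2) f) =
      ((k.1, 1) : G × P) • ((l.1, 1) : G × P) • z.get.1 (Src.move E _ _ (Src.move E _ _ f))
    rw [Src.move_move, smul_smul]
    simp

theorem Val.smul_apply {q : ℕ} (k : G × Equiv.Perm (Fin q)) (z : E.Val q) (f : E.Src q) :
    (k • z).get.1 f = ((k.1, 1) : G × P) • z.get.1 (Src.move E (k.1⁻¹, 1) k.2 f) := rfl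

instance (q : ℕ) : ContinuousConstSMul (G × Equiv.Perm (Fin q)) (E.Val q) where
  continuous_const_smul k := continuous_from_compactlyGeneratedSpace _ fun _ _ _ _ _ hz =>
    E.continuous_val_of_probe fun _ _ _ _ _ _ he hf =>
      (continuous_const_smul ((k.1, 1) : G × P)).comp (E.continuous_eval_probe (hz.comp he)
        ((Src.continuous_move E (k.1⁻¹, 1) k.2).comp hf))

end

theorem mk_mem {q : ℕ} {f : C.DHom q n} (hf : f.fn ∉ E.T q) (x : X.obj q) :
    (DObj.mk f x : (C.D X).obj n) ∈ C.degenerate X E.T := ⟨q, f, x, hf, rfl⟩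

open Classical in
/-- The map on morphisms in `𝒟(𝐪, 𝐧)` given by `z` and by the homotopy on the degenerate points. -/
noncomputable def glue {q : ℕ} (s : unitInterval) (x : X.obj q) (z : E.Val q) (f : C.DHom q n) : Y :=
  if hf : f.fn ∈ E.T q then z.get.1 ⟨f, hf⟩ else E.htpy (⟨DObj.mk f x, E.mk_mem hf x⟩, s)

theorem glue_of_mem {q : ℕ} {s : unitInterval} {x : X.obj q} {z : E.Val q} {f : C.DHom q n}
    (hf : f.fn ∈ E.T q) : E.glue s x z f = z.get.1 ⟨f, hf⟩ := dif_pos hf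

theorem glue_of_notMem {q : ℕ} {s : unitInterval} {x : X.obj q} {z : E.Val q} {f : C.DHom q n}
    (hf : f.fn ∉ E.T q) : E.glue s x z f = E.htpy (⟨DObj.mk f x, E.mk_mem hf x⟩, s) := dif_neg hf

theorem continuous_glue {q : ℕ} {V : Type u} [TopologicalSpace V] [CompactSpace V] [T2Space V]
    {s : V → unitInterval} {x : V → X.obj q} {z : V → E.Val q} {f : V → C.DHom q n}
    (hs : Continuous s) (hx : Continuous x) (hz : Continuous z) (hf : Continuous f) :
    Continuous fun v => E.glue (s v) (x v) (z v) (f v) := by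
  refine DHom.continuous_of_fn hf fun φ W _ _ _ e he hφ => ?_
  by_cases hT : φ ∈ E.T q
  · have hm : ∀ w, (f (e w)).fn ∈ E.T q := fun w => (hφ w).symm ▸ hT
    exact (E.continuous_eval_probe (hz.comp he)
      (Continuous.subtype_mk (hf.comp he) hm)).congr fun w => (E.glue_of_mem (hm w)).symm
  · have hm : ∀ w, (f (e w)).fn ∉ E.T q := fun w => (hφ w).symm ▸ hT
    have h1 := DObj.continuous_mk (C := C) (X := X) (hf.comp he) (hx.comp he)
    exact (E.htpy.continuous.comp ((Continuous.subtype_mk h1 fun w =>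
      E.mk_mem (hm w) (x (e w))).prodMk (hs.comp he))).congr fun w => (E.glue_of_notMem (hm w)).symm

theorem glue_perm {q : ℕ} (s : unitInterval) (x : X.obj q) (z : E.Val q) (f : C.DHom q n) (p : P) :
    E.glue s x z (((1, E.β p) : G × Equiv.Perm (Fin n)) • f) = ((1, p) : G × P) • E.glue s x z f := by
  by_cases hf : f.fn ∈ E.T q
  · rw [E.glue_of_mem hf, ← z.get.2, E.glue_of_mem (E.comp_mem_T (E.β p) hf)]
    refine congrArg z.get.1 (Subtype.ext ?_)
    change _ = _ • f.precomp (PiHom.ofPerm 1)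
    rw [PiHom.ofPerm_one, DHom.precomp_id]
  · have hf' : (((1, E.β p) : G × Equiv.Perm (Fin n)) • f).fn ∉ E.T q := fun h => hf (by
      have := E.comp_mem_T (E.β p)⁻¹ h
      rwa [← DHom.fn_postcomp, DHom.prod_smul_def, DHom.postcomp_postcomp, ← PiHom.ofPerm_mul,
        inv_mul_cancel, PiHom.ofPerm_one, DHom.postcomp_id, DHom.fn_smul] at this)
    rw [E.glue_of_notMem hf, E.glue_of_notMem hf']
    let w : (C.D X).obj n := DObj.mk f x
    have h1 : ((1, E.β p) : G × Equiv.Perm (Fin n)) • w =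
        DObj.mk (((1, E.β p) : G × Equiv.Perm (Fin n)) • f) x :=
      (DObj.prod_smul_mk _ f x).trans (congrArg (DObj.mk _) (_root_.one_smul G x))
    have hm := E.mk_mem hf' x
    rw [← h1] at hm
    refine Eq.trans ?_ (E.htpy_smul (1, p) ⟨DObj.mk f x, E.mk_mem hf x⟩ hm s)
    exact congrArg (fun w => E.htpy (w, s)) (Subtype.ext h1.symm)

theorem glue_smul [ContinuousConstSMul (G × P) Y] {q : ℕ} (g : G) (s : unitInterval) (x : X.obj q)
    (z : E.Val q) (f : C.DHom q n) :
    E.glue s (g • x) (((g, 1) : G × Equiv.Perm (Fin q)) • z) (g • f) =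
      ((g, 1) : G × P) • E.glue s x z f := by
  by_cases hf : f.fn ∈ E.T q
  · rw [E.glue_of_mem hf, E.glue_of_mem (f := g • f) hf, Val.smul_apply]
    refine congrArg _ (congrArg z.get.1 (Subtype.ext ?_))
    change ((g⁻¹, 1) : G × Equiv.Perm (Fin n)) • (g • f).precomp (PiHom.ofPerm 1) = f
    rw [PiHom.ofPerm_one, DHom.precomp_id, DHom.prod_smul_def, PiHom.ofPerm_one, DHom.postcomp_id,
      inv_smul_smul]
  · rw [E.glue_of_notMem hf, E.glue_of_notMem (f := g • f) hf]
    let w : (C.D X).obj n := DObj.mk f x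
    have h1 : ((g, E.β 1) : G × Equiv.Perm (Fin n)) • w =
        DObj.mk (g • f) (g • x) := by
      refine (DObj.prod_smul_mk _ f x).trans ?_
      rw [DHom.prod_smul_def, map_one, PiHom.ofPerm_one, DHom.postcomp_id]
    have hm := E.mk_mem (f := g • f) hf (g • x)
    rw [← h1] at hm
    refine Eq.trans ?_ (E.htpy_smul (g, 1) ⟨DObj.mk f x, E.mk_mem hf x⟩ hm s)
    exact congrArg (fun w => E.htpy (w, s)) (Subtype.ext h1.symm)

/-- The map `f ↦ z(f ψ)`, or the value of the homotopy if `f ψ` is degenerate. -/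
noncomputable def ins {p q : ℕ} (ψ : PiHom p q) (s : unitInterval) (x : X.obj p) (z : E.Val p) :
    E.Val q :=
  ⟨⟨⟨fun f => E.glue s x z (f.1.precomp ψ),
    continuous_from_compactlyGeneratedSpace _ fun V _ _ _ f hf =>
      E.continuous_glue continuous_const continuous_const continuous_const
        ((DHom.continuous_precomp ψ).comp (continuous_subtype_val.comp hf))⟩,
    fun p f => by
      change E.glue s x z ((_ • f.1.precomp (PiHom.ofPerm 1)).precomp ψ) = _ • E.glue s x z _
      rw [PiHom.ofPerm_one, DHom.precomp_id, DHom.prod_smul_precomp, glue_perm]⟩⟩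

theorem ins_apply {p q : ℕ} (ψ : PiHom p q) (s : unitInterval) (x : X.obj p) (z : E.Val p)
    (f : E.Src q) : (E.ins ψ s x z).get.1 f = E.glue s x z (f.1.precomp ψ) := rfl

/-- If `f` is degenerate, then so is `f ψ`, and both sides are the value of the given homotopy at
the same class. This yields the composition law for `ins`. -/
theorem glue_ins {p q : ℕ} (ψ : PiHom p q) (s : unitInterval) (x : X.obj p) (z : E.Val p)
    (f : C.DHom q n) : E.glue s (X.map ψ x) (E.ins ψ s x z) f = E.glue s x z (f.precomp ψ) := by
  by_cases hf : f.fn ∈ E.T q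
  · rw [E.glue_of_mem hf, ins_apply]
  · have hf' : (f.precomp ψ).fn ∉ E.T p := fun h => hf (E.mem_T_of_comp ψ h)
    rw [E.glue_of_notMem hf, E.glue_of_notMem hf']
    exact congrArg (fun w => E.htpy (w, s)) (Subtype.ext (DObj.mk_precomp f ψ x).symm)

/-- The values of the given map on `(𝔻X)_n`. -/
noncomputable def start (q : ℕ) : C(X.obj q, E.Val q) where
  toFun x := ⟨⟨⟨fun f => E.base (DObj.mk f.1 x),
    continuous_from_compactlyGeneratedSpace _ fun V _ _ _ f hf =>
      E.base.continuous.comp (DObj.continuous_mk (C := C) (X := X)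
        (continuous_subtype_val.comp hf) continuous_const)⟩,
    fun p f => by
      refine Eq.trans (congrArg E.base ?_) (E.base_smul (1, p) (DObj.mk f.1 x))
      refine Eq.trans ?_ (DObj.prod_smul_mk ((1, E.β p) : G × Equiv.Perm (Fin n)) f.1 x).symm
      change DObj.mk (_ • f.1.precomp (PiHom.ofPerm 1)) x = _
      rw [PiHom.ofPerm_one, DHom.precomp_id]
      exact congrArg (DObj.mk _) (_root_.one_smul G x).symm⟩⟩
  continuous_toFun := continuous_from_compactlyGeneratedSpace _ fun K _ _ _ x hx =>
    E.continuous_val_of_probe fun V _ _ _ e f he hf =>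
      E.base.continuous.comp (DObj.continuous_mk (C := C) (X := X)
        (continuous_subtype_val.comp hf) (hx.comp he))

theorem glue_start {q : ℕ} (x : X.obj q) (f : C.DHom q n) :
    E.glue 0 x (E.start q x) f = E.base (DObj.mk f x) := by
  by_cases hf : f.fn ∈ E.T q
  · rw [E.glue_of_mem hf]
    rfl
  · rw [E.glue_of_notMem hf, htpy_zero]

variable [ContinuousConstSMul (G × P) Y]

/-- The maps `ins` as insertion data. -/
noncomputable def insertion : PiDiagram.Insertion X E.Val where
  ins := E.ins
  kCont_ins ψ _ K _ _ _ y hy := E.continuous_val_of_probe fun V _ _ _ e f he hf =>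
    E.continuous_glue (s := fun v => (y (e v)).1.2) (x := fun v => (y (e v)).1.1)
      (z := fun v => (y (e v)).2) (by fun_prop) (by fun_prop) (by fun_prop)
      ((DHom.continuous_precomp ψ).comp (continuous_subtype_val.comp hf))
  ins_comp φ ψ _ _ s x z := Val.ext E fun f => by
    rw [ins_apply, ins_apply, glue_ins, DHom.precomp_precomp]
  ins_ofPerm σ s x z := Val.ext E fun f => by
    have h : f.1.precomp (PiHom.ofPerm σ) = (Src.move E (1⁻¹, 1) σ f).1 := by
      change _ = ((1 : G)⁻¹, 1) • f.1.precomp (PiHom.ofPerm σ)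
      rw [inv_one]
      exact (_root_.one_smul _ _).symm
    rw [ins_apply, Val.smul_apply, h, E.glue_of_mem (Src.move E (1⁻¹, 1) σ f).2]
    exact (_root_.one_smul (G × P) _).symm
  ins_smul ψ g s x z _ := Val.ext E fun f => by
    have h : f.1.precomp ψ = g • (Src.move E (g⁻¹, 1) 1 f).1.precomp ψ := by
      change _ = g • (_ • f.1.precomp (PiHom.ofPerm 1)).precomp ψ
      rw [PiHom.ofPerm_one, DHom.precomp_id, DHom.prod_smul_def, PiHom.ofPerm_one,
        DHom.postcomp_id, DHom.smul_precomp, smul_inv_smul]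
    rw [ins_apply, Val.smul_apply, ins_apply, h, glue_smul]

theorem start_smul (q : ℕ) (g : G) (x : X.obj q) :
    E.start q (g • x) = ((g, 1) : G × Equiv.Perm (Fin q)) • E.start q x := Val.ext E fun f => by
  refine Eq.trans (congrArg E.base ?_)
    (E.base_smul (g, 1) (DObj.mk (Src.move E (g⁻¹, 1) 1 f).1 x))
  refine Eq.trans ?_ (DObj.prod_smul_mk ((g, E.β 1) : G × Equiv.Perm (Fin n)) _ x).symm
  change _ = DObj.mk ((g, E.β 1) • ((g⁻¹, 1) : G × Equiv.Perm (Fin n)) •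
    f.1.precomp (PiHom.ofPerm 1)) (g • x)
  rw [PiHom.ofPerm_one, DHom.precomp_id, smul_smul, map_one, Prod.mk_mul_mk, mul_inv_cancel, mul_one]
  exact congrArg (fun f => DObj.mk f (g • x)) (_root_.one_smul (G × Equiv.Perm (Fin n)) f.1).symm

/-- By adjunction, a `P`-equivariant homotopy on `(𝔻X)_n` becomes a family of maps `X_q × I → Val q`
on nondegenerate morphisms. At degenerate points of `X_q` its values are forced by lower degrees,
and by the given homotopy where `f ψ` is degenerate; this is the insertion rule, so the inductive
construction for Reedy cofibrant diagrams applies. -/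
theorem exists_extension [WeakHausdorffSpace Y] (hX : ∀ n, KHausdorff (X.obj n))
    (hXR : X.IsReedyCofibrant) :
    ∃ H : C((C.D X).obj n × unitInterval, Y),
      (∀ (k : G × P) z t, H ((k.1, E.β k.2) • z, t) = k • H (z, t)) ∧
      (∀ z, H (z, 0) = E.base z) ∧
      ∀ (z : C.degenerate X E.T) t, H (z.1, t) = E.htpy (z, t) := by
  have : ∀ q, WeakHausdorffSpace (E.Val q) := fun q =>
    (Val.kHausdorff E WeakHausdorffSpace.kHausdorff q).weakHausdorff
  obtain ⟨Φ, hΦs, hΦ0, hΦ⟩ := E.insertion.exists_homotopy hX hXR E.start E.start_smul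
    fun p q ψ _ x => Val.ext E fun f => by
      refine Eq.trans (congrArg E.base ?_) (E.glue_start x (f.1.precomp ψ)).symm
      exact (DObj.mk_precomp _ _ _).symm
  -- The insertion rule is what makes the family compatible with injections, so that it descends to
  -- classes in `𝔻X`.
  have hF : ∀ t : unitInterval, DObj.InjCompat (C := C) (X := X) (n := n)
      fun q f x => E.glue t x (Φ q (x, t)) f := fun t p q f ψ x hψ _ => by
    change _ = E.glue t (X.map ψ x) (Φ q (X.map ψ x, t)) f
    rw [hΦ p q ψ hψ]
    exact (E.glue_ins ψ t x _ f).symm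
  have hc : Continuous fun y : C.DObj X n × unitInterval => DObj.injDesc (hF y.2) y.1 := by
    refine DObj.continuous_desc_interval (g := fun z t => DObj.injDesc (hF t) z)
      fun q K _ _ _ f x t hf hx ht => ?_
    refine DObj.continuous_injDesc_probe (ι := ULift.{u} unitInterval) (fun t => hF t.down)
      (fun k => ULift.up (t k)) hf hx fun p V _ _ _ e f' x' he hf' hx' => ?_
    exact E.continuous_glue (ht.comp he) hx' ((Φ p).continuous.comp (hx'.prodMk (ht.comp he))) hf'
  let H : C((C.D X).obj n × unitInterval, Y) := ⟨_, hc⟩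
  have hH : ∀ (q : ℕ) (f : C.DHom q n) (x : X.obj q) t, f.IsEffective →
      H (DObj.mk f x, t) = E.glue t x (Φ q (x, t)) f := fun q f x t hf =>
    DObj.injDesc_mk (hF t) hf x
  refine ⟨H, fun k z t => ?_, fun z => ?_, fun z t => ?_⟩
  · obtain ⟨q, f, x, hf, rfl⟩ := DObj.exists_effective_rep (C := C) (X := X) z
    refine (hH q (((k.1, E.β k.2) : G × Equiv.Perm (Fin n)) • f) (k.1 • x) t
      (hf.prod_smul _)).trans ?_
    rw [hH q f x t hf, hΦs, show ((k.1, E.β k.2) : G × Equiv.Perm (Fin n)) • f =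
      ((1, E.β k.2) : G × Equiv.Perm (Fin n)) • k.1 • f by
        rw [DHom.prod_smul_def, DHom.prod_smul_def]; simp only [_root_.one_smul], glue_perm, glue_smul, smul_smul]
    simp
  · obtain ⟨q, f, x, hf, rfl⟩ := DObj.exists_effective_rep (C := C) (X := X) z
    rw [hH q f x 0 hf, hΦ0, glue_start]
  · obtain ⟨_, q, f, x, hf, rfl⟩ := z
    -- The values of `H` are known for effective representatives; passing to one keeps the morphism
    -- degenerate.
    obtain ⟨p, ψ, y, he, h⟩ := DObj.exists_effective_precomp f x
    have hf' : (f.precomp ψ).fn ∉ E.T p := fun h => hf (E.mem_T_of_comp ψ h)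
    refine (congrArg (fun w => H (w, t)) h).trans ((hH p (f.precomp ψ) y t he).trans ?_)
    rw [E.glue_of_notMem hf']
    exact congrArg (fun w => E.htpy (w, t)) (Subtype.ext h.symm)

end ExtensionProblem

end GOperad

/-! ### Cofibrations in `𝔻X` -/

theorem PiDiagram.IsPiSpace.kHausdorff {G : Type v} [Group G] {X : PiDiagram.{u} G}
    (hX : X.IsPiSpace) (n : ℕ) : KHausdorff (X.obj n) :=
  have := hX.weakHausdorff n
  WeakHausdorffSpace.kHausdorff

namespace GOperad

variable {G : Type v} [Group G] {C : GOperad.{u} G} {X : PiDiagram.{u} G} {q n : ℕ}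

theorem DHom.postcomp_restr (f : C.DHom q n) (S : Set (Fin n))
    (h : ∀ i j, f.fn i = some j → j ∈ S) : DHom.postcomp (PiHom.restr S) f = f := by
  refine DHom.ext_delta fun j => ?_
  by_cases hj : j ∈ S
  · rw [DHom.postcomp_postcomp]
    congr 1
    apply PiHom.ext'
    intro a b
    simp only [PiHom.comp_eq_some, PiHom.restr_eq_some, PiHom.delta_eq_some]
    exact ⟨fun ⟨_, ⟨h1, _⟩, h2⟩ => h1.trans h2, by rintro rfl; exact ⟨a, ⟨rfl, hj⟩, rfl⟩⟩
  · refine DHom.eq_of_fn_eq_none (fun i => ?_) fun i => ?_ <;>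
      refine Option.eq_none_iff_forall_ne_some.2 fun b hb => hj ?_ <;>
      obtain rfl := Subsingleton.elim b 0
    · rw [DHom.fn_delta, DHom.fn_postcomp_eq_some] at hb
      obtain ⟨l, -, h2⟩ := hb
      exact (PiHom.restr_eq_some.1 h2).1 ▸ (PiHom.restr_eq_some.1 h2).2
    · exact h _ _ (DHom.fn_delta.1 hb)

/-- A morphism that misses `j` factors through `skip j`, so the latching space is given by the
morphisms that are not surjective. -/
theorem latching_D (n : ℕ) : (C.D X).latching n =
    C.degenerate X fun q => {φ : BasedMap q n | ∀ j, ∃ i, φ i = some j} := by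
  obtain _ | n := n
  · symm
    rw [PiDiagram.latching, Set.eq_empty_iff_forall_notMem]
    rintro z ⟨q, f, x, hf, -⟩
    exact hf fun j => j.elim0
  · ext z
    rw [PiDiagram.latching, Set.mem_iUnion]
    constructor
    · rintro ⟨i, y, rfl⟩
      obtain ⟨q, f, x, rfl⟩ := DObj.exists_eq_mk (C := C) (X := X) y
      refine ⟨q, DHom.postcomp (PiHom.skip i) f, x, fun h => ?_, rfl⟩
      obtain ⟨a, ha⟩ := h i
      obtain ⟨b, -, hb⟩ := DHom.fn_postcomp_eq_some.1 ha
      exact Fin.succAbove_ne _ _ (PiHom.skip_eq_some.1 hb)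
    · rintro ⟨q, f, x, hf, rfl⟩
      simp only [Set.mem_ofPred_eq, not_forall, not_exists] at hf
      obtain ⟨j, hj⟩ := hf
      let y : (C.D X).obj n := DObj.mk (DHom.postcomp (PiHom.skip j).transpose f) x
      refine ⟨j, y, (DObj.map_mk _ _ _).trans (congrArg (fun f => DObj.mk f x) ?_)⟩
      rw [DHom.postcomp_postcomp, PiHom.comp_transpose_self, PiHom.range_skip]
      exact DHom.postcomp_restr f _ fun i l hl (e : l = j) => hj i (e ▸ hl)

theorem isReedyCofibrant_D (hX : ∀ n, KHausdorff (X.obj n)) (hXR : X.IsReedyCofibrant) :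
    (C.D X).IsReedyCofibrant := by
  intro n
  rw [latching_D]
  intro Y _ _ _ _ _ f h hf hh h0
  -- Nondegenerate means surjective, and all of `Σ_n` acts.
  let E : ExtensionProblem C X n (Equiv.Perm (Fin n)) Y :=
    { β := MonoidHom.id _
      T := fun q => {φ | ∀ j, ∃ i, φ i = some j}
      mem_T_of_comp := fun ψ h j => by
        obtain ⟨i, hi⟩ := h j
        obtain ⟨l, -, hl⟩ := Option.bind_eq_some_iff.1 hi
        exact ⟨l, hl⟩
      comp_mem_T := fun σ h j => by
        obtain ⟨i, hi⟩ := h (σ⁻¹ j)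
        exact ⟨i, Option.bind_eq_some_iff.2 ⟨_, hi, PiHom.ofPerm_eq_some.2 (by simp)⟩⟩
      base := f
      htpy := h
      base_smul := hf
      htpy_smul := hh
      htpy_zero := h0 }
  exact E.exists_extension hX hXR

theorem range_zero_D (n : ℕ) : Set.range ((C.D X).map (PiHom.zero 0 n)) =
    C.degenerate X fun q => {φ : BasedMap q n | ∃ i, φ i ≠ none} := by
  ext z
  constructor
  · rintro ⟨y, rfl⟩
    obtain ⟨q, f, x, rfl⟩ := DObj.exists_eq_mk (C := C) (X := X) y
    refine ⟨q, DHom.postcomp (PiHom.zero 0 n) f, x, ?_, rfl⟩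
    rintro ⟨i, hi⟩
    obtain ⟨j, hj⟩ := Option.ne_none_iff_exists'.1 hi
    obtain ⟨l, -, -⟩ := DHom.fn_postcomp_eq_some.1 hj
    exact l.elim0
  · rintro ⟨q, f, x, hf, rfl⟩
    simp only [Set.mem_ofPred_eq, not_exists, not_not] at hf
    let y : (C.D X).obj 0 := DObj.mk (DHom.postcomp (PiHom.zero n 0) f) x
    refine ⟨y, (DObj.map_mk _ _ _).trans (congrArg (fun f => DObj.mk f x) ?_)⟩
    refine DHom.eq_of_fn_eq_none (fun i => Option.eq_none_iff_forall_ne_some.2 fun j hj => ?_) hf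
    obtain ⟨l, -, -⟩ := DHom.fn_postcomp_eq_some.1 hj
    exact l.elim0

theorem isCofibration_range_zero_D (hX : ∀ n, KHausdorff (X.obj n)) (hXR : X.IsReedyCofibrant)
    (n : ℕ) : IsCofibration G (Set.range ((C.D X).map (PiHom.zero 0 n))) := by
  rw [range_zero_D]
  intro Y _ _ _ _ _ f h hf hh h0
  -- Only `G` acts in this extension problem, so `P` is the trivial group and the nondegenerate
  -- morphisms are the nonzero ones.
  let _ : MulAction (G × PUnit.{1}) Y := MulAction.compHom Y (MonoidHom.fst G PUnit.{1})
  have : ContinuousConstSMul (G × PUnit.{1}) Y := ⟨fun k => continuous_const_smul k.1⟩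
  have hs : ∀ (g : G) (z : (C.D X).obj n), ((g, 1) : G × Equiv.Perm (Fin n)) • z = g • z :=
    fun g z => by rw [PiDiagram.prod_smul_def, PiHom.ofPerm_one, (C.D X).map_id]
  let E : ExtensionProblem C X n PUnit.{1} Y :=
    { β := 1
      T := fun q => {φ | ∃ i, φ i ≠ none}
      mem_T_of_comp := by
        rintro p q φ ψ ⟨i, hi⟩
        obtain ⟨j, hj⟩ := Option.ne_none_iff_exists'.1 hi
        obtain ⟨l, -, hl⟩ := Option.bind_eq_some_iff.1 hj
        exact ⟨l, by simp [hl]⟩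
      comp_mem_T := by
        rintro q φ σ ⟨i, hi⟩
        obtain ⟨j, hj⟩ := Option.ne_none_iff_exists'.1 hi
        exact ⟨i, Option.ne_none_iff_exists'.2
          ⟨σ j, Option.bind_eq_some_iff.2 ⟨_, hj, PiHom.ofPerm_eq_some.2 rfl⟩⟩⟩
      base := f
      htpy := h
      base_smul := fun k z => (congrArg f (hs k.1 z)).trans (hf k.1 z)
      htpy_smul := fun k z hz t =>
        (congrArg (fun w => h (w, t)) (Subtype.ext (hs k.1 z.1))).trans
          (hh k.1 z (hs k.1 z.1 ▸ hz) t)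
      htpy_zero := h0 }
  obtain ⟨H, h1, h2, h3⟩ := E.exists_extension hX hXR
  exact ⟨H, fun g z t => (congrArg (fun w => H (w, t)) (hs g z)).symm.trans (h1 (g, 1) z t), h2, h3⟩

theorem isPiSpace_D (hX : X.IsPiSpace) (hXR : X.IsReedyCofibrant) : (C.D X).IsPiSpace :=
  ⟨fun n => (DObj.kHausdorff hX.kHausdorff n).weakHausdorff, nonempty_unique_D_zero hX.point,
    isCofibration_range_zero_D hX.kHausdorff hXR⟩

end GOperad

theorem theorem6 {G : Type v} [Group G] [Finite G] (C : GOperad.{u} G) (hC : C.IsSigmaFree) :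
    (∀ (X Y : PiDiagram.{u} G) (f : PiDiagram.Hom X Y), X.IsPiSpace → X.IsReedyCofibrant →
        Y.IsPiSpace → Y.IsReedyCofibrant → f.IsLevelEquiv → (C.DMap f).IsLevelEquiv) ∧
    (∀ X : PiDiagram.{u} G, X.IsPiSpace → X.IsReedyCofibrant → X.IsSpecial →
        (C.D X).IsSpecial) ∧
    (∀ X : PiDiagram.{u} G, X.IsPiSpace → X.IsReedyCofibrant →
        (C.D X).IsPiSpace ∧ (C.D X).IsReedyCofibrant) :=
  ⟨fun _ _ _ hX hXR hY hYR hf =>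
    GOperad.isLevelEquiv_DMap hC hX.kHausdorff hY.kHausdorff hXR hYR hf,
    fun _ hX hXR hs => GOperad.isSpecial_D hC hX.kHausdorff hX.point hXR hs,
    fun _ hX hXR => ⟨GOperad.isPiSpace_D hX hXR, GOperad.isReedyCofibrant_D hX.kHausdorff hXR⟩⟩
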